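/- Let $p$ be a prime, $\Gamma$ a profinite group isomorphic to $\mathbb{Z}_p$, $G$ a finite (discrete) $p$-group, and $\tilde\Gamma=\Gamma\times G$. Let $X$ be a finite graph in Serre's sense: finite sets of vertices $V_X$ and oriented edges $\mathbb{E}_X$, source and target maps $s,t$, and a fixed-point-free involution $e\mapsto\bar e$ exchanging $s$ and $t$. Connected graphs are non-empty, and $\kappa$ denotes the number of spanning trees. **Definitions.** For a group $H$, an $H$-covering $Y/X$ is a morphism of graphs $Y\to X$, surjective on vertices and edges, with an action of $H$ on $Y$ over $X$ that is transitive on the fibre of each vertex and simply transitive on the fibre of each edge; the ramification index of a vertex of $Y$ is the order of its stabilizer. It is constant on vertices over a given vertex $v$ of $X$; write $m_v(Y/X)$. A $\tilde\Gamma$-covering of $X$ is an inverse system $(X_U)_U$ of finite graphs indexed by the open normal subgroups $U$ of $\tilde\Gamma$, with an action of $\tilde\Gamma$ inducing a $\tilde\Gamma/U$-covering structure on each $X_U/X$ and such that each transition map $X_U\to X_{U'}$ ($U\subset U'$) is a $U'/U$-covering. **(A)** Let $(X_U)_U$ be a $\tilde\Gamma$-covering of $X$ with all $X_U$ connected. Put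 $\tilde X_n=X_{\Gamma^{p^n}\times 1}$ and $X_n=X_{\Gamma^{p^n}\times G}$, so that $X_n/X$ is a $\Gamma/\Gamma^{p^n}$-covering and $\tilde X_n/X_n$ a $G$-covering. There are integers $\lambda,\mu,\tilde\lambda,\tilde\mu\ge 0$ and $\nu,\tilde\nu$ with $\operatorname{ord}_p\kappa(X_n)=\lambda n+\mu p^n+\nu$ and $\operatorname{ord}_p\kappa(\tilde X_n)=\tilde\lambda n+\tilde\mu p^n+\tilde\nu$ for all $n\gg0$. For $v\in V_X$ let $m_v=\lim_n m_v(\tilde X_n/X_n)$ (a decreasing sequence), where $m_v(\tilde X_n/X_n)$ is the ramification index in $\tilde X_n/X_n$ of any vertex of $\tilde X_n$ above $v$, and let $n_v\in\{1,2,\dots,\infty\}$ be the limit of the increasing sequence of the numbers of vertices of $\tilde X_n$ above $v$. Then $\tilde\mu=0$ if and only if $\mu=0$ and $(\star)$ for every $v\in V_X$, either $m_v(X_n/X)>1$ for some $n$, or $m_v=1$. If $\tilde\mu=0$, then $$\tilde\lambda+1=\#G\,(\lambda+1)-\sum_{v\in V_X}n_v\,(m_v-1),$$ where $\infty\cdot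 0=0$ and all terms of the sum are finite. **(B)** Let $\tilde\alpha:\mathbb{E}_X\to\tilde\Gamma$ satisfy $\tilde\alpha(\bar e)=\tilde\alpha(e)^{-1}$, and let $(\tilde I_v)_{v\in V_X}$ be closed subgroups of $\tilde\Gamma$. For an open normal subgroup $U$ of $\tilde\Gamma$ let $\tilde\alpha_U$ and $\tilde I_{v,U}$ be the images of $\tilde\alpha$ and $\tilde I_v$ in $\tilde\Gamma/U$. The derived graph $X(\tilde\Gamma/U)$ has vertices $(\gamma\tilde I_{v,U},v)$ and edges $(\gamma,e)$, for $\gamma\in\tilde\Gamma/U$, $v\in V_X$, $e\in\mathbb{E}_X$, with $s(\gamma,e)=(\gamma\tilde I_{s(e),U},s(e))$, $t(\gamma,e)=(\gamma\tilde\alpha_U(e)\tilde I_{t(e),U},t(e))$, $\overline{(\gamma,e)}=(\gamma\tilde\alpha_U(e),\bar e)$. Assume that it is connected for every $U$. For a finite graph $Y$ let $\operatorname{Pic}(Y)$ be the cokernel of the Laplacian $[w]\mapsto\sum_{s(e)=w}([w]-[t(e)])$ on $\bigoplus_{w\in V_Y}\mathbb{Z}[w]$, and put $\operatorname{Pic}(\tilde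 X_\infty)=\varprojlim_U\mathbb{Z}_p\otimes_{\mathbb{Z}}\operatorname{Pic}(X(\tilde\Gamma/U))$. Define $\operatorname{Pic}(X_\infty)$ in the same way from $\Gamma$ and the images of $\tilde\alpha$ and $\tilde I_v$ in $\Gamma=\tilde\Gamma/G$. Both are finitely generated torsion modules over $\mathbb{Z}_p[[\Gamma]]$. For such a module $M$, let $\mu(M)$ be the usual $\mu$-invariant, i.e. the length of the localization of $M$ at the prime ideal $(p)$, and let $\lambda(M)=\dim_{\mathbb{Q}_p}(\mathbb{Q}_p\otimes_{\mathbb{Z}_p}M)$. Then $\mu(\operatorname{Pic}(\tilde X_\infty))=0$ if and only if $\mu(\operatorname{Pic}(X_\infty))=0$ and every $\tilde I_v$ is infinite or trivial. If $\mu(\operatorname{Pic}(\tilde X_\infty))=0$, then $$\lambda(\operatorname{Pic}(\tilde X_\infty))=\#G\cdot\lambda(\operatorname{Pic}(X_\infty))-\sum_{v\in V_X}[\tilde\Gamma:\tilde I_v]\,(\#(G\cap\tilde I_v)-1),$$ where a term with $[\tilde\Gamma:\tilde I_v]=\infty$ is $0$. -/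

import Mathlib

open scoped TensorProduct

namespace KidaGraph

universe u v w

/-! ### Finite graphs in Serre's formalism -/

/-- A finite graph: finitely many vertices and (oriented) edges, source and target maps, and a
fixed-point-free involution `bar` on the edges which exchanges source and target. -/
structure FinGraph where
  V : Type u
  E : Type u
  finV : Finite V
  finE : Finite E
  s : E → V
  t : E → V
  bar : E → E
  bar_bar : ∀ e, bar (bar e) = e
  bar_ne : ∀ e, bar e ≠ e
  s_bar : ∀ e, s (bar e) = t e
  t_bar : ∀ e, t (bar e) = s e

attribute [instance] FinGraph.finV FinGraph.finE

namespace FinGraph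

variable (X : FinGraph.{u})

/-- The subgraph with all the vertices of `X` and with edge set `T` is connected:
there is a vertex, and any two vertices are joined by a path of edges in `T`. -/
def ConnectedBy (T : Set X.E) : Prop :=
  Nonempty X.V ∧
    ∀ a b : X.V, Relation.ReflTransGen (fun a b => ∃ e ∈ T, X.s e = a ∧ X.t e = b) a b

/-- Connected graphs (in particular non-empty). -/
def Connected : Prop := X.ConnectedBy Set.univ

/-- A circuit: a non-empty closed path `e₁, …, eₙ` with pairwise distinct vertices which does
not use an edge together with its opposite. -/
def IsCircuit (l : List X.E) : Prop :=
  ∃ h : l ≠ [], l.IsChain (fun e e' => X.t e = X.s e') ∧ X.t (l.getLast h) = X.s (l.head h) ∧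
    (l.map X.s).Nodup ∧ ∀ e ∈ l, X.bar e ∉ l

/-- The edge set of a spanning tree: stable under `bar`, connecting all the vertices,
and without circuits. -/
structure IsSpanningTree (T : Set X.E) : Prop where
  bar_mem : ∀ e ∈ T, X.bar e ∈ T
  connected : X.ConnectedBy T
  acyclic : ∀ l : List X.E, (∀ e ∈ l, e ∈ T) → ¬ X.IsCircuit l

/-- The number `κ(X)` of spanning trees. -/
noncomputable def kappa : ℕ := Nat.card {T : Set X.E // X.IsSpanningTree T}

/-- The divisor group, the free abelian group on the vertices. -/
abbrev Div : Type u := X.V →₀ ℤ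

/-- The Laplacian `[v] ↦ ∑_{s(e) = v} ([v] - [t(e)])`. -/
noncomputable def laplacian : X.Div →ₗ[ℤ] X.Div :=
  Finsupp.linearCombination ℤ (fun v : X.V =>
    ∑ᶠ e : {e : X.E // X.s e = v}, (Finsupp.single v 1 - Finsupp.single (X.t e) 1 : X.Div))

/-- The Picard group, the cokernel of the Laplacian. -/
abbrev Pic : Type u := X.Div ⧸ LinearMap.range X.laplacian

end FinGraph

/-! ### Morphisms and coverings -/

/-- Morphisms of graphs. -/
@[ext]
structure Hom (Y : FinGraph.{u}) (X : FinGraph.{v}) where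
  onV : Y.V → X.V
  onE : Y.E → X.E
  map_s : ∀ e, onV (Y.s e) = X.s (onE e)
  map_t : ∀ e, onV (Y.t e) = X.t (onE e)
  map_bar : ∀ e, onE (Y.bar e) = X.bar (onE e)

/-- (Ramified) coverings: for each vertex `w` of `Y` the map from the edges starting at `w` to
the edges starting at the image of `w` is `m`-to-one for some positive integer `m`. -/
def Hom.IsCovering {Y : FinGraph.{u}} {X : FinGraph.{v}} (f : Hom Y X) : Prop :=
  ∀ w : Y.V, ∃ m : ℕ, 0 < m ∧
    ∀ e : X.E, X.s e = f.onV w → Nat.card {e' : Y.E // Y.s e' = w ∧ f.onE e' = e} = m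

/-- The push-forward `f_* : Div(Y) → Div(X)`, `[w] ↦ [f(w)]`. -/
noncomputable def Hom.push {Y : FinGraph.{u}} {X : FinGraph.{v}} (f : Hom Y X) :
    Y.Div →ₗ[ℤ] X.Div := Finsupp.lmapDomain ℤ ℤ f.onV

theorem Hom.IsCovering.range_le {Y : FinGraph.{u}} {X : FinGraph.{v}} {f : Hom Y X}
    (hf : f.IsCovering) :
    LinearMap.range Y.laplacian ≤ (LinearMap.range X.laplacian).comap f.push := by
  classical
  rintro _ ⟨D, rfl⟩
  induction D using Finsupp.induction_linear with
  | zero => simp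
  | add D D' h h' => rw [map_add]; exact Submodule.add_mem _ h h'
  | single w n =>
    obtain ⟨m, -, hm⟩ := hf w
    refine ⟨Finsupp.single (f.onV w) (n * m), ?_⟩
    let _ := Fintype.ofFinite Y.E
    let _ := Fintype.ofFinite X.E
    simp only [FinGraph.laplacian, Finsupp.linearCombination_single, map_smul]
    rw [finsum_eq_sum_of_fintype, finsum_eq_sum_of_fintype, map_sum, mul_smul]
    congr 1
    let φ : {e' : Y.E // Y.s e' = w} → {e : X.E // X.s e = f.onV w} :=
      fun e' => ⟨f.onE e'.1, by rw [← f.map_s, e'.2]⟩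
    rw [← Finset.sum_fiberwise (s := Finset.univ) (g := φ), Finset.smul_sum]
    refine Finset.sum_congr rfl fun e _ => ?_
    have hcard : (Finset.univ.filter fun e' => φ e' = e).card = m := by
      rw [← hm e.1 e.2, ← Fintype.card_subtype, ← Nat.card_eq_fintype_card]
      exact Nat.card_congr
        ⟨fun a => ⟨a.1.1, a.1.2, congrArg Subtype.val a.2⟩,
          fun a => ⟨⟨a.1, a.2.1⟩, Subtype.ext a.2.2⟩, fun _ => rfl, fun _ => rfl⟩
    rw [← hcard, natCast_zsmul, ← Finset.sum_const]
    refine Finset.sum_congr rfl fun e' he' => ?_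
    have h1 : φ e' = e := (Finset.mem_filter.1 he').2
    subst h1
    rw [map_sub]
    simp [Hom.push, φ, f.map_t]

/-- The map on Picard groups induced by `f_*` for a covering `f`. -/
noncomputable def Hom.IsCovering.picMap {Y : FinGraph.{u}} {X : FinGraph.{v}} {f : Hom Y X}
    (hf : f.IsCovering) : Y.Pic →ₗ[ℤ] X.Pic :=
  Submodule.mapQ _ _ f.push hf.range_le

theorem Hom.IsCovering.picMap_mk {Y : FinGraph.{u}} {X : FinGraph.{v}} {f : Hom Y X}
    (hf : f.IsCovering) (D : Y.Div) :
    hf.picMap (Submodule.Quotient.mk D) = Submodule.Quotient.mk (f.push D) := rfl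

/-! ### Galois coverings -/

/-- `Γ`-coverings (Galois coverings with group `Γ`), possibly ramified. -/
structure GaloisCovering (Γ : Type w) [Group Γ] (Y : FinGraph.{u}) (X : FinGraph.{v})
    extends Hom Y X where
  actV : Γ → Y.V → Y.V
  actE : Γ → Y.E → Y.E
  one_actV : ∀ a, actV 1 a = a
  one_actE : ∀ e, actE 1 e = e
  mul_actV : ∀ g h a, actV (g * h) a = actV g (actV h a)
  mul_actE : ∀ g h e, actE (g * h) e = actE g (actE h e)
  act_s : ∀ g e, Y.s (actE g e) = actV g (Y.s e)
  act_t : ∀ g e, Y.t (actE g e) = actV g (Y.t e)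
  act_bar : ∀ g e, Y.bar (actE g e) = actE g (Y.bar e)
  onV_act : ∀ g a, onV (actV g a) = onV a
  onE_act : ∀ g e, onE (actE g e) = onE e
  surjV : Function.Surjective onV
  surjE : Function.Surjective onE
  transV : ∀ a b, onV a = onV b → ∃ g, actV g a = b
  transE : ∀ e e', onE e = onE e' → ∃ g, actE g e = e'
  freeE : ∀ g e, actE g e = e → g = 1

/-- The ramification index `m_a(Y/X)` of a vertex `a` of `Y`: the order of its stabilizer. -/
noncomputable def GaloisCovering.ramIndex {Γ : Type w} [Group Γ] {Y : FinGraph.{u}}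
    {X : FinGraph.{v}} (C : GaloisCovering Γ Y X) (a : Y.V) : ℕ :=
  Nat.card {g : Γ // C.actV g a = a}

/-- The natural map `Γ/U → Γ/V` for `U ≤ V`. -/
def quotMap {Γ : Type w} [Group Γ] [TopologicalSpace Γ] {U V : OpenNormalSubgroup Γ}
    (h : U ≤ V) : Γ ⧸ U.toSubgroup →* Γ ⧸ V.toSubgroup :=
  QuotientGroup.map _ _ (MonoidHom.id Γ) h

/-- `Γ`-coverings of a finite graph `X` for a profinite group `Γ`: inverse systems of graphs
`X_U`, indexed by the open normal subgroups `U` of `Γ`, with a `Γ/U`-covering structure on each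
`X_U / X`, such that the transition morphisms `X_U → X_V` for `U ≤ V` are morphisms over `X`, are
equivariant for `Γ`, and are themselves `V/U`-coverings. Of the last requirement only
the transitivity of `V` on the fibers of vertices has to be stated: the other parts of it
follow from the rest. -/
structure ProfiniteCovering (Γ : Type w) [Group Γ] [TopologicalSpace Γ] (X : FinGraph.{v}) where
  layer : OpenNormalSubgroup Γ → FinGraph.{u}
  cov : ∀ U : OpenNormalSubgroup Γ, GaloisCovering (Γ ⧸ U.toSubgroup) (layer U) X
  trans : ∀ {U V : OpenNormalSubgroup Γ}, U ≤ V → Hom (layer U) (layer V)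
  trans_refl_onV : ∀ (U : OpenNormalSubgroup Γ) (a : (layer U).V), (trans (le_refl U)).onV a = a
  trans_refl_onE : ∀ (U : OpenNormalSubgroup Γ) (e : (layer U).E), (trans (le_refl U)).onE e = e
  trans_trans_onV : ∀ {U V W : OpenNormalSubgroup Γ} (h : U ≤ V) (h' : V ≤ W) (a : (layer U).V),
    (trans h').onV ((trans h).onV a) = (trans (h.trans h')).onV a
  trans_trans_onE : ∀ {U V W : OpenNormalSubgroup Γ} (h : U ≤ V) (h' : V ≤ W) (e : (layer U).E),
    (trans h').onE ((trans h).onE e) = (trans (h.trans h')).onE e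
  over_onV : ∀ {U V : OpenNormalSubgroup Γ} (h : U ≤ V) (a : (layer U).V),
    (cov V).onV ((trans h).onV a) = (cov U).onV a
  over_onE : ∀ {U V : OpenNormalSubgroup Γ} (h : U ≤ V) (e : (layer U).E),
    (cov V).onE ((trans h).onE e) = (cov U).onE e
  trans_act_onV : ∀ {U V : OpenNormalSubgroup Γ} (h : U ≤ V) (g : Γ) (a : (layer U).V),
    (trans h).onV ((cov U).actV (g : Γ ⧸ U.toSubgroup) a) =
      (cov V).actV (g : Γ ⧸ V.toSubgroup) ((trans h).onV a)
  trans_act_onE : ∀ {U V : OpenNormalSubgroup Γ} (h : U ≤ V) (g : Γ) (e : (layer U).E),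
    (trans h).onE ((cov U).actE (g : Γ ⧸ U.toSubgroup) e) =
      (cov V).actE (g : Γ ⧸ V.toSubgroup) ((trans h).onE e)
  fiber_trans : ∀ {U V : OpenNormalSubgroup Γ} (h : U ≤ V) (a b : (layer U).V),
    (trans h).onV a = (trans h).onV b →
      ∃ g ∈ V, (cov U).actV (g : Γ ⧸ U.toSubgroup) a = b

/-! ### The layers `X̃_n` and `X_n` of a `Γ × G`-covering, where `Γ ≅ ℤ_p` -/

section Layers

variable {p : ℕ} [Fact p.Prime]
  {Γ : Type v} [CommGroup Γ] [TopologicalSpace Γ]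
  {G : Type w} [Group G] [TopologicalSpace G] [DiscreteTopology G]

theorem isOpen_pow_range (hΓ : Nonempty (Γ ≃ₜ* Multiplicative ℤ_[p])) (n : ℕ) :
    IsOpen ((powMonoidHom (p ^ n) : Γ →* Γ).range : Set Γ) := by
  obtain ⟨e⟩ := hΓ
  have h1 : IsOpen {x : ℤ_[p] | ‖x‖ ≤ (p : ℝ) ^ (-(n : ℤ))} := by
    have h2 : {x : ℤ_[p] | ‖x‖ ≤ (p : ℝ) ^ (-(n : ℤ))} =
        Metric.closedBall (0 : ℤ_[p]) ((p : ℝ) ^ (-(n : ℤ))) := by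
      ext x; simp
    rw [h2]
    refine IsUltrametricDist.isOpen_closedBall _ ?_
    have := (Fact.out : p.Prime).pos
    positivity
  have h3 : ((powMonoidHom (p ^ n) : Γ →* Γ).range : Set Γ) =
      (fun x => (e x).toAdd) ⁻¹' {x : ℤ_[p] | ‖x‖ ≤ (p : ℝ) ^ (-(n : ℤ))} := by
    ext x
    simp only [SetLike.mem_coe, MonoidHom.mem_range, powMonoidHom_apply, Set.mem_preimage,
      Set.mem_ofPred_eq, PadicInt.norm_le_pow_iff_mem_span_pow, Ideal.mem_span_singleton]
    constructor
    · rintro ⟨y, rfl⟩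
      refine ⟨(e y).toAdd, ?_⟩
      rw [map_pow, toAdd_pow, nsmul_eq_mul]
      push_cast
      rfl
    · rintro ⟨c, hc⟩
      refine ⟨e.symm (Multiplicative.ofAdd c), ?_⟩
      apply e.injective
      rw [map_pow]
      apply Multiplicative.toAdd.injective
      rw [hc, toAdd_pow, nsmul_eq_mul]
      push_cast
      simp
  rw [h3]
  exact h1.preimage (continuous_toAdd.comp (map_continuous e))

/-- The open normal subgroup `Γ^{p^n} × N` of `Γ × G`. -/
def layerSubgroup (hΓ : Nonempty (Γ ≃ₜ* Multiplicative ℤ_[p])) (n : ℕ) (N : Subgroup G)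
    [hN : N.Normal] : OpenNormalSubgroup (Γ × G) where
  toSubgroup := (powMonoidHom (p ^ n) : Γ →* Γ).range.prod N
  isOpen' := (isOpen_pow_range hΓ n).prod (isOpen_discrete _)
  isNormal' := Subgroup.prod_normal _ _

theorem layerSubgroup_le (hΓ : Nonempty (Γ ≃ₜ* Multiplicative ℤ_[p])) (n : ℕ) :
    layerSubgroup hΓ n (⊥ : Subgroup G) ≤ layerSubgroup hΓ n (⊤ : Subgroup G) :=
  fun _ hx => ⟨hx.1, Subgroup.mem_top _⟩

namespace ProfiniteCovering

variable {X : FinGraph.{u}} (T : ProfiniteCovering (Γ × G) X)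
  (hΓ : Nonempty (Γ ≃ₜ* Multiplicative ℤ_[p]))

/-- `X̃_n`, the layer for `Γ^{p^n} × 1`: a `Γ/Γ^{p^n} × G`-covering of `X`. -/
abbrev upper (n : ℕ) : FinGraph := T.layer (layerSubgroup hΓ n ⊥)

/-- `X_n`, the layer for `Γ^{p^n} × G`: a `Γ/Γ^{p^n}`-covering of `X`. -/
abbrev lower (n : ℕ) : FinGraph := T.layer (layerSubgroup hΓ n ⊤)

/-- The `G`-covering `X̃_n / X_n`. -/
def upperLower (n : ℕ) : GaloisCovering G (T.upper hΓ n) (T.lower hΓ n) :=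
  let U := layerSubgroup (G := G) hΓ n ⊥
  let W := layerSubgroup (G := G) hΓ n ⊤
  let ι : G →* (Γ × G) ⧸ U.toSubgroup :=
    (QuotientGroup.mk' U.toSubgroup).comp (MonoidHom.inr Γ G)
  have hUW : U ≤ W := layerSubgroup_le hΓ n
  have hι : ∀ x : Γ × G, x ∈ W → (x : (Γ × G) ⧸ U.toSubgroup) = ι x.2 := by
    rintro ⟨a, g⟩ ⟨ha, -⟩
    refine (QuotientGroup.eq).2 ⟨?_, ?_⟩
    · rw [show ((a, g)⁻¹ * MonoidHom.inr Γ G (a, g).2).1 = a⁻¹ by simp]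
      exact Subgroup.inv_mem _ ha
    · simp
  have h1 : ∀ g : G, (((1, g) : Γ × G) : (Γ × G) ⧸ W.toSubgroup) = 1 := fun g =>
    (QuotientGroup.eq_one_iff _).2 ⟨Subgroup.one_mem _, Subgroup.mem_top _⟩
  { toHom := T.trans hUW
    actV := fun g => (T.cov U).actV (ι g)
    actE := fun g => (T.cov U).actE (ι g)
    one_actV := fun a => by rw [map_one, (T.cov U).one_actV]
    one_actE := fun a => by rw [map_one, (T.cov U).one_actE]
    mul_actV := fun g h a => by rw [map_mul, (T.cov U).mul_actV]
    mul_actE := fun g h a => by rw [map_mul, (T.cov U).mul_actE]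
    act_s := fun g => (T.cov U).act_s (ι g)
    act_t := fun g => (T.cov U).act_t (ι g)
    act_bar := fun g => (T.cov U).act_bar (ι g)
    onV_act := fun g a => by
      have h := T.trans_act_onV hUW (1, g) a
      rw [h1, (T.cov W).one_actV] at h
      exact h
    onE_act := fun g a => by
      have h := T.trans_act_onE hUW (1, g) a
      rw [h1, (T.cov W).one_actE] at h
      exact h
    surjV := fun b => by
      obtain ⟨a, ha⟩ := (T.cov U).surjV ((T.cov W).onV b)
      obtain ⟨g, hg⟩ := (T.cov W).transV ((T.trans hUW).onV a) b (by rw [T.over_onV, ha])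
      induction g using QuotientGroup.induction_on with
      | H g => exact ⟨(T.cov U).actV g a, (T.trans_act_onV hUW g a).trans hg⟩
    surjE := fun b => by
      obtain ⟨a, ha⟩ := (T.cov U).surjE ((T.cov W).onE b)
      obtain ⟨g, hg⟩ := (T.cov W).transE ((T.trans hUW).onE a) b (by rw [T.over_onE, ha])
      induction g using QuotientGroup.induction_on with
      | H g => exact ⟨(T.cov U).actE g a, (T.trans_act_onE hUW g a).trans hg⟩
    transV := fun a b hab => by
      obtain ⟨x, hx, h⟩ := T.fiber_trans hUW a b hab
      rw [hι x hx] at h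
      exact ⟨x.2, h⟩
    transE := fun a b hab => by
      obtain ⟨g, hg⟩ := (T.cov U).transE a b (by
        rw [← T.over_onE hUW, ← T.over_onE hUW]
        exact congrArg _ hab)
      induction g using QuotientGroup.induction_on with
      | H g =>
        have h2 := T.trans_act_onE hUW g a
        rw [hg] at h2
        have h3 : g ∈ W :=
          (QuotientGroup.eq_one_iff _).1 ((T.cov W).freeE _ _ (h2.symm.trans hab.symm))
        rw [hι g h3] at hg
        exact ⟨g.2, hg⟩
    freeE := fun g e h => by
      have h2 : ((1, g) : Γ × G) ∈ U.toSubgroup :=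
        (QuotientGroup.eq_one_iff _).1 ((T.cov U).freeE _ e h)
      exact Subgroup.mem_bot.1 h2.2 }

/-- A chosen vertex of `X_U` above a vertex of `X`. -/
noncomputable def vertexAbove (U : OpenNormalSubgroup (Γ × G)) (x : X.V) : (T.layer U).V :=
  Classical.choose ((T.cov U).surjV x)

/-- `m_x(X_n / X)`, which does not depend on the vertex chosen above `x`. -/
noncomputable def ramLower (n : ℕ) (x : X.V) : ℕ :=
  (T.cov (layerSubgroup hΓ n ⊤)).ramIndex (T.vertexAbove (layerSubgroup hΓ n ⊤) x)

/-- `m_x(X̃_n / X_n)`, which does not depend on the vertex chosen above `x`. -/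
noncomputable def ramUpperLower (n : ℕ) (x : X.V) : ℕ :=
  (T.upperLower hΓ n).ramIndex (T.vertexAbove (layerSubgroup hΓ n ⊥) x)

/-- `m_x(X̃_∞ / X_∞)`, the limit of the decreasing sequence `m_x(X̃_n / X_n)`. -/
noncomputable def ramInfty (x : X.V) : ℕ := ⨅ n : ℕ, T.ramUpperLower hΓ n x

/-- `n_x(X̃_∞ / X)`, the limit (possibly infinite) of the increasing sequence formed by the
numbers of vertices of `X̃_n` above `x`. -/
noncomputable def numInfty (x : X.V) : ℕ∞ :=
  ⨆ n : ℕ, (Nat.card {a : (T.upper hΓ n).V // (T.cov (layerSubgroup hΓ n ⊥)).onV a = x} : ℕ∞)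

/-- Condition `(⋆)`: each vertex of `X` is ramified in `X_∞ / X` or unramified
in `X̃_∞ / X_∞`. -/
def Star : Prop := ∀ x : X.V, (∃ n, 1 < T.ramLower hΓ n x) ∨ T.ramInfty hΓ x = 1

end ProfiniteCovering

end Layers

/-- `lam` and `mu` are the Iwasawa invariants of the sequence `k`: for some integer `ν`,
`ord_p (k n) = lam * n + mu * p ^ n + ν` for all large `n`. -/
def HasIwasawaInvariants (p : ℕ) (k : ℕ → ℕ) (lam mu : ℕ) : Prop :=
  ∃ ν : ℤ, ∀ᶠ n : ℕ in Filter.atTop,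
    (padicValNat p (k n) : ℤ) = (lam : ℤ) * n + (mu : ℤ) * (p : ℤ) ^ n + ν

/-! ### Voltage graphs and derived graphs -/

/-- A voltage assignment on `X` with values in `Γ`, with a family of subgroups of `Γ`. -/
structure Voltage (X : FinGraph.{u}) (Γ : Type v) [Group Γ] where
  α : X.E → Γ
  α_bar : ∀ e, α (X.bar e) = (α e)⁻¹
  I : X.V → Subgroup Γ

namespace Voltage

variable {X : FinGraph.{u}}

/-- The voltage assignment induced along a group homomorphism (used for projections to quotient
groups). -/
def map {Γ : Type v} [Group Γ] {Δ : Type w} [Group Δ] (A : Voltage X Γ) (φ : Γ →* Δ) :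
    Voltage X Δ where
  α e := φ (A.α e)
  α_bar e := by rw [A.α_bar, map_inv]
  I x := (A.I x).map φ

variable {Γ : Type v} [Group Γ]

theorem mk_eq (A : Voltage X Γ) {x y : X.V} (h : x = y) (g : Γ) :
    (⟨x, (g : Γ ⧸ A.I x)⟩ : Σ x : X.V, Γ ⧸ A.I x) = ⟨y, (g : Γ ⧸ A.I y)⟩ := by
  subst h; rfl

/-- The derived graph `X(Γ, I)` for a finite group `Γ`. -/
def derived (A : Voltage X Γ) [Finite Γ] : FinGraph.{max u v} where
  V := Σ x : X.V, Γ ⧸ A.I x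
  E := Γ × X.E
  finV := inferInstance
  finE := inferInstance
  s e := ⟨X.s e.2, (e.1 : Γ ⧸ A.I (X.s e.2))⟩
  t e := ⟨X.t e.2, ((e.1 * A.α e.2 : Γ) : Γ ⧸ A.I (X.t e.2))⟩
  bar e := (e.1 * A.α e.2, X.bar e.2)
  bar_bar e := by
    ext
    · simp [A.α_bar]
    · exact X.bar_bar _
  bar_ne e h := X.bar_ne e.2 (congrArg Prod.snd h)
  s_bar e := A.mk_eq (X.s_bar e.2) _
  t_bar e := by
    have h : e.1 * A.α e.2 * A.α (X.bar e.2) = e.1 := by simp [A.α_bar]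
    simp only [h]
    exact A.mk_eq (X.t_bar e.2) _

/-- The action of `g ∈ Γ` on the derived graph by left multiplication. -/
def act (A : Voltage X Γ) [Finite Γ] (g : Γ) : Hom A.derived A.derived where
  onV a := ⟨a.1, g • a.2⟩
  onE e := (g * e.1, e.2)
  map_s _ := rfl
  map_t e := by
    change (⟨_, ((g * (e.1 * A.α e.2) : Γ) : Γ ⧸ A.I (X.t e.2))⟩ : Σ x : X.V, Γ ⧸ A.I x) =
      ⟨_, ((g * e.1 * A.α e.2 : Γ) : Γ ⧸ A.I (X.t e.2))⟩
    rw [mul_assoc]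
  map_bar e := by
    change (g * (e.1 * A.α e.2), X.bar e.2) = (g * e.1 * A.α e.2, X.bar e.2)
    rw [mul_assoc]

/-- The morphism of derived graphs `X(Γ, I) → X(Δ, φ(I))` given by a homomorphism `φ : Γ → Δ`. -/
def push {Δ : Type w} [Group Δ] (A : Voltage X Γ) (B : Voltage X Δ) [Finite Γ] [Finite Δ]
    (φ : Γ →* Δ) (hα : ∀ e, φ (A.α e) = B.α e) (hI : ∀ x, (A.I x).map φ = B.I x) :
    Hom A.derived B.derived where
  onV a := ⟨a.1, Quotient.map' φ (fun g h hgh => by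
    rw [QuotientGroup.leftRel_apply] at hgh ⊢
    rw [← hI, ← map_inv, ← map_mul]
    exact Subgroup.mem_map_of_mem φ hgh) a.2⟩
  onE e := (φ e.1, e.2)
  map_s _ := rfl
  map_t e := by
    change (⟨_, ((φ (e.1 * A.α e.2) : Δ) : Δ ⧸ B.I (X.t e.2))⟩ : Σ x : X.V, Δ ⧸ B.I x) =
      ⟨_, ((φ e.1 * B.α e.2 : Δ) : Δ ⧸ B.I (X.t e.2))⟩
    rw [map_mul, hα]
  map_bar e := by
    change (φ (e.1 * A.α e.2), X.bar e.2) = (φ e.1 * B.α e.2, X.bar e.2)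
    rw [map_mul, hα]

theorem push_isCovering {Δ : Type w} [Group Δ] (A : Voltage X Γ) (B : Voltage X Δ)
    [Finite Γ] [Finite Δ] (φ : Γ →* Δ) (hα : ∀ e, φ (A.α e) = B.α e)
    (hI : ∀ x, (A.I x).map φ = B.I x) : (A.push B φ hα hI).IsCovering := by
  rintro ⟨x, q⟩
  induction q using QuotientGroup.induction_on with
  | H g =>
    refine ⟨Nat.card {i : Γ // i ∈ A.I x ∧ φ i = 1}, ?_, ?_⟩
    · have : Nonempty {i : Γ // i ∈ A.I x ∧ φ i = 1} := ⟨⟨1, one_mem _, map_one φ⟩⟩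
      exact Nat.card_pos
    · rintro ⟨d, e⟩ he
      have hx : X.s e = x := congrArg Sigma.fst he
      subst hx
      have hd : (d : Δ ⧸ B.I (X.s e)) = ((φ g : Δ) : Δ ⧸ B.I (X.s e)) :=
        eq_of_heq (Sigma.mk.inj he).2
      have hd' := QuotientGroup.eq.1 hd.symm
      rw [← hI] at hd'
      obtain ⟨i, hi, hid⟩ := hd'
      have key : ∀ h : Γ, (A.derived.s (h, e) = ⟨X.s e, ((g : Γ) : Γ ⧸ A.I (X.s e))⟩ ↔
          (g * i)⁻¹ * h ∈ A.I (X.s e)) := by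
        intro h
        have h1 : (A.derived.s (h, e) = ⟨X.s e, ((g : Γ) : Γ ⧸ A.I (X.s e))⟩ ↔
            (h : Γ ⧸ A.I (X.s e)) = (g : Γ ⧸ A.I (X.s e))) :=
          ⟨fun hh => eq_of_heq (Sigma.mk.inj hh).2, fun hh => by
            change (⟨X.s e, (h : Γ ⧸ A.I (X.s e))⟩ : Σ x : X.V, Γ ⧸ A.I x) = _
            rw [hh]⟩
        rw [h1, eq_comm, QuotientGroup.eq, mul_inv_rev, mul_assoc,
          Subgroup.mul_mem_cancel_left _ (Subgroup.inv_mem _ hi)]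
      refine Nat.card_congr ⟨fun a => ⟨(g * i)⁻¹ * a.1.1, ?_, ?_⟩,
        fun b => ⟨(g * i * b.1, e), ?_, ?_⟩, ?_, ?_⟩
      · obtain ⟨⟨h, e'⟩, h3, h4⟩ := a
        have h2 : e' = e := congrArg Prod.snd h4
        subst h2
        exact (key h).1 h3
      · have h2 : φ a.1.1 = d := congrArg Prod.fst a.2.2
        rw [map_mul, h2, map_inv, map_mul, hid]
        simp
      · rw [key]
        rw [inv_mul_cancel_left]
        exact b.2.1
      · change (φ (g * i * b.1), e) = (d, e)
        rw [map_mul, map_mul, b.2.2, hid]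
        simp
      · intro a
        have h2 : a.1.2 = e := congrArg Prod.snd a.2.2
        refine Subtype.ext (Prod.ext ?_ h2.symm)
        exact mul_inv_cancel_left _ _
      · intro b
        exact Subtype.ext (inv_mul_cancel_left _ _)

theorem act_isCovering (A : Voltage X Γ) [Finite Γ] (g : Γ) : (A.act g).IsCovering := by
  rintro ⟨x, q⟩
  refine ⟨1, one_pos, ?_⟩
  rintro ⟨d, e⟩ he
  rw [Nat.card_eq_one_iff_unique]
  constructor
  · constructor
    rintro ⟨⟨h, e1⟩, ha⟩ ⟨⟨h', e2⟩, hb⟩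
    have h1 : (g * h, e1) = (d, e) := ha.2
    have h2 : (g * h', e2) = (d, e) := hb.2
    have h3 := h1.trans h2.symm
    simp only [Prod.mk.injEq, mul_right_inj] at h3
    exact Subtype.ext (Prod.ext h3.1 h3.2)
  · refine ⟨⟨(g⁻¹ * d, e), ?_, ?_⟩⟩
    · have hx : X.s e = x := congrArg Sigma.fst he
      subst hx
      have hd : (d : Γ ⧸ A.I (X.s e)) = g • q := eq_of_heq (Sigma.mk.inj he).2
      change (⟨X.s e, g⁻¹ • (d : Γ ⧸ A.I (X.s e))⟩ : Σ x : X.V, Γ ⧸ A.I x) = _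
      rw [hd, inv_smul_smul]
    · change (g * (g⁻¹ * d), e) = (d, e)
      rw [mul_inv_cancel_left]

/-! ### Picard groups of derived graphs -/

variable (p : ℕ) [Fact p.Prime]

/-- The action of `Γ` on `Pic(X(Γ, I))`. -/
noncomputable def picRep (A : Voltage X Γ) [Finite Γ] : Γ →* Module.End ℤ A.derived.Pic where
  toFun g := (A.act_isCovering g).picMap
  map_one' := by
    ext a
    change Submodule.Quotient.mk (Finsupp.mapDomain _ (Finsupp.single a 1)) =
      Submodule.Quotient.mk (Finsupp.single a 1)
    rw [Finsupp.mapDomain_single]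
    congr 2
    change (⟨a.1, (1 : Γ) • a.2⟩ : Σ x : X.V, Γ ⧸ A.I x) = a
    rw [one_smul]
    rfl
  map_mul' g h := by
    ext a
    change Submodule.Quotient.mk (Finsupp.mapDomain _ (Finsupp.single a 1)) =
      Submodule.Quotient.mk (Finsupp.mapDomain _ (Finsupp.mapDomain _ (Finsupp.single a 1)))
    rw [Finsupp.mapDomain_single, Finsupp.mapDomain_single, Finsupp.mapDomain_single]
    congr 2
    change (⟨a.1, (g * h) • a.2⟩ : Σ x : X.V, Γ ⧸ A.I x) = ⟨a.1, g • h • a.2⟩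
    rw [mul_smul]

/-- `ℤ_p ⊗ Pic(X(Γ, I))`. -/
abbrev PicP (A : Voltage X Γ) [Finite Γ] : Type (max u v) := ℤ_[p] ⊗[ℤ] A.derived.Pic

/-- The action of the group ring `ℤ_p[Γ]` on `ℤ_p ⊗ Pic(X(Γ, I))`. -/
noncomputable def picPRep (A : Voltage X Γ) [Finite Γ] :
    MonoidAlgebra ℤ_[p] Γ →ₐ[ℤ_[p]] Module.End ℤ_[p] (A.PicP p) :=
  MonoidAlgebra.lift ℤ_[p] (Module.End ℤ_[p] (A.PicP p)) Γ
    ((Module.End.baseChangeHom ℤ ℤ_[p] A.derived.Pic : _ →* _).comp A.picRep)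

end Voltage

/-! ### Iwasawa algebras and Picard groups of infinite Galois coverings -/

section Iwasawa

variable (p : ℕ) [Fact p.Prime]

/-- The Iwasawa algebra `ℤ_p[[Γ]] = lim_U ℤ_p[Γ/U]` of a commutative profinite group `Γ`. -/
noncomputable def iwasawaSubring (Γ : Type v) [CommGroup Γ] [TopologicalSpace Γ] :
    Subring (∀ U : OpenNormalSubgroup Γ, MonoidAlgebra ℤ_[p] (Γ ⧸ U.toSubgroup)) where
  carrier := {a | ∀ (U V : OpenNormalSubgroup Γ) (h : U ≤ V),
    MonoidAlgebra.mapDomainRingHom ℤ_[p] (quotMap h) (a U) = a V}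
  mul_mem' ha hb U V h := by simp only [Pi.mul_apply, map_mul, ha U V h, hb U V h]
  add_mem' ha hb U V h := by simp only [Pi.add_apply, map_add, ha U V h, hb U V h]
  neg_mem' ha U V h := by simp only [Pi.neg_apply, map_neg, ha U V h]
  one_mem' U V h := by simp only [Pi.one_apply, map_one]
  zero_mem' U V h := by simp only [Pi.zero_apply, map_zero]

/-- The Iwasawa algebra `ℤ_p[[Γ]]`, as a type. -/
abbrev IwasawaAlgebra (Γ : Type v) [CommGroup Γ] [TopologicalSpace Γ] : Type v :=
  iwasawaSubring p Γ

/-- The inverse image of an open normal subgroup. -/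
def comapONS {Γ : Type v} [Group Γ] [TopologicalSpace Γ] {Δ : Type w} [Group Δ]
    [TopologicalSpace Δ] (ι : Γ →ₜ* Δ) (U : OpenNormalSubgroup Δ) : OpenNormalSubgroup Γ where
  toSubgroup := U.toSubgroup.comap (ι : Γ →* Δ)
  isOpen' := U.isOpen'.preimage ι.continuous_toFun
  isNormal' := Subgroup.normal_comap _

/-- The map `Γ/ι⁻¹(U) → Δ/U`. -/
def comapQuot {Γ : Type v} [Group Γ] [TopologicalSpace Γ] {Δ : Type w} [Group Δ]
    [TopologicalSpace Δ] (ι : Γ →ₜ* Δ) (U : OpenNormalSubgroup Δ) :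
    Γ ⧸ (comapONS ι U).toSubgroup →* Δ ⧸ U.toSubgroup :=
  QuotientGroup.map _ _ (ι : Γ →* Δ) le_rfl

namespace Voltage

variable {X : FinGraph.{u}} {Δ : Type w} [Group Δ] [TopologicalSpace Δ] [IsTopologicalGroup Δ]
  [CompactSpace Δ]

/-- The voltage assignment induced on `Δ/U`. -/
def quot (A : Voltage X Δ) (U : OpenNormalSubgroup Δ) : Voltage X (Δ ⧸ U.toSubgroup) :=
  A.map (QuotientGroup.mk' U.toSubgroup)

/-- The transition morphism `X(Δ/U, I_U) → X(Δ/V, I_V)` for `U ≤ V`. -/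
def transition (A : Voltage X Δ) {U V : OpenNormalSubgroup Δ} (h : U ≤ V) :
    Hom (A.quot U).derived (A.quot V).derived :=
  (A.quot U).push (A.quot V) (quotMap h) (fun _ => rfl) (fun x => by
    simp only [quot, map, Subgroup.map_map]
    rfl)

theorem transition_isCovering (A : Voltage X Δ) {U V : OpenNormalSubgroup Δ} (h : U ≤ V) :
    (A.transition h).IsCovering := push_isCovering _ _ _ _ _

/-- The transition map `ℤ_p ⊗ Pic(X(Δ/U, I_U)) → ℤ_p ⊗ Pic(X(Δ/V, I_V))` for `U ≤ V`. -/
noncomputable def picTrans (A : Voltage X Δ) {U V : OpenNormalSubgroup Δ} (h : U ≤ V) :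
    (A.quot U).PicP p →ₗ[ℤ_[p]] (A.quot V).PicP p :=
  (A.transition_isCovering h).picMap.baseChange ℤ_[p]

theorem picTrans_rep (A : Voltage X Δ) {U V : OpenNormalSubgroup Δ} (h : U ≤ V)
    (b : MonoidAlgebra ℤ_[p] (Δ ⧸ U.toSubgroup)) (x : (A.quot U).PicP p) :
    A.picTrans p h ((A.quot U).picPRep p b x) =
      (A.quot V).picPRep p (MonoidAlgebra.mapDomainRingHom ℤ_[p] (quotMap h) b)
        (A.picTrans p h x) := by
  have key : ∀ (g : Δ ⧸ U.toSubgroup) (y : (A.quot U).derived.Pic),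
      (A.transition_isCovering h).picMap ((A.quot U).picRep g y) =
        (A.quot V).picRep (quotMap h g) ((A.transition_isCovering h).picMap y) := by
    intro g y
    induction y using Submodule.Quotient.induction_on with
    | H D =>
      change Submodule.Quotient.mk (Finsupp.mapDomain _ (Finsupp.mapDomain _ D)) =
        Submodule.Quotient.mk (Finsupp.mapDomain _ (Finsupp.mapDomain _ D))
      rw [← Finsupp.mapDomain_comp, ← Finsupp.mapDomain_comp]
      congr 2
      funext ⟨a, q⟩
      induction q using QuotientGroup.induction_on with
      | H d =>
        change (⟨a, ((quotMap h (g * d) : Δ ⧸ V.toSubgroup) : _ ⧸ (A.quot V).I a)⟩ :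
          Σ x : X.V, _ ⧸ (A.quot V).I x) =
            ⟨a, ((quotMap h g * quotMap h d : Δ ⧸ V.toSubgroup) : _ ⧸ (A.quot V).I a)⟩
        rw [map_mul]
  induction b using MonoidAlgebra.induction_linear with
  | zero => simp
  | add f g hf hg => simp only [map_add, LinearMap.add_apply, hf, hg]
  | single g r =>
    simp only [picPRep, MonoidAlgebra.lift_single, MonoidAlgebra.mapDomainRingHom_apply,
      MonoidAlgebra.mapDomain_single, LinearMap.smul_apply, map_smul]
    congr 1
    induction x using TensorProduct.induction_on with
    | zero => simp
    | add x y hx hy => simp only [map_add, hx, hy]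
    | tmul r y =>
      change r ⊗ₜ[ℤ] _ = r ⊗ₜ[ℤ] _
      rw [key]

/-- `Pic_{ℤ_p}(X(Δ, I)) = lim_U ℤ_p ⊗ Pic(X(Δ/U, I_U))`, as a submodule of the product. -/
noncomputable def picLim (A : Voltage X Δ) :
    Submodule ℤ_[p] (∀ U : OpenNormalSubgroup Δ, (A.quot U).PicP p) where
  carrier := {x | ∀ (U V : OpenNormalSubgroup Δ) (h : U ≤ V), A.picTrans p h (x U) = x V}
  add_mem' hx hy U V h := by simp only [Pi.add_apply, map_add, hx U V h, hy U V h]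
  zero_mem' U V h := by simp only [Pi.zero_apply, map_zero]
  smul_mem' c x hx U V h := by simp only [Pi.smul_apply, map_smul, hx U V h]

/-- `Pic_{ℤ_p}(X(Δ, I))` where `ι : Γ → Δ` is a continuous homomorphism, through which `ℤ_p[[Γ]]`
acts on it. -/
def IwasawaPic {Γ : Type v} [CommGroup Γ] [TopologicalSpace Γ] (A : Voltage X Δ)
    (_ι : Γ →ₜ* Δ) : Type (max u w) := A.picLim p

namespace IwasawaPic

variable {Γ : Type v} [CommGroup Γ] [TopologicalSpace Γ] (A : Voltage X Δ) (ι : Γ →ₜ* Δ)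

noncomputable instance : AddCommGroup (A.IwasawaPic p ι) :=
  inferInstanceAs (AddCommGroup (A.picLim p))

noncomputable instance : Module ℤ_[p] (A.IwasawaPic p ι) :=
  inferInstanceAs (Module ℤ_[p] (A.picLim p))

theorem comap_compat (a : IwasawaAlgebra p Γ) {U V : OpenNormalSubgroup Δ} (h : U ≤ V) :
    MonoidAlgebra.mapDomainRingHom ℤ_[p] (quotMap h)
      (MonoidAlgebra.mapDomainRingHom ℤ_[p] (comapQuot ι U) (a.1 (comapONS ι U))) =
        MonoidAlgebra.mapDomainRingHom ℤ_[p] (comapQuot ι V) (a.1 (comapONS ι V)) := by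
  have h' : comapONS ι U ≤ comapONS ι V := fun _ hx => h hx
  rw [← a.2 _ _ h', ← RingHom.comp_apply, ← RingHom.comp_apply,
    ← MonoidAlgebra.mapDomainRingHom_comp, ← MonoidAlgebra.mapDomainRingHom_comp]
  congr 2
  ext x
  rfl

/-- The action of `ℤ_p[[Γ]]` on `Pic_{ℤ_p}(X(Δ, I))`: on the component of `U` it is the action of
`ℤ_p[Γ/ι⁻¹(U)]`, through `ℤ_p[Δ/U]`. -/
noncomputable def rep : IwasawaAlgebra p Γ →+* Module.End ℤ_[p] (A.picLim p) where
  toFun a :=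
    { toFun := fun x => ⟨fun U => (A.quot U).picPRep p
          (MonoidAlgebra.mapDomainRingHom ℤ_[p] (comapQuot ι U) (a.1 (comapONS ι U))) (x.1 U),
        fun U V h => by rw [picTrans_rep, x.2 U V h, comap_compat]⟩
      map_add' := fun x y => by ext U : 2; simp
      map_smul' := fun c x => by ext U : 2; simp }
  map_one' := by ext x U : 3; simp
  map_mul' a b := by
    ext x U : 3
    simp [-MonoidAlgebra.mapDomainRingHom_apply]
  map_zero' := by ext x U : 3; simp
  map_add' a b := by
    ext x U : 3
    simp [-MonoidAlgebra.mapDomainRingHom_apply]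

noncomputable instance : Module (IwasawaAlgebra p Γ) (A.IwasawaPic p ι) :=
  Module.compHom (A.picLim p) (rep p A ι)

end IwasawaPic

end Voltage

/-- The elements of `ℤ_p[[Γ]]` which are non-zero-divisors modulo `p`. For `Γ ≅ ℤ_p` this is the
complement of the prime ideal `(p)`. -/
noncomputable def primeToP (Γ : Type v) [CommGroup Γ] [TopologicalSpace Γ] :
    Submonoid (IwasawaAlgebra p Γ) :=
  (nonZeroDivisors (IwasawaAlgebra p Γ ⧸ Ideal.span {(p : IwasawaAlgebra p Γ)})).comap
    (Ideal.Quotient.mk _)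

/-- The `μ`-invariant of a (finitely generated torsion) `ℤ_p[[Γ]]`-module `M` for `Γ ≅ ℤ_p`: the
length of the localization of `M` at the prime ideal `(p)`. It equals `∑ mᵢ` when `M` is
pseudo-isomorphic to `⨁ᵢ Λ/(p^{mᵢ}) ⊕ ⨁ⱼ Λ/(fⱼ)` with distinguished polynomials `fⱼ`. -/
noncomputable def muInv (Γ : Type v) [CommGroup Γ] [TopologicalSpace Γ] (M : Type w)
    [AddCommGroup M] [Module (IwasawaAlgebra p Γ) M] : ℕ∞ :=
  Module.length (Localization (primeToP p Γ)) (LocalizedModule (primeToP p Γ) M)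

/-- The `λ`-invariant of a (finitely generated torsion) `ℤ_p[[Γ]]`-module `M`: the dimension of
`ℚ_p ⊗ M`. -/
noncomputable def lambdaInv (M : Type w) [AddCommGroup M] [Module ℤ_[p] M] : ℕ :=
  Module.finrank ℚ_[p] (ℚ_[p] ⊗[ℤ_[p]] M)

end Iwasawa

end KidaGraph

open KidaGraph

/-!
The matrix-tree theorem turns numbers of spanning trees into determinants. In the form
`FinGraph.det_lap_add`, a consequence of the Cauchy–Binet formula, it says that `Δ + m mᵀ` has
determinant `κ (∑ m) ^ 2`, and `FinGraph.det_normOp` is the version for the Laplacian divided by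
the orders of the inertia groups, which is compatible with pull-back along ramified coverings. In a
`ℤ_p`-covering given by a voltage assignment, the functions on the layer `n + 1` modulo those on the
layer `n` form a vector space over the cyclotomic field of `p ^ (n + 1)`-th roots of unity, of
dimension the number of unramified vertices, on which the Laplacian acts through the twisted
Laplacian. Hence `p κ (X_{n+1}) = κ (X_n) p ^ r N(χ(f))` for large `n` (`Voltage.kappa_succ`). Here
`r` is the sum of the finite indices of the inertia groups, and `f` in the group ring is the
determinant `Voltage.charDet` of the twisted Laplacian at the vertices with trivial inertia group.
The valuations of the norms can be read off from the image of `f` in the power series ring over `𝔽_p`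
(`IsBinomial.padicValRat_norm`). So `μ = 0` if and only if `f` is non-zero modulo `p`, and in this
case `λ + 1` is `r` plus the order of the power series `f` modulo `p` (`Voltage.exists_invariants`).

A voltage assignment `A` with values in `Γ × G` yields one with values in `Γ` on `X`, by projection,
and one on the `G`-covering `X(G)` of `X`, by restriction (`Voltage.restrict`), whose layers are the
graphs of `A` for the subgroups `Γ^{p^n} × 1`. The two determinants are related by Kida's
congruence. If all inertia groups are infinite or trivial, then the matrix of the restriction is the
image of a matrix over the group ring of `G` in the regular representation. In characteristic `p`,
this representation of the `p`-group `G` is unitriangular, so that the determinant is the `#G`-th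
power of the determinant for the projection (`Voltage.charDet_restrict_eq_pow`). If some inertia
group is finite and non-trivial, the determinant vanishes modulo `p`
(`Voltage.charDet_restrict_eq_zero`). Together with a count of the ramified points
(`Voltage.sum_index_add`), this gives the formula for voltage graphs. By a compactness argument,
compatible base points exist in all layers of a profinite covering, so that its layers are the
derived graphs of a voltage assignment (`ProfiniteCovering.exists_voltage_layers`).

For the Picard groups, the Iwasawa algebra is identified with `ℤ_p⟦T⟧` (`iwasawaEquiv`), and the
limit of the Picard groups is presented by the square matrix `Voltage.presMatrix`, which consists of
the rows of the twisted Laplacian at the vertices with trivial inertia group and of the relations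
`γ ^ p ^ d - 1` at the other ones (`Voltage.isPresentation_presMatrix`). Its determinant modulo `p`
is `T ^ r` times the one of the twisted Laplacian. For a module with a square presentation matrix,
`μ = 0` if and only if the determinant is non-zero modulo `p`, and then `λ` is the order of the
determinant modulo `p` (`IsPresentation.muInv_eq_zero_iff`, `IsPresentation.lambdaInv_eq`). Thus
Kida's congruence applies again.
-/


/-! ### The Cauchy–Binet formula and the matrix-tree theorem -/

open scoped Classical in
/-- The Cauchy–Binet formula, summed over all maps instead of over subsets, whence the factorial. -/
theorem Matrix.factorial_mul_det_mul {n m R : Type*} [Fintype n] [Fintype m] [CommRing R]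
    (A : Matrix n m R) (B : Matrix m n R) :
    ((Fintype.card n).factorial : R) * (A * B).det =
      ∑ φ : n → m, (A.submatrix id φ).det * (B.submatrix φ id).det := by
  have h1 : (A * B).det = ∑ φ : n → m, (∏ i, A i (φ i)) * (B.submatrix φ id).det := by
    have h := (Matrix.detRowAlternating (n := n) (R := R)).toMultilinearMap.map_sum
      (g := fun (i : n) (k : m) => A i k • B k)
    have h2 : (fun i => ∑ k : m, A i k • B k) = A * B := by
      ext i j
      simp [Matrix.mul_apply]
    rw [h2] at h
    refine h.trans (Finset.sum_congr rfl fun φ _ => ?_)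
    exact ((Matrix.detRowAlternating (n := n) (R := R)).toMultilinearMap.map_smul_univ
      (fun i => A i (φ i)) (fun i => B (φ i))).trans (smul_eq_mul _ _)
  have h2 : ∀ σ : Equiv.Perm n, ∑ φ : n → m,
      ((Equiv.Perm.sign σ : ℤ) : R) * (∏ i, A (σ i) (φ i)) * (B.submatrix φ id).det =
        (A * B).det := by
    intro σ
    rw [h1, ← (Equiv.arrowCongr σ.symm (Equiv.refl m)).sum_comp]
    refine Finset.sum_congr rfl fun ψ _ => ?_
    have h3 : (B.submatrix ((Equiv.arrowCongr σ.symm (Equiv.refl m)) ψ) id).det =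
        ((Equiv.Perm.sign σ : ℤ) : R) * (B.submatrix ψ id).det := by
      rw [← Matrix.det_permute]
      rfl
    have h4 : ∏ i, A (σ i) ((Equiv.arrowCongr σ.symm (Equiv.refl m)) ψ i) = ∏ i, A i (ψ i) :=
      Equiv.prod_comp σ (fun i => A i (ψ i))
    rw [h3, h4]
    have h5 : ((Equiv.Perm.sign σ : ℤ) : R) * ((Equiv.Perm.sign σ : ℤ) : R) = 1 := by
      rw [← Int.cast_mul, ← Units.val_mul, Int.units_mul_self]
      simp
    linear_combination (∏ i, A i (ψ i)) * (B.submatrix ψ id).det * h5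
  calc ((Fintype.card n).factorial : R) * (A * B).det
      = ∑ σ : Equiv.Perm n, (A * B).det := by
        rw [Finset.sum_const, Finset.card_univ, Fintype.card_perm, nsmul_eq_mul]
    _ = ∑ σ : Equiv.Perm n, ∑ φ : n → m,
      ((Equiv.Perm.sign σ : ℤ) : R) * (∏ i, A (σ i) (φ i)) * (B.submatrix φ id).det :=
        Finset.sum_congr rfl fun σ _ => (h2 σ).symm
    _ = _ := by
        rw [Finset.sum_comm]
        refine Finset.sum_congr rfl fun φ _ => ?_
        rw [Matrix.det_apply' (A.submatrix id φ), Finset.sum_mul]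
        rfl

namespace KidaGraph

universe u v w

open scoped Classical

noncomputable instance (Y : FinGraph.{u}) : Fintype Y.V := Fintype.ofFinite _
noncomputable instance (Y : FinGraph.{u}) : Fintype Y.E := Fintype.ofFinite _

namespace FinGraph

variable (Y : FinGraph.{u})

/-- The Laplacian acting on functions on the vertices:
`(L g)(w) = ∑_{s(e) = w} (g(w) - g(t(e)))`. -/
noncomputable def lap (R : Type*) [CommRing R] : (Y.V → R) →ₗ[R] (Y.V → R) where
  toFun g w := ∑ e : Y.E, if Y.s e = w then g w - g (Y.t e) else 0
  map_add' g h := by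
    ext w
    simp only [Pi.add_apply, ← Finset.sum_add_distrib]
    refine Finset.sum_congr rfl fun e _ => ?_
    split_ifs <;> ring
  map_smul' c g := by
    ext w
    simp only [Pi.smul_apply, smul_eq_mul, RingHom.id_apply, Finset.mul_sum]
    refine Finset.sum_congr rfl fun e _ => ?_
    split_ifs <;> ring

theorem lap_apply (R : Type*) [CommRing R] (g : Y.V → R) (w : Y.V) :
    Y.lap R g w = ∑ e : Y.E, if Y.s e = w then g w - g (Y.t e) else 0 := rfl

/-- An orientation: a set of edges containing exactly one of `e` and `bar e` for each edge `e`. -/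
def IsOrientation (O : Set Y.E) : Prop := ∀ e, Y.bar e ∈ O ↔ e ∉ O

theorem exists_isOrientation : ∃ O : Set Y.E, Y.IsOrientation O := by
  obtain ⟨f, hf⟩ : ∃ f : Y.E → ℕ, Function.Injective f :=
    ⟨fun e => (Finite.equivFin Y.E e : ℕ), fun a b h => (Finite.equivFin Y.E).injective (Fin.ext h)⟩
  refine ⟨{e | f e < f (Y.bar e)}, fun e => ?_⟩
  have h : f e ≠ f (Y.bar e) := fun h => Y.bar_ne e (hf h).symm
  simp only [Set.mem_ofPred_eq, Y.bar_bar]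
  omega

variable {Y}

theorem IsOrientation.sum_eq {O : Set Y.E} (hO : Y.IsOrientation O) {M : Type*} [AddCommMonoid M]
    (F : Y.E → M) : ∑ e, F e = ∑ e : O, (F e + F (Y.bar e)) := by
  rw [Finset.sum_add_distrib, ← Fintype.sum_subtype_add_sum_subtype (fun e => e ∈ O) F]
  congr 1
  let φ : {e // e ∈ O} ≃ {e // e ∉ O} :=
    { toFun := fun e => ⟨Y.bar e.1, fun h => (hO e.1).1 h e.2⟩
      invFun := fun e => ⟨Y.bar e.1, (hO e.1).2 e.2⟩
      left_inv := fun e => Subtype.ext (Y.bar_bar _)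
      right_inv := fun e => Subtype.ext (Y.bar_bar _) }
  exact (Fintype.sum_equiv φ _ _ fun e => rfl).symm

/-- The boundary `[s(e)] - [t(e)]` of an edge. -/
noncomputable def bd (R : Type*) [CommRing R] (e : Y.E) : Y.V → R :=
  Pi.single (Y.s e) 1 - Pi.single (Y.t e) 1

theorem bd_bar (R : Type*) [CommRing R] (e : Y.E) : bd R (Y.bar e) = -bd R e := by
  simp [bd, Y.s_bar, Y.t_bar]

/-- The Laplacian is `∂ᵀ∂`, where the rows of `∂` are the vectors `[s(e)] - [t(e)]` for one edge
`e` out of each pair of opposite edges. -/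
theorem lap_single {O : Set Y.E} (hO : Y.IsOrientation O) (R : Type*) [CommRing R] (a b : Y.V) :
    Y.lap R (Pi.single b 1) a = ∑ e : O, bd R e.1 a * bd R e.1 b := by
  rw [lap_apply, hO.sum_eq]
  refine Finset.sum_congr rfl fun e _ => ?_
  simp only [bd, Y.s_bar, Y.t_bar, Pi.single_apply, Pi.sub_apply]
  by_cases h1 : Y.s e.1 = a <;> by_cases h2 : Y.t e.1 = a <;>
    by_cases h3 : Y.s e.1 = b <;> by_cases h4 : Y.t e.1 = b <;>
    simp_all [eq_comm]

theorem bd_dotProduct {R : Type*} [CommRing R] (e : Y.E) (x : Y.V → R) :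
    bd R e ⬝ᵥ x = x (Y.s e) - x (Y.t e) := by
  simp [bd, sub_dotProduct]

/-- Paths from one vertex to another along a list of edges. -/
def IsPath (Y : FinGraph.{u}) : Y.V → List Y.E → Y.V → Prop
  | a, [], b => a = b
  | a, e :: l, b => Y.s e = a ∧ IsPath Y (Y.t e) l b

theorem IsPath.exists_suffix {l : List Y.E} : ∀ {a b c : Y.V}, Y.IsPath a l b →
    c ∈ l.map Y.s → ∃ l', l'.Sublist l ∧ Y.IsPath c l' b := by
  induction l with
  | nil => intro a b c _ h; simp at h
  | cons e l ih =>
    intro a b c h hc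
    rcases List.mem_cons.1 hc with rfl | hc
    · exact ⟨e :: l, List.Sublist.refl _, rfl, h.2⟩
    · obtain ⟨l', h1, h2⟩ := ih h.2 hc
      exact ⟨l', h1.cons _, h2⟩

theorem IsPath.t_mem {l : List Y.E} : ∀ {a b : Y.V}, Y.IsPath a l b → ∀ e ∈ l,
    Y.t e ∈ l.map Y.s ∨ Y.t e = b := by
  induction l with
  | nil => intro a b _ e he; simp at he
  | cons e l ih =>
    intro a b h e' he'
    rcases List.mem_cons.1 he' with rfl | he'
    · cases l with
      | nil => exact Or.inr h.2
      | cons e'' l => left; simp [h.2.1]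
    · rcases ih h.2 e' he' with h | h
      · left; simp only [List.map_cons, List.mem_cons]; exact Or.inr h
      · exact Or.inr h

/-- Two vertices joined by a path in `T` are joined by a path in `T` without repetitions. -/
theorem exists_simple_path {T : Set Y.E} {a b : Y.V}
    (h : Relation.ReflTransGen (fun a b => ∃ e ∈ T, Y.s e = a ∧ Y.t e = b) a b) :
    ∃ l : List Y.E, (∀ e ∈ l, e ∈ T) ∧ Y.IsPath a l b ∧ (l.map Y.s).Nodup ∧ b ∉ l.map Y.s ∧
      ∀ e ∈ l, Y.bar e ∉ l := by
  induction h using Relation.ReflTransGen.head_induction_on with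
  | refl => exact ⟨[], by simp, rfl, by simp, by simp, by simp⟩
  | head h1 _ ih =>
    rename_i a c
    obtain ⟨l, h2, h3, h4, h5, h6⟩ := ih
    obtain ⟨e, he, rfl, rfl⟩ := h1
    by_cases hb : Y.s e = b
    · exact ⟨[], by simp, hb, by simp, by simp, by simp⟩
    by_cases ha : Y.s e ∈ l.map Y.s
    · obtain ⟨l', h7, h8⟩ := h3.exists_suffix ha
      exact ⟨l', fun x hx => h2 x (h7.subset hx), h8, h4.sublist (h7.map _),
        fun hx => h5 ((h7.map _).subset hx), fun x hx hx' => h6 x (h7.subset hx) (h7.subset hx')⟩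
    · have h9 : Y.bar e ∉ l := fun h => by
        rcases h3.t_mem _ h with h | h
        · rw [Y.t_bar] at h; exact ha h
        · rw [Y.t_bar] at h; exact hb h
      refine ⟨e :: l, ?_, ⟨rfl, h3⟩, ?_, ?_, ?_⟩
      · intro x hx
        rcases List.mem_cons.1 hx with rfl | hx
        · exact he
        · exact h2 x hx
      · simp only [List.map_cons, List.nodup_cons]; exact ⟨ha, h4⟩
      · simp only [List.map_cons, List.mem_cons, not_or]; exact ⟨Ne.symm hb, h5⟩
      · intro x hx hx'
        rcases List.mem_cons.1 hx with rfl | hx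
        · rcases List.mem_cons.1 hx' with h | h
          · exact Y.bar_ne _ h
          · exact h9 h
        · rcases List.mem_cons.1 hx' with h | h
          · apply h9; rw [← h, Y.bar_bar]; exact hx
          · exact h6 x hx h

theorem IsPath.isChain {l : List Y.E} : ∀ {a b : Y.V}, Y.IsPath a l b →
    l.IsChain (fun e e' => Y.t e = Y.s e') ∧ ∀ h : l ≠ [], Y.t (l.getLast h) = b := by
  induction l with
  | nil => intro a b _; simp
  | cons e l ih =>
    intro a b h
    obtain ⟨h1, h2⟩ := ih h.2
    cases l with
    | nil => exact ⟨by simp, fun _ => h.2⟩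
    | cons e' l =>
      refine ⟨List.IsChain.cons_cons h.2.1.symm h1, fun _ => ?_⟩
      rw [List.getLast_cons (by simp)]
      exact h2 _

/-- Closing up a simple path which avoids an edge `e` gives a circuit through `e`. -/
theorem exists_isCircuit {T : Set Y.E} {e : Y.E} (he : e ∈ T)
    (h : Relation.ReflTransGen
      (fun a b => ∃ e' ∈ T \ {e, Y.bar e}, Y.s e' = a ∧ Y.t e' = b) (Y.t e) (Y.s e)) :
    ∃ l : List Y.E, (∀ e ∈ l, e ∈ T) ∧ Y.IsCircuit l := by
  obtain ⟨l, h1, h2, h3, h4, h5⟩ := exists_simple_path h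
  have h6 : Y.IsPath (Y.s e) (e :: l) (Y.s e) := ⟨rfl, h2⟩
  refine ⟨e :: l, ?_, by simp, h6.isChain.1, h6.isChain.2 _, ?_, ?_⟩
  · intro x hx
    rcases List.mem_cons.1 hx with rfl | hx
    · exact he
    · exact (h1 x hx).1
  · simp only [List.map_cons, List.nodup_cons]; exact ⟨h4, h3⟩
  · intro x hx hx'
    rcases List.mem_cons.1 hx with rfl | hx
    · rcases List.mem_cons.1 hx' with h | h
      · exact Y.bar_ne _ h
      · exact (h1 _ h).2 (by simp)
    · rcases List.mem_cons.1 hx' with h | h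
      · refine (h1 _ hx).2 ?_
        rw [← h, Y.bar_bar]; simp
      · exact h5 x hx h

theorem sum_bd_eq {R : Type*} [CommRing R] {l : List Y.E} : ∀ h : l ≠ [],
    l.IsChain (fun e e' => Y.t e = Y.s e') →
    (l.map (bd R)).sum = Pi.single (Y.s (l.head h)) 1 - Pi.single (Y.t (l.getLast h)) 1 := by
  induction l with
  | nil => intro h; simp at h
  | cons e l ih =>
    intro _ hc
    cases l with
    | nil => simp [bd]
    | cons e' l =>
      have h1 := List.isChain_cons_cons.1 hc
      have h2 := ih (by simp) h1.2
      have h3 : (e :: e' :: l).getLast (by simp) = (e' :: l).getLast (by simp) :=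
        List.getLast_cons _
      rw [List.map_cons, List.sum_cons, h2, h3]
      simp [bd, h1.1]

theorem IsCircuit.sum_bd {R : Type*} [CommRing R] {l : List Y.E} (h : Y.IsCircuit l) :
    (l.map (bd R)).sum = 0 := by
  obtain ⟨h1, h2, h3, -, -⟩ := h
  rw [sum_bd_eq h1 h2, h3, sub_self]

/-- The differences of two vertices joined by edges in `T` are integral combinations of the
boundaries of the edges in `T`. -/
theorem single_sub_single_mem_span {R : Type*} [CommRing R] {T : Set Y.E} {a b : Y.V}
    (h : Relation.ReflTransGen (fun a b => ∃ e ∈ T, Y.s e = a ∧ Y.t e = b) a b) :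
    (Pi.single a 1 - Pi.single b 1 : Y.V → R) ∈ Submodule.span ℤ (bd R '' T) := by
  induction h with
  | refl => simp
  | tail _ h1 ih =>
    obtain ⟨e, he, rfl, rfl⟩ := h1
    have := Submodule.add_mem _ ih (Submodule.subset_span ⟨e, he, rfl⟩)
    simpa [bd] using this

/-- A function which is constant along the edges in `T`, with different values at `a` and `b`,
for vertices `a` and `b` which are not joined by edges in `T`. -/
theorem exists_locally_constant {R : Type*} [CommRing R] {T : Set Y.E}
    (hT : ∀ e ∈ T, Y.bar e ∈ T) {a b : Y.V}
    (h : ¬ Relation.ReflTransGen (fun a b => ∃ e ∈ T, Y.s e = a ∧ Y.t e = b) a b) :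
    ∃ x : Y.V → R, x a = 1 ∧ x b = 0 ∧ ∀ e ∈ T, x (Y.s e) = x (Y.t e) := by
  refine ⟨fun c => if Relation.ReflTransGen (fun a b => ∃ e ∈ T, Y.s e = a ∧ Y.t e = b) a c
    then 1 else 0, if_pos Relation.ReflTransGen.refl, if_neg h, fun e he => ?_⟩
  have : Relation.ReflTransGen (fun a b => ∃ e ∈ T, Y.s e = a ∧ Y.t e = b) a (Y.s e) ↔
      Relation.ReflTransGen (fun a b => ∃ e ∈ T, Y.s e = a ∧ Y.t e = b) a (Y.t e) :=
    ⟨fun h => h.tail ⟨e, he, rfl, rfl⟩,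
      fun h => h.tail ⟨Y.bar e, hT e he, Y.s_bar e, Y.t_bar e⟩⟩
  simp only [this]

/-- The rows `m` and `[s(e)] - [t(e)]` for the edges `e` in an orientation. -/
noncomputable def inc (O : Set Y.E) (m : Y.V → ℚ) : Matrix (Option O) Y.V ℚ :=
  fun k => k.elim m fun e => bd ℚ e.1

/-- The edges in the image of a map to an orientation, and their opposites. -/
def edgesOf {O : Set Y.E} (φ : Y.V → Option O) : Set Y.E :=
  {e | ∃ v, ∃ o : O, φ v = some o ∧ (e = o.1 ∨ e = Y.bar o.1)}

theorem bar_mem_edgesOf {O : Set Y.E} (φ : Y.V → Option O) (e : Y.E) (he : e ∈ edgesOf φ) :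
    Y.bar e ∈ edgesOf φ := by
  obtain ⟨v, o, h, rfl | rfl⟩ := he
  · exact ⟨v, o, h, Or.inr rfl⟩
  · exact ⟨v, o, h, Or.inl (Y.bar_bar _)⟩

theorem mem_edgesOf {O : Set Y.E} (hO : Y.IsOrientation O) (φ : Y.V → Option O) (o : O) :
    o.1 ∈ edgesOf φ ↔ some o ∈ Set.range φ := by
  constructor
  · rintro ⟨v, o', h, h' | h'⟩
    · exact ⟨v, by rw [h, Subtype.ext h']⟩
    · exact absurd o'.2 ((hO o'.1).1 (h' ▸ o.2))
  · rintro ⟨v, h⟩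
    exact ⟨v, o, h, Or.inl rfl⟩

/-- The matrix with the rows `[j] - [j₀]` for `j ≠ j₀`, completed by the row `m`. -/
theorem det_single_sub_single (j₀ : Y.V) (m : Y.V → ℚ) :
    (Matrix.of fun j : Y.V => if j = j₀ then m else Pi.single j 1 - Pi.single j₀ 1).det =
      ∑ j, m j := by
  have hB : ((1 : Matrix Y.V Y.V ℚ).updateCol j₀ 1).det = 1 := by
    rw [← Matrix.cramer_apply, Matrix.cramer_one]
    rfl
  have hCB : (Matrix.of fun j : Y.V => if j = j₀ then m else Pi.single j 1 - Pi.single j₀ 1) *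
      ((1 : Matrix Y.V Y.V ℚ).updateCol j₀ 1) =
        (1 : Matrix Y.V Y.V ℚ).updateRow j₀ (Function.update m j₀ (∑ j, m j)) := by
    ext a b
    rw [Matrix.mul_apply]
    simp only [Matrix.of_apply]
    by_cases ha : a = j₀ <;> by_cases hb : b = j₀
    · simp [Matrix.updateRow_apply, ha, hb]
    · simp [Matrix.updateRow_apply, ha, hb, Matrix.one_apply]
    · simp [Matrix.updateRow_apply, ha, hb, Pi.single_apply]
    · simp [Matrix.updateRow_apply, ha, hb, Ne.symm hb, Matrix.one_apply, Pi.single_apply, eq_comm]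
  have h := congrArg Matrix.det hCB
  rw [Matrix.det_mul, hB, mul_one, ← Matrix.cramer_transpose_apply, Matrix.transpose_one,
    Matrix.cramer_one] at h
  rw [h]
  simp

/-- If the chosen edges connect all vertices, then their rows and the row `m` span the same
lattice as the vectors `[j] - [j₀]` and `m`, so that the determinants agree up to sign. -/
theorem det_inc_sq {O : Set Y.E} {m : Y.V → ℚ} (hm : ∑ w, m w ≠ 0) {φ : Y.V → Option O}
    {j₀ : Y.V} (h0 : φ j₀ = none) (hinj : Function.Injective φ)
    (hc : Y.ConnectedBy (edgesOf φ)) :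
    ((inc O m).submatrix φ id).det ^ 2 = (∑ w, m w) ^ 2 := by
  set B := (inc O m).submatrix φ id with hB
  set C : Matrix Y.V Y.V ℚ :=
    Matrix.of fun j : Y.V => if j = j₀ then m else Pi.single j 1 - Pi.single j₀ 1 with hC
  have hCdet : C.det = ∑ w, m w := det_single_sub_single j₀ m
  have hCj : ∀ j, C j = if j = j₀ then m else Pi.single j 1 - Pi.single j₀ 1 := fun j => rfl
  have hB0 : B j₀ = m := by
    change inc O m (φ j₀) = m
    rw [h0]; rfl
  -- each of the two families of rows consists of integral combinations of the other one
  have h1 : ∀ j, C j ∈ Submodule.span ℤ (Set.range B) := by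
    intro j
    by_cases hj : j = j₀
    · refine Submodule.subset_span ⟨j₀, ?_⟩
      rw [hB0, hj, hCj, if_pos rfl]
    · have h2 : C j = Pi.single j 1 - Pi.single j₀ 1 := by rw [hCj, if_neg hj]
      rw [h2]
      refine Submodule.span_le.2 ?_ (single_sub_single_mem_span (hc.2 j j₀))
      rintro _ ⟨e, ⟨v, o, hv, rfl | rfl⟩, rfl⟩
      · refine Submodule.subset_span ⟨v, ?_⟩
        change inc O m (φ v) = _
        rw [hv]; rfl
      · rw [bd_bar]
        refine Submodule.neg_mem _ (Submodule.subset_span ⟨v, ?_⟩)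
        change inc O m (φ v) = _
        rw [hv]; rfl
  have h2 : ∀ j, B j ∈ Submodule.span ℤ (Set.range C) := by
    have h3 : ∀ a, (Pi.single a 1 - Pi.single j₀ 1 : Y.V → ℚ) ∈ Submodule.span ℤ (Set.range C) := by
      intro a
      by_cases ha : a = j₀
      · simp [ha]
      · exact Submodule.subset_span ⟨a, by rw [hCj, if_neg ha]⟩
    intro j
    by_cases hj : j = j₀
    · rw [hj, hB0]
      exact Submodule.subset_span ⟨j₀, by rw [hCj, if_pos rfl]⟩
    · obtain ⟨o, ho⟩ : ∃ o, φ j = some o := by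
        cases h : φ j with
        | none => exact absurd (hinj (h.trans h0.symm)) hj
        | some o => exact ⟨o, rfl⟩
      have h4 : B j = bd ℚ o.1 := by
        change inc O m (φ j) = _
        rw [ho]; rfl
      rw [h4]
      have := Submodule.sub_mem _ (h3 (Y.s o.1)) (h3 (Y.t o.1))
      simpa [bd] using this
  have key : ∀ P Q : Matrix Y.V Y.V ℚ, (∀ j, P j ∈ Submodule.span ℤ (Set.range Q)) →
      ∃ N : Matrix Y.V Y.V ℤ, P = N.map (Int.castRingHom ℚ) * Q := by
    intro P Q h
    choose c hc using fun j => (Submodule.mem_span_range_iff_exists_fun ℤ).1 (h j)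
    refine ⟨Matrix.of c, ?_⟩
    ext a b
    rw [← hc a, Matrix.mul_apply]
    simp [Finset.sum_apply]
  obtain ⟨N, hN⟩ := key C B h1
  obtain ⟨N', hN'⟩ := key B C h2
  have e1 : C.det = (N.det : ℚ) * B.det := by
    conv_lhs => rw [hN]
    rw [Matrix.det_mul, Int.cast_det]; rfl
  have e2 : B.det = (N'.det : ℚ) * C.det := by
    conv_lhs => rw [hN']
    rw [Matrix.det_mul, Int.cast_det]; rfl
  have e3 : N.det * N'.det = 1 := by
    have : ((N.det * N'.det : ℤ) : ℚ) = 1 := by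
      have h5 : C.det ≠ 0 := by rwa [hCdet]
      apply mul_right_cancel₀ h5
      rw [one_mul, Int.cast_mul, mul_assoc, ← e2, ← e1]
    exact_mod_cast this
  have e4 : N'.det ^ 2 = 1 := by
    have h6 : IsUnit N'.det := IsUnit.of_mul_eq_one N.det (by rwa [mul_comm])
    rcases Int.isUnit_iff.1 h6 with h | h <;> rw [h] <;> norm_num
  rw [e2, mul_pow, hCdet]
  have : ((N'.det : ℚ)) ^ 2 = 1 := by exact_mod_cast e4
  rw [this, one_mul]

/-- A choice of rows which is not given by `m` and a connecting set of edges is linearly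
dependent. -/
theorem det_inc_eq_zero {O : Set Y.E} {m : Y.V → ℚ} (hm : ∑ w, m w ≠ 0) {φ : Y.V → Option O}
    (h : ¬ (Function.Injective φ ∧ none ∈ Set.range φ ∧ Y.ConnectedBy (edgesOf φ))) :
    ((inc O m).submatrix φ id).det = 0 := by
  have hne : Nonempty Y.V := by
    by_contra hne
    rw [not_nonempty_iff] at hne
    exact hm (by simp)
  by_cases h1 : Function.Injective φ
  swap
  · simp only [Function.Injective, not_forall] at h1
    obtain ⟨a, b, hab, hne⟩ := h1
    refine Matrix.det_zero_of_row_eq hne ?_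
    change inc O m (φ a) = inc O m (φ b)
    rw [hab]
  rw [← Matrix.exists_mulVec_eq_zero_iff]
  by_cases h2 : none ∈ Set.range φ
  · have h3 : ¬ Y.ConnectedBy (edgesOf φ) := fun h3 => h ⟨h1, h2, h3⟩
    simp only [FinGraph.ConnectedBy, hne, true_and, not_forall] at h3
    obtain ⟨a, b, hab⟩ := h3
    obtain ⟨x, hxa, hxb, hx⟩ := exists_locally_constant (R := ℚ) (bar_mem_edgesOf φ) hab
    -- A function which is constant on the components is in the kernel of the rows of the edges;
    -- its weighted mean is made zero, so that it is also orthogonal to `m`.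
    refine ⟨fun w => x w - (∑ w, m w * x w) / ∑ w, m w, fun h0 => ?_, ?_⟩
    · have e1 := congrFun h0 a
      have e2 := congrFun h0 b
      simp only [Pi.zero_apply, hxa, hxb] at e1 e2
      linarith
    · ext j
      change inc O m (φ j) ⬝ᵥ _ = 0
      cases hj : φ j with
      | none =>
        change m ⬝ᵥ _ = 0
        simp only [dotProduct, mul_sub, Finset.sum_sub_distrib, ← Finset.sum_mul]
        field_simp
        ring
      | some o =>
        change bd ℚ o.1 ⬝ᵥ _ = 0
        rw [bd_dotProduct, hx _ ⟨j, o, hj, Or.inl rfl⟩, sub_self]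
  · refine ⟨fun _ => 1, fun h0 => ?_, ?_⟩
    · have := congrFun h0 (Classical.arbitrary Y.V)
      simp at this
    · ext j
      change inc O m (φ j) ⬝ᵥ _ = 0
      cases hj : φ j with
      | none => exact absurd ⟨j, hj⟩ h2
      | some o =>
        change bd ℚ o.1 ⬝ᵥ _ = 0
        rw [bd_dotProduct, sub_self]

/-- A connected set of `#V - 1` edges contains no circuit: the vectors `[s(e)] - [t(e)]` are
linearly independent, whereas they sum to zero along a circuit. -/
theorem isSpanningTree_edgesOf {O : Set Y.E} (hO : Y.IsOrientation O) {φ : Y.V → Option O}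
    (hinj : Function.Injective φ) (h0 : none ∈ Set.range φ) (hc : Y.ConnectedBy (edgesOf φ)) :
    Y.IsSpanningTree (edgesOf φ) := by
  refine ⟨bar_mem_edgesOf φ, hc, fun l hl hcirc => ?_⟩
  obtain ⟨j₀, hj₀⟩ := h0
  have hne := hc.1
  have hm : ∑ w : Y.V, (1 : ℚ) ≠ 0 := by simp
  have hdet : ((inc O fun _ => 1).submatrix φ id).det ≠ 0 := by
    intro h
    have := det_inc_sq hm hj₀ hinj hc
    rw [h] at this
    exact hm (by simpa using this.symm)
  -- the circuit gives a linear relation between the rows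
  let G : Option O → ℚ := fun k => k.elim 0 fun o =>
    (if o.1 ∈ l then 1 else 0) - (if Y.bar o.1 ∈ l then 1 else 0)
  have hsum : ∑ o : O, G (some o) • bd ℚ o.1 = 0 := by
    rw [← hcirc.sum_bd (R := ℚ)]
    obtain ⟨-, -, -, hnd, -⟩ := hcirc
    rw [← List.sum_toFinset _ (List.Nodup.of_map _ hnd)]
    have : ∑ e ∈ l.toFinset, bd ℚ e = ∑ e : Y.E, if e ∈ l then bd ℚ e else 0 := by
      rw [← Finset.sum_filter]
      congr 1
      ext e; simp
    rw [this, hO.sum_eq]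
    refine Finset.sum_congr rfl fun o _ => ?_
    simp only [G, Option.elim_some, bd_bar, sub_smul, ite_smul, one_smul, zero_smul]
    by_cases h1 : o.1 ∈ l <;> by_cases h2 : Y.bar o.1 ∈ l <;> simp [h1, h2]
  have hG : ∀ k, G k ≠ 0 → k ∈ Set.range φ := by
    intro k hk
    cases k with
    | none => exact ⟨j₀, hj₀⟩
    | some o =>
      rw [← mem_edgesOf hO]
      by_cases h1 : o.1 ∈ l
      · exact hl _ h1
      · by_cases h2 : Y.bar o.1 ∈ l
        · have := bar_mem_edgesOf φ _ (hl _ h2)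
          rwa [Y.bar_bar] at this
        · simp [G, h1, h2] at hk
  have hvec : Matrix.vecMul (fun v => G (φ v)) ((inc O fun _ => 1).submatrix φ id) = 0 := by
    rw [Matrix.vecMul_eq_sum]
    have h1 : ∑ v, G (φ v) • inc O (fun _ => 1) (φ v) = ∑ k, G k • inc O (fun _ => 1) k := by
      rw [← Finset.sum_image (s := Finset.univ) (g := φ)
        (f := fun k => G k • inc O (fun _ => 1) k) (fun a _ b _ h => hinj h)]
      refine Finset.sum_subset (Finset.subset_univ _) fun k _ hk => ?_
      have : G k = 0 := by
        by_contra h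
        obtain ⟨v, rfl⟩ := hG k h
        exact hk (Finset.mem_image_of_mem _ (Finset.mem_univ _))
      rw [this, zero_smul]
    refine h1.trans ?_
    rw [Fintype.sum_option]
    simp only [G, Option.elim_none, zero_smul, zero_add]
    exact hsum
  have hz : ∀ v, G (φ v) = 0 := by
    by_contra h
    refine hdet ((Matrix.exists_vecMul_eq_zero_iff).1 ⟨fun v => G (φ v), fun h' => h ?_, hvec⟩)
    exact fun v => congrFun h' v
  obtain ⟨hlne, -, -, -, hbar⟩ := hcirc
  have hmem : l.head hlne ∈ l := List.head_mem hlne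
  obtain ⟨v, o, hv, h | h⟩ := hl _ hmem
  · have := hz v
    rw [hv] at this
    rw [h] at hmem
    have h2 := hbar _ hmem
    simp [G, hmem, h2] at this
  · have := hz v
    rw [hv] at this
    rw [h] at hmem
    have h2 := hbar _ hmem
    rw [Y.bar_bar] at h2
    simp [G, hmem, h2] at this

/-- A spanning tree has one edge less than the graph has vertices. -/
theorem IsSpanningTree.card {O : Set Y.E} (hO : Y.IsOrientation O) {T : Set Y.E}
    (hT : Y.IsSpanningTree T) :
    Fintype.card {k : Option O // ∀ o, k = some o → o.1 ∈ T} = Fintype.card Y.V := by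
  have hne := hT.connected.1
  have hm : ∑ w : Y.V, (1 : ℚ) ≠ 0 := by simp
  let K := {k : Option O // ∀ o, k = some o → o.1 ∈ T}
  let v : K → Y.V → ℚ := fun k => inc O (fun _ => 1) k.1
  have hv1 : ∀ o : O, ∀ h, v ⟨some o, h⟩ = bd ℚ o.1 := fun o h => rfl
  -- The rows of the edges in the tree and the all-ones row are a basis. They are independent
  -- since the removal of an edge disconnects its end points.
  have li : LinearIndependent ℚ v := by
    rw [Fintype.linearIndependent_iff]
    intro c hc
    have hdot : ∀ x : Y.V → ℚ, ∑ k, c k * (v k ⬝ᵥ x) = 0 := by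
      intro x
      have := congrArg (fun y => y ⬝ᵥ x) hc
      simpa [sum_dotProduct] using this
    have hsome : ∀ o : O, ∀ h : (∀ o', some o = some o' → o'.1 ∈ T),
        (∀ h', c ⟨none, h'⟩ = 0) → c ⟨some o, h⟩ = 0 := by
      intro o h hnone
      have hoT := h o rfl
      have hnot : ¬ Relation.ReflTransGen (fun a b => ∃ e' ∈ T \ {o.1, Y.bar o.1},
          Y.s e' = a ∧ Y.t e' = b) (Y.t o.1) (Y.s o.1) := by
        intro hpath
        obtain ⟨l, hl, hl'⟩ := exists_isCircuit hoT hpath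
        exact hT.acyclic l hl hl'
      obtain ⟨x, hxa, hxb, hx⟩ := exists_locally_constant (R := ℚ) (T := T \ {o.1, Y.bar o.1})
        (by
          rintro e ⟨he, he'⟩
          refine ⟨hT.bar_mem e he, fun h' => he' ?_⟩
          rcases h' with h' | h'
          · right; rw [Set.mem_singleton_iff, ← h', Y.bar_bar]
          · left
            have := congrArg Y.bar (Set.mem_singleton_iff.1 h')
            rwa [Y.bar_bar, Y.bar_bar] at this) hnot
      have := hdot x
      rw [Finset.sum_eq_single ⟨some o, h⟩] at this
      · rw [hv1, bd_dotProduct, hxa, hxb] at this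
        linarith
      · rintro ⟨k, hk⟩ - hne
        cases k with
        | none => rw [hnone, zero_mul]
        | some o' =>
          rw [hv1, bd_dotProduct, hx o'.1 ⟨hk _ rfl, ?_⟩, sub_self, mul_zero]
          rintro (h' | h')
          · exact hne (Subtype.ext (congrArg some (Subtype.ext h')))
          · have h'' : o'.1 = Y.bar o.1 := h'
            exact (hO o.1).1 (h'' ▸ o'.2) o.2
      · intro h'; exact absurd (Finset.mem_univ _) h'
    have hnone : ∀ h', c ⟨none, h'⟩ = 0 := by
      intro h'
      have := hdot (fun _ => 1)
      rw [Finset.sum_eq_single ⟨none, h'⟩] at this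
      · have h2 : v ⟨none, h'⟩ ⬝ᵥ (fun _ => (1 : ℚ)) = ∑ w : Y.V, (1 : ℚ) := by
          simp [v, inc, dotProduct]
        rw [h2] at this
        exact (mul_eq_zero.1 this).resolve_right hm
      · rintro ⟨k, hk⟩ - hne
        cases k with
        | none => exact absurd rfl hne
        | some o' => rw [hv1, bd_dotProduct, sub_self, mul_zero]
      · intro h'; exact absurd (Finset.mem_univ _) h'
    rintro ⟨k, hk⟩
    cases k with
    | none => exact hnone hk
    | some o => exact hsome o hk hnone
  -- They span since the tree is connected.
  have sp : ⊤ ≤ Submodule.span ℚ (Set.range v) := by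
    let j₀ := Classical.arbitrary Y.V
    have h1 : ∀ j, (Pi.single j 1 - Pi.single j₀ 1 : Y.V → ℚ) ∈ Submodule.span ℚ (Set.range v) := by
      intro j
      have h2 := Submodule.span_subset_span ℤ ℚ _
        (single_sub_single_mem_span (R := ℚ) (hT.connected.2 j j₀))
      refine Submodule.span_le.2 ?_ h2
      rintro _ ⟨e, he, rfl⟩
      by_cases heO : e ∈ O
      · exact Submodule.subset_span ⟨⟨some ⟨e, heO⟩, by
          intro o h; rw [← Option.some.inj h]; exact he⟩, rfl⟩
      · have h3 : Y.bar e ∈ O := (hO e).2 heO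
        rw [← Y.bar_bar e, bd_bar]
        exact Submodule.neg_mem _ (Submodule.subset_span ⟨⟨some ⟨Y.bar e, h3⟩, by
          intro o h; rw [← Option.some.inj h]; exact hT.bar_mem _ he⟩, rfl⟩)
    have h2 : (Pi.single j₀ 1 : Y.V → ℚ) ∈ Submodule.span ℚ (Set.range v) := by
      have h3 : (fun _ => 1 : Y.V → ℚ) ∈ Submodule.span ℚ (Set.range v) :=
        Submodule.subset_span ⟨⟨none, by simp⟩, rfl⟩
      have h4 := Submodule.sub_mem _ h3 (Submodule.sum_mem _ (fun j (_ : j ∈ Finset.univ) => h1 j))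
      have h5 : (fun _ => 1 : Y.V → ℚ) - ∑ j, (Pi.single j 1 - Pi.single j₀ 1) =
          (∑ w : Y.V, (1 : ℚ)) • Pi.single j₀ 1 := by
        ext w
        simp [Finset.sum_apply, Pi.single_apply]
      rw [h5] at h4
      have := Submodule.smul_mem _ (∑ w : Y.V, (1 : ℚ))⁻¹ h4
      rwa [smul_smul, inv_mul_cancel₀ hm, one_smul] at this
    intro x _
    rw [pi_eq_sum_univ' x]
    refine Submodule.sum_mem _ fun j _ => Submodule.smul_mem _ _ ?_
    have := Submodule.add_mem _ (h1 j) h2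
    simpa using this
  have := Module.finrank_eq_card_basis (Module.Basis.mk li sp)
  rw [Module.finrank_fintype_fun_eq_card] at this
  exact this.symm

/-- The number of maps enumerating the edges of some spanning tree and one extra element. -/
theorem card_enumerations {O : Set Y.E} (hO : Y.IsOrientation O) :
    Fintype.card {φ : Y.V → Option O //
      Function.Injective φ ∧ none ∈ Set.range φ ∧ Y.ConnectedBy (edgesOf φ)} =
      (Fintype.card Y.V).factorial * Y.kappa := by
  let Φ := {φ : Y.V → Option O //
      Function.Injective φ ∧ none ∈ Set.range φ ∧ Y.ConnectedBy (edgesOf φ)}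
  let S := {T : Set Y.E // Y.IsSpanningTree T}
  let F : Φ → S := fun φ => ⟨edgesOf φ.1, isSpanningTree_edgesOf hO φ.2.1 φ.2.2.1 φ.2.2.2⟩
  have hF : ∀ T : S, Fintype.card {φ // F φ = T} = (Fintype.card Y.V).factorial := by
    rintro ⟨T, hT⟩
    let K := {k : Option O // ∀ o, k = some o → o.1 ∈ T}
    have hrange : ∀ φ : Y.V → Option O, none ∈ Set.range φ →
        (edgesOf φ = T ↔ ∀ k, k ∈ Set.range φ ↔ ∀ o, k = some o → o.1 ∈ T) := by
      intro φ h0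
      constructor
      · rintro rfl k
        cases k with
        | none => simp [h0]
        | some o =>
          rw [← mem_edgesOf hO]
          exact ⟨fun h o' h' => Option.some.inj h' ▸ h, fun h => h o rfl⟩
      · intro h
        have h1 : ∀ o : O, o.1 ∈ edgesOf φ ↔ o.1 ∈ T := fun o => by
          rw [mem_edgesOf hO, h]
          exact ⟨fun h => h o rfl, fun h o' h' => Option.some.inj h' ▸ h⟩
        ext e
        by_cases heO : e ∈ O
        · exact h1 ⟨e, heO⟩
        · have h3 : Y.bar e ∈ O := (hO e).2 heO
          have h4 := h1 ⟨Y.bar e, h3⟩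
          constructor
          · intro h
            have := hT.bar_mem _ (h4.1 (bar_mem_edgesOf φ e h))
            rwa [Y.bar_bar] at this
          · intro h
            have := bar_mem_edgesOf φ _ (h4.2 (hT.bar_mem e h))
            rwa [Y.bar_bar] at this
    have e : {φ // F φ = ⟨T, hT⟩} ≃ (Y.V ≃ K) :=
      { toFun := fun φ => Equiv.ofBijective (fun v => ⟨φ.1.1 v,
            ((hrange φ.1.1 φ.1.2.2.1).1 (congrArg Subtype.val φ.2) _).1 ⟨v, rfl⟩⟩)
          ⟨fun a b h => φ.1.2.1 (congrArg Subtype.val h), fun k => by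
            obtain ⟨v, hv⟩ :=
              ((hrange φ.1.1 φ.1.2.2.1).1 (congrArg Subtype.val φ.2) k.1).2 k.2
            exact ⟨v, Subtype.ext hv⟩⟩
        invFun := fun σ => by
          have h1 : ∀ k : K, k.1 ∈ Set.range fun v => (σ v).1 := fun k =>
            ⟨σ.symm k, by simp⟩
          have h2 : none ∈ Set.range fun v => (σ v).1 := h1 ⟨none, by simp⟩
          have h3 : edgesOf (fun v => (σ v).1) = T := (hrange _ h2).2 fun k =>
            ⟨fun ⟨v, hv⟩ => hv ▸ (σ v).2, fun hk => h1 ⟨k, hk⟩⟩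
          exact ⟨⟨fun v => (σ v).1, fun a b h => σ.injective (Subtype.ext h), h2,
            h3.symm ▸ hT.connected⟩, Subtype.ext h3⟩
        left_inv := fun φ => rfl
        right_inv := fun σ => by ext v; rfl }
    rw [Fintype.card_congr e]
    have hK : Fintype.card Y.V = Fintype.card K := (hT.card hO).symm
    exact Fintype.card_equiv (Fintype.equivOfCardEq hK)
  have h1 := Fintype.card_congr (Equiv.sigmaFiberEquiv F)
  rw [Fintype.card_sigma, Finset.sum_congr rfl fun T _ => hF T, Finset.sum_const,
    Finset.card_univ, smul_eq_mul] at h1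
  rw [kappa, Nat.card_eq_fintype_card, mul_comm]
  exact h1.symm

/-- The matrix-tree theorem, in a form which treats all the vertices alike. -/
theorem det_lap_add (m : Y.V → ℚ) (hm : ∑ w, m w ≠ 0) :
    (Matrix.of fun a b : Y.V => Y.lap ℚ (Pi.single b 1) a + m a * m b).det =
      Y.kappa * (∑ w, m w) ^ 2 := by
  obtain ⟨O, hO⟩ := Y.exists_isOrientation
  have h1 : (Matrix.of fun a b : Y.V => Y.lap ℚ (Pi.single b 1) a + m a * m b) =
      (inc O m).transpose * inc O m := by
    ext a b
    rw [Matrix.mul_apply, Fintype.sum_option, Matrix.of_apply, lap_single hO, add_comm]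
    rfl
  have h2 := Matrix.factorial_mul_det_mul (inc O m).transpose (inc O m)
  have h3 : ∀ φ : Y.V → Option O,
      ((inc O m).transpose.submatrix id φ).det * ((inc O m).submatrix φ id).det =
        if Function.Injective φ ∧ none ∈ Set.range φ ∧ Y.ConnectedBy (edgesOf φ)
        then (∑ w, m w) ^ 2 else 0 := by
    intro φ
    have h4 : ((inc O m).transpose.submatrix id φ).det = ((inc O m).submatrix φ id).det := by
      rw [← Matrix.det_transpose]
      rfl
    rw [h4, ← sq]
    split_ifs with h
    · obtain ⟨j₀, hj₀⟩ := h.2.1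
      exact det_inc_sq hm hj₀ h.1 h.2.2
    · rw [det_inc_eq_zero hm h]; simp
  rw [← h1, Finset.sum_congr rfl fun φ _ => h3 φ, ← Finset.sum_filter, Finset.sum_const,
    ← Fintype.card_subtype, card_enumerations hO, nsmul_eq_mul] at h2
  have h5 : (((Fintype.card Y.V).factorial : ℕ) : ℚ) ≠ 0 := by
    exact_mod_cast Nat.factorial_ne_zero _
  apply mul_left_cancel₀ h5
  rw [h2]
  push_cast
  ring

/-- The Dirichlet form of a connected graph vanishes only on constant functions. -/
theorem eq_of_lap_eq_zero (hc : Y.Connected) (g : Y.V → ℚ)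
    (h : ∑ w, g w * Y.lap ℚ g w = 0) (a b : Y.V) : g a = g b := by
  obtain ⟨O, hO⟩ := Y.exists_isOrientation
  have h1 : ∑ w, g w * Y.lap ℚ g w = ∑ e : O, (g (Y.s e.1) - g (Y.t e.1)) ^ 2 := by
    simp only [lap_apply, Finset.mul_sum, mul_ite, mul_zero]
    rw [Finset.sum_comm]
    simp only [Finset.sum_ite_eq, Finset.mem_univ, if_true]
    rw [hO.sum_eq]
    refine Finset.sum_congr rfl fun e _ => ?_
    rw [Y.s_bar, Y.t_bar]; ring
  rw [h1] at h
  have h2 : ∀ e : O, g (Y.s e.1) = g (Y.t e.1) := by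
    intro e
    have := (Finset.sum_eq_zero_iff_of_nonneg (fun e _ => sq_nonneg _)).1 h e (Finset.mem_univ _)
    nlinarith [pow_eq_zero_iff (two_ne_zero) |>.1 this]
  have h3 : ∀ e, g (Y.s e) = g (Y.t e) := by
    intro e
    by_cases heO : e ∈ O
    · exact h2 ⟨e, heO⟩
    · have := h2 ⟨Y.bar e, (hO e).2 heO⟩
      rw [Y.s_bar, Y.t_bar] at this
      exact this.symm
  have h4 := hc.2 a b
  induction h4 with
  | refl => rfl
  | tail _ h5 ih =>
    obtain ⟨e, -, rfl, rfl⟩ := h5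
    rw [ih, h3]

end FinGraph

end KidaGraph

namespace KidaGraph

open scoped Classical

/-! ### Determinants -/

/-- Let `π : W → W'` be a surjection such that the pull-back of functions along `π` intertwines
the operators `A'` and `A`. If the quotient of the functions on `W` by those pulled back from `W'`
is a vector space over `K`, on which `A` induces a `K`-linear operator `D`, then
`det A = det A' · N(det D)`. -/
theorem det_eq_det_mul_norm {W W' B K : Type*} [Fintype W] [Fintype W'] [Fintype B] [Field K]
    [Algebra ℚ K] [FiniteDimensional ℚ K] (π : W → W') (hπ : Function.Surjective π)
    (A : (W → ℚ) →ₗ[ℚ] (W → ℚ)) (A' : (W' → ℚ) →ₗ[ℚ] (W' → ℚ)) (D : Matrix B B K)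
    (q : (W → ℚ) →ₗ[ℚ] (B → K)) (hq : Function.Surjective q)
    (h1 : ∀ g : W' → ℚ, A (g ∘ π) = A' g ∘ π) (h2 : ∀ g, q (A g) = D.mulVec (q g))
    (h3 : ∀ g : W' → ℚ, q (g ∘ π) = 0)
    (hcard : Fintype.card W = Fintype.card W' + Fintype.card B * Module.finrank ℚ K) :
    LinearMap.det A = LinearMap.det A' * Algebra.norm ℚ D.det := by
  let P : (W' → ℚ) →ₗ[ℚ] (W → ℚ) := LinearMap.funLeft ℚ ℚ π
  have hP : Function.Injective P := LinearMap.funLeft_injective_of_surjective ℚ ℚ π hπ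
  let U := LinearMap.range P
  have hU : U = LinearMap.ker q := by
    refine Submodule.eq_of_le_of_finrank_eq ?_ ?_
    · rintro _ ⟨g, rfl⟩
      exact h3 g
    · have e1 : Module.finrank ℚ U = Fintype.card W' := by
        rw [LinearMap.finrank_range_of_inj hP, Module.finrank_fintype_fun_eq_card]
      have e2 := LinearMap.finrank_range_add_finrank_ker q
      rw [LinearMap.range_eq_top.2 hq, finrank_top, Module.finrank_fintype_fun_eq_card, hcard,
        ← Module.finrank_mul_finrank ℚ K (B → K), Module.finrank_fintype_fun_eq_card] at e2
      rw [e1]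
      linarith [mul_comm (Module.finrank ℚ K) (Fintype.card B)]
  have hinv : U ≤ U.comap A := by
    rintro _ ⟨g, rfl⟩
    exact ⟨A' g, (h1 g).symm⟩
  rw [LinearMap.det_eq_det_mul_det U A hinv]
  congr 1
  · let e : (W' → ℚ) ≃ₗ[ℚ] U := LinearEquiv.ofInjective P hP
    rw [← LinearMap.det_conj A' e]
    congr 1
    refine LinearMap.ext fun x => ?_
    obtain ⟨g, rfl⟩ := e.surjective x
    apply Subtype.ext
    simp only [LinearMap.comp_apply, LinearEquiv.coe_coe, LinearEquiv.symm_apply_apply]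
    exact h1 g
  · let e : ((W → ℚ) ⧸ U) ≃ₗ[ℚ] (B → K) :=
      (Submodule.quotEquivOfEq _ _ hU).trans (q.quotKerEquivOfSurjective hq)
    have he : ∀ g, e (Submodule.Quotient.mk g) = q g := fun g => rfl
    have h4 : LinearMap.det ((Matrix.toLin' D).restrictScalars ℚ) = Algebra.norm ℚ D.det := by
      rw [LinearMap.det_restrictScalars, LinearMap.det_toLin']
    rw [← h4, ← LinearMap.det_conj (U.mapQ U A hinv) e]
    congr 1
    refine LinearMap.ext fun x => ?_
    obtain ⟨y, rfl⟩ := e.surjective x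
    induction y using Submodule.Quotient.induction_on with
    | H g =>
      simp only [LinearMap.comp_apply, LinearEquiv.coe_coe]
      rw [LinearEquiv.symm_apply_apply]
      exact h2 g

/-- A representation of a finite `p`-group in characteristic `p` is unitriangular in a suitable
basis. -/
theorem exists_unitriangular {p : ℕ} [Fact p.Prime] {G : Type*} [Group G]
    (hG : IsPGroup p G) (n : ℕ) : ∀ {W : Type} [AddCommGroup W] [Module (ZMod p) W]
    [FiniteDimensional (ZMod p) W] (ρ : Representation (ZMod p) G W),
    Module.finrank (ZMod p) W = n →
      ∃ b : Module.Basis (Fin n) (ZMod p) W, ∀ g i j,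
        (i < j → b.repr (ρ g (b j)) i = 0) ∧ b.repr (ρ g (b i)) i = 1 := by
  induction n with
  | zero =>
    intro W _ _ _ ρ h
    exact ⟨Module.finBasisOfFinrankEq _ _ h, fun g i => i.elim0⟩
  | succ n ih =>
    intro W _ _ _ ρ h
    -- a non-zero invariant functional
    let _ : MulAction G (Module.Dual (ZMod p) W) :=
      { smul := fun g l => ρ.dual g l
        one_smul := fun l => by change ρ.dual 1 l = l; rw [map_one]; rfl
        mul_smul := fun g g' l => by
          change ρ.dual (g * g') l = ρ.dual g (ρ.dual g' l)
          rw [map_mul]; rfl }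
    have : Finite (Module.Dual (ZMod p) W) := Module.finite_of_finite (ZMod p)
    have hcard : p ∣ Nat.card (Module.Dual (ZMod p) W) := by
      rw [Module.natCard_eq_pow_finrank (K := ZMod p), Nat.card_zmod, Subspace.dual_finrank_eq, h]
      exact dvd_pow_self _ (Nat.succ_ne_zero n)
    obtain ⟨l, hl, hl0⟩ := hG.exists_fixed_point_of_prime_dvd_card_of_fixed_point
      (Module.Dual (ZMod p) W) hcard (a := 0) (fun g => map_zero (ρ.dual g))
    have hlρ : ∀ g x, l (ρ g x) = l x := by
      intro g x
      have h1 : ρ.dual g⁻¹ l = l := hl g⁻¹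
      conv_rhs => rw [← h1]
      change l _ = l (ρ (g⁻¹)⁻¹ x)
      rw [inv_inv]
    obtain ⟨y, hy⟩ : ∃ y, l y = 1 := by
      obtain ⟨x, hx⟩ : ∃ x, l x ≠ 0 := by
        by_contra hc
        push Not at hc
        exact hl0 (LinearMap.ext fun x => (hc x).symm)
      exact ⟨(l x)⁻¹ • x, by rw [map_smul, smul_eq_mul, inv_mul_cancel₀ hx]⟩
    let N := LinearMap.ker l
    have hN : Module.finrank (ZMod p) N = n := by
      have h1 := LinearMap.finrank_range_add_finrank_ker l
      have h2 : LinearMap.range l = ⊤ := LinearMap.range_eq_top.2 fun c =>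
        ⟨c • y, by rw [map_smul, hy, smul_eq_mul, mul_one]⟩
      rw [h2, finrank_top, Module.finrank_self, h] at h1
      change Module.finrank (ZMod p) (LinearMap.ker l) = n
      omega
    let ρN : Representation (ZMod p) G N :=
      { toFun := fun g => (ρ g).restrict (p := N) (q := N) fun x hx => by
          change l _ = 0
          rw [hlρ]; exact hx
        map_one' := by ext x; simp
        map_mul' := fun g g' => by ext x; simp }
    have : ∀ (b : Module.Basis (Fin n) (ZMod p) N),
        ∀ c : ZMod p, ∀ x ∈ N, c • y + x = 0 → c = 0 := by
      intro b c x hx hc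
      have := congrArg l hc
      rw [map_add, map_smul, hy, (show l x = 0 from hx)] at this
      simpa using this
    have key : ∃ b : Module.Basis (Fin n) (ZMod p) N, ∀ g i j,
        (i < j → b.repr (ρN g (b j)) i = 0) ∧ b.repr (ρN g (b i)) i = 1 := by
      let e := (Module.finBasisOfFinrankEq (ZMod p) N hN).equivFun
      let ρ' : Representation (ZMod p) G (Fin n → ZMod p) :=
        { toFun := fun g => e.conj (ρN g)
          map_one' := by rw [map_one]; exact LinearEquiv.conj_id e
          map_mul' := fun g g' => by
            rw [map_mul]
            exact LinearMap.ext fun x => by simp [LinearEquiv.conj_apply] }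
      obtain ⟨b, hb⟩ := ih ρ' (by rw [Module.finrank_fintype_fun_eq_card, Fintype.card_fin])
      refine ⟨b.map e.symm, fun g i j => ?_⟩
      have h1 : ∀ i j, (b.map e.symm).repr (ρN g (b.map e.symm j)) i = b.repr (ρ' g (b j)) i := by
        intro i j
        simp [ρ', LinearEquiv.conj_apply]
      rw [h1, h1]
      exact hb g i j
    obtain ⟨b, hb⟩ := key
    -- A basis of the kernel of the functional, completed by a vector on which the functional is
    -- `1`.
    let b' := Module.Basis.mkFinCons y b (this b) fun z => ⟨-l z, by
      change l _ = 0
      rw [map_add, map_smul, hy]; simp⟩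
    have hb0 : b' 0 = y := by simp [b']
    have hbs : ∀ i, b' (Fin.succ i) = b i := fun i => by simp [b']
    have hrepr : ∀ x : N, ∀ i : Fin (n + 1), b'.repr x.1 i =
        Fin.cases (motive := fun _ => ZMod p) 0 (fun i => b.repr x i) i := by
      intro x i
      have h1 : x.1 = ∑ i, b.repr x i • b' (Fin.succ i) := by
        have h2 := congrArg (Submodule.subtype N) (b.sum_repr x)
        rw [map_sum] at h2
        refine h2.symm.trans (Finset.sum_congr rfl fun i _ => ?_)
        rw [map_smul, hbs]; rfl
      rw [h1]
      simp only [map_sum, map_smul, Module.Basis.repr_self, Finsupp.coe_finsetSum,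
        Finset.sum_apply, Finsupp.smul_apply, Finsupp.single_apply, smul_eq_mul]
      refine Fin.cases ?_ (fun i => ?_) i
      · simp
      · simp
    refine ⟨b', fun g i j => ⟨fun hij => ?_, ?_⟩⟩
    · obtain ⟨j, rfl⟩ := Fin.exists_succ_eq.2 (ne_of_gt (lt_of_le_of_lt (Fin.zero_le i) hij))
      rw [hbs]
      have h1 := hrepr (ρN g (b j)) i
      refine Eq.trans h1 ?_
      induction i using Fin.cases with
      | zero => rfl
      | succ i => exact (hb g i j).1 (Fin.succ_lt_succ_iff.1 hij)
    · induction i using Fin.cases with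
      | zero =>
        rw [hb0]
        have h1 : ρ g y - y ∈ N := by
          change l _ = 0
          rw [map_sub, hlρ, sub_self]
        have h2 := hrepr ⟨_, h1⟩ 0
        have h3 : ρ g y = b' 0 + (ρ g y - y) := by rw [hb0]; abel
        rw [h3, map_add, Finsupp.add_apply, h2]
        simp
      | succ i =>
        rw [hbs]
        have h1 := hrepr (ρN g (b i)) (Fin.succ i)
        refine Eq.trans h1 ?_
        exact (hb g i i).2

open scoped Kronecker

/-- In characteristic `p`, the determinant of a matrix over the group ring of a `p`-group `G`,
acting through the regular representation, is the `#G`-th power of the determinant of its image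
under the augmentation. -/
theorem det_regular_eq_pow {p : ℕ} [Fact p.Prime] {G : Type*} [Group G] [Fintype G]
    (hG : IsPGroup p G) {R : Type*} [CommRing R] [Algebra (ZMod p) R] {B : Type*} [Fintype B]
    (M : G → Matrix B B R) :
    (Matrix.of fun a b : B × G => M (a.2⁻¹ * b.2) a.1 b.1).det =
      (∑ c, M c).det ^ Fintype.card G := by
  let n := Fintype.card G
  let eG : G ≃ Fin n := Fintype.equivFin G
  let F := ZMod p
  let ρ : Representation F G (Fin n → F) :=
    { toFun := fun c => LinearMap.funLeft F F fun i => eG (eG.symm i * c)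
      map_one' := LinearMap.ext fun x => funext fun i => by simp [LinearMap.funLeft_apply]
      map_mul' := fun c d => LinearMap.ext fun x => funext fun i => by
        simp [LinearMap.funLeft_apply, mul_assoc] }
  obtain ⟨b, hb⟩ := exists_unitriangular hG n ρ (by
    rw [Module.finrank_fintype_fun_eq_card, Fintype.card_fin])
  let s := Pi.basisFun F (Fin n)
  let U := s.toMatrix b
  let U' := b.toMatrix s
  have hUU' : U * U' = 1 := s.toMatrix_mul_toMatrix_flip b
  let T : G → Matrix (Fin n) (Fin n) F := fun c => LinearMap.toMatrix b b (ρ c)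
  let P : G → Matrix (Fin n) (Fin n) F := fun c => LinearMap.toMatrix s s (ρ c)
  have hP : ∀ c, P c = U * T c * U' := fun c =>
    (basis_toMatrix_mul_linearMap_toMatrix_mul_basis_toMatrix s b s b (ρ c)).symm
  have hPapply : ∀ c i j, P c i j = if eG (eG.symm i * c) = j then 1 else 0 := by
    intro c i j
    simp only [P, s, LinearMap.toMatrix_apply, Pi.basisFun_apply, Pi.basisFun_repr]
    change (Pi.single j 1 : Fin n → F) (eG (eG.symm i * c)) = _
    rw [Pi.single_apply]
  let φ := algebraMap F R
  have h1 : (Matrix.of fun a b : B × G => M (a.2⁻¹ * b.2) a.1 b.1) =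
      (∑ c, M c ⊗ₖ (P c).map φ).submatrix (Prod.map id eG) (Prod.map id eG) := by
    ext ⟨a, g⟩ ⟨a', g'⟩
    simp only [Matrix.of_apply, Matrix.submatrix_apply, Matrix.sum_apply, Prod.map_apply, id,
      Matrix.kronecker_apply, Matrix.map_apply, hPapply, Equiv.symm_apply_apply,
      EmbeddingLike.apply_eq_iff_eq]
    rw [Finset.sum_eq_single (g⁻¹ * g')]
    · simp
    · intro c _ hc
      rw [if_neg, map_zero, mul_zero]
      rintro rfl
      exact hc (by simp)
    · intro h; exact absurd (Finset.mem_univ _) h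
  have h2 : (∑ c, M c ⊗ₖ (P c).map φ) =
      ((1 : Matrix B B R) ⊗ₖ U.map φ) * (∑ c, M c ⊗ₖ (T c).map φ) *
        ((1 : Matrix B B R) ⊗ₖ U'.map φ) := by
    rw [Finset.mul_sum, Finset.sum_mul]
    refine Finset.sum_congr rfl fun c _ => ?_
    rw [← Matrix.mul_kronecker_mul, ← Matrix.mul_kronecker_mul, hP, one_mul, mul_one,
      Matrix.map_mul, Matrix.map_mul]
  have h3 : ((1 : Matrix B B R) ⊗ₖ U.map φ) * ((1 : Matrix B B R) ⊗ₖ U'.map φ) = 1 := by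
    rw [← Matrix.mul_kronecker_mul, one_mul, ← Matrix.map_mul, hUU',
      Matrix.map_one _ (map_zero _) (map_one _), Matrix.one_kronecker_one]
  rw [h1, show Prod.map (id : B → B) eG = ((Equiv.refl B).prodCongr eG) from rfl,
    Matrix.det_submatrix_equiv_self, h2, Matrix.det_mul, Matrix.det_mul, mul_right_comm,
    ← Matrix.det_mul, h3, Matrix.det_one, one_mul]
  -- After the base change the matrix is block triangular, and every diagonal block is `∑ c, M c`.
  have h4 : (∑ c, M c ⊗ₖ (T c).map φ).BlockTriangular (fun a => OrderDual.toDual a.2) := by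
    intro a b hab
    have h5 : a.2 < b.2 := hab
    rw [Matrix.sum_apply]
    refine Finset.sum_eq_zero fun c _ => ?_
    rw [Matrix.kronecker_apply, Matrix.map_apply]
    have : T c a.2 b.2 = 0 := by
      simp only [T, LinearMap.toMatrix_apply]
      exact (hb c _ _).1 h5
    rw [this, map_zero, mul_zero]
  rw [h4.det_fintype]
  have h5 : ∀ k : (Fin n)ᵒᵈ, ((∑ c, M c ⊗ₖ (T c).map φ).toSquareBlock
      (fun a => OrderDual.toDual a.2) k).det = (∑ c, M c).det := by
    intro k
    let e : B ≃ {a : B × Fin n // OrderDual.toDual a.2 = k} :=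
      { toFun := fun a => ⟨(a, OrderDual.ofDual k), rfl⟩
        invFun := fun a => a.1.1
        left_inv := fun a => rfl
        right_inv := fun ⟨⟨a, i⟩, h⟩ => by subst h; rfl }
    rw [← Matrix.det_submatrix_equiv_self e]
    congr 1
    ext a a'
    rw [Matrix.submatrix_apply, Matrix.toSquareBlock_def, Matrix.of_apply, Matrix.sum_apply,
      Matrix.sum_apply]
    refine Finset.sum_congr rfl fun c _ => ?_
    rw [Matrix.kronecker_apply, Matrix.map_apply]
    have : T c (e a).1.2 (e a').1.2 = 1 := by
      simp only [T, LinearMap.toMatrix_apply]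
      exact (hb c _ (e a).1.2).2
    rw [this, map_one, mul_one]
    rfl
  rw [Finset.prod_congr rfl fun k _ => h5 k, Finset.prod_const, Finset.card_univ]
  congr 1
  simp [n]

/-- If a matrix maps the functions pulled back along a surjection `c : B → B'` to such functions,
and the values over some point of `B'` vanish for all of them, then its determinant vanishes. -/
theorem det_eq_zero_of_comp {B B' R : Type*} [Fintype B] [Fintype B'] [CommRing R] [IsDomain R]
    (c : B → B') (hc : Function.Surjective c) (D : Matrix B B R) (D' : Matrix B' B' R)
    (h : ∀ u : B' → R, D.mulVec (u ∘ c) = D'.mulVec u ∘ c) (v : B') (hv : ∀ v', D' v v' = 0) :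
    D.det = 0 := by
  have h1 : D'.det = 0 := Matrix.det_eq_zero_of_row_eq_zero v hv
  obtain ⟨u, hu, hu'⟩ := Matrix.exists_mulVec_eq_zero_iff.2 h1
  refine Matrix.exists_mulVec_eq_zero_iff.1 ⟨u ∘ c, fun h0 => hu ?_, ?_⟩
  · ext b'
    obtain ⟨b, rfl⟩ := hc b'
    exact congrFun h0 b
  · rw [h, hu']; rfl

end KidaGraph

namespace KidaGraph

open scoped Classical
open Polynomial NumberField

/-! ### Norms of cyclotomic numbers -/

section Cyclotomic

variable {p : ℕ} [hp : Fact p.Prime]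

/-- Modulo `c`, the multiplication by `1 + c * y` is the identity. -/
theorem norm_one_add_mul_modEq {S : Type*} [CommRing S] [Module.Free ℤ S] [Module.Finite ℤ S]
    (c : ℤ) (y : S) : Algebra.norm ℤ (1 + (c : S) * y) ≡ 1 [ZMOD c] := by
  let b := Module.Free.chooseBasis ℤ S
  rw [Algebra.norm_eq_matrix_det b, map_add, map_one, map_mul, map_intCast]
  have h0 : ((c : ℤ) : ZMod c.natAbs) = 0 := by
    rw [ZMod.intCast_zmod_eq_zero_iff_dvd]; exact Int.natAbs_dvd_self
  have h : (Int.castRingHom (ZMod c.natAbs)).mapMatrix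
      (1 + (c : Matrix _ _ ℤ) * Algebra.leftMulMatrix b y) = 1 := by
    rw [map_add, map_one, map_mul, map_intCast,
      ← map_intCast (Matrix.scalar (α := ZMod c.natAbs) (Module.Free.ChooseBasisIndex ℤ S)) c, h0, map_zero,
      zero_mul, add_zero]
  have h2 := congrArg Matrix.det h
  rw [Matrix.det_one, ← RingHom.map_det] at h2
  rw [← Int.modEq_natAbs, ← ZMod.intCast_eq_intCast_iff, Int.cast_one]
  exact h2

/-- In the ring of integers of the cyclotomic field of `p ^ (n + 1)`-th roots of unity,
`(ζ - 1) ^ φ(p ^ (n + 1))` is divisible by `p`. -/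
theorem exists_zeta_sub_one_pow {S : Type*} [CommRing S] {n : ℕ} {ζ : S}
    (hζ : aeval ζ (cyclotomic (p ^ (n + 1)) ℤ) = 0) :
    ∃ h : S, (ζ - 1) ^ (p ^ (n + 1)).totient = p * h := by
  have h1 : ((X - 1 : ℤ[X]) ^ (p ^ (n + 1)).totient - cyclotomic (p ^ (n + 1)) ℤ).map
      (Int.castRingHom (ZMod p)) = 0 := by
    have := cyclotomic_mul_prime_pow_eq (ZMod p) (p := p) (m := 1) (by
      simpa using hp.out.ne_one) (Nat.succ_pos n)
    rw [mul_one, cyclotomic_one] at this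
    rw [Polynomial.map_sub, map_cyclotomic, this, Polynomial.map_pow, Polynomial.map_sub,
      Polynomial.map_X, Polynomial.map_one, Nat.totient_prime_pow hp.out (Nat.succ_pos n),
      sub_eq_zero]
    congr 1
    rw [Nat.succ_eq_add_one, Nat.add_sub_cancel, pow_succ, Nat.mul_sub, mul_one]
  obtain ⟨h, hh⟩ : (C (p : ℤ)) ∣ ((X - 1 : ℤ[X]) ^ (p ^ (n + 1)).totient -
      cyclotomic (p ^ (n + 1)) ℤ) := by
    rw [C_dvd_iff_dvd_coeff]
    intro i
    have := congrArg (fun q => q.coeff i) h1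
    rw [coeff_map, coeff_zero] at this
    exact (ZMod.intCast_zmod_eq_zero_iff_dvd _ _).1 this
  refine ⟨aeval ζ h, ?_⟩
  have h2 := congrArg (aeval ζ) hh
  rw [map_sub, hζ, sub_zero, map_pow, map_sub, aeval_X, map_one, map_mul, aeval_C] at h2
  rw [h2]
  simp

/-- If `P = (X - 1) ^ l * u + p * h` with `u(1)` prime to `p`, the norm of `P(ζ)` has valuation `l`
for a primitive `p ^ (n + 1)`-th root of unity `ζ`, provided `l < φ(p ^ (n + 1))`. -/
theorem padicValRat_norm {n : ℕ} (hn : p ^ (n + 1) ≠ 2) {K : Type*} [Field K] [CharZero K]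
    [IsCyclotomicExtension {p ^ (n + 1)} ℚ K] {ζ : K} (hζ : IsPrimitiveRoot ζ (p ^ (n + 1)))
    {l : ℕ} (hl : l < (p ^ (n + 1)).totient) (P u h : ℤ[X])
    (hP : P = (X - 1) ^ l * u + C (p : ℤ) * h)
    (hu : ¬ (p : ℤ) ∣ u.eval 1) :
    Algebra.norm ℚ (aeval ζ P) ≠ 0 ∧ padicValRat p (Algebra.norm ℚ (aeval ζ P)) = l := by
  have : NeZero (p ^ (n + 1)) := ⟨pow_ne_zero _ hp.out.ne_zero⟩
  have : NumberField K := IsCyclotomicExtension.numberField {p ^ (n + 1)} ℚ K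
  have : FiniteDimensional ℚ K := inferInstance
  have hp0 : (p : ℤ) ≠ 0 := by exact_mod_cast hp.out.ne_zero
  let z : 𝓞 K := hζ.toInteger
  have hz : (z : K) = ζ := rfl
  have hcyc : aeval z (cyclotomic (p ^ (n + 1)) ℤ) = 0 := by
    apply RingOfIntegers.coe_injective
    have := hζ.isRoot_cyclotomic (NeZero.pos _)
    rw [IsRoot.def, ← map_cyclotomic_int, eval_map] at this
    rw [map_zero, ← this, ← hz, ← aeval_algebraMap_apply]
    rfl
  let N : 𝓞 K →* ℤ := Algebra.norm ℤ
  have hNN : ∀ x : 𝓞 K, ((N x : ℤ) : ℚ) = Algebra.norm ℚ (x : K) := fun x => Algebra.coe_norm_int x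
  have hNπ : N (z - 1) = p := by
    have h1 := hNN (z - 1)
    have h2 := hζ.sub_one_norm_isPrimePow (K := ℚ) (hp.out.isPrimePow.pow (Nat.succ_ne_zero n))
      (cyclotomic.irreducible_rat (NeZero.pos _)) hn
    rw [Nat.Prime.pow_minFac hp.out (Nat.succ_ne_zero n)] at h2
    have h3 : ((z - 1 : 𝓞 K) : K) = ζ - 1 := by simp [hz]
    rw [h3, h2] at h1
    exact_mod_cast h1
  set φ := (p ^ (n + 1)).totient with hφ
  have hrank : Module.finrank ℚ K = φ :=
    IsCyclotomicExtension.finrank K (cyclotomic.irreducible_rat (NeZero.pos _))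
  have hNp : N (p : 𝓞 K) = (p : ℤ) ^ φ := by
    have h1 := hNN (p : 𝓞 K)
    have h3 : ((p : 𝓞 K) : K) = algebraMap ℚ K (p : ℚ) := by simp
    rw [h3, Algebra.norm_algebraMap, hrank] at h1
    exact_mod_cast h1
  obtain ⟨v, hv⟩ := exists_zeta_sub_one_pow hcyc
  -- The norms of `(ζ - 1) ^ φ` and `p` agree, so `v` has norm one and is a unit.
  have hNv : N v = 1 := by
    have := congrArg N hv
    rw [map_pow, map_mul, hNπ, hNp] at this
    exact (mul_right_eq_self₀.1 this.symm).resolve_right (pow_ne_zero _ hp0)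
  have hvu : IsUnit v := by
    rw [NumberField.isUnit_iff_norm, RingOfIntegers.coe_norm, ← hNN, hNv]
    simp
  obtain ⟨v', hv'⟩ := hvu.exists_right_inv
  -- the quotient of `P(ζ)` by `(ζ - 1) ^ l`
  let w : 𝓞 K := aeval z u + (z - 1) ^ (φ - l) * v' * aeval z h
  have hw : aeval z P = (z - 1) ^ l * w := by
    have h1 : (p : 𝓞 K) = (z - 1) ^ l * (z - 1) ^ (φ - l) * v' := by
      rw [← pow_add, Nat.add_sub_cancel' hl.le, hv, mul_assoc, hv', mul_one]
    rw [hP, map_add, map_mul, map_mul, map_pow, map_sub, aeval_X, map_one, aeval_C]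
    have h2 : algebraMap ℤ (𝓞 K) (p : ℤ) = (p : 𝓞 K) := by simp
    rw [h2, h1]
    ring
  obtain ⟨k, hk⟩ : (z - 1) ∣ w - ((u.eval 1 : ℤ) : 𝓞 K) := by
    have h1 : (z - 1) ∣ aeval z u - ((u.eval 1 : ℤ) : 𝓞 K) := by
      have h2 := sub_dvd_eval_sub z 1 (u.map (Int.castRingHom (𝓞 K)))
      rw [eval_map, eval_one_map] at h2
      exact h2
    have h2 : (z - 1) ∣ (z - 1) ^ (φ - l) * v' * aeval z h :=
      ((dvd_pow_self _ (Nat.sub_ne_zero_of_lt hl)).mul_right _).mul_right _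
    have := dvd_add h1 h2
    convert this using 1
    ring
  -- The element `w` is congruent to the integer `u(1)`, prime to `p`, modulo `ζ - 1`. Thus a
  -- multiple of it is congruent to `1` modulo `ζ - 1`, and after the `φ`-th power modulo `p`.
  have hNw : ¬ (p : ℤ) ∣ N w := by
    obtain ⟨a, b, hab⟩ : IsCoprime (u.eval 1) (p : ℤ) :=
      ((Nat.prime_iff_prime_int.1 hp.out).coprime_iff_not_dvd.2 hu).symm
    obtain ⟨c, hc⟩ : (z - 1) ∣ 1 - a * w := by
      have h1 : (z - 1) ∣ (p : 𝓞 K) := ⟨(z - 1) ^ (φ - 1) * v', by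
        rw [← mul_assoc, ← pow_succ', Nat.sub_add_cancel (by omega), hv, mul_assoc, hv', mul_one]⟩
      have h2 : (1 : 𝓞 K) = a * ((u.eval 1 : ℤ) : 𝓞 K) + b * (p : 𝓞 K) := by
        exact_mod_cast congrArg (Int.cast (R := 𝓞 K)) hab.symm
      have h3 : 1 - a * w = b * p - a * ((z - 1) * k) := by
        rw [← hk]; linear_combination h2
      rw [h3]
      exact dvd_sub (h1.mul_left _) ((dvd_mul_right _ _).mul_left _)
    obtain ⟨d, hd⟩ : a * w ∣ 1 + (p : ℤ) * (- (v * c ^ φ)) := by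
      have h1 : a * w = 1 - (z - 1) * c := by rw [← hc]; ring
      have h2 : 1 + ((p : ℤ) : 𝓞 K) * (- (v * c ^ φ)) = 1 ^ φ - ((z - 1) * c) ^ φ := by
        rw [mul_pow, hv, one_pow]; push_cast; ring
      rw [h1, h2]
      exact sub_dvd_pow_sub_pow _ _ _
    intro hdvd
    have h1 := norm_one_add_mul_modEq (p : ℤ) (-(v * c ^ φ))
    rw [hd, map_mul, map_mul] at h1
    have h2 : (p : ℤ) ∣ Algebra.norm ℤ (a : 𝓞 K) * Algebra.norm ℤ w * Algebra.norm ℤ d :=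
      (hdvd.mul_left _).mul_right _
    have h3 := (Int.modEq_zero_iff_dvd.2 h2).symm.trans h1
    have h4 := Int.modEq_zero_iff_dvd.1 h3.symm
    exact hp.out.one_lt.ne' (by exact_mod_cast Int.eq_one_of_dvd_one (by positivity) h4)
  have hPz : ((aeval z P : 𝓞 K) : K) = aeval ζ P := (aeval_algebraMap_apply K z P).symm
  rw [← hPz, ← hNN, hw, map_mul, map_pow, hNπ]
  have hNw0 : N w ≠ 0 := fun h => hNw (h ▸ dvd_zero _)
  refine ⟨by exact_mod_cast mul_ne_zero (pow_ne_zero _ hp0) hNw0, ?_⟩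
  rw [padicValRat.of_int, padicValInt.mul (pow_ne_zero _ hp0) hNw0,
    padicValInt.eq_zero_of_not_dvd hNw, add_zero, ← Nat.cast_pow, padicValInt.of_nat,
    padicValNat.prime_pow]

end Cyclotomic

end KidaGraph

namespace KidaGraph

universe u v w

open scoped Classical
open Polynomial

/-! ### Groups isomorphic to `ℤ_p` -/

section ZpGroup

variable {p : ℕ} [hp : Fact p.Prime] {Γ : Type v} [CommGroup Γ] [TopologicalSpace Γ]
  (ε : Γ ≃ₜ* Multiplicative ℤ_[p])

/-- The additive coordinate on a group isomorphic to `ℤ_p`. -/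
noncomputable def coord (γ : Γ) : ℤ_[p] := (ε γ).toAdd

theorem coord_mul (γ γ' : Γ) : coord ε (γ * γ') = coord ε γ + coord ε γ' := by
  simp [coord]

theorem coord_one : coord ε 1 = 0 := by simp [coord]

theorem coord_inv (γ : Γ) : coord ε γ⁻¹ = -coord ε γ := by simp [coord]

theorem coord_pow (γ : Γ) (n : ℕ) : coord ε (γ ^ n) = n * coord ε γ := by simp [coord]

theorem coord_injective : Function.Injective (coord ε) := fun _ _ h =>
  ε.injective (Multiplicative.toAdd.injective h)

theorem coord_surjective (c : ℤ_[p]) : ∃ γ, coord ε γ = c :=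
  ⟨ε.symm (Multiplicative.ofAdd c), by simp [coord]⟩

theorem isInducing_coord : Topology.IsInducing (coord ε) :=
  ε.toHomeomorph.isInducing

/-- The topological generator. -/
noncomputable def gen : Γ := ε.symm (Multiplicative.ofAdd 1)

theorem coord_gen : coord ε (gen ε) = 1 := by simp [coord, gen]

/-- The open subgroup `Γ^{p^n}`. -/
def powSubgroup (n : ℕ) : OpenNormalSubgroup Γ where
  toSubgroup := (powMonoidHom (p ^ n) : Γ →* Γ).range
  isOpen' := isOpen_pow_range ⟨ε⟩ n

theorem mem_powSubgroup {n : ℕ} {γ : Γ} :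
    γ ∈ (powSubgroup ε n).toSubgroup ↔ (p : ℤ_[p]) ^ n ∣ coord ε γ := by
  constructor
  · rintro ⟨γ', rfl⟩
    rw [powMonoidHom_apply, coord_pow]
    push_cast
    exact dvd_mul_right _ _
  · rintro ⟨c, hc⟩
    obtain ⟨γ', rfl⟩ := coord_surjective ε c
    refine ⟨γ', coord_injective ε ?_⟩
    rw [powMonoidHom_apply, coord_pow, hc]
    push_cast; rfl

theorem powSubgroup_anti {m n : ℕ} (h : m ≤ n) : powSubgroup ε n ≤ powSubgroup ε m := by
  intro γ hγ
  exact (mem_powSubgroup ε).2 ((pow_dvd_pow _ h).trans ((mem_powSubgroup ε).1 hγ))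

/-- The exponent `k < p ^ n` with `γ ∈ gen ^ k Γ^{p^n}`. -/
noncomputable def expo (n : ℕ) (γ : Γ) : ℕ := (PadicInt.toZModPow n (coord ε γ)).val

theorem toZModPow_eq_iff {n : ℕ} {x y : ℤ_[p]} :
    PadicInt.toZModPow n x = PadicInt.toZModPow n y ↔ (p : ℤ_[p]) ^ n ∣ y - x := by
  rw [eq_comm, ← sub_eq_zero, ← map_sub, ← RingHom.mem_ker, PadicInt.ker_toZModPow,
    Ideal.mem_span_singleton]

theorem pow_ne_zero_nat (n : ℕ) : NeZero (p ^ n) := ⟨pow_ne_zero _ hp.out.ne_zero⟩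

theorem expo_lt (n : ℕ) (γ : Γ) : expo ε n γ < p ^ n := by
  have := pow_ne_zero_nat (p := p) n
  exact ZMod.val_lt _

theorem dvd_coord_sub_expo (n : ℕ) (γ : Γ) : (p : ℤ_[p]) ^ n ∣ coord ε γ - expo ε n γ := by
  have := pow_ne_zero_nat (p := p) n
  rw [← toZModPow_eq_iff, map_natCast, expo, ZMod.natCast_zmod_val]

theorem exists_eq_gen_pow_mul (n : ℕ) (γ : Γ) :
    ∃ γ', γ = gen ε ^ expo ε n γ * γ' ^ p ^ n := by
  obtain ⟨c, hc⟩ := dvd_coord_sub_expo ε n γ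
  obtain ⟨γ', rfl⟩ := coord_surjective ε c
  refine ⟨γ', coord_injective ε ?_⟩
  rw [coord_mul, coord_pow, coord_pow, coord_gen]
  push_cast
  linear_combination hc

theorem expo_eq_iff {n : ℕ} {γ γ' : Γ} :
    expo ε n γ = expo ε n γ' ↔ γ⁻¹ * γ' ∈ (powSubgroup ε n).toSubgroup := by
  have := pow_ne_zero_nat (p := p) n
  rw [mem_powSubgroup, coord_mul, coord_inv, neg_add_eq_sub, ← toZModPow_eq_iff]
  exact (ZMod.val_injective _).eq_iff

theorem expo_gen_pow {n k : ℕ} (hk : k < p ^ n) : expo ε n (gen ε ^ k) = k := by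
  have := pow_ne_zero_nat (p := p) n
  rw [expo, coord_pow, coord_gen, mul_one, map_natCast, ZMod.val_natCast_of_lt hk]

/-- The quotient `Γ/Γ^{p^n}` is `ℤ/p^n`. -/
noncomputable def quotEquiv (n : ℕ) : Γ ⧸ (powSubgroup ε n).toSubgroup ≃ Fin (p ^ n) where
  toFun := Quotient.lift (fun γ => ⟨expo ε n γ, expo_lt ε n γ⟩) fun a b h =>
    Fin.ext ((expo_eq_iff ε).2 (QuotientGroup.leftRel_apply.1 h))
  invFun k := ((gen ε ^ (k : ℕ) : Γ) : Γ ⧸ (powSubgroup ε n).toSubgroup)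
  left_inv q := by
    induction q using QuotientGroup.induction_on with
    | H γ =>
      refine QuotientGroup.eq.2 ((expo_eq_iff ε).1 ?_)
      exact expo_gen_pow ε (expo_lt ε n γ)
  right_inv k := Fin.ext (expo_gen_pow ε k.2)

theorem card_quot (n : ℕ) : Nat.card (Γ ⧸ (powSubgroup ε n).toSubgroup) = p ^ n := by
  rw [Nat.card_congr (quotEquiv ε n), Nat.card_fin]

theorem exists_not_dvd {x : ℤ_[p]} (hx : x ≠ 0) : ∃ n, ¬ (p : ℤ_[p]) ^ n ∣ x := by
  by_contra! h
  refine hx (PadicInt.ext_of_toZModPow.1 fun n => ?_)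
  rw [eq_comm, toZModPow_eq_iff, sub_zero]
  exact h n

/-- An open subgroup contains some `Γ^{p^n}`. -/
theorem exists_powSubgroup_le (U : OpenNormalSubgroup Γ) : ∃ n, powSubgroup ε n ≤ U := by
  have h1 : (U : Set Γ) ∈ nhds (1 : Γ) := U.isOpen'.mem_nhds U.one_mem
  rw [(isInducing_coord ε).nhds_eq_comap, coord_one] at h1
  obtain ⟨s, hs, hsU⟩ := h1
  obtain ⟨r, hr, hrs⟩ := Metric.mem_nhds_iff.1 hs
  obtain ⟨n, hn⟩ := PadicInt.exists_pow_neg_lt p hr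
  refine ⟨n, fun γ hγ => hsU (hrs ?_)⟩
  have h2 := (mem_powSubgroup ε).1 hγ
  rw [← Ideal.mem_span_singleton, ← PadicInt.norm_le_pow_iff_mem_span_pow] at h2
  rw [mem_ball_zero_iff]
  exact h2.trans_lt hn

/-- A closed subgroup is stable under multiplication by `ℤ_p`. -/
theorem mem_of_coord_dvd {I : Subgroup Γ} (hI : IsClosed (I : Set Γ)) {γ γ' : Γ} (hγ : γ ∈ I)
    (h : coord ε γ ∣ coord ε γ') : γ' ∈ I := by
  obtain ⟨c, hc⟩ := h
  let g : ℤ_[p] → Γ := fun c => ε.symm (Multiplicative.ofAdd (coord ε γ * c))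
  have hg : Continuous g := by
    refine (map_continuous ε.symm).comp (continuous_ofAdd.comp ?_)
    fun_prop
  have h1 : ∀ c, g c ∈ I := by
    intro c
    refine PadicInt.denseRange_natCast.induction_on (p := fun c => g c ∈ I) c
      (hI.preimage hg) fun k => ?_
    have : g k = γ ^ k := coord_injective ε (by
      rw [coord_pow]; simp [g, coord, mul_comm])
    rw [this]
    exact I.pow_mem hγ k
  have : γ' = g c := coord_injective ε (by rw [hc]; simp [g, coord])
  rw [this]
  exact h1 c

/-- A non-trivial closed subgroup is some `Γ^{p^n}`. -/
theorem exists_eq_powSubgroup_of_isClosed {I : Subgroup Γ} (hI : IsClosed (I : Set Γ))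
    (h : I ≠ ⊥) : ∃ n, I = (powSubgroup ε n).toSubgroup := by
  have key : ∀ γ ∈ I, γ ≠ 1 →
      ∃ n, (powSubgroup ε n).toSubgroup ≤ I ∧ (p : ℤ_[p]) ^ n ∣ coord ε γ := by
    intro γ hγ hγ1
    have hx : coord ε γ ≠ 0 := fun h => hγ1 (coord_injective ε (h.trans (coord_one ε).symm))
    have h1 : Associated (coord ε γ) ((p : ℤ_[p]) ^ (coord ε γ).valuation) := by
      conv_lhs => rw [PadicInt.unitCoeff_spec hx]
      rw [mul_comm]
      exact associated_mul_unit_left _ _ (Units.isUnit _)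
    exact ⟨_, fun γ' hγ' => mem_of_coord_dvd ε hI hγ
      (h1.dvd.trans ((mem_powSubgroup ε).1 hγ')), h1.symm.dvd⟩
  obtain ⟨γ, hγ, hγ1⟩ := I.bot_or_exists_ne_one.resolve_left h
  have hex : ∃ n, (powSubgroup ε n).toSubgroup ≤ I := ⟨_, (key γ hγ hγ1).choose_spec.1⟩
  refine ⟨Nat.find hex, le_antisymm (fun γ hγ => ?_) (Nat.find_spec hex)⟩
  by_cases hγ1 : γ = 1
  · rw [hγ1]
    exact one_mem _
  · obtain ⟨n, hn, hd⟩ := key γ hγ hγ1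
    exact powSubgroup_anti ε (Nat.find_min' hex hn) ((mem_powSubgroup ε).2 hd)

/-- A group isomorphic to `ℤ_p` has no torsion. -/
theorem finite_iff_eq_bot (ε : Γ ≃ₜ* Multiplicative ℤ_[p]) {I : Subgroup Γ} : Finite I ↔ I = ⊥ := by
  constructor
  · intro h
    rw [Subgroup.eq_bot_iff_forall]
    intro γ hγ
    have h1 := pow_card_eq_one' (x := (⟨γ, hγ⟩ : I))
    have h2 : γ ^ Nat.card I = 1 := congrArg Subtype.val h1
    have h3 := coord_pow ε γ (Nat.card I)
    rw [h2, coord_one, eq_comm, mul_eq_zero] at h3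
    refine coord_injective ε ((h3.resolve_left ?_).trans (coord_one ε).symm)
    exact_mod_cast Nat.card_pos.ne'
  · rintro rfl
    infer_instance

/-- The character of `Γ` which maps the generator to the `p ^ n`-th root of unity `ζ`. -/
noncomputable def character (ε : Γ ≃ₜ* Multiplicative ℤ_[p]) {K : Type*} [Field K] {n : ℕ}
    (ζ : K) (hζ : ζ ^ p ^ n = 1) : Γ →* K :=
  have := pow_ne_zero_nat (p := p) n
  { toFun := fun γ : Γ => AddChar.zmodChar (p ^ n) hζ (PadicInt.toZModPow n (coord ε γ))
    map_one' := by rw [coord_one, map_zero, AddChar.map_zero_eq_one]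
    map_mul' := fun a b => by rw [coord_mul, map_add, AddChar.map_add_eq_mul] }

theorem character_apply {K : Type*} [Field K] {n : ℕ} (ζ : K) (hζ : ζ ^ p ^ n = 1) (γ : Γ) :
    character ε ζ hζ γ = ζ ^ expo ε n γ := by
  have := pow_ne_zero_nat (p := p) n
  exact AddChar.zmodChar_apply hζ _

end ZpGroup

/-! ### Power series attached to the group ring -/

section Order

variable {p : ℕ} [hp : Fact p.Prime] {Γ : Type v} [CommGroup Γ] [TopologicalSpace Γ]
  (ε : Γ ≃ₜ* Multiplicative ℤ_[p]) (ψ : Γ →* (PowerSeries (ZMod p)))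

/-- The homomorphism `γ ↦ ψ(γ)` from `Γ` to the units of `𝔽_p⟦T⟧` maps the topological generator
to `1 + T`, and its values have constant term `1`: so `ψ(γ) = (1 + T) ^ (coord γ)`. -/
structure IsBinomial : Prop where
  gen : ψ (gen ε) = 1 + PowerSeries.X
  constantCoeff : ∀ γ, PowerSeries.constantCoeff (ψ γ) = 1

variable {ε ψ}

theorem IsBinomial.dvd_pow_sub_one (h : IsBinomial ε ψ) (n : ℕ) (γ : Γ) :
    (PowerSeries.X : (PowerSeries (ZMod p))) ^ p ^ n ∣ ψ (γ ^ p ^ n) - 1 := by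
  obtain ⟨s, hs⟩ : (PowerSeries.X : (PowerSeries (ZMod p))) ∣ ψ γ - 1 := by
    rw [PowerSeries.X_dvd_iff, map_sub, h.constantCoeff, map_one, sub_self]
  have h1 : ψ γ = 1 + PowerSeries.X * s := by rw [← hs]; ring
  have : ExpChar (PowerSeries (ZMod p)) p := by
    have : CharP (PowerSeries (ZMod p)) p := charP_of_injective_algebraMap
      (PowerSeries.C_injective (R := ZMod p)) p
    infer_instance
  rw [map_pow, h1, add_pow_expChar_pow, one_pow, mul_pow, add_sub_cancel_left]
  exact dvd_mul_right _ _

/-- Modulo `T ^ p ^ n`, the series of `γ` only depends on `γ` modulo `Γ^{p^n}`. -/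
theorem IsBinomial.dvd_sub (h : IsBinomial ε ψ) (n : ℕ) (γ : Γ) :
    (PowerSeries.X : (PowerSeries (ZMod p))) ^ p ^ n ∣ ψ γ - (1 + PowerSeries.X) ^ expo ε n γ := by
  obtain ⟨γ', hγ'⟩ := exists_eq_gen_pow_mul ε n γ
  have h1 : ψ γ - (1 + PowerSeries.X) ^ expo ε n γ =
      (1 + PowerSeries.X) ^ expo ε n γ * (ψ (γ' ^ p ^ n) - 1) := by
    conv_lhs => rw [hγ', map_mul, map_pow, h.gen, ← hγ']
    ring
  rw [h1]
  exact (h.dvd_pow_sub_one n γ').mul_left _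

/-- The polynomial `∑ f(γ) X^k(γ)` where `γ ∈ gen ^ k(γ) Γ^{p^n}`. -/
noncomputable def levelPoly (ε : Γ ≃ₜ* Multiplicative ℤ_[p]) (n : ℕ) (f : MonoidAlgebra ℤ Γ) :
    ℤ[X] :=
  f.coeff.sum fun γ a => C a * X ^ expo ε n γ

theorem aeval_levelPoly_eq_sum {S : Type*} [CommRing S] [Algebra ℤ S] (n : ℕ) (f : MonoidAlgebra ℤ Γ)
    (x : S) :
    aeval x (levelPoly ε n f) = f.coeff.sum fun γ a => (a : S) * x ^ expo ε n γ := by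
  simp [levelPoly, Finsupp.sum, map_sum]

/-- The value of the level polynomial at a root of unity is the value of `f` at a character. -/
theorem aeval_levelPoly {K : Type*} [Field K] {n : ℕ} (ζ : K) (hζ : ζ ^ p ^ n = 1)
    (f : MonoidAlgebra ℤ Γ) :
    aeval ζ (levelPoly ε n f) = MonoidAlgebra.lift ℤ K Γ (character ε ζ hζ) f := by
  rw [aeval_levelPoly_eq_sum, MonoidAlgebra.lift_apply]
  refine Finsupp.sum_congr fun γ _ => ?_
  rw [character_apply, zsmul_eq_mul]

/-- The power series of `f` modulo `p` and the level polynomial at `1 + T` agree modulo `T ^ p ^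
n`. -/
theorem IsBinomial.dvd_lift_sub (h : IsBinomial ε ψ) (n : ℕ) (f : MonoidAlgebra ℤ Γ) :
    (PowerSeries.X : (PowerSeries (ZMod p))) ^ p ^ n ∣
      MonoidAlgebra.lift ℤ (PowerSeries (ZMod p)) Γ ψ f -
        aeval (1 + PowerSeries.X) (levelPoly ε n f) := by
  rw [aeval_levelPoly_eq_sum, MonoidAlgebra.lift_apply, Finsupp.sum, Finsupp.sum,
    ← Finset.sum_sub_distrib]
  refine Finset.dvd_sum fun γ _ => ?_
  rw [Algebra.smul_def, eq_intCast, ← mul_sub]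
  exact (h.dvd_sub n γ).mul_left _

theorem aeval_one_add_X (P : ℤ[X]) : (aeval (1 + PowerSeries.X) P : (PowerSeries (ZMod p))) =
    (((P.map (Int.castRingHom (ZMod p))).comp (1 + X) : (ZMod p)[X]) : (PowerSeries (ZMod p))) := by
  induction P using Polynomial.induction_on' with
  | add P Q hP hQ => rw [map_add, hP, hQ, Polynomial.map_add, add_comp, Polynomial.coe_add]
  | monomial n a =>
    rw [aeval_monomial, map_monomial, monomial_comp, Polynomial.coe_mul, Polynomial.coe_pow,
      Polynomial.coe_add, Polynomial.coe_one, Polynomial.coe_X, Polynomial.coe_C]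
    simp

/-- The order `l` of the power series of `f` modulo `p` is the order of vanishing at `1` of the level
polynomial of `f` modulo `p`. -/
theorem IsBinomial.exists_levelPoly_eq (h : IsBinomial ε ψ) (f : MonoidAlgebra ℤ Γ)
    {l : ℕ} (hl : (MonoidAlgebra.lift ℤ (PowerSeries (ZMod p)) Γ ψ f).order = l) {n : ℕ}
    (hn : l < p ^ n) :
    ∃ u g : ℤ[X], levelPoly ε n f = (X - 1) ^ l * u + C (p : ℤ) * g ∧ ¬ (p : ℤ) ∣ u.eval 1 := by
  set F := MonoidAlgebra.lift ℤ (PowerSeries (ZMod p)) Γ ψ f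
  set P := (levelPoly ε n f).map (Int.castRingHom (ZMod p))
  have h1 := h.dvd_lift_sub n f
  rw [aeval_one_add_X] at h1
  have hcoeff : ∀ i ≤ l, (P.comp (1 + X)).coeff i = PowerSeries.coeff i F := by
    intro i hi
    have := PowerSeries.X_pow_dvd_iff.1 h1 i (hi.trans_lt hn)
    rw [map_sub, sub_eq_zero, Polynomial.coeff_coe] at this
    exact this.symm
  obtain ⟨v, hv⟩ : X ^ l ∣ P.comp (1 + X) := by
    rw [X_pow_dvd_iff]
    intro i hi
    rw [hcoeff i hi.le]
    exact PowerSeries.coeff_of_lt_order _ (by rw [hl]; exact_mod_cast hi)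
  have hv0 : v.coeff 0 ≠ 0 := by
    have h2 := hcoeff l le_rfl
    have h3 := PowerSeries.coeff_order (φ := F) (by
      intro h0; rw [h0, PowerSeries.order_zero] at hl; exact ENat.top_ne_natCast _ hl)
    rw [hl, ENat.toNat_natCast] at h3
    have h4 := coeff_mul_X_pow v l 0
    rw [zero_add, mul_comm, ← hv, h2] at h4
    rw [← h4]
    exact h3
  have hP : P = (X - 1) ^ l * v.comp (X - 1) := by
    have := congrArg (fun q => q.comp (X - 1 : (ZMod p)[X])) hv
    simpa [comp_assoc] using this
  obtain ⟨u, hu⟩ := map_surjective (Int.castRingHom (ZMod p)) (ZMod.ringHom_surjective _)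
    (v.comp (X - 1))
  obtain ⟨g, hg⟩ : (C (p : ℤ)) ∣ (levelPoly ε n f - (X - 1) ^ l * u) := by
    rw [C_dvd_iff_dvd_coeff]
    intro i
    have h2 : (levelPoly ε n f - (X - 1) ^ l * u).map (Int.castRingHom (ZMod p)) = 0 := by
      rw [Polynomial.map_sub, Polynomial.map_mul, hu, Polynomial.map_pow, Polynomial.map_sub,
        Polynomial.map_X, Polynomial.map_one, ← hP, sub_self]
    have := congrArg (fun q => q.coeff i) h2
    rw [coeff_map, coeff_zero] at this
    exact (ZMod.intCast_zmod_eq_zero_iff_dvd _ _).1 this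
  refine ⟨u, g, by rw [← hg]; ring, fun hd => hv0 ?_⟩
  have h4 := congrArg (eval 1) hu
  rw [eval_one_map, eq_intCast, (ZMod.intCast_zmod_eq_zero_iff_dvd _ _).2 hd, eval_comp] at h4
  rw [coeff_zero_eq_eval_zero]
  simpa using h4.symm

/-- An element of `ℤ[Γ]` whose power series vanishes modulo `p` is divisible by `p`. -/
theorem IsBinomial.dvd_of_lift_eq_zero (h : IsBinomial ε ψ) (f : MonoidAlgebra ℤ Γ)
    (hf : MonoidAlgebra.lift ℤ (PowerSeries (ZMod p)) Γ ψ f = 0) (γ : Γ) : (p : ℤ) ∣ f.coeff γ := by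
  -- choose a level which separates the support of `f`
  obtain ⟨n, hn⟩ : ∃ n, ∀ γ ∈ f.coeff.support, ∀ γ' ∈ f.coeff.support,
      expo ε n γ = expo ε n γ' → γ = γ' := by
    have h1 : ∀ q : Γ × Γ, ∃ n, q.1 ≠ q.2 → ∀ m ≥ n, expo ε m q.1 ≠ expo ε m q.2 := by
      rintro ⟨γ, γ'⟩
      by_cases hne : γ = γ'
      · exact ⟨0, fun h => absurd hne h⟩
      · obtain ⟨n, hn⟩ := exists_not_dvd (p := p) (x := coord ε (γ⁻¹ * γ')) (fun h0 => hne (by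
          have := coord_injective ε (h0.trans (coord_one ε).symm)
          exact (inv_mul_eq_one.1 this)))
        refine ⟨n, fun _ m hm he => hn ?_⟩
        exact (pow_dvd_pow _ hm).trans ((mem_powSubgroup ε).1 ((expo_eq_iff ε).1 he))
    choose N hN using h1
    refine ⟨(f.coeff.support ×ˢ f.coeff.support).sup N, fun γ hγ γ' hγ' he => ?_⟩
    by_contra hne
    exact hN (γ, γ') hne _ (Finset.le_sup (Finset.mk_mem_product hγ hγ')) he
  by_cases hγ : γ ∈ f.coeff.support
  swap
  · rw [Finsupp.notMem_support_iff.1 hγ]; exact dvd_zero _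
  have h1 := h.dvd_lift_sub n f
  rw [hf, zero_sub, dvd_neg, aeval_one_add_X] at h1
  set P := (levelPoly ε n f).map (Int.castRingHom (ZMod p))
  have hdeg : P.degree < (p ^ n : ℕ) := by
    refine lt_of_le_of_lt (degree_map_le) ?_
    rw [levelPoly, Finsupp.sum]
    refine lt_of_le_of_lt (degree_sum_le _ _) ?_
    rw [Finset.sup_lt_iff (by exact_mod_cast WithBot.bot_lt_coe _)]
    intro γ _
    exact lt_of_le_of_lt (degree_C_mul_X_pow_le _ _) (by exact_mod_cast expo_lt ε n γ)
  have hP : P = 0 := by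
    have h2 : P.comp (1 + X) = 0 := by
      ext i
      rw [coeff_zero]
      by_cases hi : i < p ^ n
      · have := PowerSeries.X_pow_dvd_iff.1 h1 i hi
        rwa [Polynomial.coeff_coe] at this
      · by_cases hP0 : P = 0
        · rw [hP0, zero_comp, coeff_zero]
        · refine coeff_eq_zero_of_natDegree_lt (lt_of_lt_of_le ?_ (not_lt.1 hi))
          have h3 : (1 + X : (ZMod p)[X]).natDegree = 1 := by
            rw [add_comm]; exact natDegree_X_add_C 1
          refine lt_of_le_of_lt natDegree_comp_le ?_
          rw [h3, mul_one]
          exact (natDegree_lt_iff_degree_lt hP0).2 hdeg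
    have := congrArg (fun q => q.comp (X - 1 : (ZMod p)[X])) h2
    simpa [comp_assoc] using this
  have h3 := congrArg (fun q => q.coeff (expo ε n γ)) hP
  rw [coeff_zero, coeff_map, levelPoly, Finsupp.sum, finsetSum_coeff,
    Finset.sum_eq_single γ] at h3
  · rw [coeff_C_mul, coeff_X_pow_self, mul_one] at h3
    exact (ZMod.intCast_zmod_eq_zero_iff_dvd _ _).1 h3
  · intro γ' hγ' hne
    rw [coeff_C_mul, coeff_X_pow, if_neg, mul_zero]
    exact fun he => hne (hn _ hγ' _ hγ he.symm)
  · exact fun h => absurd hγ h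

/-- A non-zero element of `ℤ[Γ]` is a power of `p` times an element with non-zero power series
modulo `p`. -/
theorem IsBinomial.exists_eq_pow_mul (h : IsBinomial ε ψ) {f : MonoidAlgebra ℤ Γ} (hf : f ≠ 0) :
    ∃ (m : ℕ) (g : MonoidAlgebra ℤ Γ), f = (p : MonoidAlgebra ℤ Γ) ^ m * g ∧
      MonoidAlgebra.lift ℤ (PowerSeries (ZMod p)) Γ ψ g ≠ 0 := by
  obtain ⟨γ, hγ⟩ : ∃ γ, f.coeff γ ≠ 0 := by
    by_contra! hc
    exact hf (MonoidAlgebra.ext (Finsupp.ext hc))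
  generalize hN : (f.coeff γ).natAbs = N
  induction N using Nat.strong_induction_on generalizing f with
  | h N ih =>
    by_cases h0 : MonoidAlgebra.lift ℤ (PowerSeries (ZMod p)) Γ ψ f = 0
    · choose g hg using h.dvd_of_lift_eq_zero f h0
      let f' : MonoidAlgebra ℤ Γ := .ofCoeff (Finsupp.onFinset f.coeff.support g fun γ hγ => by
        rw [Finsupp.mem_support_iff, hg]
        exact mul_ne_zero (by exact_mod_cast hp.out.ne_zero) hγ)
      have hff' : f = (p : MonoidAlgebra ℤ Γ) * f' := by
        rw [← nsmul_eq_mul]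
        refine MonoidAlgebra.ext (Finsupp.ext fun γ => ?_)
        rw [hg]
        exact (nsmul_eq_mul p (g γ)).symm
      have hgγ : f'.coeff γ = g γ := rfl
      have h1 : f'.coeff γ ≠ 0 := by
        rw [hgγ]; intro h0; rw [hg, h0, mul_zero] at hγ; exact hγ rfl
      obtain ⟨m, k, hk, hk'⟩ := ih (f'.coeff γ).natAbs (by
        rw [← hN, hg, Int.natAbs_mul, hgγ, Int.natAbs_natCast]
        exact lt_mul_left (Int.natAbs_pos.2 h1) hp.out.one_lt) (f := f')
        (by rintro h0; rw [h0] at h1; exact h1 rfl) h1 rfl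
      exact ⟨m + 1, k, by rw [hff', hk, pow_succ']; ring, hk'⟩
    · exact ⟨0, f, by simp, h0⟩

/-- The growth of the norms of the values of `f = p ^ m * g ∈ ℤ[Γ]` at the characters of order
`p ^ (n + 1)`. -/
theorem IsBinomial.padicValRat_norm (h : IsBinomial ε ψ) {f g : MonoidAlgebra ℤ Γ} {m l n : ℕ}
    (hf : f = (p : MonoidAlgebra ℤ Γ) ^ m * g)
    (hl : (MonoidAlgebra.lift ℤ (PowerSeries (ZMod p)) Γ ψ g).order = l)
    (hn : p ^ (n + 1) ≠ 2) (hln : l < (p ^ (n + 1)).totient)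
    {K : Type*} [Field K] [CharZero K]
    [IsCyclotomicExtension {p ^ (n + 1)} ℚ K] {ζ : K} (hζ : IsPrimitiveRoot ζ (p ^ (n + 1))) :
    padicValRat p (Algebra.norm ℚ (MonoidAlgebra.lift ℤ K Γ (character ε ζ hζ.pow_eq_one) f)) =
      m * (p ^ (n + 1)).totient + l := by
  have : NeZero (p ^ (n + 1)) := ⟨pow_ne_zero _ hp.out.ne_zero⟩
  have : FiniteDimensional ℚ K := IsCyclotomicExtension.finiteDimensional {p ^ (n + 1)} ℚ K
  obtain ⟨u, k, h1, h2⟩ := h.exists_levelPoly_eq g hl (hln.trans_le (Nat.totient_le _))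
  obtain ⟨h3, h4⟩ := KidaGraph.padicValRat_norm hn hζ hln _ u k h1 h2
  rw [hf, map_mul, map_pow, map_natCast, map_mul, map_pow, ← aeval_levelPoly]
  have h5 : Algebra.norm ℚ (p : K) = (p : ℚ) ^ (p ^ (n + 1)).totient := by
    have : (p : K) = algebraMap ℚ K p := by simp
    rw [this, Algebra.norm_algebraMap,
      IsCyclotomicExtension.finrank K
        (cyclotomic.irreducible_rat (NeZero.pos (p ^ (n + 1))))]
  have hp0 : (p : ℚ) ≠ 0 := by exact_mod_cast hp.out.ne_zero
  rw [h5, padicValRat.mul (pow_ne_zero _ (pow_ne_zero _ hp0)) h3, h4,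
    padicValRat.pow, padicValRat.pow, padicValRat.self hp.out.one_lt]
  ring

end Order

end KidaGraph

namespace KidaGraph

universe u v w

open scoped Classical

/-! ### The Laplacian of a derived graph -/

namespace FinGraph

variable (Y : FinGraph.{u})

/-- The Laplacian has degree zero. The sum equals its negative since the edges come in pairs. -/
theorem sum_lap {R : Type*} [CommRing R] [IsAddTorsionFree R] (g : Y.V → R) :
    ∑ w, Y.lap R g w = 0 := by
  have h1 : ∑ w, Y.lap R g w = ∑ e, (g (Y.s e) - g (Y.t e)) := by
    simp only [lap_apply]
    rw [Finset.sum_comm]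
    refine Finset.sum_congr rfl fun e _ => ?_
    rw [Finset.sum_ite_eq, if_pos (Finset.mem_univ _)]
  let b : Y.E ≃ Y.E := ⟨Y.bar, Y.bar, Y.bar_bar, Y.bar_bar⟩
  have h2 : ∑ e, (g (Y.s e) - g (Y.t e)) = -∑ e, (g (Y.s e) - g (Y.t e)) := by
    conv_lhs => rw [← Equiv.sum_comp b]
    rw [← Finset.sum_neg_distrib]
    refine Finset.sum_congr rfl fun e _ => ?_
    change g (Y.s (Y.bar e)) - g (Y.t (Y.bar e)) = _
    rw [Y.s_bar, Y.t_bar]; ring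
  rw [h1]
  exact self_eq_neg.1 h2

/-- By the matrix-tree theorem, since the Laplacian of a connected graph has corank one. -/
theorem kappa_ne_zero (hc : Y.Connected) : (Y.kappa : ℚ) ≠ 0 := by
  have hne : Nonempty Y.V := hc.1
  have hcard : (Fintype.card Y.V : ℚ) ≠ 0 := by exact_mod_cast Fintype.card_ne_zero
  have h1 := Y.det_lap_add (fun _ => 1) (by simp)
  intro h0
  rw [h0, zero_mul] at h1
  obtain ⟨g, hg0, hg⟩ := Matrix.exists_mulVec_eq_zero_iff.2 h1
  have h2 : ∀ a, Y.lap ℚ g a + ∑ w, g w = 0 := by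
    intro a
    have := congrFun hg a
    rw [Matrix.mulVec, dotProduct] at this
    simp only [Matrix.of_apply, mul_one, add_mul, one_mul, Finset.sum_add_distrib] at this
    rw [Pi.zero_apply] at this
    rw [← this]
    congr 1
    conv_lhs => rw [pi_eq_sum_univ' g, map_sum, Finset.sum_apply]
    refine Finset.sum_congr rfl fun w _ => ?_
    rw [map_smul, Pi.smul_apply, smul_eq_mul, mul_comm]
  have h3 : ∑ w, g w = 0 := by
    have h4 : ∑ a, (Y.lap ℚ g a + ∑ w, g w) = 0 := Finset.sum_eq_zero fun a _ => h2 a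
    rw [Finset.sum_add_distrib, sum_lap, zero_add, Finset.sum_const, Finset.card_univ,
      nsmul_eq_mul] at h4
    exact (mul_eq_zero.1 h4).resolve_left hcard
  have h4 : ∀ a, Y.lap ℚ g a = 0 := fun a => by have := h2 a; rwa [h3, add_zero] at this
  have h5 := Y.eq_of_lap_eq_zero hc g (Finset.sum_eq_zero fun w _ => by rw [h4, mul_zero])
  apply hg0
  ext a
  have h6 : ∑ w, g w = Fintype.card Y.V * g a := by
    rw [Finset.sum_congr rfl fun w _ => h5 w a, Finset.sum_const, Finset.card_univ, nsmul_eq_mul]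
  rw [h3] at h6
  exact (mul_eq_zero.1 h6.symm).resolve_left hcard

/-- The Laplacian divided by the weights `m`, plus the projection to the constant functions given
by the weighted mean. -/
noncomputable def normOp (m : Y.V → ℚ) : (Y.V → ℚ) →ₗ[ℚ] (Y.V → ℚ) where
  toFun g w := (m w)⁻¹ * Y.lap ℚ g w + (∑ w, m w)⁻¹ * ∑ w, m w * g w
  map_add' g g' := by
    ext w
    simp only [map_add, Pi.add_apply, mul_add, Finset.sum_add_distrib]; ring
  map_smul' c g := by
    ext w
    simp only [map_smul, Pi.smul_apply, smul_eq_mul, RingHom.id_apply, mul_left_comm _ c,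
      ← Finset.mul_sum, mul_add]

/-- The weighted form of the matrix-tree theorem. -/
theorem det_normOp (m : Y.V → ℚ) (hm : ∀ w, m w ≠ 0) (hs : ∑ w, m w ≠ 0) :
    LinearMap.det (Y.normOp m) * ∏ w, m w = Y.kappa * ∑ w, m w := by
  set s := ∑ w, m w
  -- `1 / s` is not a square, so the rank one term is inserted by multiplication on the right
  set N : Matrix Y.V Y.V ℚ := Matrix.of fun a b => Y.lap ℚ (Pi.single b 1) a + m a * m b
  set k : ℚ := (s⁻¹ - 1) / s
  have hlap1 : ∀ a, ∑ b, Y.lap ℚ (Pi.single b 1) a = 0 := by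
    intro a
    rw [← Finset.sum_apply, ← map_sum, Finset.univ_sum_single]
    rw [lap_apply]
    exact Finset.sum_eq_zero fun e _ => by simp
  have h1 : Matrix.diagonal m * LinearMap.toMatrix' (Y.normOp m) =
      N * (1 + Matrix.replicateCol Unit (fun _ => k) * Matrix.replicateRow Unit m) := by
    ext a b
    rw [Matrix.diagonal_mul, LinearMap.toMatrix'_apply, mul_add, mul_one, Matrix.add_apply,
      Matrix.mul_apply]
    have h2 : ∀ j, (Matrix.replicateCol Unit (fun _ : Y.V => k) * Matrix.replicateRow Unit m) j b
        = k * m b := by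
      intro j; simp [Matrix.mul_apply]
    simp only [h2]
    rw [← Finset.sum_mul]
    have h3 : ∑ j, N a j = m a * s := by
      simp only [N, Matrix.of_apply]
      rw [Finset.sum_add_distrib, hlap1, zero_add, ← Finset.mul_sum]
    rw [h3]
    have h5 : Y.normOp m (Pi.single b 1) a =
        (m a)⁻¹ * Y.lap ℚ (Pi.single b 1) a + s⁻¹ * m b := by
      change (m a)⁻¹ * Y.lap ℚ (Pi.single b 1) a +
        s⁻¹ * ∑ w, m w * (Pi.single b 1 : Y.V → ℚ) w = _
      simp [Pi.single_apply]
    simp only [N, Matrix.of_apply]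
    rw [h5]
    have := hm a
    simp only [k]
    field_simp
    ring
  have h2 := congrArg Matrix.det h1
  rw [Matrix.det_mul, Matrix.det_mul, Matrix.det_diagonal, LinearMap.det_toMatrix',
    Y.det_lap_add m hs, Matrix.det_one_add_replicateCol_mul_replicateRow] at h2
  have h3 : m ⬝ᵥ (fun _ => k) = s⁻¹ - 1 := by
    rw [dotProduct, ← Finset.sum_mul]
    change s * ((s⁻¹ - 1) / s) = _
    field_simp
  rw [h3] at h2
  rw [mul_comm, h2, add_sub_cancel, mul_assoc, sq, mul_assoc, mul_inv_cancel₀ hs, mul_one]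

/-- The number of spanning trees only depends on the graph up to isomorphism. -/
theorem kappa_congr {Y : FinGraph.{u}} {Z : FinGraph.{v}} (a : Y.V ≃ Z.V) (b : Y.E ≃ Z.E)
    (hs : ∀ e, a (Y.s e) = Z.s (b e)) (ht : ∀ e, a (Y.t e) = Z.t (b e)) [Nonempty Y.V] :
    Y.kappa = Z.kappa := by
  have hY : ∑ _w : Y.V, (1 : ℚ) ≠ 0 := by simp
  have hcard : Fintype.card Y.V = Fintype.card Z.V := Fintype.card_congr a
  have hZ : ∑ _w : Z.V, (1 : ℚ) ≠ 0 := by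
    simp only [Finset.sum_const, Finset.card_univ, ← hcard]; simp
  have h1 := Y.det_lap_add (fun _ => 1) hY
  have h2 := Z.det_lap_add (fun _ => 1) hZ
  have hlap : ∀ (g : Z.V → ℚ) w, Y.lap ℚ (g ∘ a) w = Z.lap ℚ g (a w) := by
    intro g w
    rw [lap_apply, lap_apply, ← Equiv.sum_comp b]
    refine Finset.sum_congr rfl fun e _ => ?_
    simp only [← hs, ← ht, a.apply_eq_iff_eq, Function.comp_apply]
  have h3 : (Matrix.of fun x y => Y.lap ℚ (Pi.single y 1) x + 1 * 1).det =
      (Matrix.of fun x y => Z.lap ℚ (Pi.single y 1) x + 1 * 1).det := by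
    rw [← Matrix.det_submatrix_equiv_self a]
    congr 1
    ext x y
    simp only [Matrix.of_apply, Matrix.submatrix_apply]
    rw [← hlap, show (Pi.single (a y) (1 : ℚ) : Z.V → ℚ) ∘ a = Pi.single y 1 from
      funext fun z => by simp [Pi.single_apply]]
  rw [h1, h2] at h3
  simp only [Finset.sum_const, Finset.card_univ, hcard] at h3 hZ
  exact_mod_cast mul_right_cancel₀ (pow_ne_zero 2 hZ) h3

end FinGraph

/-! ### Characters and averages -/

theorem sum_hom_eq {K K' : Type*} [Group K] [Group K'] [Fintype K] [Fintype K'] (f : K →* K')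
    (hf : Function.Surjective f) {R : Type*} [CommRing R] (F : K' → R) :
    (Fintype.card K' : R) * ∑ k, F (f k) = Fintype.card K * ∑ k', F k' := by
  have h1 : ∑ k' : K', ∑ k, F (f k * k') = Fintype.card K' * ∑ k, F (f k) := by
    rw [← nsmul_eq_mul, ← Finset.card_univ (α := K'), ← Finset.sum_const]
    refine Finset.sum_congr rfl fun k' _ => ?_
    obtain ⟨j, rfl⟩ := hf k'
    simp only [← map_mul]
    exact Equiv.sum_comp (Equiv.mulRight j) fun k => F (f k)
  rw [← h1, Finset.sum_comm, ← nsmul_eq_mul, ← Finset.card_univ (α := K), ← Finset.sum_const]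
  refine Finset.sum_congr rfl fun k _ => ?_
  exact Equiv.sum_comp (Equiv.mulLeft (f k)) F

/-- A character is orthogonal to the functions invariant under an element on which it is not
trivial. -/
theorem sum_character_mul_eq_zero {H K : Type*} [Group H] [Fintype H] [Field K] (χ : H →* K)
    (F : H → K) {k : H} (hk : χ k ≠ 1) (hF : ∀ h, F (h * k) = F h) :
    ∑ h, χ h⁻¹ * F h = 0 := by
  have h1 : ∑ h, χ h⁻¹ * F h = χ k⁻¹ * ∑ h, χ h⁻¹ * F h := by
    conv_lhs => rw [← Equiv.sum_comp (Equiv.mulRight k)]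
    rw [Finset.mul_sum]
    refine Finset.sum_congr rfl fun h _ => ?_
    rw [Equiv.coe_mulRight, hF, mul_inv_rev, map_mul, mul_assoc]
  have h2 : χ k⁻¹ ≠ 1 := by
    intro h
    apply hk
    have := χ.map_mul k⁻¹ k
    rw [inv_mul_cancel, map_one, h, one_mul] at this
    exact this.symm
  have h3 : (1 - χ k⁻¹) * ∑ h, χ h⁻¹ * F h = 0 := by rw [sub_mul, one_mul, ← h1, sub_self]
  exact (mul_eq_zero.1 h3).resolve_left (sub_ne_zero.2 h2.symm)

namespace Voltage

variable {X : FinGraph.{u}} {H : Type v} [Group H]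

/-- The matrix `∑_{s(e) = v} ([v] - θ(α(e)) [t(e)])` of the Laplacian twisted by `θ ∘ α`. -/
noncomputable def lapMatrix (A : Voltage X H) {S : Type*} [CommRing S] (θ : H →* S) :
    Matrix X.V X.V S :=
  Matrix.of fun x y => ∑ e, if X.s e = x then
    (if x = y then 1 else 0) - (if X.t e = y then θ (A.α e) else 0) else 0

theorem map_lapMatrix (A : Voltage X H) {S S' : Type*} [CommRing S] [CommRing S'] (θ : H →* S)
    (f : S →+* S') : (A.lapMatrix θ).map f = A.lapMatrix ((f : S →* S').comp θ) := by
  ext x y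
  simp only [lapMatrix, Matrix.map_apply, Matrix.of_apply, map_sum]
  refine Finset.sum_congr rfl fun e _ => ?_
  split_ifs <;> simp

/-- The determinant of the part of the twisted Laplacian of the vertices with trivial inertia
groups. -/
noncomputable def charDet (A : Voltage X H) {S : Type*} [CommRing S] (θ : H →* S) : S :=
  ((A.lapMatrix θ).submatrix (Subtype.val : {x // A.I x = ⊥} → X.V) Subtype.val).det

theorem map_charDet (A : Voltage X H) {S S' : Type*} [CommRing S] [CommRing S'] (θ : H →* S)
    (f : S →+* S') : f (A.charDet θ) = A.charDet ((f : S →* S').comp θ) := by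
  rw [charDet, charDet, RingHom.map_det, ← map_lapMatrix]
  rfl

section Finite

variable [Finite H]

/-- The vertex `h · x` of the derived graph. -/
def vert (B : Voltage X H) (x : X.V) (h : H) : B.derived.V := ⟨x, (h : H ⧸ B.I x)⟩

theorem vert_eq_iff (B : Voltage X H) {x y : X.V} {h k : H} :
    B.vert x h = B.vert y k ↔ x = y ∧ h⁻¹ * k ∈ B.I y := by
  constructor
  · intro hh
    have hx : x = y := congrArg Sigma.fst hh
    subst hx
    exact ⟨rfl, QuotientGroup.eq.1 (eq_of_heq (Sigma.mk.inj hh).2)⟩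
  · rintro ⟨rfl, hh⟩
    exact congrArg (Sigma.mk x) (QuotientGroup.eq.2 hh)

theorem exists_vert (B : Voltage X H) (w : B.derived.V) : ∃ x h, w = B.vert x h := by
  obtain ⟨x, q⟩ := w
  induction q using QuotientGroup.induction_on with
  | H h => exact ⟨x, h, rfl⟩

end Finite

variable [Fintype H]

theorem sum_derived_V (B : Voltage X H) {R : Type*} [AddCommMonoid R] (F : B.derived.V → R) :
    ∑ w, F w = ∑ x, ∑ q : H ⧸ B.I x, F ⟨x, q⟩ := by
  refine Eq.trans (b := ∑ w : (Σ x : X.V, H ⧸ B.I x), F w) ?_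
    (Fintype.sum_sigma (fun w : (Σ x : X.V, H ⧸ B.I x) => F w))
  exact Fintype.sum_equiv (show B.derived.V ≃ Σ x : X.V, H ⧸ B.I x from Equiv.refl _) F
    (fun w : (Σ x : X.V, H ⧸ B.I x) => F w) fun _ => rfl

theorem sum_derived_E (B : Voltage X H) {R : Type*} [AddCommMonoid R] (F : B.derived.E → R) :
    ∑ e, F e = ∑ e, ∑ h : H, F (h, e) := by
  refine Eq.trans (b := ∑ q : H × X.E, F q) ?_
    (Fintype.sum_prod_type_right (fun q : H × X.E => F q))
  exact Fintype.sum_equiv (show B.derived.E ≃ H × X.E from Equiv.refl _) F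
    (fun q : H × X.E => F q) fun _ => rfl

/-- A sum over the edges which start at a vertex of a derived graph. -/
theorem sum_star (B : Voltage X H) {R : Type*} [AddCommMonoid R] (F : B.derived.E → R) (x : X.V)
    (h : H) : (∑ e, if B.derived.s e = B.vert x h then F e else 0) =
      ∑ i : B.I x, ∑ e, if X.s e = x then F (h * i, e) else 0 := by
  rw [sum_derived_E, Finset.sum_comm (s := Finset.univ (α := B.I x))]
  refine Finset.sum_congr rfl fun e _ => ?_
  have h2 : ∀ k, (if B.derived.s (k, e) = B.vert x h then F (k, e) else 0) =
      if h⁻¹ * k ∈ B.I x then (if X.s e = x then F (k, e) else 0) else 0 := by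
    intro k
    have h3 : B.derived.s (k, e) = B.vert x h ↔ X.s e = x ∧ h⁻¹ * k ∈ B.I x := by
      change B.vert (X.s e) k = B.vert x h ↔ _
      rw [vert_eq_iff, ← Subgroup.inv_mem_iff (x := k⁻¹ * h), mul_inv_rev, inv_inv]
    by_cases h4 : X.s e = x <;> by_cases h5 : h⁻¹ * k ∈ B.I x <;> simp [h3, h4, h5]
  rw [Finset.sum_congr rfl fun k _ => h2 k, ← Equiv.sum_comp (Equiv.mulLeft h)]
  simp only [Equiv.coe_mulLeft, inv_mul_cancel_left]
  rw [← Finset.sum_filter]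
  exact Finset.sum_subtype _ (p := fun k => k ∈ B.I x) (fun k => by simp) _

/-- The edges starting at the vertex `(h, x)` are the `(h * i, e)`, where `i` is in the inertia
group and `e` starts at `x`. -/
theorem lap_vert (B : Voltage X H) {R : Type*} [CommRing R] (g : B.derived.V → R) (x : X.V)
    (h : H) : B.derived.lap R g (B.vert x h) =
      ∑ i : B.I x, ∑ e, if X.s e = x then
        g (B.vert x h) - g (B.vert (X.t e) (h * i * B.α e)) else 0 := by
  rw [FinGraph.lap_apply]
  exact sum_star B (fun e => g (B.vert x h) - g (B.derived.t e)) x h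

theorem sum_card_mul (B : Voltage X H) {R : Type*} [CommRing R] (g : B.derived.V → R) :
    ∑ w, (Nat.card (B.I w.1) : R) * g w = ∑ x, ∑ h, g (B.vert x h) := by
  rw [sum_derived_V]
  refine Finset.sum_congr rfl fun x _ => ?_
  rw [← Finset.sum_fiberwise (s := Finset.univ) (g := fun h : H => (h : H ⧸ B.I x))]
  refine Finset.sum_congr rfl fun q _ => ?_
  have h2 : ∀ h ∈ Finset.univ.filter (fun h : H => (h : H ⧸ B.I x) = q),
      g (B.vert x h) = g ⟨x, q⟩ := by
    intro h hh
    rw [← (Finset.mem_filter.1 hh).2]; rfl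
  rw [Finset.sum_congr rfl h2, Finset.sum_const, nsmul_eq_mul]
  congr 2
  induction q using QuotientGroup.induction_on with
  | H c =>
    rw [← Fintype.card_subtype, ← Nat.card_eq_fintype_card]
    refine Nat.card_congr ⟨fun i => ⟨c * i, ?_⟩, fun h => ⟨c⁻¹ * h, ?_⟩, fun i => ?_, fun h => ?_⟩
    · exact (QuotientGroup.eq.2 (by simp)).symm
    · exact QuotientGroup.eq.1 h.2.symm
    · exact Subtype.ext (inv_mul_cancel_left _ _)
    · exact Subtype.ext (mul_inv_cancel_left _ _)

end Voltage

end KidaGraph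

namespace KidaGraph

universe u v w

open scoped Classical

/-! ### Growth of the number of spanning trees -/

namespace Voltage

variable {X : FinGraph.{u}} {H : Type v} [Group H] [Fintype H]

/-- The normalized Laplacian of a derived graph, where the weight of a vertex is the order of its
inertia group. -/
noncomputable def op (B : Voltage X H) : (B.derived.V → ℚ) →ₗ[ℚ] (B.derived.V → ℚ) :=
  B.derived.normOp fun w => Nat.card (B.I w.1)

/-- The normalized Laplacian at a vertex: the first summand is a mean over the inertia group. -/
theorem op_vert (B : Voltage X H) (g : B.derived.V → ℚ) (x : X.V) (h : H) :
    B.op g (B.vert x h) = (Nat.card (B.I x) : ℚ)⁻¹ * (∑ i : B.I x, ∑ e, if X.s e = x then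
        g (B.vert x h) - g (B.vert (X.t e) (h * i * B.α e)) else 0) +
      (Fintype.card X.V * Fintype.card H : ℚ)⁻¹ * ∑ x, ∑ h, g (B.vert x h) := by
  have h1 : ∑ w : B.derived.V, (Nat.card (B.I w.1) : ℚ) = Fintype.card X.V * Fintype.card H := by
    have := B.sum_card_mul (fun _ => (1 : ℚ))
    simpa using this
  rw [← lap_vert, ← sum_card_mul, ← h1]
  rfl

variable {H' : Type w} [Group H'] [Fintype H']

/-- The normalization by the weights makes the operator compatible with the pull-back of
functions along ramified coverings; the Laplacian itself is not. -/
theorem op_comp (B : Voltage X H) (B' : Voltage X H') (φ : H →* H')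
    (hφ : Function.Surjective φ) (hα : ∀ e, φ (B.α e) = B'.α e)
    (hI : ∀ x, (B.I x).map φ = B'.I x) (g : B'.derived.V → ℚ) :
    B.op (g ∘ (B.push B' φ hα hI).onV) = B'.op g ∘ (B.push B' φ hα hI).onV := by
  have hvert : ∀ x h, (B.push B' φ hα hI).onV (B.vert x h) = B'.vert x (φ h) := fun _ _ => rfl
  ext w
  obtain ⟨x, h, rfl⟩ := B.exists_vert w
  rw [Function.comp_apply, hvert, op_vert, op_vert]
  simp only [Function.comp_apply, hvert, map_mul, hα]
  have hdiv : ∀ a b c d : ℚ, a ≠ 0 → c ≠ 0 → c * b = a * d → a⁻¹ * b = c⁻¹ * d := by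
    intro a b c d ha hc h
    field_simp
    linarith
  congr 1
  · let f : B.I x →* B'.I x := (φ.comp (B.I x).subtype).codRestrict (B'.I x) fun i => by
      rw [← hI]; exact Subgroup.mem_map_of_mem φ i.2
    have hf : Function.Surjective f := by
      rintro ⟨i', hi'⟩
      rw [← hI] at hi'
      obtain ⟨i, hi, rfl⟩ := hi'
      exact ⟨⟨i, hi⟩, rfl⟩
    have h1 := sum_hom_eq f hf fun i' : B'.I x => ∑ e, if X.s e = x then
      g (B'.vert x (φ h)) - g (B'.vert (X.t e) (φ h * i' * B'.α e)) else 0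
    rw [Nat.card_eq_fintype_card, Nat.card_eq_fintype_card]
    exact hdiv _ _ _ _ (by exact_mod_cast Fintype.card_ne_zero)
      (by exact_mod_cast Fintype.card_ne_zero) h1
  · by_cases hX : (Fintype.card X.V : ℚ) = 0
    · rw [hX]; simp
    refine hdiv _ _ _ _ (mul_ne_zero hX (by exact_mod_cast Fintype.card_ne_zero))
      (mul_ne_zero hX (by exact_mod_cast Fintype.card_ne_zero)) ?_
    rw [mul_assoc, mul_assoc]
    congr 1
    rw [Finset.mul_sum, Finset.mul_sum]
    exact Finset.sum_congr rfl fun y _ => sum_hom_eq φ hφ fun h' => g (B'.vert y h')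

/-- The character sum `∑_h χ(h)⁻¹ g(h x)` for the vertices `x` in a set `P`. -/
noncomputable def charSum (B : Voltage X H) {K : Type*} [Field K] [CharZero K] (χ : H →* K)
    (P : X.V → Prop) : (B.derived.V → ℚ) →ₗ[ℚ] ({x // P x} → K) where
  toFun g x := ∑ h, χ h⁻¹ * (g (B.vert x h) : K)
  map_add' g g' := by
    ext x; simp [mul_add, Finset.sum_add_distrib]
  map_smul' c g := by
    ext x
    simp only [Pi.smul_apply, smul_eq_mul, RingHom.id_apply, Rat.cast_mul, Finset.smul_sum,
      Rat.smul_def]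
    exact Finset.sum_congr rfl fun h _ => by ring

/-- At the vertices with trivial inertia group, the character sum turns the normalized Laplacian
into the twisted Laplacian. The character sums at all other vertices vanish. -/
theorem charSum_op (B : Voltage X H) {K : Type*} [Field K] [CharZero K] (χ : H →* K)
    (P : X.V → Prop) (hu : ∀ x, P x → B.I x = ⊥) (hr : ∀ x, ¬ P x → ∃ i ∈ B.I x, χ i ≠ 1)
    (hχ : ∃ k, χ k ≠ 1) (g : B.derived.V → ℚ) :
    B.charSum χ P (B.op g) = ((B.lapMatrix χ).submatrix Subtype.val Subtype.val).mulVec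
      (B.charSum χ P g) := by
  set Q : X.V → K := fun x => ∑ h, χ h⁻¹ * (g (B.vert x h) : K) with hQ
  have hQ0 : ∀ x, ¬ P x → Q x = 0 := by
    intro x hx
    obtain ⟨i, hi, hχi⟩ := hr x hx
    refine sum_character_mul_eq_zero χ _ hχi fun h => ?_
    congr 2
    rw [vert_eq_iff]
    refine ⟨rfl, ?_⟩
    simpa using hi
  ext ⟨x, hx⟩
  have h1 : ((B.lapMatrix χ).submatrix Subtype.val Subtype.val).mulVec (B.charSum χ P g) ⟨x, hx⟩ =
      ∑ y, B.lapMatrix χ x y * Q y := by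
    rw [← Fintype.sum_subtype_add_sum_subtype P, Matrix.mulVec, dotProduct]
    rw [Finset.sum_eq_zero (s := Finset.univ (α := {y // ¬ P y})) fun y _ => by
      rw [hQ0 _ y.2, mul_zero], add_zero]
    rfl
  rw [h1]
  have h2 : ∑ y, B.lapMatrix χ x y * Q y =
      ∑ e, if X.s e = x then Q x - χ (B.α e) * Q (X.t e) else 0 := by
    simp only [lapMatrix, Matrix.of_apply, Finset.sum_mul]
    rw [Finset.sum_comm]
    refine Finset.sum_congr rfl fun e _ => ?_
    split_ifs
    · simp [sub_mul, Finset.sum_sub_distrib]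
    · simp
  rw [h2]
  obtain ⟨k, hk⟩ := hχ
  have h3 : ∀ h, B.op g (B.vert x h) = (∑ e, if X.s e = x then
        g (B.vert x h) - g (B.vert (X.t e) (h * B.α e)) else 0) +
      (Fintype.card X.V * Fintype.card H : ℚ)⁻¹ * ∑ x, ∑ h, g (B.vert x h) := by
    intro h
    rw [op_vert]
    congr 1
    have h4 : ∀ i : B.I x, i = 1 := fun i => Subtype.ext (Subgroup.mem_bot.1 (hu x hx ▸ i.2))
    have : Unique (B.I x) := ⟨⟨1⟩, h4⟩
    rw [Nat.card_unique, Nat.cast_one, inv_one, one_mul, Fintype.sum_unique, h4 default]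
    simp only [OneMemClass.coe_one, mul_one]
  change ∑ h, χ h⁻¹ * ((B.op g (B.vert x h) : ℚ) : K) = _
  simp only [h3, Rat.cast_add, mul_add, Finset.sum_add_distrib]
  rw [sum_character_mul_eq_zero χ (fun _ => (((Fintype.card X.V * Fintype.card H : ℚ)⁻¹ *
    ∑ x, ∑ h, g (B.vert x h) : ℚ) : K)) hk fun _ => rfl, add_zero]
  simp only [Rat.cast_sum, Finset.mul_sum]
  rw [Finset.sum_comm]
  refine Finset.sum_congr rfl fun e _ => ?_
  split_ifs
  · simp only [Rat.cast_sub, mul_sub, Finset.sum_sub_distrib]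
    congr 1
    conv_rhs => rw [hQ, Finset.mul_sum]
    rw [← Equiv.sum_comp (Equiv.mulRight (B.α e)) fun h =>
      χ (B.α e) * (χ h⁻¹ * (g (B.vert (X.t e) h) : K))]
    refine Finset.sum_congr rfl fun h _ => ?_
    rw [Equiv.coe_mulRight, mul_inv_rev, map_mul, ← mul_assoc, ← mul_assoc, ← map_mul,
      mul_inv_cancel, map_one, one_mul]
  · simp

/-- The character sums of a pulled back function vanish if the character is not trivial on the
kernel of `φ`. -/
theorem charSum_comp (B : Voltage X H) (B' : Voltage X H') (φ : H →* H')
    (hα : ∀ e, φ (B.α e) = B'.α e)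
    (hI : ∀ x, (B.I x).map φ = B'.I x) {K : Type*} [Field K] [CharZero K] (χ : H →* K)
    (P : X.V → Prop) {k : H} (hk : φ k = 1) (hχ : χ k ≠ 1) (g : B'.derived.V → ℚ) :
    B.charSum χ P (g ∘ (B.push B' φ hα hI).onV) = 0 := by
  ext x
  refine sum_character_mul_eq_zero χ _ hχ fun h => ?_
  change ((g (B'.vert x (φ (h * k))) : ℚ) : K) = (g (B'.vert x (φ h)) : ℚ)
  rw [map_mul, hk, mul_one]

/-- At the vertices with trivial inertia group, the values of a function on the fibre are
arbitrary. -/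
theorem charSum_surjective (B : Voltage X H) {K : Type*} [Field K] [CharZero K] (χ : H →* K)
    (P : X.V → Prop) (hu : ∀ x, P x → B.I x = ⊥)
    (hspan : Submodule.span ℚ (Set.range χ) = ⊤) : Function.Surjective (B.charSum χ P) := by
  intro y
  have h1 : ∀ x, ∃ c : H → ℚ, ∑ h, c h • χ h = y x := fun x =>
    (Submodule.mem_span_range_iff_exists_fun ℚ).1 (by rw [hspan]; trivial)
  choose c hc using h1
  -- the inertia group at `x` is trivial: a function on the fibre is a function on `H`
  have h2 : ∀ x : {x // P x}, ∀ q : H ⧸ B.I x, ∃ h : H, ∀ h' : H, (h' : H ⧸ B.I x) = q ↔ h' = h := by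
    intro x q
    induction q using QuotientGroup.induction_on with
    | H h =>
      refine ⟨h, fun h' => ⟨fun e => ?_, fun e => by rw [e]⟩⟩
      have := QuotientGroup.eq.1 e
      rw [hu x x.2, Subgroup.mem_bot, inv_mul_eq_one] at this
      exact this
  choose σ hσ using h2
  refine ⟨fun w => if hw : P w.1 then c ⟨w.1, hw⟩ (σ ⟨w.1, hw⟩ w.2)⁻¹ else 0, ?_⟩
  ext x
  rw [← hc, ← Equiv.sum_comp (Equiv.inv H)]
  refine Finset.sum_congr rfl fun h _ => ?_
  have h3 : σ x ((h : H) : H ⧸ B.I x) = h := ((hσ x _ h).1 rfl).symm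
  rw [Rat.smul_def, mul_comm]
  congr 2
  refine (dif_pos x.2).trans ?_
  exact congrArg (fun z => c x z⁻¹) h3

/-- Comparison of the determinants for two successive layers. -/
theorem det_op (B : Voltage X H) (B' : Voltage X H') (φ : H →* H')
    (hφ : Function.Surjective φ) (hα : ∀ e, φ (B.α e) = B'.α e)
    (hI : ∀ x, (B.I x).map φ = B'.I x) {K : Type*} [Field K] [CharZero K] [FiniteDimensional ℚ K]
    (χ : H →* K) (P : X.V → Prop) (hu : ∀ x, P x → B.I x = ⊥)
    (hr : ∀ x, ¬ P x → ∃ i ∈ B.I x, χ i ≠ 1) {k : H} (hk : φ k = 1) (hχ : χ k ≠ 1)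
    (hspan : Submodule.span ℚ (Set.range χ) = ⊤)
    (hcard : Fintype.card B.derived.V = Fintype.card B'.derived.V +
      Fintype.card {x // P x} * Module.finrank ℚ K) :
    LinearMap.det B.op = LinearMap.det B'.op *
      Algebra.norm ℚ ((B.lapMatrix χ).submatrix (Subtype.val : {x // P x} → X.V) Subtype.val).det := by
  have hsurj : Function.Surjective (B.push B' φ hα hI).onV := fun w => by
    obtain ⟨x, h, rfl⟩ := B'.exists_vert w
    obtain ⟨h, rfl⟩ := hφ h
    exact ⟨B.vert x h, rfl⟩
  have h2 : ∀ g, B.charSum χ P (B.op g) =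
      ((B.lapMatrix χ).submatrix Subtype.val Subtype.val).mulVec (B.charSum χ P g) :=
    B.charSum_op χ P hu hr ⟨k, hχ⟩
  have h3 : ∀ g : B'.derived.V → ℚ, B.charSum χ P (g ∘ (B.push B' φ hα hI).onV) = 0 :=
    B.charSum_comp B' φ hα hI χ P hk hχ
  have h1 := B.op_comp B' φ hφ hα hI
  have h4 := B.charSum_surjective χ P hu hspan
  generalize B.op = T at *
  generalize B'.op = T' at *
  generalize B.charSum χ P = q at *
  generalize (B.lapMatrix χ).submatrix (Subtype.val : {x // P x} → X.V) Subtype.val = D at *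
  have := det_eq_det_mul_norm (W := B.derived.V) (W' := B'.derived.V) (B := {x // P x})
    (B.push B' φ hα hI).onV hsurj T T' D q h4 h1 h2 h3
  convert this hcard
end Voltage

end KidaGraph

namespace KidaGraph

universe u v w

open scoped Classical

set_option linter.unusedSectionVars false

/-! ### Spanning trees in `ℤ_p`-coverings -/

namespace Voltage

variable {p : ℕ} [hp : Fact p.Prime] {Γ : Type v} [CommGroup Γ] [TopologicalSpace Γ]
  [IsTopologicalGroup Γ] [CompactSpace Γ] (ε : Γ ≃ₜ* Multiplicative ℤ_[p])
  {X : FinGraph.{u}} (A : Voltage X Γ)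

/-- The voltage assignment with values in `Γ/Γ^{p^n}`. -/
abbrev lev (n : ℕ) : Voltage X (Γ ⧸ (powSubgroup ε n).toSubgroup) := A.quot (powSubgroup ε n)

noncomputable instance (n : ℕ) : Fintype (Γ ⧸ (powSubgroup ε n).toSubgroup) := Fintype.ofFinite _

theorem lev_I_eq_bot {n : ℕ} {x : X.V} (hx : A.I x = ⊥) : (A.lev ε n).I x = ⊥ := by
  change (A.I x).map _ = ⊥
  rw [hx, Subgroup.map_bot]

theorem index_lev_of_le {n : ℕ} {x : X.V} (hx : (powSubgroup ε n).toSubgroup ≤ A.I x) :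
    ((A.lev ε n).I x).index = (A.I x).index :=
  Subgroup.index_map_eq _ (QuotientGroup.mk'_surjective _) (by rwa [QuotientGroup.ker_mk'])

theorem index_lev_of_eq_bot {n : ℕ} {x : X.V} (hx : A.I x = ⊥) :
    ((A.lev ε n).I x).index = p ^ n := by
  rw [lev_I_eq_bot ε A hx, Subgroup.index_bot, card_quot]

theorem card_mul_index_lev (n : ℕ) (x : X.V) :
    Nat.card ((A.lev ε n).I x) * ((A.lev ε n).I x).index = p ^ n := by
  rw [Subgroup.card_mul_index, card_quot]

theorem index_eq_zero_of_eq_bot (ε : Γ ≃ₜ* Multiplicative ℤ_[p]) (A : Voltage X Γ) {x : X.V}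
    (hx : A.I x = ⊥) : (A.I x).index = 0 := by
  have hinf : Infinite Γ := Infinite.of_surjective (coord ε) fun c => coord_surjective ε c
  rw [hx, Subgroup.index_bot, Nat.card_eq_zero_of_infinite]

theorem card_derived_V (n : ℕ) :
    Fintype.card (A.lev ε n).derived.V = ∑ x, ((A.lev ε n).I x).index := by
  rw [← Nat.card_eq_fintype_card]
  exact (Nat.card_sigma).trans (Finset.sum_congr (by ext; simp) fun x _ => rfl)

theorem prod_weights {R : Type*} [CommRing R] (n : ℕ) (F : X.V → R) :
    ∏ w : (A.lev ε n).derived.V, F w.1 = ∏ x, F x ^ ((A.lev ε n).I x).index := by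
  have h1 : ∏ w : (A.lev ε n).derived.V, F w.1 =
      ∏ w : (Σ x : X.V, _ ⧸ (A.lev ε n).I x), F w.1 :=
    Fintype.prod_equiv (show (A.lev ε n).derived.V ≃ Σ x : X.V, _ ⧸ (A.lev ε n).I x
      from Equiv.refl _) _ _ fun _ => rfl
  rw [h1, Fintype.prod_sigma]
  refine Finset.prod_congr rfl fun x _ => ?_
  refine (Finset.prod_const (F x)).trans ?_
  rw [Finset.card_univ, ← Nat.card_eq_fintype_card]
  rfl

/-- A character of `Γ/Γ^{p^n}`. -/
noncomputable def levChar {K : Type*} [Field K] {n : ℕ} (ζ : K) (hζ : ζ ^ p ^ n = 1) :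
    Γ ⧸ (powSubgroup ε n).toSubgroup →* K :=
  QuotientGroup.lift _ (character ε ζ hζ) fun γ hγ => by
    have h1 : expo ε n γ = expo ε n 1 := by
      rw [expo_eq_iff, mul_one]; exact Subgroup.inv_mem _ hγ
    rw [MonoidHom.mem_ker, character_apply, h1, ← character_apply ε ζ hζ, map_one]

theorem levChar_mk {K : Type*} [Field K] {n : ℕ} (ζ : K) (hζ : ζ ^ p ^ n = 1) (γ : Γ) :
    levChar ε ζ hζ (γ : Γ ⧸ (powSubgroup ε n).toSubgroup) = character ε ζ hζ γ := rfl

/-- The values of a faithful character of `Γ/Γ^{p^n}` are the powers of `ζ`. -/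
theorem span_levChar {K : Type*} [Field K] [CharZero K] {n : ℕ} [IsCyclotomicExtension {p ^ n} ℚ K]
    {ζ : K} (hζ : IsPrimitiveRoot ζ (p ^ n)) :
    Submodule.span ℚ (Set.range (levChar ε ζ hζ.pow_eq_one)) = ⊤ := by
  have : NeZero (p ^ n) := pow_ne_zero_nat n
  rw [eq_top_iff]
  intro y _
  have h1 := IsCyclotomicExtension.adjoin_primitive_root_eq_top (A := ℚ) hζ
  have h2 : y ∈ Algebra.adjoin ℚ {ζ} := by rw [h1]; trivial
  rw [Algebra.adjoin_singleton_eq_range_aeval] at h2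
  obtain ⟨P, rfl⟩ := h2
  rw [AlgHom.toRingHom_eq_coe, RingHom.coe_coe, Polynomial.aeval_eq_sum_range]
  refine Submodule.sum_mem _ fun i _ => Submodule.smul_mem _ _ (Submodule.subset_span ?_)
  refine ⟨((gen ε ^ (i % p ^ n) : Γ) : Γ ⧸ (powSubgroup ε n).toSubgroup), ?_⟩
  rw [levChar_mk, character_apply, expo_gen_pow ε (Nat.mod_lt _ (NeZero.pos _)),
    ← pow_eq_pow_mod _ hζ.pow_eq_one]

/-- The vertices which are not ramified contribute the determinant of the twisted Laplacian to the
quotient of the numbers of spanning trees of two successive layers, and the ramified ones a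
power of `p`. -/
theorem kappa_succ {n : ℕ} (hV : Nonempty X.V)
    (hn : ∀ x, A.I x ≠ ⊥ → (powSubgroup ε n).toSubgroup ≤ A.I x)
    {K : Type*} [Field K] [CharZero K]
    [IsCyclotomicExtension {p ^ (n + 1)} ℚ K] {ζ : K} (hζ : IsPrimitiveRoot ζ (p ^ (n + 1))) :
    ((A.lev ε (n + 1)).derived.kappa : ℚ) * p = (A.lev ε n).derived.kappa *
      p ^ (∑ x, (A.I x).index) * Algebra.norm ℚ (A.charDet (character ε ζ hζ.pow_eq_one)) := by
  have hNZ : NeZero (p ^ (n + 1)) := pow_ne_zero_nat (n + 1)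
  have hfd : FiniteDimensional ℚ K := IsCyclotomicExtension.finiteDimensional {p ^ (n + 1)} ℚ K
  have hn' : ∀ x, A.I x ≠ ⊥ → (powSubgroup ε (n + 1)).toSubgroup ≤ A.I x := fun x hx =>
    le_trans (powSubgroup_anti ε (Nat.le_succ n)) (hn x hx)
  let φ := quotMap (powSubgroup_anti ε (Nat.le_succ n))
  let k : Γ ⧸ (powSubgroup ε (n + 1)).toSubgroup := ((gen ε ^ p ^ n : Γ) : _ ⧸ _)
  have hgen : gen ε ^ p ^ n ∈ (powSubgroup ε n).toSubgroup := ⟨gen ε, rfl⟩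
  have hk : φ k = 1 := (QuotientGroup.eq_one_iff _).2 hgen
  have hlt : p ^ n < p ^ (n + 1) := Nat.pow_lt_pow_right hp.out.one_lt (Nat.lt_succ_self n)
  have hχ : levChar ε ζ hζ.pow_eq_one k ≠ 1 := by
    rw [levChar_mk, character_apply, expo_gen_pow ε hlt]
    exact hζ.pow_ne_one_of_pos_of_lt (pow_ne_zero _ hp.out.ne_zero) hlt
  -- Only the fibres of the vertices with trivial inertia group grow, by `p ^ (n + 1) - p ^ n`,
  -- the degree of the cyclotomic field.
  have hcard : Fintype.card (A.lev ε (n + 1)).derived.V = Fintype.card (A.lev ε n).derived.V +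
      Fintype.card {x // A.I x = ⊥} * Module.finrank ℚ K := by
    rw [card_derived_V, card_derived_V, IsCyclotomicExtension.finrank K
      (Polynomial.cyclotomic.irreducible_rat (NeZero.pos (p ^ (n + 1)))), Fintype.card_subtype,
      Finset.card_filter, Finset.sum_mul, ← Finset.sum_add_distrib]
    refine Finset.sum_congr rfl fun x _ => ?_
    by_cases hx : A.I x = ⊥
    · rw [index_lev_of_eq_bot ε A hx, index_lev_of_eq_bot ε A hx, if_pos hx, one_mul,
        Nat.totient_prime_pow hp.out (Nat.succ_pos n), Nat.succ_sub_one, Nat.mul_sub, mul_one,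
        ← pow_succ]
      omega
    · rw [index_lev_of_le ε A (hn x hx), index_lev_of_le ε A (hn' x hx), if_neg hx]
      omega
  -- The functions modulo those from the previous layer are a vector space over the cyclotomic
  -- field.
  have hdet := (A.lev ε (n + 1)).det_op (A.lev ε n) φ
    (QuotientGroup.map_surjective_of_surjective _ _ _ (fun q => by
      induction q using QuotientGroup.induction_on with
      | H γ => exact ⟨γ, rfl⟩) _) (fun _ => rfl) (fun x => by
        simp only [quot, map, Subgroup.map_map]; rfl)
    (levChar ε ζ hζ.pow_eq_one) (fun x => A.I x = ⊥) (fun x hx => lev_I_eq_bot ε A hx)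
    (fun x hx => ⟨k, Subgroup.mem_map_of_mem _ (hn x hx hgen), hχ⟩) hk hχ
    (span_levChar ε hζ) hcard
  have hM : (((A.lev ε (n + 1)).lapMatrix (levChar ε ζ hζ.pow_eq_one)).submatrix
      (Subtype.val : {x // A.I x = ⊥} → X.V) Subtype.val).det =
      A.charDet (character ε ζ hζ.pow_eq_one) := rfl
  rw [hM] at hdet
  have hp0 : (p : ℚ) ≠ 0 := by exact_mod_cast hp.out.ne_zero
  have hX : (Fintype.card X.V : ℚ) ≠ 0 := by exact_mod_cast Fintype.card_ne_zero
  have hsum : ∀ n, ∑ w : (A.lev ε n).derived.V, (Nat.card ((A.lev ε n).I w.1) : ℚ) =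
      Fintype.card X.V * p ^ n := by
    intro n
    have := (A.lev ε n).sum_card_mul (fun _ => (1 : ℚ))
    have h2 : Fintype.card (Γ ⧸ (powSubgroup ε n).toSubgroup) = p ^ n := by
      rw [← Nat.card_eq_fintype_card, card_quot]
    simpa [h2] using this
  have hop : ∀ n, LinearMap.det (A.lev ε n).op *
      ∏ x, (Nat.card ((A.lev ε n).I x) : ℚ) ^ ((A.lev ε n).I x).index =
      (A.lev ε n).derived.kappa * (Fintype.card X.V * p ^ n) := by
    intro n
    rw [← hsum, ← prod_weights ε A n fun x => (Nat.card ((A.lev ε n).I x) : ℚ)]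
    exact (A.lev ε n).derived.det_normOp _
      (fun w => by exact_mod_cast Nat.card_pos.ne') (by
        rw [hsum]; exact mul_ne_zero hX (pow_ne_zero _ hp0))
  -- The image of a non-trivial inertia group grows by the factor `p`.
  have hprod : ∏ x, (Nat.card ((A.lev ε (n + 1)).I x) : ℚ) ^ ((A.lev ε (n + 1)).I x).index =
      p ^ (∑ x, (A.I x).index) *
        ∏ x, (Nat.card ((A.lev ε n).I x) : ℚ) ^ ((A.lev ε n).I x).index := by
    rw [← Finset.prod_pow_eq_pow_sum, ← Finset.prod_mul_distrib]
    refine Finset.prod_congr rfl fun x _ => ?_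
    by_cases hx : A.I x = ⊥
    · rw [index_eq_zero_of_eq_bot ε A hx, lev_I_eq_bot ε A hx, lev_I_eq_bot ε A hx]
      simp
    · have h1 := card_mul_index_lev ε A (n + 1) x
      have h2 := card_mul_index_lev ε A n x
      rw [index_lev_of_le ε A (hn' x hx)] at h1 ⊢
      rw [index_lev_of_le ε A (hn x hx)] at h2 ⊢
      rw [← mul_pow]
      congr 1
      rw [pow_succ', ← h2, ← mul_assoc] at h1
      have h3 : (A.I x).index ≠ 0 := fun h0 => by
        rw [h0, mul_zero] at h2
        exact pow_ne_zero _ hp.out.ne_zero h2.symm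
      exact_mod_cast Nat.eq_of_mul_eq_mul_right (Nat.pos_of_ne_zero h3) h1
  have h1 := hop (n + 1)
  rw [hdet, hprod] at h1
  have h2 := hop n
  refine mul_right_cancel₀ (mul_ne_zero hX (pow_ne_zero n hp0)) ?_
  linear_combination -h1 + (p : ℚ) ^ (∑ x, (A.I x).index) *
    Algebra.norm ℚ (A.charDet (character ε ζ hζ.pow_eq_one)) * h2

/-- Without ramification, the constant functions are in the kernel of the untwisted Laplacian. -/
theorem charDet_one_eq_zero {S : Type*} [CommRing S] [IsDomain S] (hV : Nonempty X.V)
    (hI : ∀ x, A.I x = ⊥) : A.charDet (1 : Γ →* S) = 0 := by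
  obtain ⟨x₀⟩ := hV
  refine Matrix.exists_mulVec_eq_zero_iff.1 ⟨fun _ => 1, fun h => ?_, ?_⟩
  · exact one_ne_zero (congrFun h ⟨x₀, hI x₀⟩)
  · ext x
    rw [Matrix.mulVec, dotProduct, Pi.zero_apply]
    have h1 : ∀ F : X.V → S, ∑ y : {x // A.I x = ⊥}, F y = ∑ y, F y := fun F =>
      Fintype.sum_equiv (Equiv.subtypeUnivEquiv hI) _ _ fun _ => rfl
    simp only [Matrix.submatrix_apply, mul_one]
    rw [h1 (fun y => A.lapMatrix (1 : Γ →* S) x y)]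
    simp only [lapMatrix, Matrix.of_apply]
    rw [Finset.sum_comm]
    refine Finset.sum_eq_zero fun e _ => ?_
    split_ifs <;> simp

/-- The Iwasawa invariants of a `ℤ_p`-covering in terms of the determinant of the twisted
Laplacian and of the numbers of ramified points. -/
theorem exists_hasIwasawaInvariants (hI : ∀ x, IsClosed (A.I x : Set Γ))
    (hc : ∀ n, (A.lev ε n).derived.Connected) {ψ : Γ →* PowerSeries (ZMod p)}
    (hψ : IsBinomial ε ψ) :
    ∃ (m l lam : ℕ) (g : MonoidAlgebra ℤ Γ),
      A.charDet (MonoidAlgebra.of ℤ Γ) = (p : MonoidAlgebra ℤ Γ) ^ m * g ∧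
      (MonoidAlgebra.lift ℤ (PowerSeries (ZMod p)) Γ ψ g).order = l ∧
      lam + 1 = l + ∑ x, (A.I x).index ∧
      HasIwasawaInvariants p (fun n => (A.lev ε n).derived.kappa) lam m := by
  have hV : Nonempty X.V := by
    obtain ⟨w⟩ := (hc 0).1
    exact ⟨w.1⟩
  have hNZ : ∀ n, NeZero (p ^ (n + 1)) := fun n => pow_ne_zero_nat (n + 1)
  have hcyc : ∀ n, ∃ (K : Type) (_ : Field K) (_ : CharZero K)
      (_ : IsCyclotomicExtension {p ^ (n + 1)} ℚ K) (ζ : K), IsPrimitiveRoot ζ (p ^ (n + 1)) := by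
    intro n
    have h1 := CyclotomicField.isCyclotomicExtension (p ^ (n + 1)) ℚ
    have h2 : CyclotomicField.algebra (p ^ (n + 1)) ℚ = DivisionRing.toRatAlgebra :=
      Subsingleton.elim _ _
    rw [h2] at h1
    exact ⟨CyclotomicField (p ^ (n + 1)) ℚ, inferInstance, inferInstance, h1, _,
      IsCyclotomicExtension.zeta_spec _ ℚ _⟩
  obtain ⟨n₀, hn₀⟩ : ∃ n₀, ∀ n ≥ n₀, ∀ x, A.I x ≠ ⊥ → (powSubgroup ε n).toSubgroup ≤ A.I x := by
    have h1 : ∀ x, ∃ n, A.I x ≠ ⊥ → (powSubgroup ε n).toSubgroup ≤ A.I x := by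
      intro x
      by_cases hx : A.I x = ⊥
      · exact ⟨0, fun h => absurd hx h⟩
      · obtain ⟨n, hn⟩ := exists_eq_powSubgroup_of_isClosed ε (hI x) hx
        exact ⟨n, fun _ => hn.ge⟩
    choose N hN using h1
    exact ⟨Finset.univ.sup N, fun n hn x hx => le_trans
      (powSubgroup_anti ε ((Finset.le_sup (Finset.mem_univ x)).trans hn)) (hN x hx)⟩
  set f := A.charDet (MonoidAlgebra.of ℤ Γ) with hf
  have hlift : ∀ {S : Type} [CommRing S] (θ : Γ →* S), A.charDet θ =
      MonoidAlgebra.lift ℤ S Γ θ f := by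
    intro S _ θ
    rw [hf]
    have := A.map_charDet (MonoidAlgebra.of ℤ Γ) (MonoidAlgebra.lift ℤ S Γ θ : _ →+* S)
    refine Eq.trans ?_ this.symm
    congr 1
    ext γ
    simp
  have hrec : ∀ n ≥ n₀, ∃ (K : Type) (_ : Field K) (_ : CharZero K)
      (_ : IsCyclotomicExtension {p ^ (n + 1)} ℚ K) (ζ : K)
      (hζ : IsPrimitiveRoot ζ (p ^ (n + 1))),
      ((A.lev ε (n + 1)).derived.kappa : ℚ) * p = (A.lev ε n).derived.kappa *
      p ^ (∑ x, (A.I x).index) * Algebra.norm ℚ (MonoidAlgebra.lift ℤ K Γ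
        (character ε ζ hζ.pow_eq_one) f) := by
    intro n hn
    obtain ⟨K, hK1, hK2, hK3, ζ, hζ⟩ := hcyc n
    refine ⟨K, hK1, hK2, hK3, ζ, hζ, ?_⟩
    rw [← hlift]
    exact A.kappa_succ ε hV (hn₀ n hn) hζ
  have hp0 : (p : ℚ) ≠ 0 := by exact_mod_cast hp.out.ne_zero
  have hκ : ∀ n, ((A.lev ε n).derived.kappa : ℚ) ≠ 0 := fun n =>
    FinGraph.kappa_ne_zero _ (hc n)
  -- The norms of the values of `f` are quotients of non-zero numbers of spanning trees.
  have hf0 : f ≠ 0 := by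
    intro h0
    obtain ⟨K, _, _, _, ζ, hζ, h1⟩ := hrec n₀ le_rfl
    have hfd : FiniteDimensional ℚ K :=
      IsCyclotomicExtension.finiteDimensional {p ^ (n₀ + 1)} ℚ K
    rw [h0, map_zero, Algebra.norm_zero, mul_zero] at h1
    exact mul_ne_zero (hκ _) hp0 h1
  obtain ⟨m, g, hfg, hg⟩ := hψ.exists_eq_pow_mul hf0
  obtain ⟨l, hl⟩ : ∃ l : ℕ, (MonoidAlgebra.lift ℤ (PowerSeries (ZMod p)) Γ ψ g).order = l :=
    ENat.ne_top_iff_exists.1 (by rwa [ne_eq, PowerSeries.order_eq_top]) |>.imp fun _ h => h.symm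
  -- if nothing is ramified, the augmentation of `f` vanishes
  have hpos : 1 ≤ l + ∑ x, (A.I x).index := by
    by_contra hlt
    have hl0 : l = 0 := by omega
    have hr0 : ∑ x, (A.I x).index = 0 := by omega
    have hbot : ∀ x, A.I x = ⊥ := by
      intro x
      by_contra hx
      have h1 := card_mul_index_lev ε A n₀ x
      rw [index_lev_of_le ε A (hn₀ n₀ le_rfl x hx),
        Finset.sum_eq_zero_iff.1 hr0 x (Finset.mem_univ x), mul_zero] at h1
      exact pow_ne_zero _ hp.out.ne_zero h1.symm
    have h1 := A.charDet_one_eq_zero (S := ℤ) hV hbot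
    rw [hlift, hfg, map_mul, map_pow, map_natCast] at h1
    have h2 := (mul_eq_zero.1 h1).resolve_left
      (pow_ne_zero _ (by exact_mod_cast hp.out.ne_zero))
    have h3 : ∀ g : MonoidAlgebra ℤ Γ, PowerSeries.constantCoeff
        (MonoidAlgebra.lift ℤ (PowerSeries (ZMod p)) Γ ψ g) =
        ((MonoidAlgebra.lift ℤ ℤ Γ 1 g : ℤ) : ZMod p) := by
      intro g
      rw [MonoidAlgebra.lift_apply, MonoidAlgebra.lift_apply, Finsupp.sum, Finsupp.sum, map_sum,
        Int.cast_sum]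
      refine Finset.sum_congr rfl fun γ _ => ?_
      rw [Algebra.smul_def, map_mul, hψ.constantCoeff, eq_intCast, map_intCast]
      simp
    have h4 := h3 g
    rw [h2, Int.cast_zero, ← PowerSeries.coeff_zero_eq_constantCoeff_apply] at h4
    have h5 := PowerSeries.coeff_order (φ := MonoidAlgebra.lift ℤ _ Γ ψ g) hg
    rw [hl, ENat.toNat_natCast, hl0] at h5
    exact h5 h4
  refine ⟨m, l, l + ∑ x, (A.I x).index - 1, g, hfg, hl, by omega, ?_⟩
  set r := ∑ x, (A.I x).index
  -- the recursion for the valuations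
  have hval : ∀ n ≥ max n₀ (l + 1), (padicValNat p (A.lev ε (n + 1)).derived.kappa : ℤ) + 1 =
      padicValNat p (A.lev ε n).derived.kappa + r + (m * (p ^ (n + 1)).totient + l) := by
    intro n hn
    obtain ⟨K, _, _, _, ζ, hζ, h1⟩ := hrec n ((le_max_left _ _).trans hn)
    have hnl : l + 1 ≤ n := (le_max_right _ _).trans hn
    have h2 : l < (p ^ (n + 1)).totient := by
      rw [Nat.totient_prime_pow hp.out (Nat.succ_pos n), Nat.succ_sub_one]
      have h3 : n < p ^ n := Nat.lt_pow_self hp.out.one_lt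
      have h4 : 1 ≤ p - 1 := by have := hp.out.two_le; omega
      nlinarith
    have h5 : p ^ (n + 1) ≠ 2 := by
      have h3 : n + 1 < p ^ (n + 1) := Nat.lt_pow_self hp.out.one_lt
      have h4 : p ^ 2 ≤ p ^ (n + 1) := Nat.pow_le_pow_right hp.out.pos (by omega)
      have := hp.out.two_le
      nlinarith
    have h6 := hψ.padicValRat_norm hfg hl h5 h2 hζ
    have h7 : Algebra.norm ℚ (MonoidAlgebra.lift ℤ K Γ (character ε ζ hζ.pow_eq_one) f) ≠ 0 := by
      intro h0
      rw [h0, mul_zero] at h1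
      exact mul_ne_zero (hκ _) hp0 h1
    have h8 := congrArg (padicValRat p) h1
    rw [padicValRat.mul (hκ _) hp0, padicValRat.mul (mul_ne_zero (hκ _) (pow_ne_zero _ hp0)) h7,
      padicValRat.mul (hκ _) (pow_ne_zero _ hp0), padicValRat.pow, h6,
      padicValRat.self hp.out.one_lt, padicValRat.of_nat, padicValRat.of_nat] at h8
    linear_combination h8
  set N := max n₀ (l + 1)
  refine ⟨padicValNat p (A.lev ε N).derived.kappa -
    (((l + r - 1 : ℕ) : ℤ) * N + m * (p : ℤ) ^ N), Filter.eventually_atTop.2 ⟨N, fun n hn => ?_⟩⟩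
  induction n, hn using Nat.le_induction with
  | base => ring
  | succ n hn ih =>
    have h1 := hval n hn
    have h2 : (((p ^ (n + 1)).totient : ℕ) : ℤ) = (p : ℤ) ^ (n + 1) - (p : ℤ) ^ n := by
      rw [Nat.totient_prime_pow hp.out (Nat.succ_pos n), Nat.succ_sub_one, Nat.cast_mul,
        Nat.cast_sub hp.out.one_le]
      push_cast; ring
    rw [h2] at h1
    have h3 : ((l + r - 1 : ℕ) : ℤ) = l + r - 1 := by
      rw [Nat.cast_sub hpos]; push_cast; ring
    rw [h3] at ih ⊢
    rw [Nat.cast_add, Nat.cast_one]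
    linear_combination h1 + ih

/-- The Iwasawa invariants are determined by the sequence. -/
theorem _root_.KidaGraph.HasIwasawaInvariants.unique {k : ℕ → ℕ} {lam mu lam' mu' : ℕ}
    (h : HasIwasawaInvariants p k lam mu) (h' : HasIwasawaInvariants p k lam' mu') :
    lam = lam' ∧ mu = mu' := by
  obtain ⟨ν, h⟩ := h
  obtain ⟨ν', h'⟩ := h'
  obtain ⟨N, hN⟩ := Filter.eventually_atTop.1 (h.and h')
  have h1 : ∀ n ≥ N, ((lam : ℤ) - lam') * n + ((mu : ℤ) - mu') * (p : ℤ) ^ n + (ν - ν') = 0 := by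
    intro n hn
    have := hN n hn
    linear_combination this.2 - this.1
  have e0 := h1 N le_rfl
  have e1 := h1 (N + 1) (by omega)
  have e2 := h1 (N + 2) (by omega)
  push_cast at e1 e2
  have h2 : ((mu : ℤ) - mu') * ((p : ℤ) ^ N * (p - 1) ^ 2) = 0 := by
    linear_combination e2 - 2 * e1 + e0
  have hp1 : (p : ℤ) - 1 ≠ 0 := by
    have := hp.out.one_lt
    omega
  have h3 := (mul_eq_zero.1 h2).resolve_right
    (mul_ne_zero (pow_ne_zero _ (by exact_mod_cast hp.out.ne_zero)) (pow_ne_zero _ hp1))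
  rw [h3] at e0 e1
  constructor <;> linarith

end Voltage

end KidaGraph

namespace KidaGraph

universe u v w

open scoped Classical

set_option linter.unusedSectionVars false

namespace Voltage

/-! ### Restricting a voltage assignment to a factor -/

section Qvert

variable {X : FinGraph.{u}} {Δ : Type w} [Group Δ] [TopologicalSpace Δ] [IsTopologicalGroup Δ]
  [CompactSpace Δ] (A : Voltage X Δ)

/-- The vertex `(d I_x, x)` of the derived graph over `Δ/U`. -/
def qvert (U : OpenNormalSubgroup Δ) (x : X.V) (d : Δ) : (A.quot U).derived.V :=
  (A.quot U).vert x (d : Δ ⧸ U.toSubgroup)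

variable {A}

theorem qvert_eq_iff {U : OpenNormalSubgroup Δ} {x y : X.V} {d d' : Δ} :
    A.qvert U x d = A.qvert U y d' ↔ x = y ∧ ∃ i ∈ A.I y, i⁻¹ * (d⁻¹ * d') ∈ U.toSubgroup := by
  rw [qvert, qvert, vert_eq_iff]
  refine and_congr_right fun _ => ?_
  change _ ∈ (A.I y).map _ ↔ _
  rw [Subgroup.mem_map]
  refine exists_congr fun i => and_congr_right fun _ => ?_
  rw [← QuotientGroup.eq]
  rfl

theorem exists_qvert {U : OpenNormalSubgroup Δ} (w : (A.quot U).derived.V) :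
    ∃ x d, w = A.qvert U x d := by
  obtain ⟨x, h, rfl⟩ := exists_vert _ w
  induction h using QuotientGroup.induction_on with
  | H d => exact ⟨x, d, rfl⟩

theorem quot_s {U : OpenNormalSubgroup Δ} (d : Δ) (e : X.E) :
    (A.quot U).derived.s ((d : Δ ⧸ U.toSubgroup), e) = A.qvert U (X.s e) d := rfl

theorem quot_t {U : OpenNormalSubgroup Δ} (d : Δ) (e : X.E) :
    (A.quot U).derived.t ((d : Δ ⧸ U.toSubgroup), e) = A.qvert U (X.t e) (d * A.α e) := rfl

end Qvert

section Retraction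

variable {Γ : Type v} [CommGroup Γ] {G : Type w} [Group G] (I : Subgroup (Γ × G))

/-- Every `g` is congruent modulo the projection of `I` to the representative of its class; the
difference lifts to an element of `I`, with some first component. -/
theorem exists_retraction (g : G) :
    ∃ κ : Γ, (κ⁻¹, (g : G ⧸ I.map (MonoidHom.snd Γ G)).out⁻¹ * g) ∈ I := by
  have h : (g : G ⧸ I.map (MonoidHom.snd Γ G)).out⁻¹ * g ∈ I.map (MonoidHom.snd Γ G) := by
    rw [← QuotientGroup.eq, QuotientGroup.out_eq']
  obtain ⟨i, hi, h2⟩ := h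
  refine ⟨i.1⁻¹, ?_⟩
  rw [inv_inv, ← h2]
  exact hi

/-- An element `κ` of `Γ` such that `(1, g) I = (κ, r) I` for the chosen representative `r` of the
orbit of `(1, g) I` under `Γ`. -/
noncomputable def retraction (g : G) : Γ := (exists_retraction I g).choose

theorem retraction_mem (g : G) :
    ((retraction I g)⁻¹, (g : G ⧸ I.map (MonoidHom.snd Γ G)).out⁻¹ * g) ∈ I :=
  (exists_retraction I g).choose_spec

theorem retraction_eq_one (h : ∀ i ∈ I, i.1 = 1) (g : G) : retraction I g = 1 :=
  inv_eq_one.1 (h _ (retraction_mem I g))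

end Retraction

variable {Γ : Type v} [CommGroup Γ] {G : Type w} [Group G] [Finite G] {X : FinGraph.{u}}

/-- The restriction to `Γ` of a voltage assignment with values in `Γ × G`: the covering of `X` it
describes is, as a covering with group `Γ`, a covering of the `G`-covering `X(G)` of `X`. The
vertices of `X(G)` are the `Γ`-orbits of the vertices, and a base point is
chosen in each of these orbits. -/
noncomputable def restrict (A : Voltage X (Γ × G)) :
    Voltage (A.map (MonoidHom.snd Γ G)).derived Γ where
  α e := (retraction (A.I (X.s e.2)) e.1)⁻¹ * (A.α e.2).1 *
    retraction (A.I (X.t e.2)) (e.1 * (A.α e.2).2)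
  α_bar := by
    rintro ⟨g, e⟩
    change (retraction (A.I (X.s (X.bar e))) (g * (A.α e).2))⁻¹ * (A.α (X.bar e)).1 *
      retraction (A.I (X.t (X.bar e))) (g * (A.α e).2 * (A.α (X.bar e)).2) =
      ((retraction (A.I (X.s e)) g)⁻¹ * (A.α e).1 *
        retraction (A.I (X.t e)) (g * (A.α e).2))⁻¹
    rw [X.s_bar, X.t_bar, A.α_bar, Prod.snd_inv, mul_inv_cancel_right, Prod.fst_inv,
      mul_inv_rev, mul_inv_rev, inv_inv]
    ac_rfl
  I w := (A.I w.1).comap (MonoidHom.inl Γ G)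

/-- The vertex of `X(G)` below the vertex `(1, g) I_x`. -/
def gvert (A : Voltage X (Γ × G)) (x : X.V) (g : G) : (A.map (MonoidHom.snd Γ G)).derived.V :=
  (A.map (MonoidHom.snd Γ G)).vert x g

theorem gvert_eq_iff {A : Voltage X (Γ × G)} {x y : X.V} {g h : G} :
    A.gvert x g = A.gvert y h ↔ x = y ∧ g⁻¹ * h ∈ (A.I y).map (MonoidHom.snd Γ G) := vert_eq_iff _

theorem eq_gvert_out {A : Voltage X (Γ × G)} (w : (A.map (MonoidHom.snd Γ G)).derived.V) :
    w = A.gvert w.1 w.2.out := by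
  obtain ⟨x, q⟩ := w
  exact Sigma.ext rfl (heq_of_eq (QuotientGroup.out_eq' q).symm)

section Split

variable {p : ℕ} [hp : Fact p.Prime] [TopologicalSpace Γ] [IsTopologicalGroup Γ] [CompactSpace Γ]
  (ε : Γ ≃ₜ* Multiplicative ℤ_[p]) [TopologicalSpace G] [DiscreteTopology G]
  (A : Voltage X (Γ × G))

/-- The bijection of the vertices of `X(Γ/Γ^{p^n})`, for the restricted voltage assignment, with
those of `X((Γ/Γ^{p^n}) × G)`. -/
noncomputable def splitFun (n : ℕ) (w : (A.restrict.quot (powSubgroup ε n)).derived.V) :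
    (A.quot (layerSubgroup ⟨ε⟩ n ⊥)).derived.V :=
  A.qvert _ w.1.1 (w.2.out.out, w.1.2.out)

theorem mem_layer_bot {n : ℕ} {d : Γ × G} :
    d ∈ (layerSubgroup (G := G) ⟨ε⟩ n ⊥).toSubgroup ↔ d.1 ∈ (powSubgroup ε n).toSubgroup ∧ d.2 = 1 :=
  Iff.rfl

theorem splitFun_qvert (n : ℕ) (w : (A.map (MonoidHom.snd Γ G)).derived.V) (γ : Γ) :
    splitFun ε A n (A.restrict.qvert _ w γ) = A.qvert _ w.1 (γ, w.2.out) := by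
  obtain ⟨q, hq⟩ : ∃ q, A.restrict.qvert (powSubgroup ε n) w γ = ⟨w, q⟩ := ⟨_, rfl⟩
  have h : A.restrict.qvert (powSubgroup ε n) w (q.out.out) =
      A.restrict.qvert (powSubgroup ε n) w γ := by
    rw [hq]
    refine Sigma.ext rfl (heq_of_eq ?_)
    refine Eq.trans ?_ (QuotientGroup.out_eq' q)
    exact congrArg _ (QuotientGroup.out_eq' q.out)
  rw [hq]
  change A.qvert _ w.1 (q.out.out, w.2.out) = _
  rw [qvert_eq_iff]
  obtain ⟨-, i, hi, hu⟩ := qvert_eq_iff.1 h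
  refine ⟨rfl, _, hi, ?_⟩
  rw [mem_layer_bot]
  exact ⟨hu, by simp⟩

theorem qvert_eq_splitFun (n : ℕ) (x : X.V) (γ : Γ) (g : G) :
    A.qvert _ x (γ, g) =
      splitFun ε A n (A.restrict.qvert _ (A.gvert x g) (γ * retraction (A.I x) g)) := by
  rw [splitFun_qvert, eq_comm, qvert_eq_iff]
  refine ⟨rfl, _, retraction_mem (A.I x) g, ?_⟩
  have : ((γ * retraction (A.I x) g, (A.gvert x g).2.out)⁻¹ * (γ, g) : Γ × G) =
      ((retraction (A.I x) g)⁻¹, (g : G ⧸ (A.I x).map (MonoidHom.snd Γ G)).out⁻¹ * g) := by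
    refine Prod.ext ?_ rfl
    simp
  rw [this, inv_mul_cancel]
  exact one_mem _

theorem splitFun_bijective (n : ℕ) : Function.Bijective (splitFun ε A n) := by
  constructor
  · intro w w' h
    obtain ⟨v, γ, rfl⟩ := exists_qvert w
    obtain ⟨v', γ', rfl⟩ := exists_qvert w'
    rw [splitFun_qvert, splitFun_qvert, qvert_eq_iff] at h
    obtain ⟨hx, i, hi, hu⟩ := h
    rw [mem_layer_bot] at hu
    have h2 : i.2 = v.2.out⁻¹ * v'.2.out := by
      have := hu.2
      simp only [Prod.snd_mul, Prod.snd_inv] at this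
      exact inv_mul_eq_one.1 this
    have hv : v = v' := by
      rw [eq_gvert_out v, eq_gvert_out v', gvert_eq_iff]
      refine ⟨hx, ?_⟩
      rw [← h2]
      exact Subgroup.mem_map_of_mem _ hi
    subst hv
    rw [inv_mul_cancel] at h2
    rw [qvert_eq_iff]
    refine ⟨rfl, i.1, ?_, hu.1⟩
    change (i.1, (1 : G)) ∈ A.I v.1
    rw [← h2]
    exact hi
  · intro w
    obtain ⟨x, ⟨γ, g⟩, rfl⟩ := exists_qvert w
    exact ⟨_, (qvert_eq_splitFun ε A n x γ g).symm⟩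

/-- `splitFun` as an equivalence. -/
noncomputable def split (n : ℕ) : (A.restrict.quot (powSubgroup ε n)).derived.V ≃
    (A.quot (layerSubgroup (G := G) ⟨ε⟩ n ⊥)).derived.V :=
  Equiv.ofBijective _ (splitFun_bijective ε A n)

/-- The map on edges which goes with `split`. -/
noncomputable def splitEFun (n : ℕ) (e : (A.restrict.quot (powSubgroup ε n)).derived.E) :
    (A.quot (layerSubgroup (G := G) ⟨ε⟩ n ⊥)).derived.E :=
  (QuotientGroup.mk (e.1.out * (retraction (A.I (X.s e.2.2)) e.2.1)⁻¹, e.2.1), e.2.2)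

theorem splitEFun_mk (n : ℕ) (γ : Γ) (g : G) (e : X.E) :
    splitEFun ε A n ((γ : Γ ⧸ (powSubgroup ε n).toSubgroup), (g, e)) =
      (QuotientGroup.mk (γ * (retraction (A.I (X.s e)) g)⁻¹, g), e) := by
  refine Prod.ext ?_ rfl
  refine QuotientGroup.eq.2 ?_
  rw [mem_layer_bot]
  refine ⟨?_, by simp⟩
  have h : ((γ : Γ ⧸ (powSubgroup ε n).toSubgroup).out)⁻¹ * γ ∈ (powSubgroup ε n).toSubgroup := by
    rw [← QuotientGroup.eq, QuotientGroup.out_eq']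
  convert h using 1
  simp only [Prod.fst_mul, Prod.fst_inv, mul_inv_rev, inv_inv]
  rw [mul_comm _⁻¹ _, ← mul_assoc]
  generalize (γ : Γ ⧸ (powSubgroup ε n).toSubgroup).out = y
  change _ * _ * γ * _ = _
  rw [mul_comm, ← mul_assoc, ← mul_assoc]
  simp [mul_comm]

theorem splitEFun_bijective (n : ℕ) : Function.Bijective (splitEFun ε A n) := by
  constructor
  · rintro ⟨q, g, e⟩ ⟨q', g', e'⟩ h
    induction q using QuotientGroup.induction_on with
    | H γ =>
    induction q' using QuotientGroup.induction_on with
    | H γ' =>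
    rw [splitEFun_mk, splitEFun_mk] at h
    obtain rfl : e = e' := congrArg Prod.snd h
    have h := QuotientGroup.eq.1 (congrArg Prod.fst h)
    rw [mem_layer_bot] at h
    obtain ⟨h1, h2⟩ := h
    have h2 : g = g' := inv_mul_eq_one.1 h2
    subst h2
    refine Prod.ext ?_ rfl
    refine QuotientGroup.eq.2 ?_
    convert h1 using 1
    simp only [Prod.fst_mul, Prod.fst_inv]
    rw [← div_eq_mul_inv, ← div_eq_mul_inv, inv_mul_eq_div, inv_mul_eq_div,
      div_div_div_cancel_right]
  · rintro ⟨q, e⟩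
    induction q using QuotientGroup.induction_on with
    | H d =>
      refine ⟨((d.1 * retraction (A.I (X.s e)) d.2 : Γ), (d.2, e)), ?_⟩
      rw [splitEFun_mk, mul_inv_cancel_right]

/-- The bijection on edges which goes with `split`. -/
noncomputable def splitE (n : ℕ) : (A.restrict.quot (powSubgroup ε n)).derived.E ≃
    (A.quot (layerSubgroup (G := G) ⟨ε⟩ n ⊥)).derived.E :=
  Equiv.ofBijective _ (splitEFun_bijective ε A n)

theorem split_s (n : ℕ) (e : (A.restrict.quot (powSubgroup ε n)).derived.E) :
    split ε A n ((A.restrict.quot (powSubgroup ε n)).derived.s e) =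
      (A.quot (layerSubgroup ⟨ε⟩ n ⊥)).derived.s (splitE ε A n e) := by
  obtain ⟨q, g, e⟩ := e
  induction q using QuotientGroup.induction_on with
  | H γ =>
    change splitFun ε A n (A.restrict.qvert _ (A.gvert (X.s e) g) γ) =
      (A.quot (layerSubgroup ⟨ε⟩ n ⊥)).derived.s (splitEFun ε A n _)
    rw [splitEFun_mk, quot_s, qvert_eq_splitFun, inv_mul_cancel_right]

theorem split_t (n : ℕ) (e : (A.restrict.quot (powSubgroup ε n)).derived.E) :
    split ε A n ((A.restrict.quot (powSubgroup ε n)).derived.t e) =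
      (A.quot (layerSubgroup ⟨ε⟩ n ⊥)).derived.t (splitE ε A n e) := by
  obtain ⟨q, g, e⟩ := e
  induction q using QuotientGroup.induction_on with
  | H γ =>
    change splitFun ε A n (A.restrict.qvert _ (A.gvert (X.t e) (g * (A.α e).2))
      (γ * ((retraction (A.I (X.s e)) g)⁻¹ * (A.α e).1 *
        retraction (A.I (X.t e)) (g * (A.α e).2)))) =
      (A.quot (layerSubgroup ⟨ε⟩ n ⊥)).derived.t (splitEFun ε A n _)
    rw [splitEFun_mk, quot_t]
    have h : ((γ * (retraction (A.I (X.s e)) g)⁻¹, g) * A.α e : Γ × G) =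
      (γ * (retraction (A.I (X.s e)) g)⁻¹ * (A.α e).1, g * (A.α e).2) := rfl
    rw [h, qvert_eq_splitFun]
    congr 2
    simp only [mul_assoc]

/-- Connectedness can be transported along a surjection on vertices compatible with the edges. -/
theorem _root_.KidaGraph.FinGraph.Connected.of_surjective {Y : FinGraph.{u}} {Z : FinGraph.{v}}
    (hY : Y.Connected) (a : Y.V → Z.V) (b : Y.E → Z.E) (ha : Function.Surjective a)
    (hs : ∀ e, a (Y.s e) = Z.s (b e)) (ht : ∀ e, a (Y.t e) = Z.t (b e)) : Z.Connected := by
  refine ⟨hY.1.map a, fun c d => ?_⟩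
  obtain ⟨c, rfl⟩ := ha c
  obtain ⟨d, rfl⟩ := ha d
  refine Relation.ReflTransGen.lift (r := fun a b => ∃ e ∈ Set.univ, Y.s e = a ∧ Y.t e = b) a ?_ c d
    (hY.2 c d)
  rintro x y ⟨e, -, rfl, rfl⟩
  exact ⟨b e, Set.mem_univ _, (hs e).symm, (ht e).symm⟩

/-- The layers of the `Γ`-covering given by the restriction are isomorphic to layers of the
original covering, see `split`. -/
theorem connected_restrict {n : ℕ} (h : (A.quot (layerSubgroup ⟨ε⟩ n ⊥)).derived.Connected) :
    (A.restrict.quot (powSubgroup ε n)).derived.Connected := by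
  refine h.of_surjective (split ε A n).symm (splitE ε A n).symm (Equiv.surjective _) ?_ ?_
  · intro e
    rw [Equiv.symm_apply_eq, split_s, Equiv.apply_symm_apply]
  · intro e
    rw [Equiv.symm_apply_eq, split_t, Equiv.apply_symm_apply]

/-- The isomorphism of graphs `split` preserves the number of spanning trees. -/
theorem kappa_restrict {n : ℕ} (h : (A.quot (layerSubgroup ⟨ε⟩ n ⊥)).derived.Connected) :
    (A.restrict.quot (powSubgroup ε n)).derived.kappa =
      (A.quot (layerSubgroup ⟨ε⟩ n ⊥)).derived.kappa := by
  have := (connected_restrict ε A h).1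
  exact FinGraph.kappa_congr (split ε A n) (splitE ε A n) (split_s ε A n) (split_t ε A n)

end Split

end Voltage

end KidaGraph

namespace KidaGraph

universe u v w

open scoped Classical

set_option linter.unusedSectionVars false

/-! ### Subgroups of `Γ × G` -/

section Index

variable {H : Type v} [Group H] {G : Type w} [Group G]

/-- The index is multiplicative along the projection to `G`. -/
theorem index_eq_mul (I : Subgroup (H × G)) :
    I.index = (I.map (MonoidHom.snd H G)).index * (I.comap (MonoidHom.inl H G)).index := by
  rw [Subgroup.index, Subgroup.index, Subgroup.index, ← Nat.card_prod]
  refine (Nat.card_congr (Equiv.ofBijective (fun x : (G ⧸ I.map (MonoidHom.snd H G)) ×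
    (H ⧸ I.comap (MonoidHom.inl H G)) => (((x.2.out, x.1.out) : H × G) : (H × G) ⧸ I))
    ⟨?_, ?_⟩)).symm
  · rintro ⟨q, r⟩ ⟨q', r'⟩ h
    have h := QuotientGroup.eq.1 h
    have hq : q = q' := by
      rw [← QuotientGroup.out_eq' q, ← QuotientGroup.out_eq' q', QuotientGroup.eq]
      exact ⟨_, h, rfl⟩
    subst hq
    have hr : r = r' := by
      rw [← QuotientGroup.out_eq' r, ← QuotientGroup.out_eq' r', QuotientGroup.eq]
      change (r.out⁻¹ * r'.out, (1 : G)) ∈ I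
      convert h using 1
      exact Prod.ext rfl (inv_mul_cancel _).symm
    rw [hr]
  · intro x
    induction x using QuotientGroup.induction_on with
    | H d =>
      obtain ⟨i, hi, h2⟩ : (d.2 : G ⧸ I.map (MonoidHom.snd H G)).out⁻¹ * d.2 ∈
          I.map (MonoidHom.snd H G) := by
        rw [← QuotientGroup.eq, QuotientGroup.out_eq']
      have h2 : i.2 = (d.2 : G ⧸ I.map (MonoidHom.snd H G)).out⁻¹ * d.2 := h2
      refine ⟨((d.2 : G ⧸ _), ((d.1 * i.1⁻¹ : H) : H ⧸ _)), ?_⟩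
      have h3 := QuotientGroup.out_eq' ((d.1 * i.1⁻¹ : H) : H ⧸ I.comap (MonoidHom.inl H G))
      rw [QuotientGroup.eq] at h3
      refine QuotientGroup.eq.2 ?_
      have h4 := I.mul_mem h3 hi
      convert h4 using 1
      refine Prod.ext ?_ ?_
      · simp [mul_assoc]
      · simp [h2]

/-- The formula `[H × G : I] · #(I ∩ G) = #G · [H : pr(I)]`, which also holds for infinite
indices, encoded as `0`. -/
theorem index_mul_card [Finite G] (I : Subgroup (H × G)) :
    I.index * Nat.card (I.comap (MonoidHom.inr H G)) =
      Nat.card G * (I.map (MonoidHom.fst H G)).index := by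
  have h1 := index_eq_mul (I.map (MulEquiv.prodComm (M := H) (N := G) : H × G →* G × H))
  have h2 : (I.map (MulEquiv.prodComm (M := H) (N := G) : H × G →* G × H)).map
      (MonoidHom.snd G H) = I.map (MonoidHom.fst H G) := by
    rw [Subgroup.map_map]; rfl
  have h3 : (I.map (MulEquiv.prodComm (M := H) (N := G) : H × G →* G × H)).comap
      (MonoidHom.inl G H) = I.comap (MonoidHom.inr H G) := by
    ext g
    constructor
    · rintro ⟨i, hi, h⟩
      have : i = (1, g) := Prod.ext (congrArg Prod.snd h) (congrArg Prod.fst h)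
      rw [this] at hi
      exact hi
    · intro h
      exact ⟨_, h, rfl⟩
  have h4 : (I.map (MulEquiv.prodComm (M := H) (N := G) : H × G →* G × H)).index = I.index :=
    Subgroup.index_map_of_bijective (MulEquiv.prodComm (M := H) (N := G)).bijective I
  rw [h2, h3, h4] at h1
  rw [h1, mul_assoc, Subgroup.index_mul_card, mul_comm]

end Index

section Finiteness

variable {p : ℕ} [hp : Fact p.Prime] {Γ : Type v} [CommGroup Γ] [TopologicalSpace Γ]
  (ε : Γ ≃ₜ* Multiplicative ℤ_[p]) {G : Type w} [Group G] [Finite G] {I : Subgroup (Γ × G)}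

/-- A subgroup of `Γ × G` which meets `Γ` trivially is finite, hence has trivial image in the
torsion-free group `Γ`. -/
theorem fst_eq_one_of_comap_inl (ε : Γ ≃ₜ* Multiplicative ℤ_[p])
    (h : I.comap (MonoidHom.inl Γ G) = ⊥) : I.map (MonoidHom.fst Γ G) = ⊥ := by
  have hfin : Finite I := by
    refine Finite.of_injective (fun i : I => i.1.2) fun i j hij => ?_
    have h1 : i.1.1⁻¹ * j.1.1 ∈ I.comap (MonoidHom.inl Γ G) := by
      change (i.1.1⁻¹ * j.1.1, (1 : G)) ∈ I
      convert I.mul_mem (I.inv_mem i.2) j.2 using 1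
      refine Prod.ext rfl ?_
      have hij : i.1.2 = j.1.2 := hij
      simp [hij]
    rw [h, Subgroup.mem_bot, inv_mul_eq_one] at h1
    exact Subtype.ext (Prod.ext h1 hij)
  rw [← finite_iff_eq_bot ε]
  exact Finite.of_surjective (fun i : I => (⟨i.1.1, ⟨i.1, i.2, rfl⟩⟩ : I.map (MonoidHom.fst Γ G)))
    fun ⟨_, i, hi, h⟩ => ⟨⟨i, hi⟩, Subtype.ext h⟩

theorem comap_inl_eq_bot_iff (ε : Γ ≃ₜ* Multiplicative ℤ_[p]) :
    I.comap (MonoidHom.inl Γ G) = ⊥ ↔ I.map (MonoidHom.fst Γ G) = ⊥ := by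
  refine ⟨fst_eq_one_of_comap_inl ε, fun h => ?_⟩
  rw [eq_bot_iff]
  intro γ hγ
  have : γ ∈ I.map (MonoidHom.fst Γ G) := ⟨_, hγ, rfl⟩
  rwa [h] at this

theorem finite_iff_comap_inl (ε : Γ ≃ₜ* Multiplicative ℤ_[p]) :
    Finite I ↔ I.comap (MonoidHom.inl Γ G) = ⊥ := by
  constructor
  · intro h
    rw [← finite_iff_eq_bot ε]
    exact Finite.of_injective (fun i : I.comap (MonoidHom.inl Γ G) => (⟨_, i.2⟩ : I))
      fun i j hij => Subtype.ext (congrArg (fun k : I => k.1.1) hij)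
  · intro h
    rw [comap_inl_eq_bot_iff ε] at h
    refine Finite.of_injective (fun i : I => i.1.2) fun i j hij => ?_
    have h1 : ∀ i : I, i.1.1 = 1 := fun i => by
      rw [← Subgroup.mem_bot, ← h]
      exact ⟨_, i.2, rfl⟩
    exact Subtype.ext (Prod.ext ((h1 i).trans (h1 j).symm) hij)

end Finiteness

namespace Voltage

/-! ### Kida's congruence -/

theorem lapMatrix_mulVec {X : FinGraph.{u}} {H : Type v} [Group H] (A : Voltage X H)
    {S : Type*} [CommRing S] (θ : H →* S) (f : X.V → S) (x : X.V) :
    (A.lapMatrix θ).mulVec f x =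
      ∑ e, if X.s e = x then f x - θ (A.α e) * f (X.t e) else 0 := by
  rw [Matrix.mulVec, dotProduct]
  simp only [lapMatrix, Matrix.of_apply, Finset.sum_mul]
  rw [Finset.sum_comm]
  refine Finset.sum_congr rfl fun e _ => ?_
  split_ifs with h
  · simp [sub_mul, Finset.sum_sub_distrib]
  · simp

theorem submatrix_mulVec {V S : Type*} [Fintype V] [CommRing S] (P : V → Prop) (M : Matrix V V S)
    (f : {v // P v} → S) (x : {v // P v}) :
    (M.submatrix (Subtype.val : {v // P v} → V) Subtype.val).mulVec f x =
      M.mulVec (fun v => if h : P v then f ⟨v, h⟩ else 0) x.1 := by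
  simp only [Matrix.mulVec, dotProduct, Matrix.submatrix_apply]
  have h1 : ∀ v, (M x.1 v * if h : P v then f ⟨v, h⟩ else 0) =
      if P v then (M x.1 v * if h : P v then f ⟨v, h⟩ else 0) else 0 := fun v => by
    by_cases h : P v <;> simp [h]
  rw [Finset.sum_congr rfl fun v _ => h1 v, ← Finset.sum_filter,
    Finset.sum_subtype (Finset.univ.filter P) (p := P) (by simp)]
  refine Finset.sum_congr rfl fun v _ => ?_
  rw [dif_pos v.2]

variable {Γ : Type v} [CommGroup Γ] {G : Type w} [Group G] [Fintype G] {X : FinGraph.{u}}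
  {p : ℕ} [hp : Fact p.Prime] [TopologicalSpace Γ]
  (ε : Γ ≃ₜ* Multiplicative ℤ_[p]) (A : Voltage X (Γ × G))

theorem restrict_I_eq_bot (ε : Γ ≃ₜ* Multiplicative ℤ_[p])
    {w : (A.map (MonoidHom.snd Γ G)).derived.V} :
    A.restrict.I w = ⊥ ↔ (A.map (MonoidHom.fst Γ G)).I w.1 = ⊥ :=
  comap_inl_eq_bot_iff ε

theorem sum_index_restrict (A : Voltage X (Γ × G)) :
    ∑ w, (A.restrict.I w).index = ∑ x, (A.I x).index := by
  rw [sum_derived_V]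
  refine Finset.sum_congr rfl fun x _ => ?_
  change ∑ _q, ((A.I x).comap (MonoidHom.inl Γ G)).index = _
  rw [Finset.sum_const, index_eq_mul, Finset.card_univ, ← Nat.card_eq_fintype_card, smul_eq_mul]
  rfl

theorem retraction_of_bot {x : X.V} (hx : (A.map (MonoidHom.fst Γ G)).I x = ⊥) (g : G) :
    retraction (A.I x) g = 1 := by
  refine retraction_eq_one _ (fun i hi => ?_) g
  rw [← Subgroup.mem_bot, ← hx]
  exact ⟨i, hi, rfl⟩

theorem restrict_α_of_bot {e : X.E} (hs : (A.map (MonoidHom.fst Γ G)).I (X.s e) = ⊥)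
    (ht : (A.map (MonoidHom.fst Γ G)).I (X.t e) = ⊥) (g : G) :
    A.restrict.α (g, e) = (A.α e).1 := by
  change (retraction (A.I (X.s e)) g)⁻¹ * (A.α e).1 * retraction (A.I (X.t e)) _ = _
  rw [retraction_of_bot A hs, retraction_of_bot A ht, inv_one, one_mul, mul_one]

/-- The rows of the twisted Laplacian of the restriction, as sums over the edges of `X`. -/
theorem restrict_lapMatrix_mulVec {S : Type*} [CommRing S] (θ : Γ →* S)
    (f : (A.map (MonoidHom.snd Γ G)).derived.V → S) (x : X.V) (g : G) :
    (A.restrict.lapMatrix θ).mulVec f (A.gvert x g) =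
      ∑ j : (A.map (MonoidHom.snd Γ G)).I x, ∑ e, if X.s e = x then f (A.gvert x g) -
        θ (A.restrict.α (g * j, e)) * f (A.gvert (X.t e) (g * j * (A.α e).2)) else 0 := by
  rw [lapMatrix_mulVec]
  exact sum_star (A.map (MonoidHom.snd Γ G)) (fun e => f (A.gvert x g) - θ (A.restrict.α e) *
    f ((A.map (MonoidHom.snd Γ G)).derived.t e)) x g

theorem charDet_eq {X : FinGraph.{u}} {H : Type v} [Group H] (A : Voltage X H) {S : Type*}
    [CommRing S] (θ : H →* S) [Fintype {x // A.I x = ⊥}] [DecidableEq {x // A.I x = ⊥}] :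
    A.charDet θ = ((A.lapMatrix θ).submatrix (Subtype.val : {x // A.I x = ⊥} → X.V)
      Subtype.val).det := by
  unfold charDet
  congr!

/-- If some vertex has a finite nontrivial subgroup, then the determinant vanishes modulo `p`. -/
theorem charDet_restrict_eq_zero (ε : Γ ≃ₜ* Multiplicative ℤ_[p]) (hG : IsPGroup p G)
    {S : Type*} [CommRing S] [IsDomain S]
    [CharP S p] (θ : Γ →* S) {x₀ : X.V} (h₀ : (A.map (MonoidHom.fst Γ G)).I x₀ = ⊥)
    (h₁ : A.I x₀ ≠ ⊥) : A.restrict.charDet θ = 0 := by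
  set A₁ := A.map (MonoidHom.fst Γ G) with hA₁
  set A₂ := A.map (MonoidHom.snd Γ G) with hA₂
  let c : {w // A.restrict.I w = ⊥} → {x // A₁.I x = ⊥} :=
    fun w => ⟨w.1.1, (restrict_I_eq_bot A ε).1 w.2⟩
  have hc : Function.Surjective c := fun x =>
    ⟨⟨A.gvert x.1 1, (restrict_I_eq_bot A ε).2 x.2⟩, rfl⟩
  let D' : Matrix {x // A₁.I x = ⊥} {x // A₁.I x = ⊥} S :=
    Matrix.of fun x y => (Nat.card (A₂.I x.1) : S) * A₁.lapMatrix θ x.1 y.1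
  have key : (∀ f, ((A.restrict.lapMatrix θ).submatrix
      (Subtype.val : {w // A.restrict.I w = ⊥} → _) Subtype.val).mulVec (f ∘ c) =
      D'.mulVec f ∘ c) → (∀ y, D' ⟨x₀, h₀⟩ y = 0) → A.restrict.charDet θ = 0 := by
    intro h h'
    have h2 := det_eq_zero_of_comp c hc _ D' h ⟨x₀, h₀⟩ h'
    rw [charDet_eq]
    convert h2
  refine key ?_ ?_
  · intro f
    funext w
    obtain ⟨w, hw⟩ := w
    have hx : A₁.I w.1 = ⊥ := (restrict_I_eq_bot A ε).1 hw
    obtain ⟨x, g, rfl⟩ : ∃ x g, w = A.gvert x g := ⟨_, _, eq_gvert_out w⟩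
    have hx : A₁.I x = ⊥ := hx
    let f₁ : X.V → S := fun v => if h : A₁.I v = ⊥ then f ⟨v, h⟩ else 0
    have hf₁ : ∀ v k, (if h : A.restrict.I (A.gvert v k) = ⊥ then (f ∘ c) ⟨A.gvert v k, h⟩
        else 0) = f₁ v := by
      intro v k
      by_cases h : A₁.I v = ⊥
      · simp only [f₁, dif_pos h, dif_pos ((restrict_I_eq_bot (w := A.gvert v k) A ε).2 h)]
        rfl
      · simp only [f₁, dif_neg h, dif_neg (mt (restrict_I_eq_bot (w := A.gvert v k) A ε).1 h)]
    have h2 : D'.mulVec f ⟨x, hx⟩ = (Nat.card (A₂.I x) : S) * (A₁.lapMatrix θ).mulVec f₁ x := by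
      rw [← submatrix_mulVec (fun v => A₁.I v = ⊥) (A₁.lapMatrix θ) f ⟨x, hx⟩]
      simp only [D', Matrix.mulVec, dotProduct, Matrix.of_apply, Matrix.submatrix_apply,
        Finset.mul_sum, mul_assoc]
    change _ = D'.mulVec f ⟨x, hx⟩
    rw [h2, submatrix_mulVec (fun w => A.restrict.I w = ⊥), restrict_lapMatrix_mulVec,
      lapMatrix_mulVec]
    have h3 : ∀ j : A₂.I x, (∑ e, if X.s e = x then f₁ x - θ (A₁.α e) * f₁ (X.t e) else 0) =
        ∑ e, if X.s e = x then (if h : A.restrict.I (A.gvert x g) = ⊥ then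
          (f ∘ c) ⟨A.gvert x g, h⟩ else 0) - θ (A.restrict.α (g * j, e)) *
          (if h : A.restrict.I (A.gvert (X.t e) (g * j * (A.α e).2)) = ⊥ then
          (f ∘ c) ⟨A.gvert (X.t e) (g * j * (A.α e).2), h⟩ else 0) else 0 := by
      intro j
      refine Finset.sum_congr rfl fun e _ => ?_
      by_cases he : X.s e = x
      · rw [if_pos he, if_pos he, hf₁, hf₁]
        by_cases ht : A₁.I (X.t e) = ⊥
        · rw [restrict_α_of_bot A (by rw [he]; exact hx) ht]
          rfl
        · simp [f₁, dif_neg ht]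
      · rw [if_neg he, if_neg he]
    rw [Finset.sum_congr rfl fun j _ => (h3 j).symm, Finset.sum_const, Finset.card_univ,
      ← Nat.card_eq_fintype_card, nsmul_eq_mul]
  -- The row of `x₀` vanishes since `p` divides the order of the inertia group's image in `G`.
  · intro y
    have h2 : A₂.I x₀ ≠ ⊥ := by
      intro h2
      apply h₁
      rw [eq_bot_iff]
      intro i hi
      have h3 : i.1 ∈ A₁.I x₀ := ⟨i, hi, rfl⟩
      have h4 : i.2 ∈ A₂.I x₀ := ⟨i, hi, rfl⟩
      rw [h₀] at h3
      rw [h2] at h4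
      exact Prod.ext h3 h4
    have h3 : p ∣ Nat.card (A₂.I x₀) := by
      obtain ⟨k, hk⟩ := (hG.to_subgroup (A₂.I x₀)).exists_card_eq
      rw [hk]
      refine dvd_pow_self _ fun hk0 => h2 ?_
      rw [← Subgroup.card_eq_one, hk, hk0, pow_zero]
    have h4 : (Nat.card (A₂.I x₀) : S) = 0 := (CharP.cast_eq_zero_iff S p _).2 h3
    simp only [D', Matrix.of_apply, h4, zero_mul]

/-- If no vertex has a finite nontrivial subgroup, then the determinant for the restriction to
`Γ` is, modulo `p`, a power of the one for the projection to `Γ`. -/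
theorem charDet_restrict_eq_pow (ε : Γ ≃ₜ* Multiplicative ℤ_[p]) (hG : IsPGroup p G)
    {S : Type*} [CommRing S] [Algebra (ZMod p) S] (θ : Γ →* S)
    (h₀ : ∀ x, (A.map (MonoidHom.fst Γ G)).I x = ⊥ → A.I x = ⊥) :
    A.restrict.charDet θ = (A.map (MonoidHom.fst Γ G)).charDet θ ^ Fintype.card G := by
  set A₁ := A.map (MonoidHom.fst Γ G) with hA₁
  set A₂ := A.map (MonoidHom.snd Γ G) with hA₂
  have hbot : ∀ {x}, A₁.I x = ⊥ → A₂.I x = ⊥ := fun {x} hx => by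
    change (A.I x).map _ = ⊥
    rw [h₀ x hx, Subgroup.map_bot]
  let M : G → Matrix {x // A₁.I x = ⊥} {x // A₁.I x = ⊥} S := fun c =>
    Matrix.of fun x y => ∑ e, if X.s e = x.1 then (if x = y ∧ c = 1 then 1 else 0) -
      (if X.t e = y.1 ∧ (A.α e).2 = c then θ (A.α e).1 else 0) else 0
  let φ : {x // A₁.I x = ⊥} × G ≃ {w // A.restrict.I w = ⊥} := by
    refine Equiv.ofBijective
      (fun a => ⟨A.gvert a.1.1 a.2, (restrict_I_eq_bot A ε).2 a.1.2⟩) ⟨?_, ?_⟩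
    · rintro ⟨⟨x, hx⟩, g⟩ ⟨⟨y, hy⟩, h⟩ hh
      obtain ⟨hxy, hgh⟩ := gvert_eq_iff.1 (congrArg Subtype.val hh)
      have hxy : x = y := hxy
      subst hxy
      have hgh : g⁻¹ * h ∈ A₂.I x := hgh
      rw [hbot hx, Subgroup.mem_bot, inv_mul_eq_one] at hgh
      have hgh : g = h := hgh
      rw [hgh]
    · rintro ⟨w, hw⟩
      exact ⟨(⟨w.1, (restrict_I_eq_bot A ε).1 hw⟩, w.2.out), Subtype.ext (eq_gvert_out w).symm⟩
  have h1 := det_regular_eq_pow hG M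
  have h2 : ∑ c, M c = (A₁.lapMatrix θ).submatrix Subtype.val Subtype.val := by
    ext x y
    rw [Matrix.sum_apply]
    simp only [M, Matrix.of_apply, Matrix.submatrix_apply, lapMatrix]
    rw [Finset.sum_comm]
    refine Finset.sum_congr rfl fun e _ => ?_
    by_cases he : X.s e = x.1
    · simp only [if_pos he, Finset.sum_sub_distrib, ite_and, Subtype.ext_iff]
      congr 1
      · by_cases hxy : x.1 = y.1 <;> simp [hxy]
      · by_cases hxy : X.t e = y.1
        · simp [hxy]
          rfl
        · simp [hxy]
    · simp [he]
  have h3 : (A.restrict.charDet θ) = Matrix.det (Matrix.submatrix ((A.restrict.lapMatrix θ).submatrix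
      (Subtype.val : {w // A.restrict.I w = ⊥} → _) Subtype.val) φ φ) := by
    rw [Matrix.det_submatrix_equiv_self, charDet_eq]
  have h4 : A₁.charDet θ = (∑ c, M c).det := by
    rw [h2, charDet_eq]
  rw [h3, h4]
  -- Since the inertia groups of the vertices at hand are trivial, the matrix is the one of `M` in
  -- the regular representation.
  refine Eq.trans (b := (Matrix.of fun a b : {x // A₁.I x = ⊥} × G =>
    M (a.2⁻¹ * b.2) a.1 b.1).det) ?_ (by convert h1)
  congr 1
  ext a b
  obtain ⟨⟨x, hx⟩, g⟩ := a
  obtain ⟨⟨y, hy⟩, h⟩ := b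
  change A.restrict.lapMatrix θ (A.gvert x g) (A.gvert y h) = _
  have hsub : Subsingleton (A₂.I x) := by
    rw [hbot hx]
    infer_instance
  have h5 : A.restrict.lapMatrix θ (A.gvert x g) (A.gvert y h) =
      ∑ j : A₂.I x, ∑ e, if X.s e = x then (if A.gvert x g = A.gvert y h then 1 else 0) -
        (if A.gvert (X.t e) (g * j * (A.α e).2) = A.gvert y h then
          θ (A.restrict.α (g * j, e)) else 0) else 0 :=
    sum_star A₂ (fun e => (if A.gvert x g = A.gvert y h then 1 else 0) -
      (if A₂.derived.t e = A.gvert y h then θ (A.restrict.α e) else 0)) x g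
  have hy2 : A₂.I y = ⊥ := hbot hy
  have hg : ∀ z k, A.gvert z k = A.gvert y h ↔ z = y ∧ k = h := fun z k => by
    rw [gvert_eq_iff]
    refine and_congr_right fun _ => ?_
    change _ ∈ A₂.I y ↔ _
    rw [hy2, Subgroup.mem_bot, inv_mul_eq_one]
  rw [h5, Fintype.sum_subsingleton _ (1 : A₂.I x)]
  simp only [M, Matrix.of_apply, hg, Subgroup.coe_one, mul_one]
  refine Finset.sum_congr rfl fun e _ => ?_
  by_cases he : X.s e = x
  · rw [if_pos he, if_pos he]
    congr 1
    · simp only [Subtype.mk.injEq, inv_mul_eq_one]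
    · by_cases ht : X.t e = y
      · rw [restrict_α_of_bot A (by rw [he]; exact hx) (by rw [ht]; exact hy)]
        simp only [ht, true_and, eq_inv_mul_iff_mul_eq]
      · simp only [ht, false_and, if_false]
  · rw [if_neg he, if_neg he]

end Voltage

end KidaGraph

namespace KidaGraph

universe u v w u' v'

open scoped Classical

set_option linter.unusedSectionVars false

/-! ### From coverings to voltage assignments -/

/-- A Galois covering, with suitable base points above the vertices and the edges, is a
derived graph. -/
theorem GaloisCovering.exists_equiv {K : Type w} [Group K] {Y : FinGraph.{u'}} {X : FinGraph.{u}}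
    (C : GaloisCovering K Y X) {H : Type v} [Group H] [Finite H] (B : Voltage X H) (σ : H →* K)
    (hσ : Function.Bijective σ) (bv : X.V → Y.V) (be : X.E → Y.E) (hbv : ∀ x, C.onV (bv x) = x)
    (hbe : ∀ e, C.onE (be e) = e) (hs : ∀ e, Y.s (be e) = bv (X.s e))
    (ht : ∀ e, Y.t (be e) = C.actV (σ (B.α e)) (bv (X.t e)))
    (hI : ∀ x h, C.actV (σ h) (bv x) = bv x ↔ h ∈ B.I x) :
    ∃ (a : B.derived.V ≃ Y.V) (b : B.derived.E ≃ Y.E),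
      (∀ e, a (B.derived.s e) = Y.s (b e)) ∧ (∀ e, a (B.derived.t e) = Y.t (b e)) ∧
      ∀ w, C.onV (a w) = w.1 := by
  have hinv : ∀ k y z, C.actV k y = z ↔ y = C.actV k⁻¹ z := by
    intro k y z
    constructor
    · rintro rfl
      rw [← C.mul_actV, inv_mul_cancel, C.one_actV]
    · rintro rfl
      rw [← C.mul_actV, mul_inv_cancel, C.one_actV]
  let F : B.derived.V → Y.V := fun w => C.actV (σ w.2.out) (bv w.1)
  have hF : ∀ x h, F (B.vert x h) = C.actV (σ h) (bv x) := by
    intro x h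
    obtain ⟨i, hi⟩ : ∃ i : B.I x, (h : H ⧸ B.I x).out = h * i := QuotientGroup.mk_out_eq_mul _ _
    change C.actV (σ (h : H ⧸ B.I x).out) (bv x) = _
    rw [hi, map_mul, C.mul_actV, (hI x i).2 i.2]
  have hFb : Function.Bijective F := by
    constructor
    · intro w w' h
      obtain ⟨x, k, rfl⟩ := B.exists_vert w
      obtain ⟨x', k', rfl⟩ := B.exists_vert w'
      rw [hF, hF] at h
      have hx : x = x' := by
        have := congrArg C.onV h
        rwa [C.onV_act, C.onV_act, hbv, hbv] at this
      subst hx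
      rw [Voltage.vert_eq_iff]
      refine ⟨rfl, ?_⟩
      rw [← hI, map_mul, C.mul_actV, ← h, map_inv, ← C.mul_actV, inv_mul_cancel, C.one_actV]
    · intro y
      obtain ⟨k, hk⟩ := C.transV (bv (C.onV y)) y (hbv _)
      obtain ⟨h, rfl⟩ := hσ.2 k
      exact ⟨B.vert _ h, (hF _ _).trans hk⟩
  let E : B.derived.E → Y.E := fun e => C.actE (σ e.1) (be e.2)
  have hEb : Function.Bijective E := by
    constructor
    · rintro ⟨h, e⟩ ⟨h', e'⟩ hh
      have hh : C.actE (σ h) (be e) = C.actE (σ h') (be e') := hh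
      have he : e = e' := by
        have := congrArg C.onE hh
        rwa [C.onE_act, C.onE_act, hbe, hbe] at this
      subst he
      have h1 : σ (h'⁻¹ * h) = 1 := by
        refine C.freeE _ (be e) ?_
        rw [map_mul, C.mul_actE, hh, ← C.mul_actE, ← map_mul, inv_mul_cancel, map_one, C.one_actE]
      have h2 : h'⁻¹ * h = 1 := hσ.1 (h1.trans (map_one σ).symm)
      rw [inv_mul_eq_one] at h2
      rw [h2]
    · intro y
      obtain ⟨k, hk⟩ := C.transE (be (C.onE y)) y (hbe _)
      obtain ⟨h, rfl⟩ := hσ.2 k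
      exact ⟨(h, _), hk⟩
  refine ⟨Equiv.ofBijective F hFb, Equiv.ofBijective E hEb, ?_, ?_, ?_⟩
  · rintro ⟨h, e⟩
    change F (B.vert (X.s e) h) = Y.s (C.actE (σ h) (be e))
    rw [hF, C.act_s, hs]
  · rintro ⟨h, e⟩
    change F (B.vert (X.t e) (h * B.α e)) = Y.t (C.actE (σ h) (be e))
    rw [hF, C.act_t, ht, map_mul, C.mul_actV]
  · intro w
    change C.onV (C.actV _ _) = _
    rw [C.onV_act, hbv]

namespace ProfiniteCovering

variable {Δ : Type w} [Group Δ] [TopologicalSpace Δ] [IsTopologicalGroup Δ] [CompactSpace Δ]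
  {X : FinGraph.{u}} (T : ProfiniteCovering.{u'} Δ X) (U : ℕ → OpenNormalSubgroup Δ)

theorem trans_surjective_onV {V W : OpenNormalSubgroup Δ} (h : V ≤ W) (a : (T.layer W).V) :
    ∃ b, (T.trans h).onV b = a := by
  obtain ⟨b, hb⟩ := (T.cov V).surjV ((T.cov W).onV a)
  obtain ⟨g, hg⟩ := (T.cov W).transV ((T.trans h).onV b) a (by rw [T.over_onV, hb])
  induction g using QuotientGroup.induction_on with
  | H g => exact ⟨_, (T.trans_act_onV h g b).trans hg⟩

theorem trans_surjective_onE {V W : OpenNormalSubgroup Δ} (h : V ≤ W) (a : (T.layer W).E) :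
    ∃ b, (T.trans h).onE b = a := by
  obtain ⟨b, hb⟩ := (T.cov V).surjE ((T.cov W).onE a)
  obtain ⟨g, hg⟩ := (T.cov W).transE ((T.trans h).onE b) a (by rw [T.over_onE, hb])
  induction g using QuotientGroup.induction_on with
  | H g => exact ⟨_, (T.trans_act_onE h g b).trans hg⟩

/-- There are compatible systems of base points above the vertices and the edges. -/
theorem exists_base (hU : ∀ n, U (n + 1) ≤ U n) :
    ∃ (bv : ∀ n, X.V → (T.layer (U n)).V) (be : ∀ n, X.E → (T.layer (U n)).E),
    (∀ n x, (T.cov (U n)).onV (bv n x) = x) ∧ (∀ n e, (T.cov (U n)).onE (be n e) = e) ∧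
    (∀ n e, (T.layer (U n)).s (be n e) = bv n (X.s e)) ∧
    (∀ n x, (T.trans (hU n)).onV (bv (n + 1) x) = bv n x) ∧
    ∀ n e, (T.trans (hU n)).onE (be (n + 1) e) = be n e := by
  have hsurj : ∀ n x, ∃ b, (T.cov (U n)).onV b = x := fun n x => (T.cov (U n)).surjV x
  let bv : ∀ n, X.V → (T.layer (U n)).V := fun n =>
    Nat.rec (motive := fun n => X.V → (T.layer (U n)).V)
    (fun x => (hsurj 0 x).choose)
    (fun n r x => (T.trans_surjective_onV (hU n) (r x)).choose) n
  have hbv : ∀ n x, (T.trans (hU n)).onV (bv (n + 1) x) = bv n x := fun n x =>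
    (T.trans_surjective_onV (hU n) (bv n x)).choose_spec
  have hbv0 : ∀ n x, (T.cov (U n)).onV (bv n x) = x := by
    intro n x
    induction n with
    | zero => exact (hsurj 0 x).choose_spec
    | succ n ih => rw [← T.over_onV (hU n), hbv, ih]
  have h0 : ∀ e, ∃ b, (T.cov (U 0)).onE b = e ∧ (T.layer (U 0)).s b = bv 0 (X.s e) := by
    intro e
    obtain ⟨b, hb⟩ := (T.cov (U 0)).surjE e
    obtain ⟨g, hg⟩ := (T.cov (U 0)).transV ((T.layer (U 0)).s b) (bv 0 (X.s e)) (by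
      rw [hbv0, (T.cov (U 0)).map_s, hb])
    exact ⟨(T.cov (U 0)).actE g b, by rw [(T.cov (U 0)).onE_act, hb],
      by rw [(T.cov (U 0)).act_s, hg]⟩
  have hstep : ∀ n e (a : (T.layer (U n)).E), (T.layer (U n)).s a = bv n (X.s e) →
      ∃ b, (T.trans (hU n)).onE b = a ∧ (T.layer (U (n + 1))).s b = bv (n + 1) (X.s e) := by
    intro n e a ha
    obtain ⟨b, hb⟩ := T.trans_surjective_onE (hU n) a
    obtain ⟨g, hg, h⟩ := T.fiber_trans (hU n) ((T.layer (U (n + 1))).s b) (bv (n + 1) (X.s e)) (by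
      rw [hbv, (T.trans (hU n)).map_s, hb, ha])
    refine ⟨(T.cov (U (n + 1))).actE g b, ?_, by rw [(T.cov (U (n + 1))).act_s, h]⟩
    rw [T.trans_act_onE, (QuotientGroup.eq_one_iff g).2 hg, (T.cov (U n)).one_actE, hb]
  let be : ∀ n, ∀ e : X.E, {b : (T.layer (U n)).E // (T.layer (U n)).s b = bv n (X.s e)} :=
    fun n => Nat.rec (motive := fun n => ∀ e : X.E,
        {b : (T.layer (U n)).E // (T.layer (U n)).s b = bv n (X.s e)})
      (fun e => ⟨(h0 e).choose, (h0 e).choose_spec.2⟩)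
      (fun n r e => ⟨(hstep n e (r e).1 (r e).2).choose, (hstep n e (r e).1 (r e).2).choose_spec.2⟩) n
  have hbe : ∀ n e, (T.trans (hU n)).onE (be (n + 1) e).1 = (be n e).1 := fun n e =>
    (hstep n e (be n e).1 (be n e).2).choose_spec.1
  refine ⟨bv, fun n e => (be n e).1, hbv0, ?_, fun n e => (be n e).2, hbv, hbe⟩
  intro n e
  induction n with
  | zero => exact (h0 e).choose_spec.1
  | succ n ih => rw [← T.over_onE (hU n), hbe, ih]

/-- A nested sequence of nonempty unions of cosets of open subgroups has a common point. -/
theorem exists_mem_of_nested (S : ℕ → Set Δ) (hS : ∀ n, S (n + 1) ⊆ S n) (hne : ∀ n, (S n).Nonempty)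
    (hopen : ∀ n d u, d ∈ S n → u ∈ (U n).toSubgroup → d * u ∈ S n) : ∃ d, ∀ n, d ∈ S n := by
  have hcl : ∀ n, IsClosed (S n) := by
    intro n
    rw [← isOpen_compl_iff, isOpen_iff_mem_nhds]
    intro d hd
    have h1 : (fun x : Δ => d⁻¹ * x) ⁻¹' ((U n).toSubgroup : Set Δ) ∈ nhds d := by
      refine ((U n).isOpen'.preimage (by fun_prop)).mem_nhds ?_
      change d⁻¹ * d ∈ (U n).toSubgroup
      rw [inv_mul_cancel]
      exact one_mem _
    refine Filter.mem_of_superset h1 fun x hx hxS => hd ?_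
    have hx : d⁻¹ * x ∈ (U n).toSubgroup := hx
    have := hopen n x (d⁻¹ * x)⁻¹ hxS (inv_mem hx)
    rwa [mul_inv_rev, inv_inv, mul_inv_cancel_left] at this
  obtain ⟨d, hd⟩ := IsCompact.nonempty_iInter_of_sequence_nonempty_isCompact_isClosed S hS hne
    (hcl 0).isCompact hcl
  exact ⟨d, fun n => Set.mem_iInter.1 hd n⟩

/-- A profinite covering comes from a voltage assignment, with the stabilizers of base points as
subgroups. -/
theorem exists_voltage (hU : ∀ n, U (n + 1) ≤ U n)
    (hbot : ∀ d, (∀ n, d ∈ (U n).toSubgroup) → d = 1) :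
    ∃ (A : Voltage X Δ) (bv : ∀ n, X.V → (T.layer (U n)).V) (be : ∀ n, X.E → (T.layer (U n)).E),
      (∀ x, IsClosed (A.I x : Set Δ)) ∧
      (∀ n x, (T.cov (U n)).onV (bv n x) = x) ∧ (∀ n e, (T.cov (U n)).onE (be n e) = e) ∧
      (∀ n e, (T.layer (U n)).s (be n e) = bv n (X.s e)) ∧
      (∀ n e, (T.layer (U n)).t (be n e) = (T.cov (U n)).actV (A.α e) (bv n (X.t e))) ∧
      (∀ x (d : Δ), d ∈ A.I x ↔ ∀ n, (T.cov (U n)).actV d (bv n x) = bv n x) ∧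
      ∀ n x (d : Δ), (T.cov (U n)).actV d (bv n x) = bv n x →
        ∃ i ∈ A.I x, i⁻¹ * d ∈ (U n).toSubgroup := by
  obtain ⟨bv, be, hbv, hbe, hs, htv, hte⟩ := T.exists_base U hU
  have hnest : ∀ n, ∀ u ∈ (U (n + 1)).toSubgroup, u ∈ (U n).toSubgroup := fun n u hu => hU n hu
  -- On every layer some group element maps the base point above the opposite edge to the opposite
  -- of the base point; by compactness one element does so on all layers.
  have hα : ∀ e, ∃ d : Δ, ∀ n, (T.cov (U n)).actE d (be n (X.bar e)) =
      (T.layer (U n)).bar (be n e) := by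
    intro e
    refine exists_mem_of_nested U
      (fun n => {d | (T.cov (U n)).actE d (be n (X.bar e)) = (T.layer (U n)).bar (be n e)}) ?_ ?_ ?_
    · intro n d hd
      have hd : (T.cov (U (n + 1))).actE d (be (n + 1) (X.bar e)) =
        (T.layer (U (n + 1))).bar (be (n + 1) e) := hd
      change (T.cov (U n)).actE d (be n (X.bar e)) = (T.layer (U n)).bar (be n e)
      rw [← hte, ← T.trans_act_onE, hd, (T.trans (hU n)).map_bar, hte]
    · intro n
      obtain ⟨g, hg⟩ := (T.cov (U n)).transE (be n (X.bar e)) ((T.layer (U n)).bar (be n e)) (by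
        rw [hbe, (T.cov (U n)).map_bar, hbe])
      induction g using QuotientGroup.induction_on with
      | H g => exact ⟨g, hg⟩
    · intro n d u hd hu
      have h1 : ((d * u : Δ) : Δ ⧸ (U n).toSubgroup) = (d : Δ ⧸ (U n).toSubgroup) :=
        QuotientGroup.mk_mul_of_mem _ hu
      change (T.cov (U n)).actE ((d * u : Δ) : Δ ⧸ (U n).toSubgroup) _ = _
      rw [h1]
      exact hd
  choose α hα using hα
  let stab : X.V → Subgroup Δ := fun x =>
    { carrier := {d | ∀ n, (T.cov (U n)).actV d (bv n x) = bv n x}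
      one_mem' := fun n => (T.cov (U n)).one_actV _
      mul_mem' := fun {a b} ha hb n => by
        rw [QuotientGroup.mk_mul, (T.cov (U n)).mul_actV, hb n, ha n]
      inv_mem' := fun {a} ha n => by
        conv_lhs => rw [← ha n]
        rw [← (T.cov (U n)).mul_actV, QuotientGroup.mk_inv, inv_mul_cancel, (T.cov (U n)).one_actV] }
  let A : Voltage X Δ :=
    { α := α
      α_bar := fun e => by
        rw [← mul_eq_one_iff_eq_inv]
        refine hbot _ fun n => (QuotientGroup.eq_one_iff _).1 ((T.cov (U n)).freeE _
          (be n (X.bar e)) ?_)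
        have h2 := hα (X.bar e) n
        rw [X.bar_bar] at h2
        rw [QuotientGroup.mk_mul, (T.cov (U n)).mul_actE, hα, ← (T.cov (U n)).act_bar, h2,
          (T.layer (U n)).bar_bar]
      I := stab }
  -- An element which stabilizes a base point on one layer lifts to a stabilizer on each higher
  -- layer, hence, by compactness, on all of them.
  have hlift : ∀ n x (d : Δ), (T.cov (U n)).actV d (bv n x) = bv n x →
      ∃ i ∈ A.I x, i⁻¹ * d ∈ (U n).toSubgroup := by
    intro n x d hd
    have hle : ∀ m, U (n + m) ≤ U n := by
      intro m
      induction m with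
      | zero => exact le_rfl
      | succ m ih => exact (hU (n + m)).trans ih
    have htm : ∀ m, (T.trans (hle m)).onV (bv (n + m) x) = bv n x := by
      intro m
      induction m with
      | zero => exact T.trans_refl_onV _ _
      | succ m ih =>
        refine (T.trans_trans_onV (hU (n + m)) (hle m) (bv (n + m + 1) x)).symm.trans ?_
        rw [htv, ih]
    have hex : ∃ i, ∀ m, i ∈ {i : Δ | (T.cov (U (n + m))).actV i (bv (n + m) x) = bv (n + m) x ∧
        i⁻¹ * d ∈ (U n).toSubgroup} := by
      refine exists_mem_of_nested (fun m => U (n + m)) (fun m => {i : Δ |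
        (T.cov (U (n + m))).actV i (bv (n + m) x) = bv (n + m) x ∧
          i⁻¹ * d ∈ (U n).toSubgroup}) ?_ ?_ ?_
      · rintro m i ⟨hi, hi'⟩
        refine ⟨?_, hi'⟩
        have h := congrArg (T.trans (hU (n + m))).onV hi
        change (T.trans (hU (n + m))).onV ((T.cov (U (n + m + 1))).actV i (bv (n + m + 1) x)) =
          (T.trans (hU (n + m))).onV (bv (n + m + 1) x) at h
        rwa [T.trans_act_onV, htv] at h
      · intro m
        obtain ⟨g, hg, h⟩ := T.fiber_trans (hle m) ((T.cov (U (n + m))).actV d (bv (n + m) x))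
          (bv (n + m) x) (by rw [T.trans_act_onV, htm, hd])
        refine ⟨g * d, ?_, ?_⟩
        · rw [QuotientGroup.mk_mul, (T.cov (U (n + m))).mul_actV, h]
        · rw [mul_inv_rev]
          have := (U n).isNormal'.conj_mem g⁻¹ (inv_mem hg) d⁻¹
          rwa [inv_inv] at this
      · rintro m i u ⟨hi, hi'⟩ hu
        constructor
        · have h1 : ((i * u : Δ) : Δ ⧸ (U (n + m)).toSubgroup) = (i : Δ ⧸ (U (n + m)).toSubgroup) :=
            QuotientGroup.mk_mul_of_mem _ hu
          rw [h1]
          exact hi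
        · rw [mul_inv_rev, mul_assoc]
          exact mul_mem (inv_mem (hle m hu)) hi'
    obtain ⟨i, hi⟩ := hex
    refine ⟨i, fun m => ?_, (hi 0).2⟩
    have h1 := (hi m).1
    have hm : ∀ k, (T.cov (U (m + k))).actV i (bv (m + k) x) = bv (m + k) x →
        (T.cov (U m)).actV i (bv m x) = bv m x := by
      intro k
      induction k with
      | zero => exact id
      | succ k ih =>
        intro h
        refine ih ?_
        have h := congrArg (T.trans (hU (m + k))).onV h
        change (T.trans (hU (m + k))).onV ((T.cov (U (m + k + 1))).actV i (bv (m + k + 1) x)) =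
          (T.trans (hU (m + k))).onV (bv (m + k + 1) x) at h
        rwa [T.trans_act_onV, htv] at h
    refine hm n ?_
    rw [add_comm]
    exact h1
  refine ⟨A, bv, be, ?_, hbv, hbe, hs, ?_, fun x d => Iff.rfl, hlift⟩
  · intro x
    have h1 : (A.I x : Set Δ) = ⋂ n, {d : Δ | (T.cov (U n)).actV d (bv n x) = bv n x} := by
      ext d
      simp only [Set.mem_iInter]
      rfl
    rw [h1]
    refine isClosed_iInter fun n => ?_
    have : DiscreteTopology (Δ ⧸ (U n).toSubgroup) := QuotientGroup.discreteTopology (U n).isOpen'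
    exact (isClosed_discrete {q : Δ ⧸ (U n).toSubgroup | (T.cov (U n)).actV q (bv n x) = bv n x}).preimage
      continuous_quotient_mk'
  · intro n e
    change _ = (T.cov (U n)).actV (α e) (bv n (X.t e))
    rw [← X.s_bar, ← hs, ← (T.cov (U n)).act_s, hα, (T.layer (U n)).s_bar]

end ProfiniteCovering

end KidaGraph

namespace KidaGraph

universe u v w u' v'

open scoped Classical

set_option linter.unusedSectionVars false

/-! ### Layers and ramification of a covering with group `Γ × G` -/

section FiberCard

variable {H : Type v} [Group H] [Finite H] {X : FinGraph.{u}} (B : Voltage X H)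

theorem Voltage.card_fiber (x : X.V) :
    Nat.card {w : B.derived.V // w.1 = x} = (B.I x).index :=
  Nat.card_congr (Equiv.sigmaSubtype (β := fun x => H ⧸ B.I x) x)

end FiberCard

/-- The order of a stabilizer does not depend on the point of the orbit. -/
theorem GaloisCovering.ramIndex_act {K : Type w} [Group K] {Y : FinGraph.{u'}} {X : FinGraph.{u}}
    (C : GaloisCovering K Y X) (k : K) (a : Y.V) : C.ramIndex (C.actV k a) = C.ramIndex a := by
  refine Nat.card_congr ((MulAut.conj k⁻¹).toEquiv.subtypeEquiv fun g => ?_)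
  change C.actV g (C.actV k a) = C.actV k a ↔ C.actV (k⁻¹ * g * k⁻¹⁻¹) a = a
  rw [inv_inv, C.mul_actV, C.mul_actV]
  constructor
  · intro h
    rw [h, ← C.mul_actV, inv_mul_cancel, C.one_actV]
  · intro h
    have := congrArg (C.actV k) h
    rwa [← C.mul_actV, mul_inv_cancel, C.one_actV] at this

namespace ProfiniteCovering

variable {p : ℕ} [hp : Fact p.Prime] {Γ : Type v} [CommGroup Γ] [TopologicalSpace Γ]
  [IsTopologicalGroup Γ] [CompactSpace Γ] (ε : Γ ≃ₜ* Multiplicative ℤ_[p])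
  {G : Type w} [Group G] [Finite G] [TopologicalSpace G] [DiscreteTopology G]
  {X : FinGraph.{u}} (T : ProfiniteCovering.{u'} (Γ × G) X)

theorem eq_one_of_mem_layerSubgroup (d : Γ × G)
    (h : ∀ n, d ∈ (layerSubgroup (G := G) ⟨ε⟩ n ⊥).toSubgroup) : d = 1 := by
  refine Prod.ext ?_ (h 0).2
  apply coord_injective ε
  change coord ε d.1 = coord ε 1
  rw [coord_one]
  by_contra hne
  obtain ⟨n, hn⟩ := exists_not_dvd hne
  exact hn ((mem_powSubgroup ε).1 (h n).1)

/-- The voltage assignment of a covering with group `Γ × G`, the layers as derived graphs, and the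
ramification in terms of the subgroups of the assignment. -/
theorem exists_voltage_layers (hc : ∀ U, (T.layer U).Connected) :
    ∃ A : Voltage X (Γ × G), (∀ x, IsClosed (A.I x : Set (Γ × G))) ∧
      (∀ n, ((A.map (MonoidHom.fst Γ G)).lev ε n).derived.Connected ∧
        ((A.map (MonoidHom.fst Γ G)).lev ε n).derived.kappa = (T.lower ⟨ε⟩ n).kappa) ∧
      (∀ n, (A.quot (layerSubgroup ⟨ε⟩ n ⊥)).derived.Connected ∧
        (A.quot (layerSubgroup ⟨ε⟩ n ⊥)).derived.kappa = (T.upper ⟨ε⟩ n).kappa) ∧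
      (∀ x, (∃ n, 1 < T.ramLower ⟨ε⟩ n x) ↔ (A.I x).map (MonoidHom.fst Γ G) ≠ ⊥) ∧
      (∀ x, T.ramInfty ⟨ε⟩ x = Nat.card ((A.I x).comap (MonoidHom.inr Γ G))) ∧
      ∀ x, (A.I x).index ≠ 0 → T.numInfty ⟨ε⟩ x = ((A.I x).index : ℕ∞) := by
  let U : ℕ → OpenNormalSubgroup (Γ × G) := fun n => layerSubgroup ⟨ε⟩ n ⊥
  let W : ℕ → OpenNormalSubgroup (Γ × G) := fun n => layerSubgroup ⟨ε⟩ n ⊤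
  have hanti : ∀ n, U (n + 1) ≤ U n := fun n d hd =>
    ⟨powSubgroup_anti ε n.le_succ hd.1, hd.2⟩
  have hUW : ∀ n, U n ≤ W n := fun n => layerSubgroup_le ⟨ε⟩ n
  obtain ⟨A, bv, be, hcl, hbv, hbe, hs, ht, hI, hlift⟩ :=
    T.exists_voltage U hanti (eq_one_of_mem_layerSubgroup ε)
  -- the stabilizer of a base point in a layer
  have hstab : ∀ n x (d : Γ × G), (T.cov (U n)).actV d (bv n x) = bv n x ↔
      ∃ i ∈ A.I x, i⁻¹ * d ∈ (U n).toSubgroup := by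
    refine fun n x d => ⟨hlift n x d, ?_⟩
    rintro ⟨i, hi, hd⟩
    have h1 : (d : (Γ × G) ⧸ (U n).toSubgroup) = i := (QuotientGroup.eq.2 hd).symm
    rw [h1]
    exact (hI x i).1 hi n
  -- the upper layers
  have hupper : ∀ n, ∃ (a : (A.quot (U n)).derived.V ≃ (T.layer (U n)).V)
      (b : (A.quot (U n)).derived.E ≃ (T.layer (U n)).E),
      (∀ e, a ((A.quot (U n)).derived.s e) = (T.layer (U n)).s (b e)) ∧
      (∀ e, a ((A.quot (U n)).derived.t e) = (T.layer (U n)).t (b e)) ∧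
      ∀ w, (T.cov (U n)).onV (a w) = w.1 := by
    intro n
    refine (T.cov (U n)).exists_equiv (A.quot (U n)) (MonoidHom.id _) Function.bijective_id
      (bv n) (be n) (hbv n) (hbe n) (hs n) (ht n) fun x h => ?_
    induction h using QuotientGroup.induction_on with
    | H d =>
      refine (hstab n x d).trans ?_
      change _ ↔ _ ∈ (A.I x).map _
      rw [Subgroup.mem_map]
      refine exists_congr fun i => and_congr_right fun _ => ?_
      rw [← QuotientGroup.eq]
      rfl
  -- the lower layers
  let bv' : ∀ n, X.V → (T.layer (W n)).V := fun n x => (T.trans (hUW n)).onV (bv n x)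
  have hstab' : ∀ n x (d : Γ × G), (T.cov (W n)).actV d (bv' n x) = bv' n x ↔
      ∃ i ∈ A.I x, i.1⁻¹ * d.1 ∈ (powSubgroup ε n).toSubgroup := by
    intro n x d
    constructor
    · intro h
      obtain ⟨g, hg, h1⟩ := T.fiber_trans (hUW n) ((T.cov (U n)).actV d (bv n x)) (bv n x) (by
        rw [T.trans_act_onV]
        exact h)
      rw [← (T.cov (U n)).mul_actV, ← QuotientGroup.mk_mul] at h1
      obtain ⟨i, hi, h2⟩ := hlift n x (g * d) h1
      refine ⟨i, hi, ?_⟩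
      have h3 : i.1⁻¹ * (g.1 * d.1) ∈ (powSubgroup ε n).toSubgroup := h2.1
      have h4 : g.1 ∈ (powSubgroup ε n).toSubgroup := hg.1
      rwa [mul_left_comm, Subgroup.mul_mem_cancel_left _ h4] at h3
    · rintro ⟨i, hi, hd⟩
      have h0 : i⁻¹ * d ∈ (W n).toSubgroup := ⟨hd, Subgroup.mem_top _⟩
      have h1 : (d : (Γ × G) ⧸ (W n).toSubgroup) = i := (QuotientGroup.eq.2 h0).symm
      rw [h1]
      change (T.cov (W n)).actV i ((T.trans (hUW n)).onV (bv n x)) = _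
      rw [← T.trans_act_onV, (hI x i).1 hi n]
  have hlower : ∀ n, ∃ (a : ((A.map (MonoidHom.fst Γ G)).lev ε n).derived.V ≃ (T.layer (W n)).V)
      (b : ((A.map (MonoidHom.fst Γ G)).lev ε n).derived.E ≃ (T.layer (W n)).E),
      (∀ e, a (((A.map (MonoidHom.fst Γ G)).lev ε n).derived.s e) = (T.layer (W n)).s (b e)) ∧
      (∀ e, a (((A.map (MonoidHom.fst Γ G)).lev ε n).derived.t e) = (T.layer (W n)).t (b e)) ∧
      ∀ w, (T.cov (W n)).onV (a w) = w.1 := by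
    intro n
    let σ : Γ ⧸ (powSubgroup ε n).toSubgroup →* (Γ × G) ⧸ (W n).toSubgroup :=
      QuotientGroup.map _ _ (MonoidHom.inl Γ G) fun γ hγ => ⟨hγ, Subgroup.mem_top _⟩
    have hσd : ∀ d : Γ × G, σ (d.1 : Γ ⧸ (powSubgroup ε n).toSubgroup) = d := by
      intro d
      refine QuotientGroup.eq.2 ⟨?_, Subgroup.mem_top _⟩
      change d.1⁻¹ * d.1 ∈ (powSubgroup ε n).toSubgroup
      rw [inv_mul_cancel]
      exact one_mem _
    have hσ : Function.Bijective σ := by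
      constructor
      · rw [injective_iff_map_eq_one]
        intro q hq
        induction q using QuotientGroup.induction_on with
        | H γ => exact (QuotientGroup.eq_one_iff γ).2 ((QuotientGroup.eq_one_iff _).1 hq).1
      · intro q
        induction q using QuotientGroup.induction_on with
        | H d => exact ⟨_, hσd d⟩
    refine (T.cov (W n)).exists_equiv ((A.map (MonoidHom.fst Γ G)).lev ε n) σ hσ (bv' n)
      (fun e => (T.trans (hUW n)).onE (be n e)) ?_ ?_ ?_ ?_ fun x h => ?_
    · intro x
      rw [T.over_onV, hbv]
    · intro e
      rw [T.over_onE, hbe]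
    · intro e
      rw [← (T.trans (hUW n)).map_s, hs]
    · intro e
      change _ = (T.cov (W n)).actV (σ ((A.α e).1 : Γ ⧸ (powSubgroup ε n).toSubgroup)) (bv' n (X.t e))
      rw [← (T.trans (hUW n)).map_t, ht, hσd, T.trans_act_onV]
    · induction h using QuotientGroup.induction_on with
      | H γ =>
        refine (hstab' n x (γ, 1)).trans ?_
        change _ ↔ _ ∈ ((A.I x).map _).map _
        rw [Subgroup.map_map, Subgroup.mem_map]
        refine exists_congr fun i => and_congr_right fun _ => ?_
        rw [← QuotientGroup.eq]
        rfl
  refine ⟨A, hcl, ?_, ?_, ?_, ?_, ?_⟩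
  · intro n
    obtain ⟨a, b, h1, h2, -⟩ := hlower n
    have hconn : ((A.map (MonoidHom.fst Γ G)).lev ε n).derived.Connected := by
      refine (hc (W n)).of_surjective a.symm b.symm (Equiv.surjective _) ?_ ?_
      · intro e
        rw [Equiv.symm_apply_eq, h1, Equiv.apply_symm_apply]
      · intro e
        rw [Equiv.symm_apply_eq, h2, Equiv.apply_symm_apply]
    have := hconn.1
    exact ⟨hconn, FinGraph.kappa_congr a b h1 h2⟩
  · intro n
    obtain ⟨a, b, h1, h2, -⟩ := hupper n
    have hconn : (A.quot (U n)).derived.Connected := by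
      refine (hc (U n)).of_surjective a.symm b.symm (Equiv.surjective _) ?_ ?_
      · intro e
        rw [Equiv.symm_apply_eq, h1, Equiv.apply_symm_apply]
      · intro e
        rw [Equiv.symm_apply_eq, h2, Equiv.apply_symm_apply]
    have := hconn.1
    exact ⟨hconn, FinGraph.kappa_congr a b h1 h2⟩
  · intro x
    have h1 : ∀ n, T.ramLower ⟨ε⟩ n x = (T.cov (W n)).ramIndex (bv' n x) := by
      intro n
      obtain ⟨k, hk⟩ := (T.cov (W n)).transV (bv' n x) (T.vertexAbove (W n) x) (by
        rw [T.over_onV, hbv]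
        exact ((T.cov (W n)).surjV x).choose_spec.symm)
      rw [ramLower, ← (T.cov (W n)).ramIndex_act k (bv' n x), hk]
    have h2 : ∀ n, 1 < T.ramLower ⟨ε⟩ n x ↔ ∃ i ∈ A.I x, i.1 ∉ (powSubgroup ε n).toSubgroup := by
      intro n
      rw [h1, GaloisCovering.ramIndex, Finite.one_lt_card_iff_nontrivial]
      have hone : (T.cov (W n)).actV 1 (bv' n x) = bv' n x := (T.cov (W n)).one_actV _
      constructor
      · intro h
        obtain ⟨⟨q, hq⟩, hne⟩ := exists_ne (⟨1, hone⟩ : {g // (T.cov (W n)).actV g (bv' n x) = bv' n x})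
        induction q using QuotientGroup.induction_on with
        | H d =>
          obtain ⟨i, hi, hd⟩ := (hstab' n x d).1 hq
          refine ⟨i, hi, fun h3 => hne (Subtype.ext ?_)⟩
          refine (QuotientGroup.eq_one_iff d).2 ⟨?_, Subgroup.mem_top _⟩
          have := (powSubgroup ε n).toSubgroup.mul_mem h3 hd
          rwa [mul_inv_cancel_left] at this
      · rintro ⟨i, hi, h3⟩
        refine ⟨⟨⟨i, ?_⟩, ⟨1, hone⟩, fun h4 => h3 ?_⟩⟩
        · rw [hstab']
          refine ⟨i, hi, ?_⟩
          rw [inv_mul_cancel]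
          exact one_mem _
        · exact ((QuotientGroup.eq_one_iff i).1 (congrArg Subtype.val h4)).1
    simp only [h2]
    constructor
    · rintro ⟨n, i, hi, h3⟩ h4
      apply h3
      have h5 : i.1 ∈ (A.I x).map (MonoidHom.fst Γ G) := ⟨i, hi, rfl⟩
      rw [h4, Subgroup.mem_bot] at h5
      rw [h5]
      exact one_mem _
    · intro h
      by_contra hcon
      push Not at hcon
      apply h
      rw [eq_bot_iff]
      rintro _ ⟨i, hi, rfl⟩
      have := eq_one_of_mem_layerSubgroup (G := G) ε (i.1, 1) fun n => ⟨hcon n i hi, rfl⟩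
      exact congrArg Prod.fst this
  · intro x
    let S : ℕ → Set G := fun n => {g | (T.cov (U n)).actV ((1, g) : Γ × G) (bv n x) = bv n x}
    have h1 : ∀ n, T.ramUpperLower ⟨ε⟩ n x = Nat.card (S n) := by
      intro n
      obtain ⟨k, hk⟩ := (T.cov (U n)).transV (bv n x) (T.vertexAbove (U n) x) (by
        rw [hbv]
        exact ((T.cov (U n)).surjV x).choose_spec.symm)
      induction k using QuotientGroup.induction_on with
      | H d =>
        have h2 : T.vertexAbove (U n) x = (T.upperLower ⟨ε⟩ n).actV d.2
            ((T.cov (U n)).actV ((d.1, 1) : Γ × G) (bv n x)) := by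
          rw [← hk]
          change _ = (T.cov (U n)).actV ((1, d.2) : Γ × G)
            ((T.cov (U n)).actV ((d.1, 1) : Γ × G) (bv n x))
          rw [← (T.cov (U n)).mul_actV, ← QuotientGroup.mk_mul]
          congr 2
          exact Prod.ext (one_mul _).symm (mul_one _).symm
        rw [ramUpperLower, h2, GaloisCovering.ramIndex_act]
        refine Nat.card_congr (Equiv.subtypeEquivRight fun g => ?_)
        change (T.cov (U n)).actV ((1, g) : Γ × G) ((T.cov (U n)).actV ((d.1, 1) : Γ × G) (bv n x)) =
          (T.cov (U n)).actV ((d.1, 1) : Γ × G) (bv n x) ↔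
            (T.cov (U n)).actV ((1, g) : Γ × G) (bv n x) = bv n x
        have h3 : (((1, g) : Γ × G) : (Γ × G) ⧸ (U n).toSubgroup) * ((d.1, 1) : Γ × G) =
            ((d.1, 1) : Γ × G) * ((1, g) : Γ × G) := by
          rw [← QuotientGroup.mk_mul, ← QuotientGroup.mk_mul]
          congr 1
          exact Prod.ext (mul_comm _ _) ((mul_one g).trans (one_mul g).symm)
        rw [← (T.cov (U n)).mul_actV, h3, (T.cov (U n)).mul_actV]
        constructor
        · intro h
          have := congrArg ((T.cov (U n)).actV (((d.1, 1) : Γ × G) : (Γ × G) ⧸ (U n).toSubgroup)⁻¹) h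
          rwa [← (T.cov (U n)).mul_actV, ← (T.cov (U n)).mul_actV (_)⁻¹, inv_mul_cancel,
            (T.cov (U n)).one_actV, (T.cov (U n)).one_actV] at this
        · intro h
          rw [h]
    have hSI : ∀ g, g ∈ (A.I x).comap (MonoidHom.inr Γ G) ↔ ∀ n, g ∈ S n := fun g => hI x (1, g)
    have hSanti : ∀ n, S (n + 1) ⊆ S n := by
      intro n g hg
      obtain ⟨i, hi, h⟩ := hlift (n + 1) x (1, g) hg
      exact (hstab n x (1, g)).2 ⟨i, hi, hanti n h⟩
    have hSanti' : Antitone S := antitone_nat_of_succ_le hSanti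
    obtain ⟨N, hN⟩ : ∃ N, S N ⊆ ((A.I x).comap (MonoidHom.inr Γ G) : Set G) := by
      have h2 : ∀ g : G, ∃ n, g ∉ (A.I x).comap (MonoidHom.inr Γ G) → g ∉ S n := by
        intro g
        by_cases hg : g ∈ (A.I x).comap (MonoidHom.inr Γ G)
        · exact ⟨0, fun h => absurd hg h⟩
        · rw [hSI] at hg
          push Not at hg
          exact hg.imp fun n hn _ => hn
      choose M hM using h2
      have := Fintype.ofFinite G
      refine ⟨Finset.univ.sup M, fun g hg => ?_⟩
      by_contra h
      exact hM g h (hSanti' (Finset.le_sup (Finset.mem_univ g)) hg)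
    have hle : ∀ n, Nat.card ((A.I x).comap (MonoidHom.inr Γ G)) ≤ Nat.card (S n) := fun n =>
      Nat.card_mono (Set.toFinite _) fun g hg => (hSI g).1 hg n
    rw [ramInfty]
    simp only [h1]
    refine le_antisymm ((ciInf_le (OrderBot.bddBelow _) N).trans (Nat.card_mono (Set.toFinite _) hN))
      (le_ciInf hle)
  · intro x hx
    have h1 : ∀ n, Nat.card {a : (T.upper ⟨ε⟩ n).V // (T.cov (layerSubgroup ⟨ε⟩ n ⊥)).onV a = x} =
        ((A.quot (U n)).I x).index := by
      intro n
      obtain ⟨a, -, -, -, ha⟩ := hupper n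
      rw [← Voltage.card_fiber]
      refine (Nat.card_congr (a.subtypeEquiv fun w => ?_)).symm
      rw [← ha]
    have h2 : ∀ n, ((A.quot (U n)).I x).index ≤ (A.I x).index := fun n => by
      refine Nat.le_of_dvd (Nat.pos_of_ne_zero hx) ?_
      exact Subgroup.index_map_dvd _ (QuotientGroup.mk'_surjective _)
    obtain ⟨N, hN⟩ : ∃ N, (powSubgroup ε N).toSubgroup ≤ (A.I x).comap (MonoidHom.inl Γ G) := by
      refine (exists_eq_powSubgroup_of_isClosed ε ((hcl x).preimage
        (show Continuous fun γ : Γ => (γ, (1 : G)) by fun_prop)) fun h => ?_).imp fun N hN => hN.ge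
      have hinf : Infinite Γ := Infinite.of_surjective (coord ε) fun c => coord_surjective ε c
      apply hx
      rw [index_eq_mul, h, Subgroup.index_bot, Nat.card_eq_zero_of_infinite, mul_zero]
    have h3 : ((A.quot (U N)).I x).index = (A.I x).index := by
      refine Subgroup.index_map_eq _ (QuotientGroup.mk'_surjective _) ?_
      rw [QuotientGroup.ker_mk']
      intro d hd
      have h4 := hN hd.1
      have h5 : d = (d.1, 1) := Prod.ext rfl hd.2
      rw [h5]
      exact h4
    rw [numInfty]
    simp only [h1]
    refine le_antisymm (iSup_le fun n => by exact_mod_cast h2 n) ?_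
    rw [← h3]
    exact le_iSup (fun n => (((A.quot (U n)).I x).index : ℕ∞)) N

end ProfiniteCovering

end KidaGraph

namespace KidaGraph

universe u v w u' v'

open scoped Classical

set_option linter.unusedSectionVars false

/-! ### Kida's formula for numbers of spanning trees -/

section Kida

variable {p : ℕ} [hp : Fact p.Prime] {Γ : Type v} [CommGroup Γ] [TopologicalSpace Γ]
  [IsTopologicalGroup Γ] [CompactSpace Γ] (ε : Γ ≃ₜ* Multiplicative ℤ_[p])
  {G : Type w} [Group G] [Finite G] [TopologicalSpace G] [DiscreteTopology G]
  {X : FinGraph.{u}}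

namespace Voltage

variable {A : Voltage X (Γ × G)}

theorem isClosed_map_fst (ε : Γ ≃ₜ* Multiplicative ℤ_[p])
    (hcl : ∀ x, IsClosed (A.I x : Set (Γ × G))) (x : X.V) :
    IsClosed ((A.map (MonoidHom.fst Γ G)).I x : Set Γ) := by
  have : T2Space Γ := ε.toHomeomorph.isEmbedding.t2Space
  exact ((hcl x).isCompact.image continuous_fst).isClosed

theorem isClosed_restrict (hcl : ∀ x, IsClosed (A.I x : Set (Γ × G)))
    (w : (A.map (MonoidHom.snd Γ G)).derived.V) : IsClosed (A.restrict.I w : Set Γ) :=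
  (hcl w.1).preimage (show Continuous fun γ : Γ => (γ, (1 : G)) by fun_prop)

theorem index_ne_zero_of_isClosed (ε : Γ ≃ₜ* Multiplicative ℤ_[p]) {I : Subgroup Γ}
    (hI : IsClosed (I : Set Γ)) (h : I ≠ ⊥) : I.index ≠ 0 := by
  obtain ⟨n, rfl⟩ := exists_eq_powSubgroup_of_isClosed ε hI h
  rw [Subgroup.index, card_quot]
  exact pow_ne_zero n hp.out.ne_zero

theorem eq_bot_iff_of_fst_eq_bot {I : Subgroup (Γ × G)} (h : I.map (MonoidHom.fst Γ G) = ⊥) :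
    I = ⊥ ↔ Nat.card (I.comap (MonoidHom.inr Γ G)) = 1 := by
  have h1 : ∀ i ∈ I, i.1 = 1 := fun i hi => by
    rw [← Subgroup.mem_bot, ← h]
    exact ⟨i, hi, rfl⟩
  rw [Subgroup.card_eq_one]
  constructor
  · intro h2
    rw [eq_bot_iff]
    intro g hg
    have hg : ((1, g) : Γ × G) ∈ I := hg
    rw [h2, Subgroup.mem_bot] at hg
    exact congrArg Prod.snd hg
  · intro h2
    rw [eq_bot_iff]
    intro i hi
    have h3 : i.2 ∈ I.comap (MonoidHom.inr Γ G) := by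
      change (1, i.2) ∈ I
      rw [← h1 i hi]
      exact hi
    rw [h2, Subgroup.mem_bot] at h3
    exact Prod.ext (h1 i hi) h3

/-- Kida's congruence for the orders of vanishing. -/
theorem order_charDet_restrict (hG : IsPGroup p G) (ε : Γ ≃ₜ* Multiplicative ℤ_[p])
    (ψ : Γ →* PowerSeries (ZMod p))
    (h : ∀ x, (A.map (MonoidHom.fst Γ G)).I x = ⊥ → A.I x = ⊥) :
    (A.restrict.charDet ψ).order =
      Nat.card G * ((A.map (MonoidHom.fst Γ G)).charDet ψ).order := by
  have := Fintype.ofFinite G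
  rw [charDet_restrict_eq_pow A ε hG ψ h, PowerSeries.order_pow, Nat.card_eq_fintype_card,
    nsmul_eq_mul]

/-- The determinant for the restriction is non-zero modulo `p` if and only if the one for the
projection is and no vertex has a finite non-trivial inertia group. -/
theorem charDet_restrict_ne_zero_iff (hG : IsPGroup p G) (ε : Γ ≃ₜ* Multiplicative ℤ_[p])
    (ψ : Γ →* PowerSeries (ZMod p)) :
    A.restrict.charDet ψ ≠ 0 ↔ (A.map (MonoidHom.fst Γ G)).charDet ψ ≠ 0 ∧
      ∀ x, (A.map (MonoidHom.fst Γ G)).I x = ⊥ → A.I x = ⊥ := by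
  have := Fintype.ofFinite G
  have hchar : CharP (PowerSeries (ZMod p)) p :=
    charP_of_injective_algebraMap (algebraMap (ZMod p) (PowerSeries (ZMod p))).injective p
  by_cases h : ∀ x, (A.map (MonoidHom.fst Γ G)).I x = ⊥ → A.I x = ⊥
  · rw [charDet_restrict_eq_pow A ε hG ψ h, ne_eq, pow_eq_zero_iff Fintype.card_ne_zero]
    exact ⟨fun h1 => ⟨h1, h⟩, fun h1 => h1.1⟩
  · refine iff_of_false (fun h1 => h1 ?_) fun h1 => h h1.2
    push Not at h
    obtain ⟨x, hx, hx'⟩ := h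
    exact charDet_restrict_eq_zero A ε hG ψ hx hx'

/-- The comparison of the numbers of ramified points. An infinite index counts as `0`, so that only
the ramified points contribute. -/
theorem sum_index_add (A : Voltage X (Γ × G)) :
    ∑ w, (A.restrict.I w).index +
      ∑ x, (A.I x).index * (Nat.card ((A.I x).comap (MonoidHom.inr Γ G)) - 1) =
      Nat.card G * ∑ x, ((A.map (MonoidHom.fst Γ G)).I x).index := by
  have := Fintype.ofFinite G
  have h1 : ∑ w, (A.restrict.I w).index = ∑ x, (A.I x).index := sum_index_restrict A
  rw [h1, ← Finset.sum_add_distrib, Finset.mul_sum]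
  refine Finset.sum_congr rfl fun x _ => ?_
  refine Eq.trans ?_ (index_mul_card (A.I x))
  have h2 : 0 < Nat.card ((A.I x).comap (MonoidHom.inr Γ G)) := Nat.card_pos
  obtain ⟨k, hk⟩ := Nat.exists_eq_add_of_lt h2
  rw [hk]
  simp only [zero_add, Nat.add_sub_cancel]
  ring

/-- The determinant for `ψ` is the image of the determinant over the integral group ring. -/
theorem lift_charDet (B : Voltage X Γ) (ψ : Γ →* PowerSeries (ZMod p)) :
    MonoidAlgebra.lift ℤ (PowerSeries (ZMod p)) Γ ψ (B.charDet (MonoidAlgebra.of ℤ Γ)) =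
      B.charDet ψ := by
  have := B.map_charDet (MonoidAlgebra.of ℤ Γ)
    (MonoidAlgebra.lift ℤ (PowerSeries (ZMod p)) Γ ψ : _ →+* PowerSeries (ZMod p))
  refine Eq.trans this ?_
  congr 1
  ext γ
  simp

/-- The Iwasawa invariants of the numbers of spanning trees in terms of the determinant of the
twisted Laplacian modulo `p`. -/
theorem exists_invariants {B : Voltage X Γ} (hI : ∀ x, IsClosed (B.I x : Set Γ))
    (hc : ∀ n, (B.lev ε n).derived.Connected) {ψ : Γ →* PowerSeries (ZMod p)}
    (hψ : IsBinomial ε ψ) :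
    ∃ lam m : ℕ, HasIwasawaInvariants p (fun n => (B.lev ε n).derived.kappa) lam m ∧
      (m = 0 ↔ B.charDet ψ ≠ 0) ∧
      (m = 0 → (lam : ℕ∞) + 1 = (B.charDet ψ).order + (∑ x, (B.I x).index : ℕ)) := by
  obtain ⟨m, l, lam, g, h1, h2, h3, h4⟩ := B.exists_hasIwasawaInvariants ε hI hc hψ
  have h5 := lift_charDet B ψ
  rw [h1, map_mul, map_pow, map_natCast] at h5
  have h6 : ((p : ℕ) : PowerSeries (ZMod p)) = 0 := by
    have h7 : ((p : ZMod p)) = 0 := CharP.cast_eq_zero _ _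
    rw [← map_natCast (algebraMap (ZMod p) (PowerSeries (ZMod p))), h7, map_zero]
  have h7 : MonoidAlgebra.lift ℤ (PowerSeries (ZMod p)) Γ ψ g ≠ 0 := by
    rw [ne_eq, ← PowerSeries.order_eq_top, h2]
    exact ENat.natCast_ne_top l
  refine ⟨lam, m, h4, ?_, ?_⟩
  · rw [← h5, h6]
    constructor
    · rintro rfl
      rwa [pow_zero, one_mul]
    · intro h
      by_contra hm
      rw [zero_pow hm, zero_mul] at h
      exact h rfl
  · rintro rfl
    rw [← h5, pow_zero, one_mul, h2]
    exact_mod_cast h3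

end Voltage

/-- Kida's formula for the numbers of spanning trees. -/
theorem ProfiniteCovering.kida (hG : IsPGroup p G) (T : ProfiniteCovering.{u'} (Γ × G) X)
    (hc : ∀ U, (T.layer U).Connected) {ψ : Γ →* PowerSeries (ZMod p)} (hψ : IsBinomial ε ψ) :
    (∃ lam mu : ℕ, HasIwasawaInvariants p (fun n => (T.lower ⟨ε⟩ n).kappa) lam mu) ∧
      (∃ lam' mu' : ℕ, HasIwasawaInvariants p (fun n => (T.upper ⟨ε⟩ n).kappa) lam' mu') ∧
      ∀ lam mu lam' mu' : ℕ,
        HasIwasawaInvariants p (fun n => (T.lower ⟨ε⟩ n).kappa) lam mu →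
        HasIwasawaInvariants p (fun n => (T.upper ⟨ε⟩ n).kappa) lam' mu' →
        (mu' = 0 ↔ mu = 0 ∧ T.Star ⟨ε⟩) ∧
        (mu' = 0 →
          ((lam' : ℕ∞) + 1) + ∑ᶠ x : X.V, T.numInfty ⟨ε⟩ x * ((T.ramInfty ⟨ε⟩ x - 1 : ℕ) : ℕ∞) =
            (Nat.card G : ℕ∞) * ((lam : ℕ∞) + 1)) := by
  obtain ⟨A, hcl, hlow, hup, hram, hraminf, hnum⟩ := T.exists_voltage_layers ε hc
  obtain ⟨lam₁, m₁, h₁, hm₁, hl₁⟩ := Voltage.exists_invariants ε (Voltage.isClosed_map_fst ε hcl)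
    (fun n => (hlow n).1) hψ
  obtain ⟨lam₂, m₂, h₂, hm₂, hl₂⟩ := Voltage.exists_invariants ε (B := A.restrict)
    (Voltage.isClosed_restrict hcl) (fun n => A.connected_restrict ε (hup n).1) hψ
  have hk₁ : (fun n => ((A.map (MonoidHom.fst Γ G)).lev ε n).derived.kappa) =
      fun n => (T.lower ⟨ε⟩ n).kappa := funext fun n => (hlow n).2
  have hk₂ : (fun n => (A.restrict.lev ε n).derived.kappa) =
      fun n => (T.upper ⟨ε⟩ n).kappa := funext fun n =>
    (A.kappa_restrict ε (hup n).1).trans (hup n).2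
  rw [hk₁] at h₁
  rw [hk₂] at h₂
  have hstar : T.Star ⟨ε⟩ ↔ ∀ x, (A.map (MonoidHom.fst Γ G)).I x = ⊥ → A.I x = ⊥ := by
    refine forall_congr' fun x => ?_
    rw [hram, hraminf]
    change ¬ (A.map (MonoidHom.fst Γ G)).I x = ⊥ ∨ _ ↔ _
    rw [← imp_iff_not_or]
    exact forall_congr' fun h => (Voltage.eq_bot_iff_of_fst_eq_bot h).symm
  refine ⟨⟨_, _, h₁⟩, ⟨_, _, h₂⟩, fun lam mu lam' mu' h h' => ?_⟩
  obtain ⟨rfl, rfl⟩ := h.unique h₁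
  obtain ⟨rfl, rfl⟩ := h'.unique h₂
  have hiff := Voltage.charDet_restrict_ne_zero_iff (A := A) hG ε ψ
  rw [← hm₁, ← hm₂, ← hstar] at hiff
  refine ⟨hiff, fun h0 => ?_⟩
  have hS := hstar.1 (hiff.1 h0).2
  -- An infinite index is encoded as `0`; the term is zero then, by the condition on the inertia
  -- groups.
  have hterm : ∀ x, T.numInfty ⟨ε⟩ x * ((T.ramInfty ⟨ε⟩ x - 1 : ℕ) : ℕ∞) =
      (((A.I x).index * (Nat.card ((A.I x).comap (MonoidHom.inr Γ G)) - 1) : ℕ) : ℕ∞) := by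
    intro x
    rw [hraminf]
    by_cases hx : (A.I x).index = 0
    · have h1 : (A.map (MonoidHom.fst Γ G)).I x = ⊥ := by
        by_contra h2
        have h3 := index_mul_card (A.I x)
        rw [hx, zero_mul, eq_comm, mul_eq_zero] at h3
        exact Voltage.index_ne_zero_of_isClosed ε (Voltage.isClosed_map_fst ε hcl x) h2
          (h3.resolve_left Nat.card_pos.ne')
      rw [(Voltage.eq_bot_iff_of_fst_eq_bot h1).1 (hS x h1)]
      simp
    · rw [hnum x hx]
      push_cast
      rfl
  rw [finsum_eq_sum_of_fintype, Finset.sum_congr rfl fun x _ => hterm x, hl₂ h0,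
    Voltage.order_charDet_restrict hG ε ψ hS, hl₁ (hiff.1 h0).1, mul_add, add_assoc]
  congr 1
  have := A.sum_index_add
  exact_mod_cast this

end Kida

end KidaGraph

namespace KidaGraph

universe u v w

open scoped Classical
open Polynomial

set_option linter.unusedSectionVars false

/-! ### The Iwasawa algebra as a power series ring -/

section IwasawaAlgebraEquiv

variable {p : ℕ} [hp : Fact p.Prime]

/-- A power series over `ℤ_p` reduces to zero modulo `p` iff it is divisible by `p`. -/
theorem map_toZMod_eq_zero_iff {f : PowerSeries ℤ_[p]} :
    f.map (PadicInt.toZMod (p := p)) = 0 ↔ (p : PowerSeries ℤ_[p]) ∣ f := by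
  constructor
  · intro h
    have h1 : ∀ i, ∃ c : ℤ_[p], PowerSeries.coeff i f = p * c := by
      intro i
      have h2 := congrArg (PowerSeries.coeff i) h
      rw [PowerSeries.coeff_map, map_zero, ← RingHom.mem_ker, PadicInt.ker_toZMod,
        PadicInt.maximalIdeal_eq_span_p, Ideal.mem_span_singleton] at h2
      exact h2
    choose c hc using h1
    refine ⟨PowerSeries.mk c, ?_⟩
    ext i
    rw [hc, ← map_natCast (PowerSeries.C (R := ℤ_[p])), PowerSeries.coeff_C_mul, PowerSeries.coeff_mk]
  · rintro ⟨g, rfl⟩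
    rw [map_mul, map_natCast, ← map_natCast (PowerSeries.C (R := ZMod p)), CharP.cast_eq_zero,
      map_zero, zero_mul]

theorem natCast_p_ne_zero : (p : PowerSeries ℤ_[p]) ≠ 0 := by
  rw [← map_natCast (PowerSeries.C (R := ℤ_[p]))]
  intro h
  have := congrArg (PowerSeries.constantCoeff (R := ℤ_[p])) h
  rw [PowerSeries.constantCoeff_C, map_zero] at this
  exact (by exact_mod_cast hp.out.ne_zero : ((p : ℕ) : ℤ_[p]) ≠ 0) this

theorem surjective_map_toZMod :
    Function.Surjective (PowerSeries.map (PadicInt.toZMod (p := p))) := by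
  intro f
  refine ⟨PowerSeries.mk fun i => ((PowerSeries.coeff i f).val : ℤ_[p]), ?_⟩
  ext i
  simp

/-- The distinguished polynomial `(1 + X)^{p^n} - 1`. -/
noncomputable def omega (p : ℕ) [Fact p.Prime] (n : ℕ) : ℤ_[p][X] := (1 + X) ^ p ^ n - 1

theorem omega_eq (n : ℕ) : omega p n = X ^ p ^ n + (omega p n - X ^ p ^ n) := by ring

theorem degree_omega_sub (n : ℕ) : (omega p n - X ^ p ^ n).degree < ((p ^ n : ℕ) : WithBot ℕ) := by
  have h0 : p ^ n ≠ 0 := pow_ne_zero n hp.out.ne_zero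
  have h1 : (((1 : ℤ_[p][X]) + X) ^ p ^ n - X ^ p ^ n).degree < ((p ^ n : ℕ) : WithBot ℕ) := by
    have h2 : ((X + C 1 : ℤ_[p][X]) ^ p ^ n).Monic := (monic_X_add_C 1).pow _
    have h3 : ((X + C 1 : ℤ_[p][X]) ^ p ^ n).degree = ((p ^ n : ℕ) : WithBot ℕ) := by
      rw [degree_eq_natDegree h2.ne_zero, (monic_X_add_C 1).natDegree_pow, natDegree_X_add_C, mul_one]
    rw [add_comm 1 X, ← C_1, ← h3]
    refine degree_sub_lt_left ?_ h2.ne_zero ?_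
    · rw [h3, degree_X_pow]
    · rw [h2.leadingCoeff, leadingCoeff_X_pow]
  have h2 : omega p n - X ^ p ^ n = ((1 + X) ^ p ^ n - X ^ p ^ n) - 1 := by rw [omega]; ring
  rw [h2]
  refine (degree_sub_le _ _).trans_lt (max_lt h1 ?_)
  rw [degree_one]
  exact_mod_cast Nat.pos_of_ne_zero h0

theorem monic_omega (n : ℕ) : (omega p n).Monic := by
  rw [omega_eq]
  exact monic_X_pow_add (degree_omega_sub n)

theorem natDegree_omega (n : ℕ) : (omega p n).natDegree = p ^ n := by
  rw [omega_eq]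
  refine natDegree_eq_of_degree_eq_some ?_
  rw [degree_add_eq_left_of_degree_lt, degree_X_pow]
  rw [degree_X_pow]
  exact degree_omega_sub n

theorem map_omega (n : ℕ) : (omega p n).map (PadicInt.toZMod (p := p)) = X ^ p ^ n := by
  rw [omega, Polynomial.map_sub, Polynomial.map_pow, Polynomial.map_add, Polynomial.map_one,
    Polynomial.map_X, add_pow_char_pow, one_pow, add_sub_cancel_left]

theorem isDistinguishedAt_omega (n : ℕ) :
    (omega p n).IsDistinguishedAt (IsLocalRing.maximalIdeal ℤ_[p]) where
  monic := monic_omega n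
  mem := by
    intro i hi
    rw [natDegree_omega] at hi
    rw [← PadicInt.ker_toZMod, RingHom.mem_ker, ← coeff_map, map_omega, coeff_X_pow, if_neg hi.ne]

theorem map_omega_coe (n : ℕ) : ((omega p n : ℤ_[p][X]) : PowerSeries ℤ_[p]).map
    (PadicInt.toZMod (p := p)) = PowerSeries.X ^ p ^ n := by
  rw [← Polynomial.polynomial_map_coe, map_omega]
  simp

theorem omega_ne_zero (n : ℕ) : ((omega p n : ℤ_[p][X]) : PowerSeries ℤ_[p]) ≠ 0 := by
  intro h
  have := map_omega_coe (p := p) n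
  rw [h, map_zero] at this
  exact pow_ne_zero _ PowerSeries.X_ne_zero this.symm

theorem omega_dvd {m n : ℕ} (h : m ≤ n) : omega p m ∣ omega p n := by
  obtain ⟨k, rfl⟩ := Nat.exists_eq_add_of_le h
  rw [omega, omega, pow_add p m k, pow_mul]
  exact sub_one_dvd_pow_sub_one _ _

/-- A power series divisible by all the `(1 + X)^{p^n} - 1` vanishes. -/
theorem eq_zero_of_omega_dvd {f : PowerSeries ℤ_[p]}
    (h : ∀ n, ((omega p n : ℤ_[p][X]) : PowerSeries ℤ_[p]) ∣ f) : f = 0 := by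
  have hstep : ∀ f : PowerSeries ℤ_[p],
      (∀ n, ((omega p n : ℤ_[p][X]) : PowerSeries ℤ_[p]) ∣ f) →
      ∃ g, f = p * g ∧ ∀ n, ((omega p n : ℤ_[p][X]) : PowerSeries ℤ_[p]) ∣ g := by
    intro f hf
    have h1 : f.map (PadicInt.toZMod (p := p)) = 0 := by
      ext i
      obtain ⟨q, hq⟩ := hf i
      rw [hq, map_mul, map_omega_coe, PowerSeries.coeff_X_pow_mul', if_neg, map_zero]
      exact not_le.2 (Nat.lt_pow_self hp.out.one_lt)
    obtain ⟨g, hg⟩ := map_toZMod_eq_zero_iff.1 h1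
    refine ⟨g, hg, fun n => ?_⟩
    obtain ⟨q, hq⟩ := hf n
    have h2 : q.map (PadicInt.toZMod (p := p)) = 0 := by
      have h3 : (((omega p n : ℤ_[p][X]) : PowerSeries ℤ_[p]) * q).map
          (PadicInt.toZMod (p := p)) = 0 := by rw [← hq, h1]
      rw [map_mul, map_omega_coe] at h3
      exact (mul_eq_zero.1 h3).resolve_left (pow_ne_zero _ PowerSeries.X_ne_zero)
    obtain ⟨r, hr⟩ := map_toZMod_eq_zero_iff.1 h2
    refine ⟨r, mul_left_cancel₀ natCast_p_ne_zero ?_⟩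
    rw [← hg, hq, hr]
    ring
  have hall : ∀ k : ℕ, ∀ f : PowerSeries ℤ_[p],
      (∀ n, ((omega p n : ℤ_[p][X]) : PowerSeries ℤ_[p]) ∣ f) →
      ∃ g, f = (p : PowerSeries ℤ_[p]) ^ k * g := by
    intro k
    induction k with
    | zero => exact fun f _ => ⟨f, by rw [pow_zero, one_mul]⟩
    | succ k ih =>
      intro f hf
      obtain ⟨g, hg, hg'⟩ := hstep f hf
      obtain ⟨g', hg''⟩ := ih g hg'
      exact ⟨g', by rw [hg, hg'', pow_succ']; ring⟩
  ext i
  rw [map_zero]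
  by_contra hne
  obtain ⟨k, hk⟩ := exists_not_dvd hne
  obtain ⟨g, hg⟩ := hall k f h
  apply hk
  rw [hg, ← map_natCast (PowerSeries.C (R := ℤ_[p])), ← map_pow, PowerSeries.coeff_C_mul]
  exact dvd_mul_right _ _

variable {Γ : Type v} [CommGroup Γ] [TopologicalSpace Γ] [IsTopologicalGroup Γ] [CompactSpace Γ]
  (ε : Γ ≃ₜ* Multiplicative ℤ_[p])

/-- The group ring `ℤ_p[Γ/Γ^{p^n}]`. -/
abbrev LevelRing (n : ℕ) : Type v := MonoidAlgebra ℤ_[p] (Γ ⧸ (powSubgroup ε n).toSubgroup)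

/-- The class of the generator in `ℤ_p[Γ/Γ^{p^n}]`. -/
noncomputable def genClass (n : ℕ) : LevelRing ε n :=
  MonoidAlgebra.of ℤ_[p] _ (QuotientGroup.mk (gen ε) : Γ ⧸ (powSubgroup ε n).toSubgroup)

theorem genClass_pow (n : ℕ) : genClass ε n ^ p ^ n = 1 := by
  rw [genClass, ← map_pow, ← QuotientGroup.mk_pow, (QuotientGroup.eq_one_iff _).2, map_one]
  exact ⟨gen ε, rfl⟩

theorem genClass_pow_eq (n j : ℕ) : genClass ε n ^ j = MonoidAlgebra.single
    ((QuotientGroup.mk (gen ε) : Γ ⧸ (powSubgroup ε n).toSubgroup) ^ j) 1 := by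
  rw [genClass, ← map_pow]
  rfl

theorem aeval_omega (n : ℕ) : aeval (genClass ε n - 1) (omega p n) = 0 := by
  rw [omega, map_sub, map_pow, map_add, map_one, aeval_X, add_sub_cancel, genClass_pow, sub_self]

theorem exists_aeval_eq (n : ℕ) (a : LevelRing ε n) :
    ∃ P : ℤ_[p][X], aeval (genClass ε n - 1) P = a := by
  induction a using MonoidAlgebra.induction_linear with
  | zero => exact ⟨0, map_zero _⟩
  | add f g hf hg =>
    obtain ⟨P, rfl⟩ := hf
    obtain ⟨Q, rfl⟩ := hg
    exact ⟨P + Q, map_add _ _ _⟩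
  | single q r =>
    induction q using QuotientGroup.induction_on with
    | H γ =>
      refine ⟨C r * (1 + X) ^ expo ε n γ, ?_⟩
      have h1 : (γ : Γ ⧸ (powSubgroup ε n).toSubgroup) =
          (QuotientGroup.mk (gen ε) : Γ ⧸ (powSubgroup ε n).toSubgroup) ^ expo ε n γ :=
        ((quotEquiv ε n).left_inv γ).symm
      rw [map_mul, aeval_C, map_pow, map_add, map_one, aeval_X, add_sub_cancel, genClass,
        ← map_pow, ← h1, MonoidAlgebra.of_apply, ← Algebra.smul_def, MonoidAlgebra.smul_single,
        smul_eq_mul, mul_one]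

theorem omega_dvd_of_aeval_eq_zero {n : ℕ} {P : ℤ_[p][X]} (h : aeval (genClass ε n - 1) P = 0) :
    omega p n ∣ P := by
  rw [← modByMonic_eq_zero_iff_dvd (monic_omega n)]
  set Q := P %ₘ omega p n with hQ
  have hdeg : Q.natDegree < p ^ n := by
    rw [← natDegree_omega (p := p) n]
    refine natDegree_modByMonic_lt P (monic_omega n) fun h1 => ?_
    have := natDegree_omega (p := p) n
    rw [h1, natDegree_one] at this
    exact pow_ne_zero n hp.out.ne_zero this.symm
  have h1 : aeval (genClass ε n - 1) Q = 0 := by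
    rw [hQ, modByMonic_eq_sub_mul_div _ (omega p n), map_sub, map_mul, aeval_omega, zero_mul, h, sub_zero]
  have h2 : aeval (genClass ε n) (Q.comp (X - 1)) = 0 := by
    rw [aeval_comp, map_sub, map_one, aeval_X, h1]
  have h3 : (Q.comp (X - 1)).natDegree < p ^ n := by
    rw [natDegree_comp, ← C_1, natDegree_X_sub_C, mul_one]
    exact hdeg
  have h4 : Q.comp (X - 1) = 0 := by
    ext k
    rw [coeff_zero]
    by_cases hk : k < p ^ n
    · rw [aeval_eq_sum_range' h3] at h2
      have h5 := congrArg (fun a : LevelRing ε n =>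
        a.coeff (QuotientGroup.mk (gen ε ^ k))) h2
      have h6 : ∀ j < p ^ n, (QuotientGroup.mk (gen ε) : Γ ⧸ (powSubgroup ε n).toSubgroup) ^ j =
          QuotientGroup.mk (gen ε ^ k) ↔ j = k := by
        intro j hj
        rw [← QuotientGroup.mk_pow, QuotientGroup.eq, ← expo_eq_iff, expo_gen_pow ε hj,
          expo_gen_pow ε hk]
      simp only [genClass_pow_eq, MonoidAlgebra.coeff_sum,
        MonoidAlgebra.coeff_smul, MonoidAlgebra.coeff_single] at h5
      rw [Finsupp.finsetSum_apply, Finset.sum_congr rfl fun j hj => by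
        rw [Finsupp.smul_apply, Finsupp.single_apply,
          if_congr (h6 j (Finset.mem_range.1 hj)) rfl rfl]] at h5
      simpa [hk] using h5
    · exact coeff_eq_zero_of_natDegree_lt (h3.trans_le (not_lt.1 hk))
  have h5 : Q = (Q.comp (X - 1)).comp (X + 1) := by
    rw [comp_assoc]
    simp
  rw [h5, h4, zero_comp]

/-- The evaluation of polynomials at `γ - 1`, modulo `(1 + X)^{p^n} - 1`. -/
noncomputable def polyLevelMap (n : ℕ) : ℤ_[p][X] ⧸ Ideal.span {omega p n} →+* LevelRing ε n :=
  Ideal.Quotient.lift _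
    ((aeval (genClass ε n - 1) : ℤ_[p][X] →ₐ[ℤ_[p]] LevelRing ε n) : ℤ_[p][X] →+* LevelRing ε n)
    (fun a ha => by
      obtain ⟨b, rfl⟩ := Ideal.mem_span_singleton.1 ha
      rw [map_mul, RingHom.coe_coe, aeval_omega, zero_mul])

/-- The projection from the power series ring to `ℤ_p[Γ/Γ^{p^n}]`, with `T ↦ γ - 1` for the
generator `γ`: the reduction modulo `(1 + T)^{p^n} - 1`, by Weierstrass division. -/
noncomputable def levelMap (n : ℕ) : PowerSeries ℤ_[p] →+* LevelRing ε n :=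
  (polyLevelMap ε n).comp
    ((isDistinguishedAt_omega (p := p) n).algEquivQuotient.symm.toRingEquiv.toRingHom.comp
      (Ideal.Quotient.mk (Ideal.span {((omega p n : ℤ_[p][X]) : PowerSeries ℤ_[p])})))

/-- The level map evaluates the remainder of Weierstrass division by `(1 + T) ^ p ^ n - 1`. -/
theorem exists_levelMap_eq (n : ℕ) (f : PowerSeries ℤ_[p]) :
    ∃ P : ℤ_[p][X], ((omega p n : ℤ_[p][X]) : PowerSeries ℤ_[p]) ∣ f - P ∧
      levelMap ε n f = aeval (genClass ε n - 1) P := by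
  obtain ⟨P, hP⟩ := Ideal.Quotient.mk_surjective
    ((isDistinguishedAt_omega (p := p) n).algEquivQuotient.symm (Ideal.Quotient.mk _ f))
  refine ⟨P, ?_, ?_⟩
  · rw [eq_comm, AlgEquiv.symm_apply_eq] at hP
    exact Ideal.mem_span_singleton.1 (Ideal.Quotient.eq.1 hP)
  · change polyLevelMap ε n ((isDistinguishedAt_omega (p := p) n).algEquivQuotient.symm
      (Ideal.Quotient.mk _ f)) = _
    rw [← hP]
    rfl

theorem levelMap_coe (n : ℕ) (P : ℤ_[p][X]) :
    levelMap ε n (P : PowerSeries ℤ_[p]) = aeval (genClass ε n - 1) P := by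
  change polyLevelMap ε n ((isDistinguishedAt_omega (p := p) n).algEquivQuotient.symm
      (Ideal.Quotient.mk _ (P : PowerSeries ℤ_[p]))) = _
  have h : (isDistinguishedAt_omega (p := p) n).algEquivQuotient.symm
      (Ideal.Quotient.mk _ (P : PowerSeries ℤ_[p])) = Ideal.Quotient.mk _ P := by
    rw [AlgEquiv.symm_apply_eq]
    rfl
  rw [h]
  rfl

/-- The level map identifies the group ring of `Γ/Γ^{p^n}` with the quotient of the power series
ring by `(1 + T) ^ p ^ n - 1`. -/
theorem levelMap_eq_zero_iff {n : ℕ} {f : PowerSeries ℤ_[p]} :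
    levelMap ε n f = 0 ↔ ((omega p n : ℤ_[p][X]) : PowerSeries ℤ_[p]) ∣ f := by
  constructor
  · intro h
    obtain ⟨P, h1, h2⟩ := exists_levelMap_eq ε n f
    obtain ⟨Q, rfl⟩ := omega_dvd_of_aeval_eq_zero ε (h2.symm.trans h)
    have h3 : ((omega p n : ℤ_[p][X]) : PowerSeries ℤ_[p]) ∣
        ((omega p n * Q : ℤ_[p][X]) : PowerSeries ℤ_[p]) := by
      rw [Polynomial.coe_mul]
      exact dvd_mul_right _ _
    have h4 := dvd_add h1 h3
    rwa [sub_add_cancel] at h4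
  · rintro ⟨g, rfl⟩
    rw [map_mul, levelMap_coe, aeval_omega, zero_mul]

theorem levelMap_surjective (n : ℕ) : Function.Surjective (levelMap ε n) := fun a => by
  obtain ⟨P, rfl⟩ := exists_aeval_eq ε n a
  exact ⟨_, levelMap_coe ε n P⟩

theorem mapDomain_quotMap_trans {U V W : OpenNormalSubgroup Γ} (h : U ≤ V) (h' : V ≤ W)
    (a : MonoidAlgebra ℤ_[p] (Γ ⧸ U.toSubgroup)) :
    MonoidAlgebra.mapDomainRingHom ℤ_[p] (quotMap h')
      (MonoidAlgebra.mapDomainRingHom ℤ_[p] (quotMap h) a) =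
      MonoidAlgebra.mapDomainRingHom ℤ_[p] (quotMap (h.trans h')) a := by
  rw [← RingHom.comp_apply, ← MonoidAlgebra.mapDomainRingHom_comp]
  congr 2
  ext x
  rfl

theorem mapDomain_levelMap {m n : ℕ} (hmn : m ≤ n) (f : PowerSeries ℤ_[p]) :
    MonoidAlgebra.mapDomainRingHom ℤ_[p] (quotMap (powSubgroup_anti ε hmn)) (levelMap ε n f) =
      levelMap ε m f := by
  obtain ⟨P, h1, h2⟩ := exists_levelMap_eq ε n f
  have h3 : levelMap ε m (f - P) = 0 := by
    rw [levelMap_eq_zero_iff]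
    refine dvd_trans ?_ h1
    obtain ⟨Q, hQ⟩ := omega_dvd (p := p) hmn
    rw [hQ, Polynomial.coe_mul]
    exact dvd_mul_right _ _
  rw [map_sub, sub_eq_zero, levelMap_coe] at h3
  rw [h2, h3, ← RingHom.coe_coe (aeval (genClass ε n - 1)), ← RingHom.comp_apply,
    ← RingHom.coe_coe (aeval (genClass ε m - 1))]
  congr 1
  refine Polynomial.ringHom_ext (fun r => ?_) ?_
  · simp
  · rw [RingHom.comp_apply, RingHom.coe_coe, RingHom.coe_coe, aeval_X, aeval_X, map_sub, map_one]
    congr 1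
    exact MonoidAlgebra.mapDomain_single ..

/-- The group elements in the Iwasawa algebra. -/
noncomputable def iwasawaOf : Γ →* IwasawaAlgebra p Γ where
  toFun γ := ⟨fun U => MonoidAlgebra.of ℤ_[p] _ (γ : Γ ⧸ U.toSubgroup), fun U V h =>
    (MonoidAlgebra.mapDomain_single ..).trans rfl⟩
  map_one' := by
    ext U : 2
    exact map_one _
  map_mul' a b := by
    ext U : 2
    exact map_mul (MonoidAlgebra.of ℤ_[p] (Γ ⧸ U.toSubgroup)) (a : Γ ⧸ U.toSubgroup) b

/-- The projection of the Iwasawa algebra to `ℤ_p[Γ/Γ^{p^n}]`. -/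
noncomputable def iwasawaProj (n : ℕ) : IwasawaAlgebra p Γ →+* LevelRing ε n :=
  (Pi.evalRingHom _ (powSubgroup ε n)).comp (iwasawaSubring p Γ).subtype

theorem iwasawaProj_ext {a b : IwasawaAlgebra p Γ}
    (h : ∀ n, iwasawaProj ε n a = iwasawaProj ε n b) :
    a = b := by
  ext U : 2
  obtain ⟨n, hn⟩ := exists_powSubgroup_le ε U
  rw [← a.2 _ _ hn, ← b.2 _ _ hn]
  exact congrArg _ (h n)

theorem mapDomain_iwasawaProj {m n : ℕ} (h : powSubgroup ε n ≤ powSubgroup ε m)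
    (a : IwasawaAlgebra p Γ) :
    MonoidAlgebra.mapDomainRingHom ℤ_[p] (quotMap h) (iwasawaProj ε n a) = iwasawaProj ε m a :=
  a.2 _ _ h

theorem mapDomain_levelMap_eq {U : OpenNormalSubgroup Γ} {m n : ℕ} (hm : powSubgroup ε m ≤ U)
    (hn : powSubgroup ε n ≤ U) (f : PowerSeries ℤ_[p]) :
    MonoidAlgebra.mapDomainRingHom ℤ_[p] (quotMap hm) (levelMap ε m f) =
      MonoidAlgebra.mapDomainRingHom ℤ_[p] (quotMap hn) (levelMap ε n f) := by
  rw [← mapDomain_levelMap ε (le_max_left m n), ← mapDomain_levelMap ε (le_max_right m n),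
    mapDomain_quotMap_trans, mapDomain_quotMap_trans]

/-- The homomorphism from the power series ring to the Iwasawa algebra with `T ↦ γ - 1`. -/
noncomputable def powerSeriesToIwasawa : PowerSeries ℤ_[p] →+* IwasawaAlgebra p Γ :=
  RingHom.codRestrict (RingHom.pi fun U =>
    (MonoidAlgebra.mapDomainRingHom ℤ_[p] (quotMap (exists_powSubgroup_le ε U).choose_spec)).comp
      (levelMap ε (exists_powSubgroup_le ε U).choose)) (iwasawaSubring p Γ) fun f U V h => by
    refine (mapDomain_quotMap_trans _ h _).trans ?_
    exact mapDomain_levelMap_eq ε _ _ f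

theorem iwasawaProj_powerSeriesToIwasawa (n : ℕ) (f : PowerSeries ℤ_[p]) :
    iwasawaProj ε n (powerSeriesToIwasawa ε f) = levelMap ε n f := by
  refine (mapDomain_levelMap_eq ε (exists_powSubgroup_le ε (powSubgroup ε n)).choose_spec
    (le_refl _) f).trans ?_
  exact mapDomain_levelMap ε (le_refl n) f

open PowerSeries.WithPiTopology in
/-- Injective since no non-zero power series is divisible by all `(1 + T) ^ p ^ n - 1`, and surjective
by compactness of the power series ring. -/
theorem powerSeriesToIwasawa_bijective : Function.Bijective (powerSeriesToIwasawa (p := p) ε) := by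
  constructor
  · rw [injective_iff_map_eq_zero]
    intro f hf
    refine eq_zero_of_omega_dvd fun n => ?_
    rw [← levelMap_eq_zero_iff ε, ← iwasawaProj_powerSeriesToIwasawa, hf, map_zero]
  · intro a
    have hcompact : CompactSpace (PowerSeries ℤ_[p]) :=
      inferInstanceAs (CompactSpace ((Unit →₀ ℕ) → ℤ_[p]))
    have hclosed : ∀ n, IsClosed {f | levelMap ε n f = iwasawaProj ε n a} := by
      intro n
      obtain ⟨g, hg⟩ := levelMap_surjective ε n (iwasawaProj ε n a)
      have h1 : {f | levelMap ε n f = iwasawaProj ε n a} =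
          Set.range fun q => g + ((omega p n : ℤ_[p][X]) : PowerSeries ℤ_[p]) * q := by
        ext f
        rw [Set.mem_ofPred_eq, ← hg, ← sub_eq_zero, ← map_sub, levelMap_eq_zero_iff]
        constructor
        · rintro ⟨q, hq⟩
          exact ⟨q, (eq_add_of_sub_eq' hq).symm⟩
        · rintro ⟨q, rfl⟩
          exact ⟨q, by ring⟩
      rw [h1]
      exact (isCompact_range (by fun_prop)).isClosed
    obtain ⟨f, hf⟩ := IsCompact.nonempty_iInter_of_sequence_nonempty_isCompact_isClosed
      (fun n => {f | levelMap ε n f = iwasawaProj ε n a}) (fun n f hf => by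
        have hf : levelMap ε (n + 1) f = iwasawaProj ε (n + 1) a := hf
        change levelMap ε n f = iwasawaProj ε n a
        rw [← mapDomain_levelMap ε n.le_succ, hf, mapDomain_iwasawaProj])
      (fun n => levelMap_surjective ε n _) (hclosed 0).isCompact hclosed
    refine ⟨f, iwasawaProj_ext ε fun n => ?_⟩
    rw [iwasawaProj_powerSeriesToIwasawa]
    exact Set.mem_iInter.1 hf n

/-- The Iwasawa algebra of `Γ ≅ ℤ_p` is the power series ring over `ℤ_p`. -/
noncomputable def iwasawaEquiv : IwasawaAlgebra p Γ ≃+* PowerSeries ℤ_[p] :=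
  (RingEquiv.ofBijective _ (powerSeriesToIwasawa_bijective ε)).symm

theorem iwasawaEquiv_gen : iwasawaEquiv ε (iwasawaOf (gen ε)) = 1 + PowerSeries.X := by
  rw [iwasawaEquiv, RingEquiv.symm_apply_eq]
  refine iwasawaProj_ext ε fun n => ?_
  refine Eq.trans ?_ (iwasawaProj_powerSeriesToIwasawa ε n _).symm
  have h : (1 + PowerSeries.X : PowerSeries ℤ_[p]) = ((1 + X : ℤ_[p][X]) : PowerSeries ℤ_[p]) := by
    simp
  rw [h, levelMap_coe, map_add, map_one, aeval_X, add_sub_cancel]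
  rfl

/-- The Iwasawa algebra modulo `p`. -/
noncomputable def iwasawaModP : IwasawaAlgebra p Γ →+* PowerSeries (ZMod p) :=
  (PowerSeries.map (PadicInt.toZMod (p := p))).comp (iwasawaEquiv ε : _ →+* _)

theorem iwasawaModP_surjective : Function.Surjective (iwasawaModP (p := p) ε) :=
  surjective_map_toZMod.comp (iwasawaEquiv ε).surjective

theorem iwasawaModP_eq_zero_iff {a : IwasawaAlgebra p Γ} :
    iwasawaModP (p := p) ε a = 0 ↔ (p : IwasawaAlgebra p Γ) ∣ a := by
  change PowerSeries.map (PadicInt.toZMod (p := p)) (iwasawaEquiv ε a) = 0 ↔ _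
  rw [map_toZMod_eq_zero_iff, ← map_natCast (iwasawaEquiv ε), map_dvd_iff]

/-- The tautological character modulo `p` maps the generator to `1 + T`. -/
theorem isBinomial_iwasawaModP :
    IsBinomial ε ((iwasawaModP ε : IwasawaAlgebra p Γ →* PowerSeries (ZMod p)).comp iwasawaOf) where
  gen := by
    change PowerSeries.map (PadicInt.toZMod (p := p)) (iwasawaEquiv ε (iwasawaOf (gen ε))) = _
    rw [iwasawaEquiv_gen]
    simp
  constantCoeff γ := by
    -- `Γ` is divisible by `p - 1`, the order of the group of units of `ℤ/p`
    obtain ⟨u, hu⟩ := IsLocalRing.isUnit_one_sub_self_of_mem_nonunits (p : ℤ_[p]) PadicInt.p_nonunit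
    obtain ⟨δ, hδ⟩ := coord_surjective ε (-(↑u⁻¹ * coord ε γ))
    have h1 : γ = δ ^ (p - 1) := by
      refine coord_injective ε ?_
      rw [coord_pow, hδ, Nat.cast_sub hp.out.one_le]
      have h2 : (1 - (p : ℤ_[p])) * ↑u⁻¹ = 1 := by rw [← hu, Units.mul_inv]
      push_cast
      linear_combination (-coord ε γ) * h2
    set χ : Γ →* ZMod p := (PowerSeries.constantCoeff (R := ZMod p) : _ →* ZMod p).comp
      ((iwasawaModP ε : IwasawaAlgebra p Γ →* PowerSeries (ZMod p)).comp iwasawaOf) with hχ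
    change χ γ = 1
    have h3 : χ δ ≠ 0 := by
      intro h0
      have h4 : χ (δ * δ⁻¹) = 1 := by rw [mul_inv_cancel, map_one]
      rw [map_mul, h0, zero_mul] at h4
      exact zero_ne_one h4
    rw [h1, map_pow, ZMod.pow_card_sub_one_eq_one h3]

end IwasawaAlgebraEquiv

end KidaGraph

namespace KidaGraph

universe u v w

open scoped Classical Matrix

set_option linter.unusedSectionVars false

/-! ### Cokernels of matrices over power series over a field -/

section Cokernel

/-- A power series over a field is a unit times `T ^ n`, and the remainders modulo `T ^ n` are
the truncated power series. -/
theorem card_quotient_span_powerSeries {k : Type*} [Field k] {a : PowerSeries k} (ha : a ≠ 0) :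
    Nat.card (PowerSeries k ⧸ Ideal.span {a}) = Nat.card k ^ a.order.toNat := by
  set n := a.order.toNat with hn
  have hspan : ∀ f : PowerSeries k, f ∈ Ideal.span {a} ↔ PowerSeries.X ^ n ∣ f := by
    intro f
    rw [Ideal.mem_span_singleton]
    have h1 : a.order = (n : ℕ∞) := (PowerSeries.coe_toNat_order ha).symm
    have h2 : Associated (PowerSeries.X ^ n) a := by
      obtain ⟨b, hb⟩ := PowerSeries.X_pow_order_dvd (φ := a)
      rw [← hn] at hb
      have h3 : IsUnit b := by
        rw [PowerSeries.isUnit_iff_constantCoeff, isUnit_iff_ne_zero]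
        intro h0
        have h4 := PowerSeries.coeff_order ha
        rw [← hn, hb, PowerSeries.coeff_X_pow_mul', if_pos le_rfl, Nat.sub_self,
          PowerSeries.coeff_zero_eq_constantCoeff_apply, h0] at h4
        exact h4 rfl
      obtain ⟨c, rfl⟩ := h3
      exact ⟨c, hb.symm⟩
    exact h2.dvd_iff_dvd_left.symm
  let φ : PowerSeries k →ₗ[k] (Fin n → k) := LinearMap.pi fun i => PowerSeries.coeff (i : ℕ)
  have hφ : Function.Surjective φ := fun c =>
    ⟨PowerSeries.mk fun i => if h : i < n then c ⟨i, h⟩ else 0, by ext i; simp [φ]⟩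
  have hker : ∀ f : PowerSeries k, f ∈ Ideal.span {a} ↔ φ f = 0 := by
    intro f
    rw [hspan, PowerSeries.X_pow_dvd_iff]
    exact ⟨fun h => funext fun i => h i i.2, fun h i hi => congrFun h ⟨i, hi⟩⟩
  have e : (PowerSeries k ⧸ Ideal.span {a}) ≃ (Fin n → k) := by
    refine Equiv.ofBijective (Quotient.lift φ fun f g hfg => ?_) ⟨?_, ?_⟩
    · have h1 : f - g ∈ Ideal.span {a} := (Submodule.quotientRel_def _).1 hfg
      rwa [hker, map_sub, sub_eq_zero] at h1
    · intro x y
      induction x using Submodule.Quotient.induction_on with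
      | H f =>
      induction y using Submodule.Quotient.induction_on with
      | H g =>
      intro h
      have h : φ f = φ g := h
      refine (Submodule.Quotient.eq _).2 ((hker _).2 ?_)
      rw [map_sub, h, sub_self]
    · intro c
      obtain ⟨f, hf⟩ := hφ c
      exact ⟨Submodule.Quotient.mk f, hf⟩
  rw [Nat.card_congr e, Nat.card_fun, Nat.card_fin]

/-- The cokernel of a square matrix over a power series ring over a field: its dimension is the
order of the determinant. -/
theorem card_coker_powerSeries {k V : Type*} [Field k] [Fintype V]
    (D : Matrix V V (PowerSeries k)) (hD : D.det ≠ 0) :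
    Nat.card ((V → PowerSeries k) ⧸ LinearMap.range D.vecMulLinear) =
      Nat.card k ^ D.det.order.toNat := by
  set N := LinearMap.range D.vecMulLinear with hN
  have hmem : ∀ z, z ᵥ* D ∈ N := fun z => ⟨z, rfl⟩
  have hinj : Function.Injective D.vecMulLinear := by
    rw [← LinearMap.ker_eq_bot, LinearMap.ker_eq_bot']
    intro z hz
    exact Matrix.eq_zero_of_vecMul_eq_zero hD hz
  have hrank : Module.finrank (PowerSeries k) N = Module.finrank (PowerSeries k) (V → PowerSeries k) :=
    LinearMap.finrank_range_of_inj hinj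
  obtain ⟨b, a, c, hc⟩ := Submodule.exists_smith_normal_form_of_rank_eq
    (Pi.basisFun (PowerSeries k) V) hrank
  -- the matrices of the two bases of `N` differ by a factor of determinant a unit
  set B : Matrix V V (PowerSeries k) := Matrix.of fun i => b i with hB
  have hA : ∀ i, (Matrix.diagonal a * B) i = c i := by
    intro i
    rw [hc]
    ext j
    rw [Matrix.diagonal_mul]
    rfl
  have h1 : ∃ P : Matrix V V (PowerSeries k), Matrix.diagonal a * B = P * D := by
    have : ∀ i, ∃ z, z ᵥ* D = (c i : V → PowerSeries k) := fun i => (c i).2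
    choose P hP using this
    refine ⟨Matrix.of P, ?_⟩
    refine Matrix.ext fun i j => ?_
    rw [hA, ← hP]
    rfl
  have h2 : ∃ P : Matrix V V (PowerSeries k), D = P * (Matrix.diagonal a * B) := by
    have hrow : ∀ i, D i ∈ N := fun i => ⟨Pi.single i 1, by
      rw [Matrix.vecMulLinear_apply, Matrix.single_one_vecMul]; rfl⟩
    refine ⟨Matrix.of fun i => c.repr ⟨D i, hrow i⟩, ?_⟩
    refine Matrix.ext fun i j => ?_
    have h3 : ∑ l, c.repr ⟨D i, hrow i⟩ l • (c l : V → PowerSeries k) j = D i j := by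
      have h4 := congrArg (fun x : N => (x : V → PowerSeries k) j) (c.sum_repr ⟨D i, hrow i⟩)
      simpa only [Submodule.coe_sum, Submodule.coe_smul, Finset.sum_apply, Pi.smul_apply] using h4
    rw [← h3, Matrix.mul_apply]
    refine Finset.sum_congr rfl fun l _ => ?_
    rw [hA]
    rfl
  have hBu : IsUnit B.det := by
    have h3 : ∃ Q : Matrix V V (PowerSeries k), 1 = Q * B := by
      refine ⟨Matrix.of fun i => b.repr (Pi.single i 1), ?_⟩
      refine Matrix.ext fun i j => ?_
      have h4 := congrFun (b.sum_repr (Pi.single i 1)) j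
      simp only [Finset.sum_apply, Pi.smul_apply] at h4
      rw [Matrix.one_apply, Matrix.mul_apply]
      refine Eq.trans ?_ h4.symm
      rw [Pi.single_apply]
      exact if_congr eq_comm rfl rfl
    obtain ⟨Q, hQ⟩ := h3
    have h4 := congrArg Matrix.det hQ
    rw [Matrix.det_one, Matrix.det_mul, mul_comm] at h4
    exact IsUnit.of_mul_eq_one _ h4.symm
  have hass : Associated D.det (∏ i, a i) := by
    have h3 : Associated (Matrix.diagonal a * B).det (∏ i, a i) := by
      rw [Matrix.det_mul, Matrix.det_diagonal]
      exact (associated_mul_unit_left _ _ hBu)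
    refine Associated.trans (associated_of_dvd_dvd ?_ ?_) h3
    · obtain ⟨P, hP⟩ := h1
      rw [hP, Matrix.det_mul]
      exact dvd_mul_left _ _
    · obtain ⟨P, hP⟩ := h2
      conv_rhs => rw [hP, Matrix.det_mul]
      exact dvd_mul_left _ _
  have hprod : ∏ i, a i ≠ 0 := fun h => hD (by rwa [h, associated_zero_iff_eq_zero] at hass)
  have ha : ∀ i, a i ≠ 0 := fun i => (Finset.prod_ne_zero_iff.1 hprod) i (Finset.mem_univ i)
  -- The Smith normal form splits the cokernel into cyclic modules.
  let φ : (V → PowerSeries k) →ₗ[PowerSeries k] (∀ i, PowerSeries k ⧸ Ideal.span {a i}) :=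
    LinearMap.pi fun i => (Submodule.mkQ (Ideal.span {a i})).comp (b.coord i)
  have hφ : Function.Surjective φ := by
    intro y
    choose f hf using fun i => Submodule.mkQ_surjective _ (y i)
    refine ⟨b.equivFun.symm f, funext fun i => ?_⟩
    rw [← hf]
    change Submodule.mkQ _ (b.equivFun (b.equivFun.symm f) i) = _
    rw [LinearEquiv.apply_symm_apply]
  have hker : LinearMap.ker φ = N := by
    ext x
    rw [LinearMap.mem_ker]
    constructor
    · intro hx
      have h3 : ∀ i, ∃ q, b.repr x i = a i * q := fun i => by
        have h4 := congrFun hx i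
        exact Ideal.mem_span_singleton.1 ((Submodule.Quotient.mk_eq_zero _).1 h4)
      choose q hq using h3
      rw [← b.sum_repr x]
      refine Submodule.sum_mem _ fun i _ => ?_
      rw [hq, mul_comm, mul_smul, ← hc]
      exact N.smul_mem _ (c i).2
    · intro hx
      have h3 := congrArg (fun x : N => φ x) (c.sum_repr ⟨x, hx⟩)
      change φ ((∑ i, c.repr ⟨x, hx⟩ i • c i : N) : V → PowerSeries k) = φ x at h3
      rw [← h3, Submodule.coe_sum, map_sum]
      refine Finset.sum_eq_zero fun i _ => ?_
      rw [Submodule.coe_smul, map_smul, hc]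
      have h4 : φ (a i • b i) = 0 := by
        funext j
        refine (Submodule.Quotient.mk_eq_zero _).2 (Ideal.mem_span_singleton.2 ?_)
        rw [map_smul, Module.Basis.coord_apply, Module.Basis.repr_self, smul_eq_mul, Finsupp.single_apply]
        split_ifs with h
        · rw [h, mul_one]
        · rw [mul_zero]
          exact dvd_zero _
      rw [h4, smul_zero]
  rw [← hker, Nat.card_congr (φ.quotKerEquivOfSurjective hφ).toEquiv, Nat.card_pi,
    Finset.prod_congr rfl fun i _ => card_quotient_span_powerSeries (ha i), Finset.prod_pow_eq_pow_sum]
  have hord : D.det.order = (∏ i, a i).order := by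
    obtain ⟨c, hc⟩ := hass
    rw [← hc, PowerSeries.order_mul, PowerSeries.order_zero_of_unit c.isUnit, add_zero]
  rw [hord, PowerSeries.order_prod]
  congr 1
  rw [ENat.toNat_sum]
  exact fun i _ => PowerSeries.order_eq_top.not.2 (ha i)

end Cokernel

end KidaGraph

namespace KidaGraph

universe u v w

open scoped Classical Matrix

set_option linter.unusedSectionVars false

/-! ### Modules with a square presentation matrix -/

section Presentation

variable {p : ℕ} [hp : Fact p.Prime] {Γ : Type v} [CommGroup Γ] [TopologicalSpace Γ]
  [IsTopologicalGroup Γ] [CompactSpace Γ] (ε : Γ ≃ₜ* Multiplicative ℤ_[p])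

theorem isDomain_iwasawaAlgebra (ε : Γ ≃ₜ* Multiplicative ℤ_[p]) : IsDomain (IwasawaAlgebra p Γ) :=
  (iwasawaEquiv (p := p) ε).toMulEquiv.isDomain (PowerSeries ℤ_[p])

theorem mem_primeToP_iff {r : IwasawaAlgebra p Γ} :
    r ∈ primeToP p Γ ↔ iwasawaModP (p := p) ε r ≠ 0 := by
  have h1 : Ideal.span {(p : IwasawaAlgebra p Γ)} = RingHom.ker (iwasawaModP (p := p) ε) := by
    ext a
    rw [Ideal.mem_span_singleton, RingHom.mem_ker, iwasawaModP_eq_zero_iff]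
  have h2 : (Ideal.span {(p : IwasawaAlgebra p Γ)}).IsPrime := h1 ▸ RingHom.ker_isPrime _
  have h3 : IsDomain (IwasawaAlgebra p Γ ⧸ Ideal.span {(p : IwasawaAlgebra p Γ)}) :=
    (Ideal.Quotient.isDomain_iff_prime _).2 h2
  change Ideal.Quotient.mk _ r ∈ nonZeroDivisors _ ↔ _
  rw [mem_nonZeroDivisors_iff_ne_zero, Ne, Ideal.Quotient.eq_zero_iff_mem, h1, RingHom.mem_ker]

/-- The matrix `D` is a square presentation matrix of `M`: the linear map `Φ`
is surjective and its kernel is spanned by the rows of `D`. -/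
def IsPresentation {R V M : Type*} [CommRing R] [Fintype V] [AddCommGroup M] [Module R M]
    (D : Matrix V V R) (Φ : (V → R) →ₗ[R] M) : Prop :=
  Function.Surjective Φ ∧ LinearMap.ker Φ = LinearMap.range D.vecMulLinear

section General

variable {R V M : Type*} [CommRing R] [Fintype V] [AddCommGroup M] [Module R M]
  {D : Matrix V V R} {Φ : (V → R) →ₗ[R] M}

theorem IsPresentation.apply_eq_zero_iff (h : IsPresentation D Φ) {b : V → R} :
    Φ b = 0 ↔ ∃ z, z ᵥ* D = b := by
  rw [← LinearMap.mem_ker, h.2]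
  rfl

theorem IsPresentation.finite (h : IsPresentation D Φ) : Module.Finite R M :=
  Module.Finite.of_surjective Φ h.1

/-- The determinant annihilates the module, by means of the adjugate matrix. -/
theorem IsPresentation.det_smul (h : IsPresentation D Φ) (m : M) : D.det • m = 0 := by
  obtain ⟨b, rfl⟩ := h.1 m
  rw [← map_smul, h.apply_eq_zero_iff]
  refine ⟨b ᵥ* D.adjugate, ?_⟩
  rw [Matrix.vecMul_vecMul, Matrix.adjugate_mul, Matrix.vecMul_smul, Matrix.vecMul_one]

/-- An element annihilating the module has a power divisible by the determinant. -/
theorem IsPresentation.det_dvd_pow (h : IsPresentation D Φ) {s : R} (hs : ∀ m : M, s • m = 0) :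
    D.det ∣ s ^ Fintype.card V := by
  have h1 : ∀ i, ∃ z, z ᵥ* D = s • (Pi.single i 1 : V → R) := fun i => by
    rw [← h.apply_eq_zero_iff, map_smul, hs]
  choose C hC using h1
  have h2 : Matrix.of C * D = s • (1 : Matrix V V R) := by
    refine Matrix.ext fun i j => ?_
    refine (congrFun (hC i) j).trans ?_
    rw [Pi.smul_apply, Matrix.smul_apply, Matrix.one_apply, Pi.single_apply]
    congr 1
    exact if_congr eq_comm rfl rfl
  have h3 := congrArg Matrix.det h2
  rw [Matrix.det_mul, Matrix.det_smul, Matrix.det_one, mul_one] at h3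
  exact ⟨_, h3.symm.trans (mul_comm _ _)⟩

end General

variable {V M : Type*} [Fintype V] [AddCommGroup M] [Module (IwasawaAlgebra p Γ) M]
  {D : Matrix V V (IwasawaAlgebra p Γ)} {Φ : (V → IwasawaAlgebra p Γ) →ₗ[IwasawaAlgebra p Γ] M}

theorem IsPresentation.isTorsion (ε : Γ ≃ₜ* Multiplicative ℤ_[p]) (h : IsPresentation D Φ)
    (hD : D.det ≠ 0) :
    Module.IsTorsion (IwasawaAlgebra p Γ) M := by
  have := isDomain_iwasawaAlgebra (p := p) ε
  intro m
  exact ⟨⟨D.det, mem_nonZeroDivisors_of_ne_zero hD⟩, h.det_smul m⟩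

/-- The localization at `(p)` vanishes if and only if some element prime to `p` annihilates the
module. The determinant is such an element as soon as there is one, since it divides a power of
every annihilator. -/
theorem IsPresentation.muInv_eq_zero_iff (h : IsPresentation D Φ) :
    muInv p Γ M = 0 ↔ iwasawaModP (p := p) ε D.det ≠ 0 := by
  rw [muInv, Module.length_eq_zero_iff, LocalizedModule.subsingleton_iff]
  constructor
  · intro hs
    choose s hs hsm using hs
    have h1 : ∀ m : M, (∏ i, s (Φ (Pi.single i 1))) • m = 0 := by
      intro m
      obtain ⟨b, rfl⟩ := h.1 m
      rw [← Finset.univ_sum_single b, map_sum, Finset.smul_sum]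
      refine Finset.sum_eq_zero fun i _ => ?_
      have h2 : (Pi.single i (b i) : V → IwasawaAlgebra p Γ) = b i • Pi.single i 1 := by
        rw [← Pi.single_smul, smul_eq_mul, mul_one]
      rw [h2, map_smul, smul_comm, ← Finset.prod_erase_mul _ _ (Finset.mem_univ i), mul_smul, hsm,
        smul_zero, smul_zero]
    intro h0
    have h2 := map_dvd (iwasawaModP (p := p) ε) (h.det_dvd_pow h1)
    rw [h0, zero_dvd_iff, map_pow, map_prod] at h2
    refine pow_ne_zero _ ?_ h2
    exact Finset.prod_ne_zero_iff.2 fun i _ => (mem_primeToP_iff ε).1 (hs _)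
  · intro h0 m
    exact ⟨D.det, (mem_primeToP_iff ε).2 h0, h.det_smul m⟩

variable [Module ℤ_[p] M]

/-- A module whose presentation matrix has determinant prime to `p` is finitely generated
over `ℤ_p`, by Weierstrass division by the determinant. -/
theorem IsPresentation.finite_padicInt (h : IsPresentation D Φ)
    (hC : ∀ (c : ℤ_[p]) (m : M), (iwasawaEquiv ε).symm (PowerSeries.C c) • m = c • m)
    (hD : iwasawaModP (p := p) ε D.det ≠ 0) : Module.Finite ℤ_[p] M := by
  set f := iwasawaEquiv ε D.det with hf
  have hf0 : f.map (IsLocalRing.residue ℤ_[p]) ≠ 0 := by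
    intro h0
    apply hD
    change f.map (PadicInt.toZMod (p := p)) = 0
    ext i
    have h1 := congrArg (PowerSeries.coeff i) h0
    rw [PowerSeries.coeff_map, map_zero, IsLocalRing.residue_eq_zero_iff, ← PadicInt.ker_toZMod] at h1
    rw [PowerSeries.coeff_map, map_zero]
    exact h1
  set d := (f.map (Ideal.Quotient.mk (IsLocalRing.maximalIdeal ℤ_[p]))).order.toNat with hd
  let gens : V × Fin d → M := fun x =>
    Φ (Pi.single x.1 ((iwasawaEquiv ε).symm (PowerSeries.X ^ (x.2 : ℕ))))
  refine ⟨⟨(Set.finite_range gens).toFinset, ?_⟩⟩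
  rw [Set.Finite.coe_toFinset, eq_top_iff]
  rintro m -
  obtain ⟨b, rfl⟩ := h.1 m
  rw [← Finset.univ_sum_single b, map_sum]
  refine Submodule.sum_mem _ fun x _ => ?_
  obtain ⟨q, r, hr, hqr⟩ := PowerSeries.exists_isWeierstrassDivision (iwasawaEquiv ε (b x)) hf0
  have h1 : b x = D.det * (iwasawaEquiv ε).symm q + (iwasawaEquiv ε).symm (r : PowerSeries ℤ_[p]) := by
    rw [← (iwasawaEquiv ε).symm_apply_apply (b x), hqr, map_add, map_mul, hf,
      RingEquiv.symm_apply_apply]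
  have h2 : (Pi.single x (D.det * (iwasawaEquiv ε).symm q) : V → IwasawaAlgebra p Γ) =
      D.det • Pi.single x ((iwasawaEquiv ε).symm q) := by
    rw [← Pi.single_smul, smul_eq_mul]
  rw [h1, Pi.single_add, map_add, h2, map_smul, h.det_smul, zero_add]
  have h3 : (r : PowerSeries ℤ_[p]) = ∑ i : Fin d, PowerSeries.C (r.coeff i) * PowerSeries.X ^ (i : ℕ) := by
    by_cases h0 : r = 0
    · simp [h0]
    rw [Fin.sum_univ_eq_sum_range (fun i => PowerSeries.C (r.coeff i) * PowerSeries.X ^ i) d]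
    conv_lhs => rw [r.as_sum_range' d ((Polynomial.natDegree_lt_iff_degree_lt h0).2 hr)]
    rw [← Polynomial.coeToPowerSeries.ringHom_apply, map_sum]
    refine Finset.sum_congr rfl fun i _ => ?_
    simp [← Polynomial.C_mul_X_pow_eq_monomial]
  rw [h3, map_sum, ← LinearMap.single_apply (R := IwasawaAlgebra p Γ), map_sum, map_sum]
  refine Submodule.sum_mem _ fun i _ => ?_
  rw [map_mul, ← smul_eq_mul, map_smul, map_smul, hC]
  exact Submodule.smul_mem _ _ (Submodule.subset_span ⟨(x, i), rfl⟩)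

/-- A module with a square presentation matrix has no `p`-torsion if the determinant is prime to
`p`: the matrix is injective modulo `p`, so that the coefficients of a relation divisible by `p`
are divisible by `p`. -/
theorem IsPresentation.isTorsionFree_padicInt (h : IsPresentation D Φ)
    (hC : ∀ (c : ℤ_[p]) (m : M), (iwasawaEquiv ε).symm (PowerSeries.C c) • m = c • m)
    (hD : iwasawaModP (p := p) ε D.det ≠ 0) : Module.IsTorsionFree ℤ_[p] M := by
  have := isDomain_iwasawaAlgebra (p := p) ε
  have hp0 : (p : IwasawaAlgebra p Γ) ≠ 0 := by
    intro h0
    have := congrArg (iwasawaEquiv ε) h0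
    rw [map_natCast, map_zero] at this
    exact natCast_p_ne_zero this
  have h1 : ∀ m : M, (p : ℤ_[p]) • m = 0 → m = 0 := by
    intro m hm
    obtain ⟨b, rfl⟩ := h.1 m
    rw [← hC, map_natCast, map_natCast, ← map_smul, h.apply_eq_zero_iff] at hm
    obtain ⟨z, hz⟩ := hm
    have h2 : ((iwasawaModP (p := p) ε) ∘ z) = 0 := by
      have h3 : ((iwasawaModP (p := p) ε) ∘ z) ᵥ* D.map (iwasawaModP (p := p) ε) = 0 := by
        funext x
        rw [← RingHom.map_vecMul, hz, Pi.smul_apply, Pi.zero_apply, iwasawaModP_eq_zero_iff]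
        exact dvd_mul_right _ _
      refine Matrix.eq_zero_of_vecMul_eq_zero ?_ h3
      rwa [← RingHom.mapMatrix_apply, ← RingHom.map_det]
    have h3 : ∀ x, ∃ y, z x = p * y := fun x => (iwasawaModP_eq_zero_iff ε).1 (congrFun h2 x)
    choose y hy using h3
    rw [h.apply_eq_zero_iff]
    refine ⟨y, ?_⟩
    have h4 : z = (p : IwasawaAlgebra p Γ) • y := funext hy
    rw [h4, Matrix.smul_vecMul] at hz
    exact smul_right_injective _ hp0 hz
  have h2 : ∀ (c : ℤ_[p]) (m : M), c ≠ 0 → c • m = 0 → m = 0 := by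
    intro c m hc hcm
    rw [PadicInt.unitCoeff_spec hc, mul_smul] at hcm
    have h3 : ∀ k : ℕ, ∀ m : M, (p : ℤ_[p]) ^ k • m = 0 → m = 0 := by
      intro k
      induction k with
      | zero => intro m hm; rwa [pow_zero, one_smul] at hm
      | succ k ih =>
        intro m hm
        rw [pow_succ, mul_smul] at hm
        exact h1 m (ih _ hm)
    exact h3 _ _ ((IsUnit.smul_eq_zero (PadicInt.unitCoeff hc).isUnit).1 hcm)
  exact Module.IsTorsionFree.of_smul_eq_zero fun c m hcm => or_iff_not_imp_left.2 fun hc => h2 c m hc hcm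

theorem card_eq_of_ker_eq {B A A' : Type*} [AddGroup B] [AddGroup A] [AddGroup A'] (f : B →+ A)
    (g : B →+ A') (hf : Function.Surjective f) (hg : Function.Surjective g)
    (h : ∀ b, f b = 0 ↔ g b = 0) : Nat.card A = Nat.card A' := by
  have h1 : f.ker = g.ker := by
    ext b
    exact h b
  rw [← Nat.card_congr (QuotientAddGroup.quotientKerEquivOfSurjective f hf).toEquiv,
    ← Nat.card_congr (QuotientAddGroup.quotientKerEquivOfSurjective g hg).toEquiv, h1]

/-- The `λ`-invariant is the order of the determinant modulo `p`. -/
theorem IsPresentation.lambdaInv_eq (h : IsPresentation D Φ)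
    (hC : ∀ (c : ℤ_[p]) (m : M), (iwasawaEquiv ε).symm (PowerSeries.C c) • m = c • m)
    (hD : iwasawaModP (p := p) ε D.det ≠ 0) :
    lambdaInv p M = (iwasawaModP (p := p) ε D.det).order.toNat := by
  have := h.finite_padicInt ε hC hD
  have := h.isTorsionFree_padicInt ε hC hD
  have hfin : lambdaInv p M = Module.finrank ℤ_[p] M := Module.finrank_baseChange
  set b := Module.finBasis ℤ_[p] M with hb
  set D' := D.map (iwasawaModP (p := p) ε) with hD'
  have hdet : D'.det = iwasawaModP (p := p) ε D.det := by
    rw [hD', ← RingHom.mapMatrix_apply, ← RingHom.map_det]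
  -- both sides compute the order of `M/pM`
  let g : (V → IwasawaAlgebra p Γ) →+
      (V → PowerSeries (ZMod p)) ⧸ LinearMap.range D'.vecMulLinear :=
    (Submodule.mkQ _).toAddMonoidHom.comp
      ((iwasawaModP (p := p) ε : _ →+ PowerSeries (ZMod p)).compLeft V)
  let g' : (V → IwasawaAlgebra p Γ) →+ (Fin (Module.finrank ℤ_[p] M) → ZMod p) :=
    ((PadicInt.toZMod (p := p) : ℤ_[p] →+ ZMod p).compLeft _).comp
      (b.equivFun.toLinearMap.toAddMonoidHom.comp Φ.toAddMonoidHom)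
  have hsurj : Function.Surjective (PadicInt.toZMod (p := p)) := ZMod.ringHom_surjective _
  have hg : Function.Surjective g := by
    refine (Submodule.mkQ_surjective _).comp fun y => ?_
    choose x hx using fun i => iwasawaModP_surjective (p := p) ε (y i)
    exact ⟨x, funext hx⟩
  have hg' : Function.Surjective g' := by
    refine Function.Surjective.comp (g := (PadicInt.toZMod (p := p) : ℤ_[p] →+ ZMod p).compLeft _)
      (fun y => ?_) (b.equivFun.surjective.comp h.1)
    choose x hx using fun i => hsurj (y i)
    exact ⟨x, funext hx⟩
  have key : ∀ a, g a = 0 ↔ g' a = 0 := by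
    intro a
    have h1 : g a = 0 ↔ ∃ z y, a = z ᵥ* D + (p : IwasawaAlgebra p Γ) • y := by
      refine (Submodule.Quotient.mk_eq_zero _).trans ?_
      constructor
      · rintro ⟨z, hz⟩
        choose x hx using fun i => iwasawaModP_surjective (p := p) ε (z i)
        obtain rfl : (iwasawaModP (p := p) ε) ∘ x = z := funext hx
        rw [Matrix.vecMulLinear_apply, hD'] at hz
        have h2 : ∀ i, ∃ y, a i - (x ᵥ* D) i = p * y := fun i => by
          refine (iwasawaModP_eq_zero_iff ε).1 ?_
          rw [map_sub, sub_eq_zero]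
          exact ((RingHom.map_vecMul _ _ _ i).trans (congrFun hz i)).symm
        choose y hy using h2
        exact ⟨x, y, funext fun i => (sub_eq_iff_eq_add'.1 (hy i))⟩
      · rintro ⟨z, y, rfl⟩
        refine ⟨(iwasawaModP (p := p) ε) ∘ z, ?_⟩
        rw [Matrix.vecMulLinear_apply, hD']
        funext i
        change _ = iwasawaModP (p := p) ε ((z ᵥ* D) i + p * y i)
        rw [map_add, (iwasawaModP_eq_zero_iff ε).2 (dvd_mul_right _ (y i)), add_zero]
        exact (RingHom.map_vecMul _ _ _ i).symm
    have h2 : g' a = 0 ↔ ∃ z y, a = z ᵥ* D + (p : IwasawaAlgebra p Γ) • y := by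
      have h3 : g' a = 0 ↔ ∃ m : M, Φ a = (p : ℤ_[p]) • m := by
        constructor
        · intro h3
          have h4 : ∀ i, ∃ c, b.equivFun (Φ a) i = p * c := fun i => by
            have h5 : PadicInt.toZMod (b.equivFun (Φ a) i) = 0 := congrFun h3 i
            rw [← RingHom.mem_ker, PadicInt.ker_toZMod, PadicInt.maximalIdeal_eq_span_p,
              Ideal.mem_span_singleton] at h5
            exact h5
          choose c hc using h4
          refine ⟨b.equivFun.symm c, b.equivFun.injective ?_⟩
          rw [map_smul, LinearEquiv.apply_symm_apply]
          exact funext hc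
        · rintro ⟨m, hm⟩
          funext i
          change PadicInt.toZMod (b.equivFun (Φ a) i) = 0
          rw [hm, map_smul, Pi.smul_apply, smul_eq_mul, map_mul, map_natCast, CharP.cast_eq_zero,
            zero_mul]
      rw [h3]
      constructor
      · rintro ⟨m, hm⟩
        obtain ⟨y, rfl⟩ := h.1 m
        rw [← hC, map_natCast, map_natCast, ← map_smul, ← sub_eq_zero, ← map_sub,
          h.apply_eq_zero_iff] at hm
        obtain ⟨z, hz⟩ := hm
        exact ⟨z, y, (sub_eq_iff_eq_add.1 hz.symm)⟩
      · rintro ⟨z, y, rfl⟩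
        refine ⟨Φ y, ?_⟩
        rw [map_add, h.apply_eq_zero_iff.2 ⟨z, rfl⟩, zero_add, map_smul, ← hC, map_natCast,
          map_natCast]
    rw [h1, h2]
  have hcard := card_eq_of_ker_eq g g' hg hg' key
  rw [card_coker_powerSeries _ (hdet ▸ hD), Nat.card_fun, Nat.card_fin, Nat.card_zmod, hdet] at hcard
  rw [hfin]
  exact (Nat.pow_right_injective hp.out.two_le hcard).symm

end Presentation

end KidaGraph

namespace KidaGraph

universe u v w

open scoped Classical Matrix TensorProduct

set_option linter.unusedSectionVars false

/-! ### Picard groups at finite level -/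

section PicClass

variable (p : ℕ) [hp : Fact p.Prime] (Y : FinGraph.{u})

variable {Y} in
theorem FinGraph.lap_eq_sum (R : Type*) [CommRing R] (f : Y.V → R) :
    Y.lap R f = ∑ e, f (Y.s e) • FinGraph.bd R e := by
  funext w
  rw [FinGraph.lap_apply, Finset.sum_apply]
  have h1 : (∑ e, if Y.s e = w then f (Y.t e) else 0) = ∑ e, if Y.t e = w then f (Y.s e) else 0 := by
    let φ : Y.E ≃ Y.E := ⟨Y.bar, Y.bar, Y.bar_bar, Y.bar_bar⟩
    rw [← φ.sum_comp]
    refine Finset.sum_congr rfl fun e _ => ?_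
    change (if Y.s (Y.bar e) = w then f (Y.t (Y.bar e)) else 0) = _
    rw [Y.s_bar, Y.t_bar]
  have h2 : ∀ e, (if Y.s e = w then f w - f (Y.t e) else 0) =
      (if Y.s e = w then f (Y.s e) else 0) - (if Y.s e = w then f (Y.t e) else 0) := by
    intro e
    split_ifs with h
    · rw [h]
    · rw [sub_zero]
  rw [Finset.sum_congr rfl fun e _ => h2 e, Finset.sum_sub_distrib, h1, ← Finset.sum_sub_distrib]
  refine Finset.sum_congr rfl fun e _ => ?_
  simp only [FinGraph.bd, Pi.smul_apply, Pi.sub_apply, Pi.single_apply, smul_eq_mul, mul_sub,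
    mul_ite, mul_one, mul_zero, eq_comm (a := w)]

theorem FinGraph.laplacian_single (w : Y.V) : Y.laplacian (Finsupp.single w 1) =
    ∑ e, if Y.s e = w then (Finsupp.single (Y.s e) 1 - Finsupp.single (Y.t e) 1 : Y.Div) else 0 := by
  rw [FinGraph.laplacian, Finsupp.linearCombination_single, one_smul, finsum_eq_sum_of_fintype,
    ← Finset.sum_filter]
  rw [Finset.sum_subtype (Finset.univ.filter fun e => Y.s e = w) (p := fun e => Y.s e = w) (by simp)]
  refine Fintype.sum_congr _ _ fun e => ?_
  rw [e.2]

/-- The class in `ℤ_p ⊗ Pic(Y)` of a divisor with coefficients in `ℤ_p`. -/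
noncomputable def picClass : (Y.V → ℤ_[p]) →ₗ[ℤ_[p]] ℤ_[p] ⊗[ℤ] Y.Pic :=
  Fintype.linearCombination ℤ_[p] fun w => 1 ⊗ₜ[ℤ] Submodule.Quotient.mk (Finsupp.single w 1)

theorem picClass_single (w : Y.V) (c : ℤ_[p]) :
    picClass p Y (Pi.single w c) = c ⊗ₜ[ℤ] Submodule.Quotient.mk (Finsupp.single w 1) := by
  rw [picClass, Fintype.linearCombination_apply_single, TensorProduct.smul_tmul', smul_eq_mul, mul_one]

theorem picClass_surjective : Function.Surjective (picClass p Y) := by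
  rw [← LinearMap.range_eq_top, eq_top_iff]
  rintro x -
  induction x using TensorProduct.induction_on with
  | zero => exact zero_mem _
  | add x y hx hy => exact add_mem hx hy
  | tmul c y =>
    induction y using Submodule.Quotient.induction_on with
    | H D =>
      induction D using Finsupp.induction_linear with
      | zero => rw [Submodule.Quotient.mk_zero, TensorProduct.tmul_zero]; exact zero_mem _
      | add D D' h h' => rw [Submodule.Quotient.mk_add, TensorProduct.tmul_add]; exact add_mem h h'
      | single w n =>
        refine ⟨Pi.single w (n • c), ?_⟩
        rw [picClass_single, TensorProduct.smul_tmul, ← Submodule.Quotient.mk_smul,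
          Finsupp.smul_single, smul_eq_mul, mul_one]

/-- A divisor with coefficients in `ℤ`, with its coefficients in `ℤ_p`. -/
noncomputable def divToFun : Y.Div →ₗ[ℤ] (Y.V → ℤ_[p]) :=
  Finsupp.linearCombination ℤ fun w => Pi.single w 1

/-- The Laplacian of divisors and the one of functions agree after the identification of divisors
with functions. -/
theorem picClass_eq_zero_iff {f : Y.V → ℤ_[p]} :
    picClass p Y f = 0 ↔ f ∈ LinearMap.range (Y.lap ℤ_[p]) := by
  have hsingle : ∀ w, Y.lap ℤ_[p] (Pi.single w 1) =
      ∑ e, if Y.s e = w then FinGraph.bd ℤ_[p] e else 0 := by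
    intro w
    rw [FinGraph.lap_eq_sum]
    refine Finset.sum_congr rfl fun e _ => ?_
    rw [Pi.single_apply]
    split_ifs
    · rw [one_smul]
    · rw [zero_smul]
  constructor
  · intro h
    have hle : LinearMap.range Y.laplacian ≤ LinearMap.ker
        (((LinearMap.range (Y.lap ℤ_[p])).mkQ.restrictScalars ℤ).comp (divToFun p Y)) := by
      rintro _ ⟨D, rfl⟩
      rw [LinearMap.mem_ker]
      induction D using Finsupp.induction_linear with
      | zero => simp only [map_zero]
      | add D D' h h' => rw [map_add, map_add, h, h', add_zero]
      | single w n =>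
        have h1 : (Finsupp.single w n : Y.Div) = n • Finsupp.single w 1 := by
          rw [Finsupp.smul_single, smul_eq_mul, mul_one]
        have h2 : divToFun p Y (Y.laplacian (Finsupp.single w 1)) = Y.lap ℤ_[p] (Pi.single w 1) := by
          rw [FinGraph.laplacian_single, hsingle, map_sum]
          refine Finset.sum_congr rfl fun e _ => ?_
          split_ifs
          · simp [divToFun, FinGraph.bd]
          · exact map_zero _
        rw [h1, map_smul, map_smul]
        refine smul_eq_zero_of_right _ ?_
        rw [LinearMap.comp_apply, h2]
        exact (Submodule.Quotient.mk_eq_zero _).2 ⟨_, rfl⟩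
    let ψ : ℤ_[p] ⊗[ℤ] Y.Pic →ₗ[ℤ_[p]] (Y.V → ℤ_[p]) ⧸ LinearMap.range (Y.lap ℤ_[p]) :=
      LinearMap.liftBaseChange ℤ_[p] (Submodule.liftQ _ _ hle)
    have h1 : ψ.comp (picClass p Y) = (LinearMap.range (Y.lap ℤ_[p])).mkQ := by
      refine LinearMap.pi_ext' fun w => LinearMap.ext_ring ?_
      change ψ (picClass p Y (Pi.single w 1)) = Submodule.mkQ _ (Pi.single w 1)
      rw [picClass_single, LinearMap.liftBaseChange_tmul, one_smul]
      change Submodule.mkQ _ (divToFun p Y (Finsupp.single w 1)) = _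
      simp [divToFun]
    have h2 := LinearMap.congr_fun h1 f
    rw [LinearMap.comp_apply, h, map_zero] at h2
    exact (Submodule.Quotient.mk_eq_zero _).1 h2.symm
  · rintro ⟨g, rfl⟩
    have h1 : (picClass p Y).comp (Y.lap ℤ_[p]) = 0 := by
      refine LinearMap.pi_ext' fun w => LinearMap.ext_ring ?_
      change picClass p Y (Y.lap ℤ_[p] (Pi.single w 1)) = 0
      have h2 : picClass p Y (Y.lap ℤ_[p] (Pi.single w 1)) =
          1 ⊗ₜ[ℤ] Submodule.Quotient.mk (Y.laplacian (Finsupp.single w 1)) := by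
        rw [hsingle, FinGraph.laplacian_single, map_sum, ← Submodule.mkQ_apply, map_sum,
          TensorProduct.tmul_sum]
        refine Finset.sum_congr rfl fun e _ => ?_
        split_ifs
        · rw [FinGraph.bd, map_sub, map_sub, picClass_single, picClass_single, TensorProduct.tmul_sub]
          rfl
        · rw [map_zero, map_zero, TensorProduct.tmul_zero]
      rw [h2, (Submodule.Quotient.mk_eq_zero _).2 (LinearMap.mem_range_self _ _), TensorProduct.tmul_zero]
    exact LinearMap.congr_fun h1 g

end PicClass

namespace Voltage

section FiniteLevel

variable {X : FinGraph.{u}} {k : Type*} [CommRing k]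

theorem vecMul_lapMatrix {H : Type v} [Group H] (C : Voltage X H) (θ : H →* k) (f : X.V → k) :
    f ᵥ* C.lapMatrix θ = ∑ e, (Pi.single (X.s e) (f (X.s e)) -
      Pi.single (X.t e) (f (X.s e) * θ (C.α e))) := by
  funext y
  rw [Matrix.vecMul, dotProduct, Finset.sum_apply]
  simp only [lapMatrix, Matrix.of_apply, Finset.mul_sum]
  rw [Finset.sum_comm]
  refine Finset.sum_congr rfl fun e _ => ?_
  rw [Finset.sum_eq_single (X.s e)]
  · rw [if_pos rfl, Pi.sub_apply, Pi.single_apply, Pi.single_apply, mul_sub, mul_ite, mul_ite,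
      mul_one, mul_zero]
    simp only [eq_comm (a := y)]
  · intro x _ hx
    rw [if_neg (Ne.symm hx), mul_zero]
  · intro h
    exact absurd (Finset.mem_univ _) h

variable {H : Type v} [CommGroup H] [Fintype H] (C : Voltage X H)

/-- The divisor `∑ c_x · (vertex over x)` of the derived graph, for coefficients `c_x` in the group
ring. -/
noncomputable def toVert (k : Type*) [CommRing k] :
    (X.V → MonoidAlgebra k H) →+ (C.derived.V → k) where
  toFun c := ∑ x, ∑ h, Pi.single (C.vert x h) ((c x).coeff h)
  map_zero' := by simp
  map_add' c c' := by
    simp only [Pi.add_apply, MonoidAlgebra.coeff_add, Finsupp.add_apply, Pi.single_add,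
      Finset.sum_add_distrib]

theorem toVert_single (x : X.V) (h : H) (r : k) :
    C.toVert k (Pi.single x (MonoidAlgebra.single h r)) = Pi.single (C.vert x h) r := by
  change ∑ y, ∑ h', Pi.single (M := fun _ => k) (C.vert y h')
    (((Pi.single x (MonoidAlgebra.single h r) : X.V → MonoidAlgebra k H) y).coeff h') = _
  rw [Finset.sum_eq_single x, Finset.sum_eq_single h]
  · rw [Pi.single_eq_same, MonoidAlgebra.coeff_single, Finsupp.single_eq_same]
  · intro h' _ hne
    rw [Pi.single_eq_same, MonoidAlgebra.coeff_single, Finsupp.single_eq_of_ne hne, Pi.single_zero]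
  · exact fun h' => absurd (Finset.mem_univ _) h'
  · intro y _ hne
    refine Finset.sum_eq_zero fun h' _ => ?_
    rw [Pi.single_eq_of_ne hne, MonoidAlgebra.coeff_zero, Finsupp.zero_apply, Pi.single_zero]
  · exact fun h' => absurd (Finset.mem_univ _) h'

theorem addHom_ext_single {M : Type*} [AddCommMonoid M] {f g : (X.V → MonoidAlgebra k H) →+ M}
    (h : ∀ x h r, f (Pi.single x (MonoidAlgebra.single h r)) =
      g (Pi.single x (MonoidAlgebra.single h r))) : f = g := by
  refine AddMonoidHom.functions_ext _ _ _ fun x c => ?_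
  induction c using MonoidAlgebra.induction_linear with
  | zero => simp only [Pi.single_zero, map_zero]
  | add a b ha hb => rw [Pi.single_add, map_add, map_add, ha, hb]
  | single q r => exact h x q r

theorem toVert_surjective : Function.Surjective (C.toVert k) := by
  intro f
  rw [← Finset.univ_sum_single f]
  have h1 : ∀ w, ∃ c, C.toVert k c = Pi.single w (f w) := fun w => by
    obtain ⟨x, h, rfl⟩ := exists_vert _ w
    exact ⟨_, C.toVert_single x h _⟩
  choose c hc using h1
  exact ⟨∑ w, c w, by rw [map_sum, Finset.sum_congr rfl fun w _ => hc w]⟩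

/-- The lift of a divisor on the derived graph which is invariant under the inertia groups. -/
noncomputable def ofVert (f : C.derived.V → k) (x : X.V) : MonoidAlgebra k H :=
  ∑ h, MonoidAlgebra.single h (f (C.vert x h))

theorem single_mul_ofVert (f : C.derived.V → k) {x : X.V} {i : H} (hi : i ∈ C.I x) :
    MonoidAlgebra.single i 1 * C.ofVert f x = C.ofVert f x := by
  rw [ofVert, Finset.mul_sum]
  refine Eq.trans ?_ (Equiv.sum_comp (Equiv.mulLeft i) fun h => MonoidAlgebra.single h (f (C.vert x h)))
  refine Finset.sum_congr rfl fun h _ => ?_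
  rw [MonoidAlgebra.single_mul_single, one_mul, Equiv.coe_mulLeft]
  congr 2
  rw [vert_eq_iff]
  refine ⟨rfl, ?_⟩
  change h⁻¹ * (i * h) ∈ _
  rwa [mul_comm i h, inv_mul_cancel_left]

/-- The Laplacian of the derived graph is induced by the twisted Laplacian of the base. -/
theorem toVert_vecMul (f : C.derived.V → k) :
    C.toVert k (C.ofVert f ᵥ* C.lapMatrix (MonoidAlgebra.of k H)) = C.derived.lap k f := by
  rw [vecMul_lapMatrix, FinGraph.lap_eq_sum, map_sum]
  rw [sum_derived_E]
  refine Finset.sum_congr rfl fun e _ => ?_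
  have hsum : ∀ (x : X.V) (F : H → MonoidAlgebra k H),
      (Pi.single x (∑ h, F h) : X.V → MonoidAlgebra k H) = ∑ h, Pi.single x (F h) := fun x F =>
    map_sum (AddMonoidHom.single (fun _ : X.V => MonoidAlgebra k H) x) F _
  rw [ofVert, Finset.sum_mul, hsum, hsum, map_sub, map_sum, map_sum, ← Finset.sum_sub_distrib]
  refine Finset.sum_congr rfl fun h _ => ?_
  rw [MonoidAlgebra.of_apply, MonoidAlgebra.single_mul_single, mul_one, toVert_single, toVert_single]
  change Pi.single (M := fun _ => k) (C.vert (X.s e) h) (f (C.vert (X.s e) h)) -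
    Pi.single (M := fun _ => k) (C.vert (X.t e) (h * C.α e)) (f (C.vert (X.s e) h)) =
    f (C.vert (X.s e) h) • (Pi.single (C.vert (X.s e) h) 1 - Pi.single (C.vert (X.t e) (h * C.α e)) 1)
  rw [smul_sub, ← Pi.single_smul, ← Pi.single_smul, smul_eq_mul, mul_one]

/-- The coefficient at `x` of an element with trivial divisor is trivial modulo the inertia group
of `x`. -/
theorem mapDomain_eq_zero_of_toVert {H' : Type*} [Group H'] (φ : H →* H') {x : X.V}
    (hφ : C.I x ≤ φ.ker) {c : X.V → MonoidAlgebra k H} (hc : C.toVert k c = 0) :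
    MonoidAlgebra.mapDomainRingHom k φ (c x) = 0 := by
  let T : (C.derived.V → k) →+ MonoidAlgebra k H' :=
    { toFun := fun f => ∑ q : H ⧸ C.I x, MonoidAlgebra.single (φ q.out) (f (C.vert x q.out))
      map_zero' := by simp
      map_add' := fun f g => by
        rw [← Finset.sum_add_distrib]
        refine Finset.sum_congr rfl fun q _ => ?_
        rw [Pi.add_apply, MonoidAlgebra.single_add] }
  have h1 : T.comp (C.toVert k) = (MonoidAlgebra.mapDomainRingHom k φ : _ →+ MonoidAlgebra k H').comp
      (Pi.evalAddMonoidHom (fun _ : X.V => MonoidAlgebra k H) x) := by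
    refine addHom_ext_single fun y h r => ?_
    change T (C.toVert k _) = MonoidAlgebra.mapDomainRingHom k φ
      ((Pi.single y (MonoidAlgebra.single h r) : X.V → MonoidAlgebra k H) x)
    rw [toVert_single]
    change ∑ q : H ⧸ C.I x, MonoidAlgebra.single (φ q.out) ((Pi.single (C.vert y h) r :
      C.derived.V → k) (C.vert x q.out)) = _
    by_cases hx : x = y
    · subst hx
      rw [Pi.single_eq_same, Finset.sum_eq_single (h : H ⧸ C.I x)]
      · have h0 : (h : H ⧸ C.I x).out⁻¹ * h ∈ C.I x := by
          rw [← QuotientGroup.eq, QuotientGroup.out_eq']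
        have h2 : φ (h : H ⧸ C.I x).out = φ h := by
          rw [← inv_mul_eq_one, ← map_inv, ← map_mul, ← MonoidHom.mem_ker]
          exact hφ h0
        have h3 : C.vert x (h : H ⧸ C.I x).out = C.vert x h := (vert_eq_iff _).2 ⟨rfl, h0⟩
        rw [h2, h3, Pi.single_eq_same]
        exact (MonoidAlgebra.mapDomain_single ..).symm
      · intro q _ hq
        rw [Pi.single_eq_of_ne, MonoidAlgebra.single_zero]
        intro h4
        refine hq ?_
        rw [← QuotientGroup.out_eq' q, QuotientGroup.eq]
        exact ((vert_eq_iff _).1 h4).2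
      · intro h'
        exact absurd (Finset.mem_univ _) h'
    · rw [Pi.single_eq_of_ne hx, map_zero]
      refine Finset.sum_eq_zero fun q _ => ?_
      rw [Pi.single_eq_of_ne, MonoidAlgebra.single_zero]
      exact fun h4 => hx ((vert_eq_iff _).1 h4).1
  have h2 := DFunLike.congr_fun h1 c
  rw [AddMonoidHom.comp_apply, hc, map_zero] at h2
  exact h2.symm

/-- At a vertex with trivial inertia group, the row of the twisted Laplacian becomes a principal
divisor. -/
theorem toVert_row {x : X.V} (hx : C.I x = ⊥) :
    C.toVert k (C.lapMatrix (MonoidAlgebra.of k H) x) ∈ LinearMap.range (C.derived.lap k) := by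
  refine ⟨Pi.single (C.vert x 1) 1, ?_⟩
  rw [← toVert_vecMul]
  congr 1
  have h1 : C.ofVert (Pi.single (C.vert x 1) (1 : k)) = Pi.single x 1 := by
    funext y
    rw [ofVert, Finset.sum_eq_single 1]
    · by_cases hy : y = x
      · subst hy
        rw [Pi.single_eq_same, Pi.single_eq_same]
        rfl
      · rw [Pi.single_eq_of_ne hy, Pi.single_eq_of_ne, MonoidAlgebra.single_zero]
        exact fun h => hy ((vert_eq_iff _).1 h).1
    · intro h _ hh
      rw [Pi.single_eq_of_ne, MonoidAlgebra.single_zero]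
      intro h2
      obtain ⟨rfl, h3⟩ := (vert_eq_iff _).1 h2
      rw [hx, Subgroup.mem_bot, mul_one, inv_eq_one] at h3
      exact hh h3
    · intro h'
      exact absurd (Finset.mem_univ _) h'
  rw [h1, Matrix.single_one_vecMul]
  rfl

/-- The relation given by an element of the inertia group. -/
theorem toVert_inertia {x : X.V} {i : H} (hi : i ∈ C.I x) :
    C.toVert k (Pi.single x (MonoidAlgebra.of k H i - 1)) = 0 := by
  have h1 : C.vert x i = C.vert x 1 := by
    rw [vert_eq_iff, mul_one]
    exact ⟨rfl, inv_mem hi⟩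
  rw [Pi.single_sub, map_sub, MonoidAlgebra.of_apply, MonoidAlgebra.one_def, toVert_single,
    toVert_single, h1, sub_self]

end FiniteLevel

end Voltage

end KidaGraph

namespace KidaGraph

universe u v w

open scoped Classical Matrix

set_option linter.unusedSectionVars false

/-! ### The presentation of the limit of the Picard groups -/

section LevelElt

variable {p : ℕ} [hp : Fact p.Prime] {Γ : Type v} [CommGroup Γ] [TopologicalSpace Γ]
  [IsTopologicalGroup Γ] [CompactSpace Γ] (ε : Γ ≃ₜ* Multiplicative ℤ_[p])

theorem isLocalRing_iwasawaAlgebra (ε : Γ ≃ₜ* Multiplicative ℤ_[p]) :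
    IsLocalRing (IwasawaAlgebra p Γ) := by
  have := (isDomain_iwasawaAlgebra (p := p) ε).toNontrivial
  exact IsLocalRing.of_surjective' ((iwasawaEquiv (p := p) ε).symm : PowerSeries ℤ_[p] →+* _)
    (iwasawaEquiv (p := p) ε).symm.surjective

theorem isNoetherianRing_iwasawaAlgebra (ε : Γ ≃ₜ* Multiplicative ℤ_[p]) :
    IsNoetherianRing (IwasawaAlgebra p Γ) :=
  isNoetherianRing_of_ringEquiv (PowerSeries ℤ_[p]) (iwasawaEquiv (p := p) ε).symm

/-- The element `γ^{p^n} - 1` of the Iwasawa algebra. -/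
noncomputable def levelElt (n : ℕ) : IwasawaAlgebra p Γ := iwasawaOf (gen ε) ^ p ^ n - 1

theorem iwasawaEquiv_levelElt (n : ℕ) :
    iwasawaEquiv ε (levelElt (p := p) ε n) = (omega p n : Polynomial ℤ_[p]) := by
  rw [levelElt, map_sub, map_pow, iwasawaEquiv_gen, map_one, omega]
  simp

theorem iwasawaProj_eq_levelMap (n : ℕ) (a : IwasawaAlgebra p Γ) :
    iwasawaProj ε n a = levelMap ε n (iwasawaEquiv ε a) := by
  rw [← iwasawaProj_powerSeriesToIwasawa]
  congr 1
  exact ((iwasawaEquiv (p := p) ε).symm_apply_apply a).symm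

theorem iwasawaProj_eq_zero_iff {n : ℕ} {a : IwasawaAlgebra p Γ} :
    iwasawaProj ε n a = 0 ↔ levelElt ε n ∣ a := by
  rw [iwasawaProj_eq_levelMap, levelMap_eq_zero_iff, ← iwasawaEquiv_levelElt ε, map_dvd_iff]

theorem iwasawaProj_surjective (n : ℕ) : Function.Surjective (iwasawaProj (p := p) ε n) := fun b => by
  obtain ⟨f, hf⟩ := levelMap_surjective ε n b
  exact ⟨powerSeriesToIwasawa ε f, by rw [iwasawaProj_powerSeriesToIwasawa, hf]⟩

theorem levelElt_ne_zero (n : ℕ) : levelElt (p := p) ε n ≠ 0 := by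
  intro h
  have h1 := congrArg (iwasawaEquiv ε) h
  rw [iwasawaEquiv_levelElt, map_zero] at h1
  exact omega_ne_zero n h1

theorem iwasawaModP_levelElt (n : ℕ) :
    iwasawaModP (p := p) ε (levelElt ε n) = PowerSeries.X ^ p ^ n := by
  change PowerSeries.map (PadicInt.toZMod (p := p)) (iwasawaEquiv ε (levelElt ε n)) = _
  rw [iwasawaEquiv_levelElt, map_omega_coe]

theorem iwasawaProj_levelElt (n m : ℕ) : iwasawaProj (p := p) ε n (levelElt ε m) =
    MonoidAlgebra.of ℤ_[p] _ (QuotientGroup.mk (gen ε ^ p ^ m)) - 1 := by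
  rw [levelElt, map_sub, map_pow, map_one]
  congr 1
  exact (map_pow (MonoidAlgebra.of ℤ_[p] (Γ ⧸ (powSubgroup ε n).toSubgroup)) _ _).symm

/-- The quotient of `γ^{p^n} - 1` by `γ^{p^m} - 1` lies in a high power of the maximal ideal. -/
theorem exists_levelElt_eq_mul [IsLocalRing (IwasawaAlgebra p Γ)] {m n : ℕ} (h : m ≤ n) :
    ∃ ν ∈ IsLocalRing.maximalIdeal (IwasawaAlgebra p Γ) ^ (n - m),
      levelElt ε n = levelElt ε m * ν := by
  induction n, h using Nat.le_induction with
  | base => exact ⟨1, by simp, by rw [mul_one]⟩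
  | succ n h ih =>
    obtain ⟨ν, hν, h1⟩ := ih
    set g : IwasawaAlgebra p Γ := iwasawaOf (gen ε) with hg
    set s : IwasawaAlgebra p Γ := ∑ i ∈ Finset.range p, (g ^ p ^ n) ^ i with hs
    refine ⟨ν * s, ?_, ?_⟩
    · rw [Nat.succ_sub h, pow_succ]
      refine Ideal.mul_mem_mul hν ((IsLocalRing.mem_maximalIdeal _).2 fun hu => ?_)
      have h2 := (hu.map (iwasawaEquiv ε)).map (PowerSeries.constantCoeff (R := ℤ_[p]))
      rw [hs, map_sum, map_sum, hg] at h2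
      simp only [map_pow, iwasawaEquiv_gen, map_add, map_one, PowerSeries.constantCoeff_X, add_zero,
        one_pow, Finset.sum_const, Finset.card_range, nsmul_eq_mul, mul_one] at h2
      exact PadicInt.p_nonunit h2
    · rw [← mul_assoc, ← h1, hs, levelElt, levelElt, ← hg, mul_geom_sum, ← pow_mul, ← pow_succ]

end LevelElt

section Compactness

/-- Over a power series ring with coefficients in `ℤ_p`, a nested sequence of cosets of
submodules of a free module has a common point, since these cosets are compact. -/
theorem exists_forall_sub_mem {p : ℕ} [Fact p.Prime] {R V : Type*} [CommRing R] [Finite V]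
    (e : R ≃+* PowerSeries ℤ_[p]) (E : ℕ → Submodule R (V → R)) (hE : Antitone E)
    (a : ℕ → V → R) (ha : ∀ n, a (n + 1) - a n ∈ E n) : ∃ b, ∀ n, b - a n ∈ E n := by
  let _ := Fintype.ofFinite V
  have : IsNoetherianRing R := isNoetherianRing_of_ringEquiv (PowerSeries ℤ_[p]) e.symm
  open PowerSeries.WithPiTopology in
  have hcompact : CompactSpace (PowerSeries ℤ_[p]) :=
    inferInstanceAs (CompactSpace ((Unit →₀ ℕ) → ℤ_[p]))
  let K : ℕ → Set (V → PowerSeries ℤ_[p]) := fun n => {y | e.symm ∘ y - a n ∈ E n}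
  open PowerSeries.WithPiTopology in
  have hK : ∀ n, IsCompact (K n) := by
    intro n
    obtain ⟨m, g, hg⟩ := Submodule.fg_iff_exists_fin_generating_family.1 (IsNoetherian.noetherian (E n))
    have h1 : K n = Set.range fun c : Fin m → PowerSeries ℤ_[p] =>
        fun x => e (a n x) + ∑ i, c i * e (g i x) := by
      ext y
      change e.symm ∘ y - a n ∈ E n ↔ _
      rw [← hg, Submodule.mem_span_range_iff_exists_fun]
      constructor
      · rintro ⟨c, hc⟩
        refine ⟨fun i => e (c i), funext fun x => ?_⟩
        have h2 : e ((∑ i, c i • g i) x) = e ((e.symm ∘ y - a n) x) := by rw [hc]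
        rw [Finset.sum_apply, map_sum, Pi.sub_apply, map_sub, Function.comp_apply,
          e.apply_symm_apply] at h2
        simp only [Pi.smul_apply, smul_eq_mul, map_mul] at h2
        change e (a n x) + ∑ i, e (c i) * e (g i x) = _
        rw [h2, add_sub_cancel]
      · rintro ⟨c, rfl⟩
        refine ⟨fun i => e.symm (c i), funext fun x => ?_⟩
        rw [Finset.sum_apply, Pi.sub_apply, Function.comp_apply, map_add, map_sum,
          e.symm_apply_apply, add_sub_cancel_left]
        refine Finset.sum_congr rfl fun i _ => ?_
        rw [map_mul, e.symm_apply_apply]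
        rfl
    rw [h1]
    refine isCompact_range (continuous_pi fun x => ?_)
    fun_prop
  open PowerSeries.WithPiTopology in
  obtain ⟨y, hy⟩ := IsCompact.nonempty_iInter_of_sequence_nonempty_isCompact_isClosed K
    (fun n y hy => by
      have hy : e.symm ∘ y - a (n + 1) ∈ E (n + 1) := hy
      change e.symm ∘ y - a n ∈ E n
      rw [← sub_add_sub_cancel _ (a (n + 1))]
      exact add_mem (hE n.le_succ hy) (ha n))
    (fun n => ⟨e ∘ a n, by
      change e.symm ∘ (e ∘ a n) - a n ∈ E n
      have h1 : e.symm ∘ (e ∘ a n) - a n = 0 := by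
        funext x
        simp
      rw [h1]
      exact zero_mem _⟩) (hK 0) (fun n => (hK n).isClosed)
  exact ⟨e.symm ∘ y, fun n => Set.mem_iInter.1 hy n⟩

end Compactness

namespace Voltage

variable {p : ℕ} [hp : Fact p.Prime] {Γ : Type v} [CommGroup Γ] [TopologicalSpace Γ]
  [IsTopologicalGroup Γ] [CompactSpace Γ] (ε : Γ ≃ₜ* Multiplicative ℤ_[p])
  {X : FinGraph.{u}} (B : Voltage X Γ)

/-- The non-trivial inertia groups are the subgroups `Γ^{p^d}`, with the exponents `d` given by a
function on the vertices. -/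
def IsDepth (d : X.V → ℕ) : Prop :=
  ∀ x, B.I x ≠ ⊥ → B.I x = (powSubgroup ε (d x)).toSubgroup

/-- The presentation matrix of the limit of the Picard groups: the rows of the twisted Laplacian at
the vertices with trivial inertia group, and for the other vertices, the relation which
expresses the invariance under the inertia group. -/
noncomputable def presMatrix (d : X.V → ℕ) : Matrix X.V X.V (IwasawaAlgebra p Γ) :=
  Matrix.of fun x => if B.I x = ⊥ then B.lapMatrix iwasawaOf x else Pi.single x (levelElt ε (d x))

theorem presMatrix_of_eq_bot {d : X.V → ℕ} {x : X.V} (hx : B.I x = ⊥) :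
    B.presMatrix (p := p) ε d x = B.lapMatrix iwasawaOf x := if_pos hx

theorem presMatrix_of_ne_bot {d : X.V → ℕ} {x : X.V} (hx : ¬ B.I x = ⊥) :
    B.presMatrix (p := p) ε d x = Pi.single x (levelElt ε (d x)) := if_neg hx

theorem det_presMatrix (d : X.V → ℕ) : (B.presMatrix (p := p) ε d).det =
    B.charDet (iwasawaOf (p := p)) * ∏ x : {x // ¬ B.I x = ⊥}, levelElt ε (d x) := by
  rw [Matrix.twoBlockTriangular_det _ fun x => B.I x = ⊥]
  · congr 1
    · rw [charDet]
      congr 1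
      refine Matrix.ext fun x y => ?_
      change presMatrix ε B d x.1 y.1 = B.lapMatrix iwasawaOf x.1 y.1
      rw [presMatrix_of_eq_bot ε B x.2]
    · rw [← Matrix.det_diagonal]
      congr 1
      refine Matrix.ext fun x y => ?_
      change presMatrix ε B d x.1 y.1 = _
      rw [presMatrix_of_ne_bot ε B x.2, Pi.single_apply, Matrix.diagonal_apply]
      exact if_congr (by rw [Subtype.ext_iff, eq_comm]) rfl rfl
  · intro x hx y hy
    rw [presMatrix_of_ne_bot ε B hx, Pi.single_eq_of_ne]
    rintro rfl
    exact hx hy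

/-- The images of a vector in the group rings of finite level. -/
noncomputable def projVec (n : ℕ) (b : X.V → IwasawaAlgebra p Γ) : X.V → LevelRing (p := p) ε n :=
  fun x => iwasawaProj ε n (b x)

theorem map_lapMatrix_iwasawaProj (n : ℕ) :
    (B.lapMatrix (iwasawaOf (p := p))).map (iwasawaProj ε n) =
      (B.quot (powSubgroup ε n)).lapMatrix (MonoidAlgebra.of ℤ_[p] _) := by
  rw [map_lapMatrix]
  rfl

/-- The rows of the presentation matrix are relations at every finite level. -/
theorem toVert_presMatrix_mem {d : X.V → ℕ} (hd : B.IsDepth ε d) (n : ℕ) (x : X.V) :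
    (B.quot (powSubgroup ε n)).toVert ℤ_[p] (projVec ε n (B.presMatrix ε d x)) ∈
      LinearMap.range ((B.quot (powSubgroup ε n)).derived.lap ℤ_[p]) := by
  by_cases hx : B.I x = ⊥
  · have h1 : projVec ε n (B.presMatrix ε d x) =
        (B.quot (powSubgroup ε n)).lapMatrix (MonoidAlgebra.of ℤ_[p] _) x := by
      rw [← map_lapMatrix_iwasawaProj, presMatrix_of_eq_bot ε B hx]
      rfl
    rw [h1]
    refine toVert_row _ ?_
    change (B.I x).map _ = ⊥
    rw [hx, Subgroup.map_bot]
  · have h1 : projVec ε n (B.presMatrix ε d x) = Pi.single x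
        (MonoidAlgebra.of ℤ_[p] _ (QuotientGroup.mk (gen ε ^ p ^ d x)) - 1) := by
      rw [presMatrix_of_ne_bot ε B hx, ← iwasawaProj_levelElt]
      funext y
      exact Pi.apply_single (fun _ => iwasawaProj (p := p) ε n) (fun _ => map_zero _) x _ y
    rw [h1, toVert_inertia]
    · exact zero_mem _
    · refine Subgroup.mem_map_of_mem _ ?_
      rw [hd x hx]
      exact ⟨gen ε, rfl⟩

/-- The relations at finite level are consequences of those of the presentation matrix, up to
elements in a high power of the maximal ideal. -/
theorem mem_of_toVert_mem [IsLocalRing (IwasawaAlgebra p Γ)] {d : X.V → ℕ} (hd : B.IsDepth ε d)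
    {k n : ℕ} (hk : ∀ x, d x ≤ k) (hn : k ≤ n) {b : X.V → IwasawaAlgebra p Γ}
    (hb : (B.quot (powSubgroup ε n)).toVert ℤ_[p] (projVec ε n b) ∈
      LinearMap.range ((B.quot (powSubgroup ε n)).derived.lap ℤ_[p])) :
    b ∈ LinearMap.range (B.presMatrix (p := p) ε d).vecMulLinear ⊔
      IsLocalRing.maximalIdeal (IwasawaAlgebra p Γ) ^ (n - k) •
        (⊤ : Submodule (IwasawaAlgebra p Γ) (X.V → IwasawaAlgebra p Γ)) := by
  have := isDomain_iwasawaAlgebra (p := p) ε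
  set K := LinearMap.range (B.presMatrix (p := p) ε d).vecMulLinear with hK
  set J := IsLocalRing.maximalIdeal (IwasawaAlgebra p Γ) ^ (n - k) with hJ
  set C := B.quot (powSubgroup ε n) with hC
  obtain ⟨f, hf⟩ := hb
  choose c hc using fun x => iwasawaProj_surjective ε n (C.ofVert f x)
  have hrow : ∀ x, B.presMatrix (p := p) ε d x ∈ K := fun x => ⟨Pi.single x 1, by
    rw [Matrix.vecMulLinear_apply, Matrix.single_one_vecMul]; rfl⟩
  -- The principal divisor of `f` is lifted by the twisted Laplacian; the difference `y` has
  -- trivial divisor at level `n`.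
  set y := b - c ᵥ* B.lapMatrix iwasawaOf with hy
  have hy0 : C.toVert ℤ_[p] (projVec ε n y) = 0 := by
    have h1 : projVec ε n y = projVec ε n b -
        C.ofVert f ᵥ* C.lapMatrix (MonoidAlgebra.of ℤ_[p] _) := by
      funext x
      rw [← map_lapMatrix_iwasawaProj, Pi.sub_apply]
      change iwasawaProj ε n (b x - (c ᵥ* B.lapMatrix iwasawaOf) x) = _
      rw [map_sub, RingHom.map_vecMul]
      congr 2
      funext x
      exact hc x
    rw [h1, map_sub, toVert_vecMul, hf, sub_self]
  have hproj : ∀ x m, m ≤ n → B.I x ≤ (powSubgroup ε m).toSubgroup → levelElt ε m ∣ y x := by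
    intro x m hmn hm
    rw [← iwasawaProj_eq_zero_iff, ← mapDomain_iwasawaProj ε (powSubgroup_anti ε hmn)]
    refine mapDomain_eq_zero_of_toVert C (quotMap (powSubgroup_anti ε hmn)) (x := x) ?_ hy0
    rintro _ ⟨γ, hγ, rfl⟩
    exact (QuotientGroup.eq_one_iff _).2 (hm hγ)
  have hmul : ∀ {a : IwasawaAlgebra p Γ} (z : X.V → IwasawaAlgebra p Γ), a ∈ J →
      a • z ∈ J • (⊤ : Submodule (IwasawaAlgebra p Γ) (X.V → IwasawaAlgebra p Γ)) := fun z ha =>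
    Submodule.smul_mem_smul ha Submodule.mem_top
  have hsplit : b = ∑ x, (c x • B.lapMatrix iwasawaOf x + Pi.single x (y x)) := by
    rw [Finset.sum_add_distrib, Finset.univ_sum_single, hy]
    have h1 : c ᵥ* B.lapMatrix iwasawaOf = ∑ x, c x • B.lapMatrix iwasawaOf x := by
      rw [Matrix.vecMul_eq_sum]
    rw [h1, add_sub_cancel]
  rw [hsplit]
  refine Submodule.sum_mem _ fun x _ => ?_
  -- With trivial inertia group, the row of the Laplacian is a relation and `y x` is small, as it
  -- vanishes at level `n`. Otherwise `y x` is a multiple of the relation for the inertia group,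
  -- and `c x` is small, as its product with the relation vanishes at level `n`.
  by_cases hx : B.I x = ⊥
  · refine add_mem (Submodule.mem_sup_left ?_) (Submodule.mem_sup_right ?_)
    · have h1 := hrow x
      rw [presMatrix_of_eq_bot ε B hx] at h1
      exact K.smul_mem _ h1
    · obtain ⟨q, hq⟩ := hproj x n le_rfl (by rw [hx]; exact bot_le)
      obtain ⟨ν, hν, h2⟩ := exists_levelElt_eq_mul (p := p) ε hn
      have h3 : (Pi.single x (y x) : X.V → IwasawaAlgebra p Γ) =
          ν • Pi.single x (levelElt ε k * q) := by
        rw [← Pi.single_smul, hq, h2, smul_eq_mul]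
        congr 1
        ring
      rw [h3]
      exact hmul _ hν
  · refine add_mem (Submodule.mem_sup_right ?_) (Submodule.mem_sup_left ?_)
    · refine hmul _ ?_
      have h1 : levelElt ε n ∣ levelElt ε (d x) * c x := by
        rw [← iwasawaProj_eq_zero_iff, map_mul, hc, iwasawaProj_levelElt, sub_mul, one_mul,
          MonoidAlgebra.of_apply, single_mul_ofVert, sub_self]
        refine Subgroup.mem_map_of_mem _ ?_
        rw [hd x hx]
        exact ⟨gen ε, rfl⟩
      obtain ⟨q, hq⟩ := h1
      obtain ⟨ν, hν, h2⟩ := exists_levelElt_eq_mul (p := p) ε ((hk x).trans hn)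
      rw [h2, mul_assoc] at hq
      rw [mul_left_cancel₀ (levelElt_ne_zero ε _) hq]
      exact Ideal.mul_mem_right _ _ (Ideal.pow_le_pow_right (Nat.sub_le_sub_left (hk x) n) hν)
    · obtain ⟨q, hq⟩ := hproj x (d x) ((hk x).trans hn) (hd x hx).le
      have h1 := hrow x
      rw [presMatrix_of_ne_bot ε B hx] at h1
      have h2 : (Pi.single x (y x) : X.V → IwasawaAlgebra p Γ) = q • Pi.single x (levelElt ε (d x)) := by
        rw [← Pi.single_smul, hq, smul_eq_mul, mul_comm]
      rw [h2]
      exact K.smul_mem _ h1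

/-- A module `M` which is the limit of the cokernels `Q n` of the Laplacians of the graphs
`X(Γ/Γ^{p^n})`, with compatible classes `m x` of the vertices, is presented by `presMatrix`. The
classes generate `M` by compactness, and Krull's intersection theorem yields the relations. -/
theorem isPresentation_presMatrix {d : X.V → ℕ} (hd : B.IsDepth ε d)
    {M : Type*} [AddCommGroup M] [Module (IwasawaAlgebra p Γ) M] (m : X.V → M)
    {Q : ℕ → Type*} [∀ n, AddCommGroup (Q n)] (π : ∀ n, M →+ Q n)
    (cls : ∀ n, ((B.quot (powSubgroup ε n)).derived.V → ℤ_[p]) →+ Q n)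
    (hcls : ∀ n f, cls n f = 0 ↔
      f ∈ LinearMap.range ((B.quot (powSubgroup ε n)).derived.lap ℤ_[p]))
    (hcls' : ∀ n, Function.Surjective (cls n))
    (hm : ∀ n x a, π n (a • m x) =
      cls n ((B.quot (powSubgroup ε n)).toVert ℤ_[p] (Pi.single x (iwasawaProj ε n a))))
    (hπ : ∀ n y, π (n + 1) y = 0 → π n y = 0) (hπ' : ∀ y, (∀ n, π n y = 0) → y = 0)
    (hsmul : ∀ n (a : IwasawaAlgebra p Γ) y, π n y = 0 → π n (a • y) = 0) :
    IsPresentation (B.presMatrix ε d) (Fintype.linearCombination (IwasawaAlgebra p Γ) m) := by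
  have := isLocalRing_iwasawaAlgebra (p := p) ε
  have := isNoetherianRing_iwasawaAlgebra (p := p) ε
  set Φ := Fintype.linearCombination (IwasawaAlgebra p Γ) m with hΦ
  set K := LinearMap.range (B.presMatrix (p := p) ε d).vecMulLinear with hK
  have hΦπ : ∀ n b, π n (Φ b) = cls n ((B.quot (powSubgroup ε n)).toVert ℤ_[p] (projVec ε n b)) := by
    intro n b
    rw [hΦ, Fintype.linearCombination_apply, map_sum, Finset.sum_congr rfl fun x _ => hm n x (b x),
      ← map_sum, ← map_sum]
    congr 2
    exact Finset.univ_sum_single (projVec ε n b)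
  let E : ℕ → Submodule (IwasawaAlgebra p Γ) (X.V → IwasawaAlgebra p Γ) := fun n =>
    { carrier := {b | π n (Φ b) = 0}
      add_mem' := fun {a b} ha hb => by
        change π n (Φ (a + b)) = 0
        rw [map_add, map_add, show π n (Φ a) = 0 from ha, show π n (Φ b) = 0 from hb, add_zero]
      zero_mem' := by
        change π n (Φ 0) = 0
        rw [map_zero, map_zero]
      smul_mem' := fun a b hb => by
        change π n (Φ (a • b)) = 0
        rw [map_smul]
        exact hsmul n a _ hb }
  have hE : ∀ n b, b ∈ E n ↔ π n (Φ b) = 0 := fun n b => Iff.rfl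
  have hEanti : Antitone E := antitone_nat_of_succ_le fun n b hb => hπ n _ hb
  have hKE : ∀ n, K ≤ E n := by
    rintro n _ ⟨z, rfl⟩
    rw [Matrix.vecMulLinear_apply, Matrix.vecMul_eq_sum]
    refine Submodule.sum_mem _ fun x _ => (E n).smul_mem _ ?_
    rw [hE, hΦπ, hcls]
    exact toVert_presMatrix_mem ε B hd n x
  obtain ⟨k, hk⟩ : ∃ k, ∀ x, d x ≤ k :=
    ⟨Finset.univ.sup d, fun x => Finset.le_sup (f := d) (Finset.mem_univ x)⟩
  refine ⟨fun y => ?_, ?_⟩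
  -- the preimages at the finite levels are glued by compactness
  · have h1 : ∀ n, ∃ b, π n (Φ b) = π n y := by
      intro n
      obtain ⟨f, hf⟩ := hcls' n (π n y)
      obtain ⟨c, rfl⟩ := (B.quot (powSubgroup ε n)).toVert_surjective (k := ℤ_[p]) f
      choose b hb using fun x => iwasawaProj_surjective ε n (c x)
      exact ⟨b, by rw [hΦπ, ← hf, ← (funext hb : projVec ε n b = c)]⟩
    choose a ha using h1
    obtain ⟨b, hb⟩ := exists_forall_sub_mem (iwasawaEquiv (p := p) ε) E hEanti a fun n => by
      rw [hE, map_sub, map_sub, ha n, ← map_sub]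
      refine hπ n _ ?_
      rw [map_sub, ha, sub_self]
    refine ⟨b, sub_eq_zero.1 (hπ' _ fun n => ?_)⟩
    have h2 := (hE n _).1 (hb n)
    rw [map_sub, map_sub, ha n] at h2
    rw [map_sub, h2]
  · refine le_antisymm (fun b hb => ?_) fun b hb => ?_
    · have h1 : ∀ n, b ∈ E n := fun n => by
        rw [hE, LinearMap.mem_ker.1 hb, map_zero]
      -- Krull's intersection theorem for the cokernel of the presentation matrix
      have h2 := Ideal.iInf_pow_smul_eq_bot_of_isLocalRing (M := (X.V → IwasawaAlgebra p Γ) ⧸ K)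
        (IsLocalRing.maximalIdeal (IwasawaAlgebra p Γ)) (Ideal.IsPrime.ne_top inferInstance)
      rw [← Submodule.Quotient.mk_eq_zero, ← Submodule.mem_bot (R := IwasawaAlgebra p Γ), ← h2,
        Submodule.mem_iInf]
      intro i
      have h3 : b ∈ K ⊔ _ := mem_of_toVert_mem ε B hd hk (Nat.le_add_left k i)
        ((hcls _ _).1 ((hΦπ _ _).symm.trans ((hE _ _).1 (h1 _))))
      rw [Nat.add_sub_cancel] at h3
      obtain ⟨z, hz, t, ht, rfl⟩ := Submodule.mem_sup.1 h3
      rw [Submodule.Quotient.mk_add, (Submodule.Quotient.mk_eq_zero K).2 hz, zero_add]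
      have h4 := Submodule.mem_map_of_mem (f := K.mkQ) ht
      rw [Submodule.map_smul''] at h4
      exact Submodule.smul_mono le_rfl le_top h4
    · exact LinearMap.mem_ker.2 (hπ' _ fun n => (hE n b).1 (hKE n hb))

end Voltage

end KidaGraph

namespace KidaGraph

universe u v w

open scoped Classical Matrix TensorProduct

set_option linter.unusedSectionVars false

/-! ### Invariants of the limit of the Picard groups -/

namespace Voltage

section Invariants

variable {p : ℕ} [hp : Fact p.Prime] {Γ : Type v} [CommGroup Γ] [TopologicalSpace Γ]
  [IsTopologicalGroup Γ] [CompactSpace Γ] (ε : Γ ≃ₜ* Multiplicative ℤ_[p])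
  {X : FinGraph.{u}} {B : Voltage X Γ}

theorem exists_isDepth (hI : ∀ x, IsClosed (B.I x : Set Γ)) : ∃ d, B.IsDepth ε d := by
  have h1 : ∀ x, ∃ n, B.I x ≠ ⊥ → B.I x = (powSubgroup ε n).toSubgroup := by
    intro x
    by_cases hx : B.I x = ⊥
    · exact ⟨0, fun h => absurd hx h⟩
    · obtain ⟨n, hn⟩ := exists_eq_powSubgroup_of_isClosed ε (hI x) hx
      exact ⟨n, fun _ => hn⟩
  choose d hd using h1
  exact ⟨d, hd⟩

/-- The reduction modulo `p` of the tautological character with values in the Iwasawa algebra. -/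
noncomputable def charModP : Γ →* PowerSeries (ZMod p) :=
  (iwasawaModP ε : IwasawaAlgebra p Γ →* PowerSeries (ZMod p)).comp iwasawaOf

theorem sum_index_eq {d : X.V → ℕ} (hd : B.IsDepth ε d) :
    ∑ x, (B.I x).index = ∑ x : {x // ¬ B.I x = ⊥}, p ^ d x := by
  rw [← Fintype.sum_subtype_add_sum_subtype (fun x => B.I x = ⊥) fun x => (B.I x).index,
    Finset.sum_eq_zero fun x _ => ?_, zero_add]
  · refine Finset.sum_congr rfl fun x _ => ?_
    rw [hd x x.2, Subgroup.index, card_quot]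
  · exact index_eq_zero_of_eq_bot ε B x.2

/-- Modulo `p`, the relation at a ramified vertex with inertia group of index `p ^ d` is `T ^ p ^
d`. -/
theorem iwasawaModP_det_presMatrix {d : X.V → ℕ} (hd : B.IsDepth ε d) :
    iwasawaModP (p := p) ε (B.presMatrix ε d).det =
      B.charDet (charModP (p := p) ε) * PowerSeries.X ^ ∑ x, (B.I x).index := by
  rw [det_presMatrix, map_mul, map_charDet, map_prod, sum_index_eq ε hd,
    ← Finset.prod_pow_eq_pow_sum]
  congr 1
  exact Finset.prod_congr rfl fun x _ => iwasawaModP_levelElt ε (d x)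

/-- Over the integral group ring, the determinant of the twisted Laplacian is the product of a
power of `p` and an element which is non-zero modulo `p`. -/
theorem det_presMatrix_ne_zero (hI : ∀ x, IsClosed (B.I x : Set Γ))
    (hc : ∀ n, (B.lev ε n).derived.Connected) (d : X.V → ℕ) :
    (B.presMatrix (p := p) ε d).det ≠ 0 := by
  have := isDomain_iwasawaAlgebra (p := p) ε
  rw [det_presMatrix]
  refine mul_ne_zero ?_ (Finset.prod_ne_zero_iff.2 fun x _ => levelElt_ne_zero ε _)
  obtain ⟨m, l, -, g, h1, h2, -⟩ := B.exists_hasIwasawaInvariants ε hI hc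
    (isBinomial_iwasawaModP (p := p) ε)
  set ρ := (MonoidAlgebra.lift ℤ (IwasawaAlgebra p Γ) Γ iwasawaOf) with hρ
  have h3 : B.charDet (iwasawaOf (p := p)) = p ^ m * ρ g := by
    have h4 := B.map_charDet (MonoidAlgebra.of ℤ Γ) (ρ : MonoidAlgebra ℤ Γ →+* IwasawaAlgebra p Γ)
    have h5 : ((ρ : MonoidAlgebra ℤ Γ →+* IwasawaAlgebra p Γ) : _ →* IwasawaAlgebra p Γ).comp
        (MonoidAlgebra.of ℤ Γ) = iwasawaOf := by
      ext1 γ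
      simp [hρ]
    rw [h5, h1] at h4
    rw [← h4, RingHom.coe_coe, map_mul, map_pow, map_natCast]
  have h4 : iwasawaModP (p := p) ε (ρ g) = MonoidAlgebra.lift ℤ (PowerSeries (ZMod p)) Γ
      ((iwasawaModP ε : IwasawaAlgebra p Γ →* PowerSeries (ZMod p)).comp iwasawaOf) g := by
    have h5 : (iwasawaModP (p := p) ε).comp (ρ : MonoidAlgebra ℤ Γ →+* IwasawaAlgebra p Γ) =
        ((MonoidAlgebra.lift ℤ (PowerSeries (ZMod p)) Γ
          ((iwasawaModP ε : IwasawaAlgebra p Γ →* PowerSeries (ZMod p)).comp iwasawaOf)) :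
          MonoidAlgebra ℤ Γ →+* PowerSeries (ZMod p)) := by
      refine MonoidAlgebra.ringHom_ext (fun r => ?_) fun γ => ?_
      · change iwasawaModP ε (ρ _) = MonoidAlgebra.lift ℤ (PowerSeries (ZMod p)) Γ _ _
        rw [hρ, MonoidAlgebra.lift_single, MonoidAlgebra.lift_single, map_zsmul, map_one, map_one,
          map_one]
        rfl
      · change iwasawaModP ε (ρ _) = MonoidAlgebra.lift ℤ (PowerSeries (ZMod p)) Γ _ _
        rw [hρ, MonoidAlgebra.lift_single, MonoidAlgebra.lift_single, map_zsmul]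
        rfl
    exact RingHom.congr_fun h5 g
  rw [h3]
  refine mul_ne_zero (pow_ne_zero _ fun h0 => ?_) fun h0 => ?_
  · have h5 := congrArg (iwasawaEquiv ε) h0
    rw [map_natCast, map_zero] at h5
    exact natCast_p_ne_zero h5
  · rw [h0, map_zero] at h4
    rw [← h4, PowerSeries.order_zero] at h2
    exact ENat.natCast_ne_top l h2.symm

variable {M : Type*} [AddCommGroup M] [Module (IwasawaAlgebra p Γ) M] {d : X.V → ℕ}
  {Φ : (X.V → IwasawaAlgebra p Γ) →ₗ[IwasawaAlgebra p Γ] M}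

/-- The `μ`-invariant vanishes if and only if the determinant of the twisted Laplacian is
non-zero modulo `p`. -/
theorem muInv_eq_zero_iff (hd : B.IsDepth ε d) (h : IsPresentation (B.presMatrix ε d) Φ) :
    muInv p Γ M = 0 ↔ B.charDet (charModP (p := p) ε) ≠ 0 := by
  rw [h.muInv_eq_zero_iff ε, iwasawaModP_det_presMatrix ε hd, mul_ne_zero_iff]
  exact and_iff_left (pow_ne_zero _ PowerSeries.X_ne_zero)

/-- The `λ`-invariant is the order of vanishing of the determinant of the presentation matrix
modulo `p`. -/
theorem lambdaInv_eq [Module ℤ_[p] M] (hd : B.IsDepth ε d)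
    (h : IsPresentation (B.presMatrix ε d) Φ)
    (hC : ∀ (c : ℤ_[p]) (m : M), (iwasawaEquiv ε).symm (PowerSeries.C c) • m = c • m)
    (h0 : B.charDet (charModP (p := p) ε) ≠ 0) :
    (lambdaInv p M : ℕ∞) = (B.charDet (charModP (p := p) ε)).order + (∑ x, (B.I x).index : ℕ) := by
  have hne : iwasawaModP (p := p) ε (B.presMatrix ε d).det ≠ 0 := by
    rw [iwasawaModP_det_presMatrix ε hd]
    exact mul_ne_zero h0 (pow_ne_zero _ PowerSeries.X_ne_zero)
  rw [h.lambdaInv_eq ε hC hne, PowerSeries.coe_toNat_order hne, iwasawaModP_det_presMatrix ε hd,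
    PowerSeries.order_mul, PowerSeries.order_X_pow]

end Invariants

section IwasawaPic

variable {p : ℕ} [hp : Fact p.Prime] {Γ : Type v} [CommGroup Γ] [TopologicalSpace Γ]
  [IsTopologicalGroup Γ] [CompactSpace Γ] (ε : Γ ≃ₜ* Multiplicative ℤ_[p])
  {Δ : Type w} [Group Δ] [TopologicalSpace Δ] [IsTopologicalGroup Δ] [CompactSpace Δ]
  {X : FinGraph.{u}} (A : Voltage X Δ) (ι : Γ →ₜ* Δ)

theorem mapDomain_algebraMap {H H' : Type*} [Group H] [Group H'] (φ : H →* H') (c : ℤ_[p]) :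
    MonoidAlgebra.mapDomainRingHom ℤ_[p] φ (algebraMap ℤ_[p] _ c) = algebraMap ℤ_[p] _ c := by
  rw [MonoidAlgebra.coe_algebraMap, MonoidAlgebra.coe_algebraMap]
  refine (MonoidAlgebra.mapDomain_single ..).trans ?_
  rw [map_one]
  rfl

/-- The constants in the power series ring act as the scalars in `ℤ_p`. -/
theorem iwasawaEquiv_symm_C_smul (c : ℤ_[p]) (y : A.IwasawaPic p ι) :
    (iwasawaEquiv ε).symm (PowerSeries.C c) • y = c • y := by
  refine Subtype.ext (funext fun U => ?_)
  set a := (iwasawaEquiv ε).symm (PowerSeries.C c) with ha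
  have h1 : ∀ V : OpenNormalSubgroup Γ, a.1 V = algebraMap ℤ_[p] _ c := by
    intro V
    obtain ⟨n, hn⟩ := exists_powSubgroup_le ε V
    have h2 : iwasawaProj ε n a = algebraMap ℤ_[p] _ c := by
      rw [iwasawaProj_eq_levelMap, ha, RingEquiv.apply_symm_apply, ← Polynomial.coe_C,
        levelMap_coe, Polynomial.aeval_C]
    rw [← a.2 _ _ hn]
    exact (congrArg _ h2).trans (mapDomain_algebraMap _ c)
  change (A.quot U).picPRep p (MonoidAlgebra.mapDomainRingHom ℤ_[p] (comapQuot ι U)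
    (a.1 (comapONS ι U))) (y.1 U) = c • y.1 U
  rw [h1, mapDomain_algebraMap, AlgHom.commutes, Module.algebraMap_end_apply]

/-- The compatible system of the classes of the vertices `(δ I_x, x)`. -/
noncomputable def vertexClass (x : X.V) (δ : Δ) : A.IwasawaPic p ι :=
  ⟨fun U => picClass p _ (Pi.single (A.qvert U x δ) 1), fun U V h => by
    change A.picTrans p h (picClass p _ (Pi.single (A.qvert U x δ) 1)) =
      picClass p _ (Pi.single (A.qvert V x δ) 1)
    rw [picClass_single, picClass_single]
    change (1 : ℤ_[p]) ⊗ₜ[ℤ] (A.transition_isCovering h).picMap (Submodule.Quotient.mk _) = _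
    rw [Hom.IsCovering.picMap_mk]
    congr 2
    exact Finsupp.mapDomain_single⟩

theorem picPRep_single (U : OpenNormalSubgroup Δ) (x : X.V) (g δ : Δ) (r : ℤ_[p]) :
    (A.quot U).picPRep p (MonoidAlgebra.single (g : Δ ⧸ U.toSubgroup) r)
      (picClass p _ (Pi.single (A.qvert U x δ) 1)) =
      picClass p _ (Pi.single (A.qvert U x (g * δ)) r) := by
  rw [picPRep, MonoidAlgebra.lift_single, picClass_single, picClass_single, LinearMap.smul_apply]
  change r • (1 : ℤ_[p]) ⊗ₜ[ℤ] ((A.quot U).act_isCovering (g : Δ ⧸ U.toSubgroup)).picMap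
    (Submodule.Quotient.mk _) = _
  rw [Hom.IsCovering.picMap_mk, TensorProduct.smul_tmul', smul_eq_mul, mul_one]
  congr 2
  exact Finsupp.mapDomain_single

/-- An isomorphism of graphs identifies the images of the Laplacians. -/
theorem _root_.KidaGraph.FinGraph.comp_symm_mem_range_lap_iff {Y : FinGraph.{u}} {Z : FinGraph.{v}}
    {k : Type*} [CommRing k] (a : Y.V ≃ Z.V) (b : Y.E ≃ Z.E) (hs : ∀ e, a (Y.s e) = Z.s (b e))
    (ht : ∀ e, a (Y.t e) = Z.t (b e)) (f : Y.V → k) :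
    f ∘ a.symm ∈ LinearMap.range (Z.lap k) ↔ f ∈ LinearMap.range (Y.lap k) := by
  have h1 : ∀ g : Z.V → k, Y.lap k (g ∘ a) = Z.lap k g ∘ a := by
    intro g
    funext w
    rw [Function.comp_apply, FinGraph.lap_apply, FinGraph.lap_apply, ← b.sum_comp]
    refine Finset.sum_congr rfl fun e _ => ?_
    rw [← hs, ← ht]
    simp only [a.injective.eq_iff, Function.comp_apply]
  constructor
  · rintro ⟨g, hg⟩
    refine ⟨g ∘ a, ?_⟩
    rw [h1, hg]
    funext w
    simp
  · rintro ⟨g, rfl⟩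
    refine ⟨g ∘ a.symm, ?_⟩
    have h2 := h1 (g ∘ a.symm)
    have h3 : (g ∘ a.symm) ∘ a = g := by
      funext w
      simp
    rw [h3] at h2
    rw [h2]
    funext w
    simp

/-- A presentation of the limit of the Picard groups as a module over the
Iwasawa algebra of `Γ`, from an identification of a cofinal system of layers with the
layers of a covering with group `Γ`. -/
theorem exists_isPresentation {Y : FinGraph} {B : Voltage Y Γ} {d : Y.V → ℕ} (hd : B.IsDepth ε d)
    (W : ℕ → OpenNormalSubgroup Δ) (hanti : ∀ n, W (n + 1) ≤ W n) (hW : ∀ U, ∃ n, W n ≤ U)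
    (hι : ∀ n γ, γ ∈ (powSubgroup ε n).toSubgroup → ι γ ∈ (W n).toSubgroup)
    (σ : ∀ n, (B.quot (powSubgroup ε n)).derived.V ≃ (A.quot (W n)).derived.V)
    (σE : ∀ n, (B.quot (powSubgroup ε n)).derived.E ≃ (A.quot (W n)).derived.E)
    (hs : ∀ n e, σ n ((B.quot (powSubgroup ε n)).derived.s e) = (A.quot (W n)).derived.s (σE n e))
    (ht : ∀ n e, σ n ((B.quot (powSubgroup ε n)).derived.t e) = (A.quot (W n)).derived.t (σE n e))
    (x : Y.V → X.V) (δ : Y.V → Δ)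
    (hσ : ∀ n w γ, σ n (B.qvert (powSubgroup ε n) w γ) = A.qvert (W n) (x w) (ι γ * δ w)) :
    ∃ Φ : (Y.V → IwasawaAlgebra p Γ) →ₗ[IwasawaAlgebra p Γ] A.IwasawaPic p ι,
      IsPresentation (B.presMatrix ε d) Φ := by
  let R (n : ℕ) : ((B.quot (powSubgroup ε n)).derived.V → ℤ_[p]) →ₗ[ℤ_[p]]
      ((A.quot (W n)).derived.V → ℤ_[p]) := LinearMap.funLeft ℤ_[p] ℤ_[p] (σ n).symm
  have hR : ∀ n v r, R n (Pi.single v r) = Pi.single (σ n v) r := by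
    intro n v r
    funext z
    change (Pi.single v r : _ → ℤ_[p]) ((σ n).symm z) = _
    rw [Pi.single_apply, Pi.single_apply, Equiv.symm_apply_eq]
  refine ⟨_, isPresentation_presMatrix ε B hd (M := A.IwasawaPic p ι)
    (fun w => A.vertexClass ι (x w) (δ w)) (Q := fun n => (A.quot (W n)).PicP p)
    (fun n => { toFun := fun y => y.1 (W n), map_zero' := rfl, map_add' := fun _ _ => rfl })
    (fun n => ((picClass p (A.quot (W n)).derived).comp (R n)).toAddMonoidHom) ?_ ?_ ?_ ?_ ?_ ?_⟩
  · intro n f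
    refine (picClass_eq_zero_iff p _).trans ?_
    exact FinGraph.comp_symm_mem_range_lap_iff (σ n) (σE n) (hs n) (ht n) f
  · intro n
    refine (picClass_surjective p _).comp (g := picClass p _) fun f => ⟨f ∘ σ n, ?_⟩
    funext z
    exact congrArg f ((σ n).apply_symm_apply z)
  · intro n w a
    have hle : powSubgroup ε n ≤ comapONS ι (W n) := fun γ hγ => hι n γ hγ
    have h1 : ((a • A.vertexClass ι (x w) (δ w) : A.IwasawaPic p ι).1 (W n) :
        (A.quot (W n)).PicP p) = (A.quot (W n)).picPRep p
          (MonoidAlgebra.mapDomainRingHom ℤ_[p] (comapQuot ι (W n))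
            (MonoidAlgebra.mapDomainRingHom ℤ_[p] (quotMap hle) (iwasawaProj ε n a)))
          (picClass p _ (Pi.single (A.qvert (W n) (x w) (δ w)) 1)) := by
      rw [show MonoidAlgebra.mapDomainRingHom ℤ_[p] (quotMap hle) (iwasawaProj ε n a) =
        a.1 (comapONS ι (W n)) from a.2 _ _ hle]
      rfl
    refine h1.trans ?_
    generalize iwasawaProj ε n a = b
    change _ = picClass p _ (R n ((B.quot (powSubgroup ε n)).toVert ℤ_[p] (Pi.single w b)))
    induction b using MonoidAlgebra.induction_linear with
    | zero => simp only [map_zero, Pi.single_zero, LinearMap.zero_apply]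
    | add f g hf hg => rw [map_add, map_add, map_add, LinearMap.add_apply, hf, hg, Pi.single_add,
        map_add, map_add, map_add]
    | single q r =>
      induction q using QuotientGroup.induction_on with
      | H γ =>
        rw [toVert_single, hR]
        have h2 : MonoidAlgebra.mapDomainRingHom ℤ_[p] (comapQuot ι (W n))
            (MonoidAlgebra.mapDomainRingHom ℤ_[p] (quotMap hle) (MonoidAlgebra.single
              (γ : Γ ⧸ (powSubgroup ε n).toSubgroup) r)) =
            MonoidAlgebra.single ((ι γ : Δ) : Δ ⧸ (W n).toSubgroup) r := by
          rw [show MonoidAlgebra.mapDomainRingHom ℤ_[p] (quotMap hle) (MonoidAlgebra.single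
              (γ : Γ ⧸ (powSubgroup ε n).toSubgroup) r) = MonoidAlgebra.single
              (γ : Γ ⧸ (comapONS ι (W n)).toSubgroup) r from MonoidAlgebra.mapDomain_single ..]
          exact MonoidAlgebra.mapDomain_single ..
        rw [h2, picPRep_single, ← hσ]
        rfl
  · intro n y hy
    have hy : y.1 (W (n + 1)) = 0 := hy
    change y.1 (W n) = 0
    rw [← y.2 _ _ (hanti n), hy, map_zero]
  · intro y hy
    refine Subtype.ext (funext fun U => ?_)
    obtain ⟨n, hn⟩ := hW U
    rw [← y.2 _ _ hn, show y.1 (W n) = 0 from hy n, map_zero]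
    rfl
  · intro n a y hy
    have hy : y.1 (W n) = 0 := hy
    change (A.quot (W n)).picPRep p _ (y.1 (W n)) = 0
    rw [hy, map_zero]

end IwasawaPic

end Voltage

end KidaGraph

namespace KidaGraph

universe u v w

open scoped Classical

set_option linter.unusedSectionVars false

/-! ### Kida's formula for Picard groups -/

namespace Voltage

variable {p : ℕ} [hp : Fact p.Prime] {Γ : Type v} [CommGroup Γ] [TopologicalSpace Γ]
  [IsTopologicalGroup Γ] [CompactSpace Γ] (ε : Γ ≃ₜ* Multiplicative ℤ_[p])
  {G : Type w} [Group G] [Finite G] [TopologicalSpace G] [DiscreteTopology G]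
  {X : FinGraph.{u}} {A : Voltage X (Γ × G)}

/-- A quotient of a connected graph is connected. -/
theorem connected_lev_map_fst {n : ℕ} (h : (A.quot (layerSubgroup ⟨ε⟩ n ⊥)).derived.Connected) :
    ((A.map (MonoidHom.fst Γ G)).lev ε n).derived.Connected := by
  let φ : (Γ × G) ⧸ (layerSubgroup (G := G) ⟨ε⟩ n ⊥).toSubgroup →* Γ ⧸ (powSubgroup ε n).toSubgroup :=
    QuotientGroup.map _ _ (MonoidHom.fst Γ G) fun d hd => hd.1
  have hI : ∀ x, ((A.quot (layerSubgroup ⟨ε⟩ n ⊥)).I x).map φ =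
      ((A.map (MonoidHom.fst Γ G)).lev ε n).I x := fun x => by
    refine (Subgroup.map_map _ _ _).trans (Eq.trans ?_ (Subgroup.map_map _ _ _).symm)
    rfl
  let f := (A.quot (layerSubgroup ⟨ε⟩ n ⊥)).push ((A.map (MonoidHom.fst Γ G)).lev ε n) φ
    (fun _ => rfl) hI
  refine h.of_surjective f.onV f.onE (fun w => ?_) f.map_s f.map_t
  obtain ⟨x, γ, rfl⟩ := exists_qvert w
  exact ⟨A.qvert _ x (γ, 1), rfl⟩

variable (A) in
/-- The presentation of the limit of the Picard groups of the layers of the `Γ`-covering of `X`. -/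
theorem exists_isPresentation_map_fst {d : X.V → ℕ} (hd : (A.map (MonoidHom.fst Γ G)).IsDepth ε d) :
    ∃ Φ : (X.V → IwasawaAlgebra p Γ) →ₗ[IwasawaAlgebra p Γ]
      (A.map (MonoidHom.fst Γ G)).IwasawaPic p (ContinuousMonoidHom.id Γ),
      IsPresentation ((A.map (MonoidHom.fst Γ G)).presMatrix ε d) Φ :=
  exists_isPresentation ε _ _ hd (powSubgroup ε) (fun n => powSubgroup_anti ε n.le_succ)
    (exists_powSubgroup_le ε) (fun _ _ h => h) (fun _ => Equiv.refl _) (fun _ => Equiv.refl _)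
    (fun _ _ => rfl) (fun _ _ => rfl) id (fun _ => 1) fun n w γ => by
      rw [mul_one]
      rfl

variable (A) in
/-- The presentation of the limit of the Picard groups for `Γ × G`, by the restriction to `Γ`: the
layers for the subgroups `Γ^{p^n} × 1` are cofinal. -/
theorem exists_isPresentation_restrict {d : (A.map (MonoidHom.snd Γ G)).derived.V → ℕ}
    (hd : A.restrict.IsDepth ε d) :
    ∃ Φ : ((A.map (MonoidHom.snd Γ G)).derived.V → IwasawaAlgebra p Γ) →ₗ[IwasawaAlgebra p Γ]
      A.IwasawaPic p (ContinuousMonoidHom.inl Γ G),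
      IsPresentation (A.restrict.presMatrix ε d) Φ := by
  refine exists_isPresentation ε _ _ hd (fun n => layerSubgroup ⟨ε⟩ n ⊥) (fun n δ hδ => ?_)
    (fun U => ?_) (fun n γ hγ => ?_) (split ε A) (splitE ε A) (split_s ε A) (split_t ε A)
    (fun w => w.1) (fun w => (1, w.2.out)) fun n w γ => ?_
  · exact ⟨powSubgroup_anti ε n.le_succ hδ.1, hδ.2⟩
  · obtain ⟨n, hn⟩ := exists_powSubgroup_le ε (comapONS (ContinuousMonoidHom.inl Γ G) U)
    refine ⟨n, fun δ hδ => ?_⟩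
    have h1 : (δ.1, (1 : G)) ∈ U := hn hδ.1
    have h2 : δ = (δ.1, 1) := Prod.ext rfl (Subgroup.mem_bot.1 hδ.2)
    rw [h2]
    exact h1
  · exact ⟨hγ, Subgroup.mem_bot.2 rfl⟩
  · refine (splitFun_qvert ε A n w γ).trans ?_
    congr 1
    exact Prod.ext (mul_one γ).symm (one_mul _).symm

/-- Kida's formula for the limits of the Picard groups. -/
theorem kida_iwasawaPic (hG : IsPGroup p G) (ε : Γ ≃ₜ* Multiplicative ℤ_[p])
    (hcl : ∀ x, IsClosed (A.I x : Set (Γ × G)))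
    (hc : ∀ U, (A.quot U).derived.Connected) :
    let M := (A.map (MonoidHom.fst Γ G)).IwasawaPic p (ContinuousMonoidHom.id Γ)
    let M' := A.IwasawaPic p (ContinuousMonoidHom.inl Γ G)
    (Module.Finite (IwasawaAlgebra p Γ) M ∧ Module.IsTorsion (IwasawaAlgebra p Γ) M) ∧
    (Module.Finite (IwasawaAlgebra p Γ) M' ∧ Module.IsTorsion (IwasawaAlgebra p Γ) M') ∧
    (muInv p Γ M' = 0 ↔
      muInv p Γ M = 0 ∧ ∀ x, Infinite (A.I x) ∨ A.I x = ⊥) ∧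
    (muInv p Γ M' = 0 →
      (lambdaInv p M' : ℤ) = (Nat.card G : ℤ) * (lambdaInv p M : ℤ) -
        ∑ᶠ x : X.V, ((A.I x).index : ℤ) *
          ((Nat.card ((A.I x).comap (MonoidHom.inr Γ G)) : ℤ) - 1)) := by
  intro M M'
  have hcl₁ := isClosed_map_fst ε hcl
  have hcl₂ := isClosed_restrict hcl
  obtain ⟨d₁, hd₁⟩ := exists_isDepth ε hcl₁
  obtain ⟨d₂, hd₂⟩ := exists_isDepth ε hcl₂
  obtain ⟨Φ₁, h₁⟩ := exists_isPresentation_map_fst ε A hd₁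
  obtain ⟨Φ₂, h₂⟩ := exists_isPresentation_restrict ε A hd₂
  have hfin : (∀ x, Infinite (A.I x) ∨ A.I x = ⊥) ↔
      ∀ x, (A.map (MonoidHom.fst Γ G)).I x = ⊥ → A.I x = ⊥ := by
    refine forall_congr' fun x => ?_
    rw [← not_finite_iff_infinite, finite_iff_comap_inl ε, comap_inl_eq_bot_iff ε]
    exact imp_iff_not_or.symm
  have hmu : muInv p Γ M' = 0 ↔ muInv p Γ M = 0 ∧ ∀ x, Infinite (A.I x) ∨ A.I x = ⊥ := by
    rw [hfin, muInv_eq_zero_iff ε hd₁ h₁, muInv_eq_zero_iff ε hd₂ h₂]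
    exact charDet_restrict_ne_zero_iff hG ε _
  refine ⟨⟨h₁.finite, h₁.isTorsion ε (det_presMatrix_ne_zero ε hcl₁
    (fun n => connected_lev_map_fst ε (hc _)) d₁)⟩, ⟨h₂.finite, h₂.isTorsion ε
    (det_presMatrix_ne_zero ε hcl₂ (fun n => connected_restrict ε A (hc _)) d₂)⟩, hmu, fun h0 => ?_⟩
  obtain ⟨h0₁, hS⟩ := hmu.1 h0
  have hl₁ := lambdaInv_eq ε hd₁ h₁ (iwasawaEquiv_symm_C_smul ε _ _)
    ((muInv_eq_zero_iff ε hd₁ h₁).1 h0₁)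
  have hl₂ := lambdaInv_eq ε hd₂ h₂ (iwasawaEquiv_symm_C_smul ε _ _)
    ((muInv_eq_zero_iff ε hd₂ h₂).1 h0)
  rw [order_charDet_restrict hG ε _ (hfin.1 hS)] at hl₂
  rw [← PowerSeries.coe_toNat_order ((muInv_eq_zero_iff ε hd₁ h₁).1 h0₁)] at hl₁ hl₂
  generalize ((A.map (MonoidHom.fst Γ G)).charDet (charModP (p := p) ε)).order.toNat = l at hl₁ hl₂
  have hl₁ : lambdaInv p M = l + ∑ x, ((A.map (MonoidHom.fst Γ G)).I x).index := by
    exact_mod_cast hl₁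
  have hl₂ : lambdaInv p M' = Nat.card G * l + ∑ w, (A.restrict.I w).index := by
    exact_mod_cast hl₂
  have hsum := sum_index_add A
  have hterm : ∑ᶠ x : X.V, ((A.I x).index : ℤ) *
      ((Nat.card ((A.I x).comap (MonoidHom.inr Γ G)) : ℤ) - 1) =
      ((∑ x, (A.I x).index * (Nat.card ((A.I x).comap (MonoidHom.inr Γ G)) - 1) : ℕ) : ℤ) := by
    rw [finsum_eq_sum_of_fintype, Nat.cast_sum]
    refine Finset.sum_congr rfl fun x _ => ?_
    rw [Nat.cast_mul, Nat.cast_sub Nat.card_pos, Nat.cast_one]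
  rw [hterm, hl₁, hl₂, eq_sub_iff_add_eq, mul_comm (Nat.card G : ℤ)]
  have h3 : Nat.card G * l + ∑ w, (A.restrict.I w).index +
      ∑ x, (A.I x).index * (Nat.card ((A.I x).comap (MonoidHom.inr Γ G)) - 1) =
      (l + ∑ x, ((A.map (MonoidHom.fst Γ G)).I x).index) * Nat.card G := by
    rw [add_assoc, hsum]
    ring
  exact_mod_cast h3

end Voltage

end KidaGraph

theorem theorem1p1 (p : ℕ) [Fact p.Prime]
    (Γ : Type*) [CommGroup Γ] [TopologicalSpace Γ] [IsTopologicalGroup Γ] [CompactSpace Γ]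
    (hΓ : Nonempty (Γ ≃ₜ* Multiplicative ℤ_[p]))
    (G : Type*) [Group G] [Finite G] [TopologicalSpace G] [DiscreteTopology G]
    (hG : IsPGroup p G) (X : FinGraph) :
    -- Kida's formula for coverings, with the invariants from the numbers of spanning trees
    (∀ T : ProfiniteCovering (Γ × G) X, (∀ U, (T.layer U).Connected) →
      (∃ lam mu : ℕ, HasIwasawaInvariants p (fun n => (T.lower hΓ n).kappa) lam mu) ∧
      (∃ lam' mu' : ℕ, HasIwasawaInvariants p (fun n => (T.upper hΓ n).kappa) lam' mu') ∧
      ∀ lam mu lam' mu' : ℕ,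
        HasIwasawaInvariants p (fun n => (T.lower hΓ n).kappa) lam mu →
        HasIwasawaInvariants p (fun n => (T.upper hΓ n).kappa) lam' mu' →
        (mu' = 0 ↔ mu = 0 ∧ T.Star hΓ) ∧
        (mu' = 0 →
          ((lam' : ℕ∞) + 1) + ∑ᶠ x : X.V, T.numInfty hΓ x * ((T.ramInfty hΓ x - 1 : ℕ) : ℕ∞) =
            (Nat.card G : ℕ∞) * ((lam : ℕ∞) + 1))) ∧
    -- Kida's formula for voltage graphs, with the invariants of the Picard groups
    (∀ A : Voltage X (Γ × G), (∀ x, IsClosed (A.I x : Set (Γ × G))) →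
      (∀ U, (A.quot U).derived.Connected) →
      let M := (A.map (MonoidHom.fst Γ G)).IwasawaPic p (ContinuousMonoidHom.id Γ)
      let M' := A.IwasawaPic p (ContinuousMonoidHom.inl Γ G)
      (Module.Finite (IwasawaAlgebra p Γ) M ∧ Module.IsTorsion (IwasawaAlgebra p Γ) M) ∧
      (Module.Finite (IwasawaAlgebra p Γ) M' ∧ Module.IsTorsion (IwasawaAlgebra p Γ) M') ∧
      (muInv p Γ M' = 0 ↔
        muInv p Γ M = 0 ∧ ∀ x, Infinite (A.I x) ∨ A.I x = ⊥) ∧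
      (muInv p Γ M' = 0 →
        (lambdaInv p M' : ℤ) = (Nat.card G : ℤ) * (lambdaInv p M : ℤ) -
          ∑ᶠ x : X.V, ((A.I x).index : ℤ) *
            ((Nat.card ((A.I x).comap (MonoidHom.inr Γ G)) : ℤ) - 1))) := by
  obtain ⟨ε⟩ := hΓ
  exact ⟨fun T hc => T.kida ε hG hc (isBinomial_iwasawaModP ε),
    fun _ hcl hc => Voltage.kida_iwasawaPic hG ε hcl hc⟩
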